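/- **Setting.** Work on $\mathbb R^2$ and for times $t\ge 0$; $\langle x\rangle=(1+|x|^2)^{1/2}$; $\langle\nabla\rangle,|\nabla|$ are the Fourier multipliers with symbols $\langle\xi\rangle,|\xi|$, and $\hat u(\xi)=(2\pi)^{-2}\int u(x)e^{-ix\cdot\xi}\,dx$, so that $\widehat{uv}=\hat u*\hat v$. The positive parameters $N_1,N',N,\epsilon_1,\delta_1,\delta_2$ satisfy $$1\ll N_1\ll N'\ll N,\quad \epsilon_1\ll \tfrac{\delta_2}{N_1}\ll\delta_2\ll1,\quad \delta_1\ll \tfrac{\delta_2}{N_1}\ll\delta_2\ll1,\quad N\gg \tfrac1{\delta_1},$$ where $A\ll B$ means $KA\le B$ for a sufficiently large universal constant $K$. Put $q=N_1/\epsilon_1$. For $h:[0,\infty)\to L^2(\mathbb R^2;\mathbb C)$ let $$\|h\|_{X_1}=\|\langle t\rangle|\nabla|^{1/2}\langle\nabla\rangle h\|_{L^\infty_tL^\infty_x}+\|\langle t\rangle^{1-2/q}h\|_{L^\infty_tL^q_x}+\|h\|_{L^\infty_tH^{N'}}+\|\langle x\rangle e^{-it\langle\nabla\rangle}h\|_{L^\infty_tL^{2+\epsilon_1}_x},$$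 $$\|h\|_X=\|h\|_{X_1}+\|\langle t\rangle^{-\delta_1}h\|_{L^\infty_tH^N}.$$ Let $f(t)=e^{-it\langle\nabla\rangle}h(t)$, $\hat f^{+}(t,\xi)=\hat f(t,\xi)$, $\hat f^{-}(t,\xi)=\overline{\hat f(t,-\xi)}$. The boundary term $g$ arising at time $t$ from integrating by parts in time in the quadratic (Duhamel) term of the Euler–Poisson system is $$\hat g(t,\xi)=\sum_{\sigma,\tau\in\{\pm1\}}\int_{\mathbb R^2}e^{-it\phi_{\sigma\tau}(\xi,\eta)}\,\frac{m_{\sigma\tau}(\xi,\eta)}{-i\,\phi_{\sigma\tau}(\xi,\eta)}\,\hat f^{\sigma}(t,\xi-\eta)\,\hat f^{\tau}(t,\eta)\,d\eta,\qquad \phi_{\sigma\tau}(\xi,\eta)=\langle\xi\rangle-\sigma\langle\xi-\eta\rangle-\tau\langle\eta\rangle,$$ $$m_{\sigma\tau}(\xi,\eta)=c^{\sigma\tau}_0\langle\xi\rangle\frac{\xi\cdot\eta}{|\xi||\eta|}\frac{|\xi-\eta|}{\langle\xi-\eta\rangle}+c^{\sigma\tau}_1\langle\xi\rangle\frac{\xi\cdot(\xi-\eta)}{|\xi||\xi-\eta|}\frac{|\eta|}{\langle\eta\rangle}+c^{\sigma\tau}_2|\xi|\frac{|\eta|}{\langle\eta\rangle}\frac{|\xi-\eta|}{\langle\xi-\eta\rangle}+c^{\sigma\tau}_3|\xi|\frac{\eta\cdot(\xi-\eta)}{|\eta||\xi-\eta|},$$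 with arbitrary complex constants $c^{\sigma\tau}_j$ (for the Euler–Poisson system, $c^{\sigma\tau}=(0,\tfrac{i\sigma}{4},\tfrac i8,\tfrac{i\sigma\tau}{8})$). **Proposition 4.1.** For $K$ universal and large enough, all parameters as above and all constants $c^{\sigma\tau}_j$, there is $C$ depending only on the parameters and on the $c^{\sigma\tau}_j$ such that, for every $h$ with $\|h\|_X<\infty$: for almost every $t\ge0$ the integrals defining $\hat g(t,\xi)$ converge absolutely for every $\xi$, and $\hat g(t,\cdot)\in L^2$; moreover $$\|g\|_{L^\infty_tH^{N'}}+\|\langle t\rangle g\|_{L^\infty_tH^{N'/2}}+\|\langle x\rangle g\|_{L^\infty_tL^{2+\epsilon_1}_x}\le C\|h\|_X^2,$$ and, as a corollary, $$\|e^{it\langle\nabla\rangle}g\|_{X_1}\le C\|h\|_X^2.$$ -/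

import Mathlib

open MeasureTheory FourierTransform
open scoped ENNReal NNReal

namespace EulerPoisson

/-- The plane `ℝ²`, with its Euclidean norm. -/
abbrev Plane : Type := EuclideanSpace ℝ (Fin 2)

/-- Complex-valued square integrable functions on the plane. The Fourier transform `𝓕` on this space
is Mathlib's (the `L²` extension of `𝓕 f ξ = ∫ f x e^{-2πi x·ξ} dx`). -/
abbrev L2 : Type := Lp ℂ 2 (volume : Measure Plane)

/-- The Japanese bracket `⟨x⟩ = (1 + |x|²)^{1/2}`. -/
noncomputable def jb {V : Type*} [Norm V] (x : V) : ℝ := √(1 + ‖x‖ ^ 2)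

/-- The angular frequency `2πξ`. With Mathlib's Fourier transform the gradient has symbol `2πiξ`, so
that a Fourier multiplier written `m(ξ)` in the convention "`∇` has symbol `iξ`" acts as
multiplication of `𝓕 f` by `m (freq ξ)`. In Mathlib's normalization `𝓕 (u v)` is exactly the
convolution `𝓕 u * 𝓕 v`. -/
noncomputable def freq (ξ : Plane) : Plane := (2 * Real.pi) • ξ

/-- The `L²` function with Fourier transform `F` (and `0` if `F` is not in `L²`). -/
noncomputable def ofFourier (F : Plane → ℂ) : L2 :=
  open Classical in if hF : MemLp F 2 volume then 𝓕⁻ (hF.toLp F) else 0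

/-- The Klein-Gordon propagator `e^{it⟨∇⟩}` on `L²`. -/
noncomputable def propagator (t : ℝ) (u : L2) : L2 :=
  ofFourier fun ξ => Complex.exp (Complex.I * ((t * jb (freq ξ) : ℝ) : ℂ)) * (𝓕 u : L2) ξ

/-- The Sobolev norm `‖u‖_{H^s} = ‖⟨∇⟩^s u‖_{L²}` (it is `∞` if `u ∉ H^s`). -/
noncomputable def sobolevNorm (s : ℝ) (u : L2) : ℝ≥0∞ :=
  eLpNorm (fun ξ : Plane => ((jb (freq ξ) ^ s : ℝ) : ℂ) * (𝓕 u : L2) ξ) 2 volume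

/-- The Fourier transform of `|∇|^{1/2} ⟨∇⟩ u`. -/
noncomputable def halfDerivHat (u : L2) (ξ : Plane) : ℂ :=
  ((‖freq ξ‖ ^ (1 / 2 : ℝ) * jb (freq ξ) : ℝ) : ℂ) * (𝓕 u : L2) ξ

/-- The norm `‖ |∇|^{1/2} ⟨∇⟩ u ‖_{L^∞}`, for `u` with `|∇|^{1/2} ⟨∇⟩ u ∈ L²`; it is set to `∞` for
other `u` (in particular those are not in `H^s` for any `s ≥ 3/2`). -/
noncomputable def halfDerivSupNorm (u : L2) : ℝ≥0∞ :=
  open Classical in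
  if MemLp (halfDerivHat u) 2 volume then eLpNorm (ofFourier (halfDerivHat u)) ∞ volume else ∞

/-- The norm `‖ ⟨x⟩ u ‖_{L^p}`. -/
noncomputable def weightedNorm (p : ℝ) (u : L2) : ℝ≥0∞ :=
  eLpNorm (fun x : Plane => ((jb x : ℝ) : ℂ) * u x) (ENNReal.ofReal p) volume

/-- The norm `‖ ⟨t⟩^a ν(t) ‖_{L^∞_t}` over times `t ≥ 0`, where `ν(t)` is a spatial norm at time
`t`. -/
noncomputable def supTime (a : ℝ) (ν : ℝ → ℝ≥0∞) : ℝ≥0∞ :=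
  essSup (fun t => ENNReal.ofReal (jb t ^ a) * ν t) (volume.restrict (Set.Ici (0 : ℝ)))

/-- The norm `‖·‖_{X₁}`, with `q = N₁ / ε₁`:
`‖⟨t⟩ |∇|^{1/2}⟨∇⟩ h‖_{L^∞_t L^∞} + ‖⟨t⟩^{1-2/q} h‖_{L^∞_t L^q} + ‖h‖_{L^∞_t H^{N'}}
  + ‖⟨x⟩ e^{-it⟨∇⟩} h‖_{L^∞_t L^{2+ε₁}}`. -/
noncomputable def X1Norm (N₁ N' ε₁ : ℝ) (h : ℝ → L2) : ℝ≥0∞ :=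
  supTime 1 (fun t => halfDerivSupNorm (h t))
    + supTime (1 - 2 / (N₁ / ε₁)) (fun t => eLpNorm (h t) (ENNReal.ofReal (N₁ / ε₁)) volume)
    + supTime 0 (fun t => sobolevNorm N' (h t))
    + supTime 0 (fun t => weightedNorm (2 + ε₁) (propagator (-t) (h t)))

/-- The norm `‖·‖_X`, with `q = N₁ / ε₁`: the four terms of `‖·‖_{X₁}`, and
`‖⟨t⟩^{-δ₁} h‖_{L^∞_t H^N}`. -/
noncomputable def XNorm (N₁ N' N ε₁ δ₁ : ℝ) (h : ℝ → L2) : ℝ≥0∞ :=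
  supTime 1 (fun t => halfDerivSupNorm (h t))
    + supTime (-δ₁) (fun t => sobolevNorm N (h t))
    + supTime (1 - 2 / (N₁ / ε₁)) (fun t => eLpNorm (h t) (ENNReal.ofReal (N₁ / ε₁)) volume)
    + supTime 0 (fun t => sobolevNorm N' (h t))
    + supTime 0 (fun t => weightedNorm (2 + ε₁) (propagator (-t) (h t)))

/-- The choice of constants
`1 ≪ N₁ ≪ N' ≪ N`, `ε₁ ≪ δ₂/N₁ ≪ δ₂ ≪ 1`, `δ₁ ≪ δ₂/N₁ ≪ δ₂ ≪ 1`, `N ≫ 1/δ₁`,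
all parameters being positive, where `A ≪ B` is read as `K A ≤ B`. -/
structure AdmissibleParameters (K N₁ N' N ε₁ δ₁ δ₂ : ℝ) : Prop where
  N₁_pos : 0 < N₁
  N'_pos : 0 < N'
  N_pos : 0 < N
  ε₁_pos : 0 < ε₁
  δ₁_pos : 0 < δ₁
  δ₂_pos : 0 < δ₂
  one_ll_N₁ : K * 1 ≤ N₁
  N₁_ll_N' : K * N₁ ≤ N'
  N'_ll_N : K * N' ≤ N
  ε₁_ll : K * ε₁ ≤ δ₂ / N₁
  δ₁_ll : K * δ₁ ≤ δ₂ / N₁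
  δ₂_div_ll : K * (δ₂ / N₁) ≤ δ₂
  δ₂_ll_one : K * δ₂ ≤ 1
  inv_δ₁_ll_N : K * (1 / δ₁) ≤ N

/-- The phase `⟨ξ⟩ - σ⟨ξ-η⟩ - τ⟨η⟩`, for signs `σ, τ`. -/
noncomputable def phase (σ τ : ℤˣ) (ξ η : Plane) : ℝ :=
  jb ξ - ((σ : ℤ) : ℝ) * jb (ξ - η) - ((τ : ℤ) : ℝ) * jb η

/-- The symbol `m₀(ξ,η)` of the quadratic interaction, with constants `c 0, …, c 3`. -/
noncomputable def m₀ (c : Fin 4 → ℂ) (ξ η : Plane) : ℂ :=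
  c 0 * ((jb ξ * (inner ℝ ξ η / (‖ξ‖ * ‖η‖)) * (‖ξ - η‖ / jb (ξ - η)) : ℝ) : ℂ)
    + c 1 * ((jb ξ * (inner ℝ ξ (ξ - η) / (‖ξ‖ * ‖ξ - η‖)) * (‖η‖ / jb η) : ℝ) : ℂ)
    + c 2 * ((‖ξ‖ * (‖η‖ / jb η) * (‖ξ - η‖ / jb (ξ - η)) : ℝ) : ℂ)
    + c 3 * ((‖ξ‖ * (inner ℝ η (ξ - η) / (‖η‖ * ‖ξ - η‖)) : ℝ) : ℂ)

/-- For the sign `+`, the function `F` itself; for the sign `-`, the function `conj (F (-ξ))`. If `F`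
is the Fourier transform of `f` these are the Fourier transforms of `f` and of its complex
conjugate. -/
noncomputable def signed (σ : ℤˣ) (F : Plane → ℂ) (ξ : Plane) : ℂ :=
  if σ = 1 then F ξ else (starRingEnd ℂ) (F (-ξ))

/-- The profile `f(t) = e^{-it⟨∇⟩} h(t)`. -/
noncomputable def profile (h : ℝ → L2) (t : ℝ) : L2 := propagator (-t) (h t)

/-- The integrand, as a function of `η`, of the boundary term of type `(σ, τ)`:
`e^{-itφ(ξ,η)} m₀(ξ,η) / (-iφ(ξ,η)) f̂(t,ξ-η) f̂(t,η)`, where `f̂` stands for the Fourier transform of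
`f` or of its conjugate, according to the sign. -/
noncomputable def boundaryIntegrand (c : ℤˣ → ℤˣ → Fin 4 → ℂ) (h : ℝ → L2) (t : ℝ)
    (σ τ : ℤˣ) (ξ η : Plane) : ℂ :=
  Complex.exp (-Complex.I * ((t * phase σ τ (freq ξ) (freq η) : ℝ) : ℂ))
    * (m₀ (c σ τ) (freq ξ) (freq η) / (-Complex.I * ((phase σ τ (freq ξ) (freq η) : ℝ) : ℂ)))
    * signed σ (𝓕 (profile h t) : L2) (ξ - η) * signed τ (𝓕 (profile h t) : L2) η

/-- The Fourier transform `ĝ(t,ξ)` of the boundary term: the sum over the four types of interaction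
`f f`, `f f̄`, `f̄ f`, `f̄ f̄`. For the Euler-Poisson system `c σ τ = (0, σ i/4, i/8, σ τ i/8)`, or,
after symmetrization between `η` and `ξ - η`, `c σ τ = (τ i/8, σ i/8, i/8, σ τ i/8)`. -/
noncomputable def boundaryHat (c : ℤˣ → ℤˣ → Fin 4 → ℂ) (h : ℝ → L2) (t : ℝ) (ξ : Plane) : ℂ :=
  ∑ σ : ℤˣ, ∑ τ : ℤˣ, ∫ η : Plane, boundaryIntegrand c h t σ τ ξ η

/-- The boundary term `g(t)`. -/
noncomputable def boundaryTerm (c : ℤˣ → ℤˣ → Fin 4 → ℂ) (h : ℝ → L2) (t : ℝ) : L2 :=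
  ofFourier (boundaryHat c h t)

end EulerPoisson

/-! Write T = ⟨t⟩. The interaction is nonresonant: up to sign, the product of the four phases ⟨p+q⟩
± ⟨p⟩ ± ⟨q⟩ is the polynomial `resDen`, which is at least 1 (`phase_mul_conjPhases`,
`one_le_resDen`). Hence 1/φ is smooth with derivatives of polynomial growth. The symbol m is
singular at the origin of each variable, but only through one Riesz symbol in each of ξ, ξ-η and η
(`m₀_eq_sum`). So g is a finite sum of terms e^{-it⟨∇⟩} R_i B(R_j u, R_k v), where u and v are h or
its conjugate and B is a bilinear multiplier with smooth symbol of polynomial growth.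

The growth is paid for with derivatives: dividing the symbol by 1 + |ζ|^{2B} + |η|^{2B} puts all of
them on one factor, and the other factor can even be smoothed (`symbol_mul_modes`). The remaining
symbol decays enough to be the Fourier transform of an integrable kernel on pairs of points, so B
maps L^{18/5} × L^{9/2} to L² by Minkowski and Hölder (`IsSymbol.exists_eLpNorm_bil_le`).
Interpolation between L² and the 1/T decay gives T^{-4/9} in L^{18/5} and T^{-5/9} in L^{9/2}, in
total 1/T; this is the decay in H^{N'/2}. At regularity N' the factor carrying the derivatives is
measured in H^N, whose growth is at most T; it then costs T^{1/9}, still compensated by T^{-5/9}.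

The interpolation needs care, because the decay is known only for |∇|^{1/2} of the solution and the
Riesz transforms are unbounded on L^∞. A function is written as an integral over s of pieces of
frequency about s^{-1/2} (`eLpNorm_fourierInv_le_of_bump`); on each piece the singular factors
become smooth. High frequencies are summed with Sobolev norms, low frequencies with the spatial
localization of the profile, by a duality argument (`exists_eLpNorm_resolvent_mul_le`).

For the weighted norm, multiplication by x is differentiation in ξ, carried out with difference
quotients (`dq`, `wfac`) because the transforms are only measurable functions. The derivative of the
outer e^{-it⟨∇⟩} costs T, paid by the 1/T decay of the quadratic term in L². The derivative of the
outer Riesz symbol costs 1/|ξ|, paid by the boundedness of the Fourier transform of the quadratic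
term. When the weight enters B it is moved to the smoothed factor, whose weighted L^{9/2} norm is
O(T^{4/9}) (`exists_eventually_eLpNorm_wfac_low_le`); this balances the T^{-4/9} of the other
factor. The most delicate part is e^{ia⟨∇⟩} acting on x f in L^p: after smoothing it is a
contraction of L² with a kernel of mass O(T⁴), so its norm on L^p is O(T^{4(1-2/p)}), a small power
for p near 2.

The corollary follows because e^{it⟨∇⟩} preserves Sobolev norms, its inverse restores g in the
weighted norm, and the L^∞ and L^q norms are controlled by four derivatives in L², which decay like
1/T. -/

namespace EulerPoisson

/-! ### Calculus of symbols with a loss of ρ powers per derivative. -/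

section Symbols

variable {E F G H : Type*} [NormedAddCommGroup E] [NormedSpace ℝ E] [NormedAddCommGroup F]
  [NormedSpace ℝ F] [NormedAddCommGroup G] [NormedSpace ℝ G] [NormedAddCommGroup H]
  [NormedSpace ℝ H]

/-- Smooth functions whose derivatives of order `k ≤ n` are `O((1 + ‖x‖) ^ (m + ρ k))`. -/
def IsSymbol (n : ℕ) (ρ m : ℝ) (f : E → F) : Prop :=
  ContDiff ℝ ((⊤ : ℕ∞) : WithTop ℕ∞) f ∧
    ∀ k ≤ n, ∃ C : ℝ, ∀ x, ‖iteratedFDeriv ℝ k f x‖ ≤ C * (1 + ‖x‖) ^ (m + ρ * k)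

omit [NormedSpace ℝ E] in
theorem one_le_one_add_norm (x : E) : 1 ≤ 1 + ‖x‖ := by linarith [norm_nonneg x]

omit [NormedSpace ℝ E] in
theorem one_add_norm_pos (x : E) : 0 < 1 + ‖x‖ := by linarith [norm_nonneg x]

theorem natCast_le_top (k : ℕ) : (k : WithTop ℕ∞) ≤ ((⊤ : ℕ∞) : WithTop ℕ∞) := by
  exact_mod_cast le_top

namespace IsSymbol

variable {n : ℕ} {ρ m : ℝ}

theorem exists_nonneg {f : E → F} (hf : IsSymbol n ρ m f) {k : ℕ} (hk : k ≤ n) :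
    ∃ C : ℝ, 0 ≤ C ∧ ∀ x, ‖iteratedFDeriv ℝ k f x‖ ≤ C * (1 + ‖x‖) ^ (m + ρ * k) := by
  obtain ⟨C, hC⟩ := hf.2 k hk
  refine ⟨|C|, abs_nonneg _, fun x => (hC x).trans ?_⟩
  have := one_add_norm_pos x
  gcongr
  exact le_abs_self C

theorem mono {f : E → F} (hf : IsSymbol n ρ m f) {n' : ℕ} {ρ' m' : ℝ} (hn : n' ≤ n)
    (hρ : ρ ≤ ρ') (hm : m ≤ m') : IsSymbol n' ρ' m' f := by
  refine ⟨hf.1, fun k hk => ?_⟩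
  obtain ⟨C, hC0, hC⟩ := hf.exists_nonneg (hk.trans hn)
  refine ⟨C, fun x => (hC x).trans ?_⟩
  gcongr
  exact one_le_one_add_norm x

theorem order_mono {f : E → F} (hf : IsSymbol n ρ m f) {m' : ℝ} (hm : m ≤ m') :
    IsSymbol n ρ m' f := hf.mono le_rfl le_rfl hm

theorem of_fderiv {f : E → F} (h1 : ContDiff ℝ ((⊤ : ℕ∞) : WithTop ℕ∞) f)
    (h2 : ∃ C : ℝ, ∀ x, ‖f x‖ ≤ C * (1 + ‖x‖) ^ m)
    (h3 : IsSymbol n ρ (m + ρ) (fderiv ℝ f)) : IsSymbol (n + 1) ρ m f := by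
  refine ⟨h1, fun k hk => ?_⟩
  rcases k with _ | k
  · obtain ⟨C, hC⟩ := h2
    exact ⟨C, fun x => by simpa using hC x⟩
  · obtain ⟨C, hC⟩ := h3.2 k (by omega)
    refine ⟨C, fun x => ?_⟩
    rw [← norm_iteratedFDeriv_fderiv]
    convert hC x using 2
    push_cast; ring_nf

theorem of_bound {f : E → F} (h1 : ContDiff ℝ ((⊤ : ℕ∞) : WithTop ℕ∞) f)
    (h2 : ∃ C : ℝ, ∀ x, ‖f x‖ ≤ C * (1 + ‖x‖) ^ m) : IsSymbol 0 ρ m f := by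
  refine ⟨h1, fun k hk => ?_⟩
  obtain rfl : k = 0 := by omega
  obtain ⟨C, hC⟩ := h2
  exact ⟨C, fun x => by simpa using hC x⟩

theorem fderiv {f : E → F} (hf : IsSymbol (n + 1) ρ m f) :
    IsSymbol n ρ (m + ρ) (fderiv ℝ f) := by
  refine ⟨hf.1.fderiv_right (by simp), fun k hk => ?_⟩
  obtain ⟨C, hC⟩ := hf.2 (k + 1) (by omega)
  refine ⟨C, fun x => ?_⟩
  rw [norm_iteratedFDeriv_fderiv]
  convert hC x using 2
  push_cast; ring_nf

theorem const (c : F) (hρ : 0 ≤ ρ) : IsSymbol n ρ 0 (fun _ : E => c) := by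
  refine ⟨contDiff_const, fun k _ => ⟨‖c‖, fun x => ?_⟩⟩
  have h1 : 1 ≤ (1 + ‖x‖) ^ (0 + ρ * k) :=
    Real.one_le_rpow (one_le_one_add_norm x) (by positivity)
  rcases k with _ | k
  · simp
  · rw [iteratedFDeriv_const_of_ne (by omega)]
    simp only [Pi.zero_apply, norm_zero]
    positivity

theorem clm (L : E →L[ℝ] F) (hρ : 0 ≤ ρ) : IsSymbol n ρ 1 (fun x => L x) := by
  have hb : ∃ C : ℝ, ∀ x, ‖L x‖ ≤ C * (1 + ‖x‖) ^ (1 : ℝ) := ⟨‖L‖, fun x => by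
    rw [Real.rpow_one]
    refine (L.le_opNorm x).trans ?_
    gcongr; linarith [norm_nonneg x]⟩
  rcases n with _ | n
  · exact of_bound L.contDiff hb
  · refine of_fderiv L.contDiff hb ?_
    have : _root_.fderiv ℝ (fun x => L x) = fun _ => L := by ext1 x; exact L.fderiv
    rw [this]
    exact (const L hρ).order_mono (by linarith)

theorem add {f g : E → F} (hf : IsSymbol n ρ m f) (hg : IsSymbol n ρ m g) :
    IsSymbol n ρ m (fun x => f x + g x) := by
  refine ⟨hf.1.add hg.1, fun k hk => ?_⟩
  obtain ⟨C, hC⟩ := hf.2 k hk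
  obtain ⟨D, hD⟩ := hg.2 k hk
  refine ⟨C + D, fun x => ?_⟩
  rw [fun_iteratedFDeriv_add_apply (hf.1.of_le (natCast_le_top k)).contDiffAt
    (hg.1.of_le (natCast_le_top k)).contDiffAt, add_mul]
  exact (norm_add_le _ _).trans (add_le_add (hC x) (hD x))

/-- Leibniz rule: since the loss is charged per derivative, it adds up correctly over i and k - i,
so the orders add and ρ does not change. -/
theorem bilin (B : F →L[ℝ] G →L[ℝ] H) {f : E → F} {g : E → G} {m' : ℝ}
    (hf : IsSymbol n ρ m f) (hg : IsSymbol n ρ m' g) :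
    IsSymbol n ρ (m + m') (fun x => B (f x) (g x)) := by
  refine ⟨B.isBoundedBilinearMap.contDiff.comp (hf.1.prodMk hg.1), fun k hk => ?_⟩
  choose! C hC0 hC using fun (i : ℕ) (hi : i ≤ n) => hf.exists_nonneg hi
  choose! D hD0 hD using fun (i : ℕ) (hi : i ≤ n) => hg.exists_nonneg hi
  refine ⟨‖B‖ * ∑ i ∈ Finset.range (k + 1), (k.choose i : ℝ) * C i * D (k - i), fun x => ?_⟩
  refine (B.norm_iteratedFDeriv_le_of_bilinear hf.1 hg.1 x (natCast_le_top k)).trans ?_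
  rw [mul_assoc, Finset.sum_mul]
  refine mul_le_mul_of_nonneg_left (Finset.sum_le_sum fun i hi => ?_) (norm_nonneg B)
  have hik : i ≤ k := by simpa [Nat.lt_succ_iff] using hi
  have hx := one_add_norm_pos x
  calc (k.choose i : ℝ) * ‖iteratedFDeriv ℝ i f x‖ * ‖iteratedFDeriv ℝ (k - i) g x‖
      ≤ (k.choose i : ℝ) * (C i * (1 + ‖x‖) ^ (m + ρ * i))
        * (D (k - i) * (1 + ‖x‖) ^ (m' + ρ * (k - i : ℕ))) := by
        gcongr
        · exact mul_nonneg (by positivity) (mul_nonneg (hC0 i (by omega)) (by positivity))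
        · exact hC i (by omega) x
        · exact hD (k - i) (by omega) x
    _ = (k.choose i : ℝ) * C i * D (k - i) * ((1 + ‖x‖) ^ (m + ρ * i)
        * (1 + ‖x‖) ^ (m' + ρ * (k - i : ℕ))) := by ring
    _ = _ := by
        rw [← Real.rpow_add hx]
        congr 2
        rw [Nat.cast_sub hik]; ring

theorem clm_comp (L : F →L[ℝ] G) {f : E → F} (hf : IsSymbol n ρ m f) :
    IsSymbol n ρ m (fun x => L (f x)) := by
  refine ⟨L.contDiff.comp hf.1, fun k hk => ?_⟩
  obtain ⟨C, hC⟩ := hf.2 k hk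
  refine ⟨‖L‖ * C, fun x => ?_⟩
  refine (L.norm_iteratedFDeriv_comp_left hf.1.contDiffAt (natCast_le_top k)).trans ?_
  rw [mul_assoc]
  gcongr
  exact hC x

theorem ofReal {f : E → ℝ} (hf : IsSymbol n ρ m f) : IsSymbol n ρ m (fun x => (f x : ℂ)) :=
  hf.clm_comp Complex.ofRealCLM

theorem mul {A : Type*} [NormedRing A] [NormedAlgebra ℝ A] {f g : E → A} {m' : ℝ}
    (hf : IsSymbol n ρ m f) (hg : IsSymbol n ρ m' g) :
    IsSymbol n ρ (m + m') (fun x => f x * g x) :=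
  bilin (ContinuousLinearMap.mul ℝ A) hf hg

theorem smul {f : E → ℝ} {g : E → F} {m' : ℝ} (hf : IsSymbol n ρ m f) (hg : IsSymbol n ρ m' g) :
    IsSymbol n ρ (m + m') (fun x => f x • g x) :=
  bilin (ContinuousLinearMap.lsmul ℝ ℝ) hf hg

theorem const_mul {A : Type*} [NormedRing A] [NormedAlgebra ℝ A] (c : A) {f : E → A}
    (hf : IsSymbol n ρ m f) : IsSymbol n ρ m (fun x => c * f x) :=
  hf.clm_comp (ContinuousLinearMap.mul ℝ A c)

theorem pow {A : Type*} [NormedCommRing A] [NormedAlgebra ℝ A] {f : E → A} (hρ : 0 ≤ ρ)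
    (hf : IsSymbol n ρ m f) (k : ℕ) : IsSymbol n ρ (k * m) (fun x => f x ^ k) := by
  induction k with
  | zero => simpa using const (1 : A) hρ
  | succ k ih =>
    simp only [pow_succ]
    convert ih.mul hf using 1
    push_cast; ring

/-- Induction through ∇(D^{-1/2}) = -½ (D^{-1/2})³ ∇D: the right side has order -3e + d, which `hd`
makes at most -e + ρ. The loss ρ is what permits a D that grows faster than its lower bound, as
happens for functions of only one of the two frequencies. -/
theorem one_div_sqrt {D : E → ℝ} {d e c : ℝ} (hρ : 0 ≤ ρ) (hc : 0 < c)
    (hD : ∀ n, IsSymbol n 0 d D) (hlow : ∀ x, c * (1 + ‖x‖) ^ (2 * e) ≤ D x)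
    (hd : d ≤ 2 * e + ρ) : IsSymbol n ρ (-e) (fun x => 1 / √(D x)) := by
  have hpos : ∀ x, 0 < D x := fun x =>
    lt_of_lt_of_le (mul_pos hc (Real.rpow_pos_of_pos (one_add_norm_pos x) _)) (hlow x)
  have hsm : ContDiff ℝ ((⊤ : ℕ∞) : WithTop ℕ∞) (fun x => 1 / √(D x)) :=
    contDiff_const.div ((hD 0).1.sqrt fun x => (hpos x).ne') fun x => (Real.sqrt_pos.2 (hpos x)).ne'
  have hb : ∃ C : ℝ, ∀ x, ‖1 / √(D x)‖ ≤ C * (1 + ‖x‖) ^ (-e) := by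
    refine ⟨1 / √c, fun x => ?_⟩
    have hx := one_add_norm_pos x
    have h1 : √c * (1 + ‖x‖) ^ e ≤ √(D x) := by
      refine Real.le_sqrt_of_sq_le ?_
      rw [mul_pow, Real.sq_sqrt hc.le, ← Real.rpow_natCast, ← Real.rpow_mul hx.le]
      convert hlow x using 3
      push_cast; ring
    rw [Real.norm_of_nonneg (by positivity), Real.rpow_neg hx.le, ← div_eq_mul_inv, div_div]
    have := Real.sqrt_pos.2 hc
    gcongr
  induction n with
  | zero => exact of_bound hsm hb
  | succ n ih =>
    refine of_fderiv hsm hb ?_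
    have h1 : _root_.fderiv ℝ (fun x => 1 / √(D x))
        = fun x => (-(1 / 2) * (1 / √(D x)) ^ 3) • _root_.fderiv ℝ D x := by
      ext1 x
      have hDx : HasFDerivAt D (_root_.fderiv ℝ D x) x :=
        ((hD 0).1.differentiable (by simp) x).hasFDerivAt
      have hs := Real.sqrt_pos.2 (hpos x)
      have h2 : HasDerivAt (fun y : ℝ => 1 / √y) (-(1 / 2) * (1 / √(D x)) ^ 3) (D x) := by
        have := ((Real.hasDerivAt_sqrt (hpos x).ne').inv hs.ne')
        simp only [one_div]
        convert! this using 1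
        field_simp
      exact (h2.comp_hasFDerivAt x hDx).fderiv
    rw [h1]
    have h3 := ((ih.pow hρ 3).const_mul (-(1 / 2) : ℝ)).smul ((hD (n + 1)).fderiv.mono le_rfl hρ le_rfl)
    refine h3.order_mono ?_
    push_cast; linarith

theorem inv {D : E → ℝ} {d e c : ℝ} (hρ : 0 ≤ ρ) (hc : 0 < c)
    (hD : ∀ n, IsSymbol n 0 d D) (hlow : ∀ x, c * (1 + ‖x‖) ^ (2 * e) ≤ D x)
    (hd : d ≤ 2 * e + ρ) : IsSymbol n ρ (-(2 * e)) (fun x => 1 / D x) := by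
  have h := (one_div_sqrt (n := n) hρ hc hD hlow hd).pow hρ 2
  have hpos : ∀ x, 0 < D x := fun x =>
    lt_of_lt_of_le (mul_pos hc (Real.rpow_pos_of_pos (one_add_norm_pos x) _)) (hlow x)
  have h2 : (fun x => (1 / √(D x)) ^ 2) = fun x => 1 / D x := by
    ext x; rw [div_pow, Real.sq_sqrt (hpos x).le, one_pow]
  rw [h2] at h
  exact h.order_mono (by push_cast; linarith)

/-- Here √D = D · D^{-1/2}, so no separate induction is needed. -/
theorem sqrt {D : E → ℝ} {d e c : ℝ} (hρ : 0 ≤ ρ) (hc : 0 < c)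
    (hD : ∀ n, IsSymbol n 0 d D) (hlow : ∀ x, c * (1 + ‖x‖) ^ (2 * e) ≤ D x)
    (hd : d ≤ 2 * e + ρ) : IsSymbol n ρ (d - e) (fun x => √(D x)) := by
  have h := ((hD n).mono le_rfl hρ le_rfl).mul (one_div_sqrt (n := n) hρ hc hD hlow hd)
  have h2 : (fun x => D x * (1 / √(D x))) = fun x => √(D x) := by
    ext x; rw [mul_one_div, Real.div_sqrt]
  rwa [h2] at h

end IsSymbol

end Symbols

/-! ### Decaying symbols are Fourier transforms of integrable kernels. -/

section Kernel

variable (V : Type*) [NormedAddCommGroup V] [InnerProductSpace ℝ V] [FiniteDimensional ℝ V]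
  [MeasurableSpace V] [BorelSpace V]

/-- A function whose derivatives decay is the Fourier transform of an integrable kernel. -/
theorem exists_fourierInv_bound : ∃ C : ℝ, 0 ≤ C ∧ ∀ (S : V → ℂ) (C₀ : ℝ),
    ContDiff ℝ ((⊤ : ℕ∞) : WithTop ℕ∞) S →
    (∀ k ≤ Module.finrank ℝ V + 2, ∀ x, ‖iteratedFDeriv ℝ k S x‖
      ≤ C₀ * (1 + ‖x‖) ^ (-(Module.finrank ℝ V + 1 : ℝ))) →
    Integrable S ∧ Continuous (𝓕⁻ S) ∧ 𝓕 (𝓕⁻ S) = S ∧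
      ∀ x, ‖𝓕⁻ S x‖ ≤ C * C₀ * (1 + ‖x‖) ^ (-(Module.finrank ℝ V + 2 : ℝ)) := by
  set d := Module.finrank ℝ V
  set I : ℝ := ∫ x : V, (1 + ‖x‖) ^ (-(d + 1 : ℝ))
  have hI : Integrable (fun x : V => (1 + ‖x‖) ^ (-(d + 1 : ℝ))) :=
    integrable_one_add_norm (by linarith)
  have hI2 : Integrable (fun x : V => (1 + ‖x‖) ^ (-(d + 2 : ℝ))) :=
    integrable_one_add_norm (by linarith)
  have hI0 : 0 ≤ I := integral_nonneg fun x => by positivity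
  -- The constant results from (1 + ‖x‖)^{d+2} ≤ 2^{d+2}(1 + ‖x‖^{d+2}) and the bounds of ‖x‖^n ‖𝓕 S
  -- x‖ for n = 0 and n = d + 2, the latter using derivatives of S up to order d + 2.
  set A : ℝ := 2 ^ (d + 2) * (1 + 2 ^ (d + 2) * (d + 3)) with hA
  refine ⟨A * I, by positivity, fun S C₀ hS hb => ?_⟩
  have hC₀ : 0 ≤ C₀ := by
    have := (norm_nonneg _).trans (hb 0 (by omega) 0)
    simpa using this
  have hcont : ∀ k : ℕ, Continuous (iteratedFDeriv ℝ k S) := fun k =>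
    hS.continuous_iteratedFDeriv (natCast_le_top k)
  have hint : ∀ k ≤ d + 2, Integrable (fun x => ‖iteratedFDeriv ℝ k S x‖) := fun k hk =>
    (hI.const_mul C₀).mono' (hcont k).norm.aestronglyMeasurable
      (Filter.Eventually.of_forall fun x => by simpa using hb k hk x)
  have hle : ∀ k ≤ d + 2, ∫ x, ‖iteratedFDeriv ℝ k S x‖ ≤ C₀ * I := fun k hk => by
    rw [← integral_const_mul]
    exact integral_mono (hint k hk) (hI.const_mul C₀) fun x => hb k hk x
  have hSint : Integrable S := by
    have := hint 0 (by omega)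
    refine (integrable_norm_iff hS.continuous.aestronglyMeasurable).1 ?_
    simpa using this
  have hbd : ∀ n ≤ d + 2, ∀ w, ‖w‖ ^ n * ‖𝓕 S w‖ ≤ 2 ^ n * ((n + 1) * (C₀ * I)) := by
    intro n hn w
    have h := Real.pow_mul_norm_iteratedFDeriv_fourier_le (f := S) (K := 0) (N := (n : ℕ∞))
      (hS.of_le (natCast_le_top n)) (fun k m hk hm => by
        have hk0 : k = 0 := by simpa using hk
        subst hk0
        simpa using hint m ((by exact_mod_cast hm : m ≤ n).trans hn)) (k := 0) (n := n) le_rfl le_rfl w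
    simp only [norm_iteratedFDeriv_zero, pow_zero, one_mul, Nat.cast_zero, mul_zero, zero_add,
      Finset.range_one, Finset.sum_product, Finset.sum_singleton] at h
    refine h.trans ?_
    gcongr
    calc ∑ p ∈ Finset.range (n + 1), ∫ v, ‖iteratedFDeriv ℝ p S v‖
        ≤ ∑ p ∈ Finset.range (n + 1), C₀ * I :=
          Finset.sum_le_sum fun p hp => hle p (by have := Finset.mem_range.1 hp; omega)
      _ = _ := by simp
  have hK : ∀ x, ‖𝓕 S x‖ ≤ A * I * C₀ * (1 + ‖x‖) ^ (-(d + 2 : ℝ)) := by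
    intro x
    have hx := one_add_norm_pos x
    have h0 := hbd 0 (by omega) x
    have h1 := hbd (d + 2) le_rfl x
    have h2 : (1 + ‖x‖) ^ (d + 2) ≤ 2 ^ (d + 2) * (1 + ‖x‖ ^ (d + 2)) := by
      rcases le_total ‖x‖ 1 with h | h
      · calc (1 + ‖x‖) ^ (d + 2) ≤ 2 ^ (d + 2) := by gcongr; linarith
          _ ≤ _ := by nlinarith [pow_nonneg (norm_nonneg x) (d + 2), pow_pos (two_pos : (0:ℝ) < 2) (d + 2)]
      · calc (1 + ‖x‖) ^ (d + 2) ≤ (2 * ‖x‖) ^ (d + 2) := by gcongr; linarith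
          _ ≤ _ := by rw [mul_pow]; gcongr; linarith
    rw [Real.rpow_neg hx.le, ← div_eq_mul_inv, le_div_iff₀ (by positivity)]
    have h3 : (1 + ‖x‖) ^ ((d : ℝ) + 2) = (1 + ‖x‖) ^ (d + 2) := by
      rw [← Real.rpow_natCast]; push_cast; rfl
    rw [h3]
    calc ‖𝓕 S x‖ * (1 + ‖x‖) ^ (d + 2) ≤ ‖𝓕 S x‖ * (2 ^ (d + 2) * (1 + ‖x‖ ^ (d + 2))) := by gcongr
      _ = 2 ^ (d + 2) * (‖x‖ ^ 0 * ‖𝓕 S x‖ + ‖x‖ ^ (d + 2) * ‖𝓕 S x‖) := by ring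
      _ ≤ 2 ^ (d + 2) * (2 ^ 0 * (((0 : ℕ) + 1) * (C₀ * I)) + 2 ^ (d + 2) * (((d + 2 : ℕ) + 1) * (C₀ * I))) := by
          gcongr
      _ = _ := by rw [hA]; push_cast; ring
  have hinv : ∀ x, 𝓕⁻ S x = 𝓕 S (-x) := fun x => Real.fourierInv_eq_fourier_neg S x
  have hcontF : Continuous (𝓕 S) :=
    VectorFourier.fourierIntegral_continuous Real.continuous_fourierChar
      (by exact continuous_inner) hSint
  have hFint : Integrable (𝓕 S) :=
    (hI2.const_mul (A * I * C₀)).mono' hcontF.aestronglyMeasurable (Filter.Eventually.of_forall hK)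
  refine ⟨hSint, ?_, Continuous.fourier_fourierInv_eq hS.continuous hSint hFint, fun x => ?_⟩
  · have : 𝓕⁻ S = fun x => 𝓕 S (-x) := funext hinv
    rw [this]
    exact hcontF.comp continuous_neg
  · rw [hinv]
    simpa using hK (-x)

variable {V}

/-- Among the derivatives up to order d + 2, the last one has the worst order, m + ρ(d + 2), so one
inequality suffices. The kernel decays like the power d + 2: one more than integrability would
require with this room, so that a linear weight can be absorbed. -/
theorem IsSymbol.exists_kernel {n : ℕ} {ρ m : ℝ} {S : V → ℂ} (hS : IsSymbol n ρ m S)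
    (hρ : 0 ≤ ρ) (hn : Module.finrank ℝ V + 2 ≤ n)
    (hm : m + ρ * (Module.finrank ℝ V + 2) ≤ -(Module.finrank ℝ V + 1)) :
    Integrable S ∧ Continuous (𝓕⁻ S) ∧ 𝓕 (𝓕⁻ S) = S ∧ ∃ C : ℝ, 0 < C ∧
      ∀ x, ‖𝓕⁻ S x‖ ≤ C * (1 + ‖x‖) ^ (-(Module.finrank ℝ V + 2 : ℝ)) := by
  obtain ⟨A, hA0, hA⟩ := exists_fourierInv_bound V
  choose! C hC0 hC using fun (k : ℕ) (hk : k ≤ n) => hS.exists_nonneg hk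
  set C₀ := ∑ k ∈ Finset.range (n + 1), |C k|
  obtain ⟨h1, h2, h3, h4⟩ := hA S C₀ hS.1 fun k hk x => by
    refine (hC k (hk.trans hn) x).trans ?_
    have hkn : k ∈ Finset.range (n + 1) := Finset.mem_range.2 (by omega)
    have h5 : C k ≤ C₀ := (le_abs_self _).trans
      (Finset.single_le_sum (f := fun k => |C k|) (fun i _ => abs_nonneg _) hkn)
    have h6 : 0 ≤ C₀ := Finset.sum_nonneg fun i _ => abs_nonneg _
    have hx := one_add_norm_pos x
    gcongr
    · exact one_le_one_add_norm x
    · refine le_trans ?_ hm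
      have : (k : ℝ) ≤ Module.finrank ℝ V + 2 := by exact_mod_cast hk
      gcongr
  refine ⟨h1, h2, h3, A * C₀ + 1, ?_, fun x => (h4 x).trans ?_⟩
  · have h6 : 0 ≤ C₀ := Finset.sum_nonneg fun i _ => abs_nonneg _
    positivity
  · have hx := one_add_norm_pos x
    gcongr
    linarith

end Kernel

/-! ### The inverse Fourier transform on L¹ ∩ L² and Fourier multipliers as averages. -/

section FourierL2

variable {V : Type*} [NormedAddCommGroup V] [InnerProductSpace ℝ V] [FiniteDimensional ℝ V]
  [MeasurableSpace V] [BorelSpace V]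

theorem continuous_fourierInv {F : V → ℂ} (hF : Integrable F) : Continuous (𝓕⁻ F) :=
  VectorFourier.fourierIntegral_continuous Real.continuous_fourierChar
    (by simp only [LinearMap.neg_apply, innerₗ_apply_apply]; exact continuous_inner.neg) hF

theorem integral_fourierInv_mul {F G : V → ℂ} (hF : Integrable F) (hG : Integrable G) :
    ∫ x, 𝓕⁻ F x * G x = ∫ x, F x * 𝓕⁻ G x := by
  have := VectorFourier.integral_fourierIntegral_smul_eq_flip (e := Real.fourierChar)
    (μ := (volume : Measure V)) (ν := (volume : Measure V)) (L := -innerₗ V) (f := F) (g := G)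
    Real.continuous_fourierChar
    (by simp only [LinearMap.neg_apply, innerₗ_apply_apply]; exact continuous_inner.neg) hF hG
  have hflip : (-innerₗ V : V →ₗ[ℝ] V →ₗ[ℝ] ℝ).flip = -innerₗ V := by
    ext v w; simp [real_inner_comm]
  rw [hflip] at this
  exact this

theorem norm_fourierInv_le (F : V → ℂ) (x : V) : ‖𝓕⁻ F x‖ ≤ ∫ v, ‖F v‖ :=
  VectorFourier.norm_fourierIntegral_le_integral_norm _ _ _ _ _

/-- On `L¹ ∩ L²` the `L²` inverse Fourier transform is given by the integral. -/
theorem fourierInv_toLp_ae_eq {F : V → ℂ} (h1 : Integrable F) (h2 : MemLp F 2) :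
    ((𝓕⁻ (h2.toLp F) : Lp ℂ 2 (volume : Measure V)) : V → ℂ) =ᵐ[volume] 𝓕⁻ F := by
  refine ae_eq_of_integral_contDiff_smul_eq
    ((Lp.memLp _).locallyIntegrable (by norm_num))
    (continuous_fourierInv h1).locallyIntegrable fun g hg hc => ?_
  have hcc : HasCompactSupport (fun x => (g x : ℂ)) :=
    hc.comp_left (g := fun y : ℝ => (y : ℂ)) (by simp)
  have hcd : ContDiff ℝ ((⊤ : ℕ∞) : WithTop ℕ∞) (fun x => (g x : ℂ)) :=
    Complex.ofRealCLM.contDiff.comp hg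
  set ψ : SchwartzMap V ℂ := hcc.toSchwartzMap hcd
  have hψ : ∀ x, ψ x = (g x : ℂ) := fun x => rfl
  have h := congrArg (fun T => T ψ) (Lp.fourierInv_toTemperedDistribution_eq (h2.toLp F))
  simp only [TemperedDistribution.fourierInv_apply, Lp.toTemperedDistribution_apply] at h
  have h3 : ∫ x, (𝓕⁻ ψ) x • (h2.toLp F : V → ℂ) x = ∫ x, 𝓕⁻ (fun x => (g x : ℂ)) x * F x := by
    refine integral_congr_ae ?_
    filter_upwards [h2.coeFn_toLp] with x hx
    rw [hx, smul_eq_mul, SchwartzMap.fourierInv_coe]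
    rfl
  have h4 : Integrable (fun x => (g x : ℂ)) := ψ.integrable
  rw [h3, integral_fourierInv_mul h4 h1] at h
  simp only [hψ, smul_eq_mul] at h
  simpa [Complex.real_smul] using h.symm

theorem memLp_fourierInv {F : V → ℂ} (h1 : Integrable F) (h2 : MemLp F 2) :
    MemLp (𝓕⁻ F) 2 :=
  (memLp_congr_ae (fourierInv_toLp_ae_eq h1 h2)).1 (Lp.memLp _)

theorem eLpNorm_fourierInv {F : V → ℂ} (h1 : Integrable F) (h2 : MemLp F 2) :
    eLpNorm (𝓕⁻ F) 2 volume = eLpNorm F 2 volume := by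
  rw [← eLpNorm_congr_ae (fourierInv_toLp_ae_eq h1 h2), ← eLpNorm_congr_ae h2.coeFn_toLp,
    ← Lp.enorm_def, ← Lp.enorm_def, ← ofReal_norm, ← ofReal_norm]
  congr 1
  exact (Lp.fourierTransformₗᵢ V ℂ).symm.norm_map _

theorem integral_conj_fourierInv_mul {F G : V → ℂ} (h1 : Integrable F) (h2 : MemLp F 2)
    (k1 : Integrable G) (k2 : MemLp G 2) :
    ∫ x, (starRingEnd ℂ) (𝓕⁻ F x) * 𝓕⁻ G x = ∫ ξ, (starRingEnd ℂ) (F ξ) * G ξ := by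
  have h := (Lp.fourierTransformₗᵢ V ℂ).symm.inner_map_map (h2.toLp F) (k2.toLp G)
  have e1 : inner ℂ ((Lp.fourierTransformₗᵢ V ℂ).symm (h2.toLp F))
      ((Lp.fourierTransformₗᵢ V ℂ).symm (k2.toLp G))
      = ∫ x, (starRingEnd ℂ) (𝓕⁻ F x) * 𝓕⁻ G x := by
    rw [L2.inner_def]
    refine integral_congr_ae ?_
    filter_upwards [fourierInv_toLp_ae_eq h1 h2, fourierInv_toLp_ae_eq k1 k2] with x hx hx'
    rw [← hx, ← hx', RCLike.inner_apply']
    rfl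
  have e2 : inner ℂ (h2.toLp F) (k2.toLp G) = ∫ ξ, (starRingEnd ℂ) (F ξ) * G ξ := by
    rw [L2.inner_def]
    refine integral_congr_ae ?_
    filter_upwards [h2.coeFn_toLp, k2.coeFn_toLp] with x hx hx'
    rw [hx, hx']
    simp [RCLike.inner_apply, mul_comm]
  rw [← e1, ← e2, h]

/-- A Fourier multiplier `𝓕 κ (c ξ)` averages translates with the kernel `κ`. -/
theorem fourierInv_fourier_mul {κ Ψ : V → ℂ} (hκ : Integrable κ) (hΨ : Integrable Ψ) (c : ℝ)
    (x : V) : 𝓕⁻ (fun ξ => 𝓕 κ (c • ξ) * Ψ ξ) x = ∫ y, κ y * 𝓕⁻ Ψ (x - c • y) := by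
  simp only [Real.fourierInv_eq, Real.fourier_eq, Circle.smul_def, smul_eq_mul]
  calc ∫ v, (Real.fourierChar (inner ℝ v x) : ℂ)
        * ((∫ y, (Real.fourierChar (-inner ℝ y (c • v)) : ℂ) * κ y) * Ψ v)
      = ∫ v, ∫ y, (Real.fourierChar (inner ℝ v (x - c • y)) : ℂ) * (κ y * Ψ v) := by
        congr 1; ext v
        rw [← integral_mul_const, ← integral_const_mul]
        congr 1; ext y
        have : inner ℝ v (x - c • y) = inner ℝ v x + -inner ℝ y (c • v) := by
          rw [inner_sub_right, inner_smul_right, inner_smul_right, real_inner_comm v y]; ring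
        rw [this, AddChar.map_add_eq_mul, Circle.coe_mul]
        ring
    _ = ∫ y, ∫ v, (Real.fourierChar (inner ℝ v (x - c • y)) : ℂ) * (κ y * Ψ v) := by
        refine integral_integral_swap ?_
        refine Integrable.bdd_mul (c := 1) (hΨ.mul_prod hκ |>.congr ?_) ?_ ?_
        · exact Filter.Eventually.of_forall fun z => by simp [mul_comm]
        · refine Continuous.aestronglyMeasurable ?_
          fun_prop
        · exact Filter.Eventually.of_forall fun z => (Circle.norm_coe _).le
    _ = _ := by
        congr 1; ext y
        rw [← integral_const_mul]
        congr 1; ext v; ring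

end FourierL2

/-! ### Interpolation with L^∞ and Minkowski's integral inequality. -/

section Inequalities

variable {α X E : Type*} [MeasurableSpace α] [MeasurableSpace X] [NormedAddCommGroup E]

theorem eLpNorm_ofReal_rpow {p : ℝ} (hp : 0 < p) (f : X → E) (ν : Measure X) :
    eLpNorm f (ENNReal.ofReal p) ν ^ p = ∫⁻ x, ‖f x‖ₑ ^ p ∂ν := by
  rw [eLpNorm_eq_lintegral_rpow_enorm_toReal (by simpa using hp) ENNReal.ofReal_ne_top,
    ENNReal.toReal_ofReal hp.le, ← ENNReal.rpow_mul, one_div, inv_mul_cancel₀ hp.ne',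
    ENNReal.rpow_one]

/-- Log-convexity of the `L^p` norms, with endpoint `L^∞`. -/
theorem eLpNorm_le_of_bounded {p r M : ℝ} (hr : 0 < r) (hrp : r ≤ p) (hM : 0 ≤ M) {f : X → E}
    {ν : Measure X} (hf : ∀ᵐ x ∂ν, ‖f x‖ ≤ M) :
    eLpNorm f (ENNReal.ofReal p) ν
      ≤ eLpNorm f (ENNReal.ofReal r) ν ^ (r / p) * ENNReal.ofReal (M ^ (1 - r / p)) := by
  have hp : 0 < p := hr.trans_le hrp
  rw [← ENNReal.rpow_le_rpow_iff hp, eLpNorm_ofReal_rpow hp, ENNReal.mul_rpow_of_nonneg _ _ hp.le,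
    ← ENNReal.rpow_mul, div_mul_cancel₀ _ hp.ne', eLpNorm_ofReal_rpow hr,
    ENNReal.ofReal_rpow_of_nonneg (by positivity) hp.le, ← Real.rpow_mul hM, sub_mul, one_mul,
    div_mul_cancel₀ _ hp.ne']
  have hMt : ENNReal.ofReal (M ^ (p - r)) ≠ ∞ := ENNReal.ofReal_ne_top
  rw [← lintegral_mul_const' _ _ hMt]
  refine lintegral_mono_ae ?_
  filter_upwards [hf] with x hx
  rw [← ofReal_norm, ENNReal.ofReal_rpow_of_nonneg (norm_nonneg _) hp.le,
    ENNReal.ofReal_rpow_of_nonneg (norm_nonneg _) hr.le, ← ENNReal.ofReal_mul (by positivity)]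
  refine ENNReal.ofReal_le_ofReal ?_
  rcases (norm_nonneg (f x)).eq_or_lt with h | h
  · rw [← h, Real.zero_rpow hp.ne']; positivity
  · calc ‖f x‖ ^ p = ‖f x‖ ^ r * ‖f x‖ ^ (p - r) := by rw [← Real.rpow_add h]; ring_nf
      _ ≤ _ := by gcongr

theorem eLpNorm_le_of_sq_of_bounded {p A M : ℝ} (hp : 2 ≤ p) (hM : 0 ≤ M) (hA : 0 ≤ A) {f : X → E}
    {ν : Measure X} (hf2 : eLpNorm f 2 ν ≤ ENNReal.ofReal A) (hf : ∀ᵐ x ∂ν, ‖f x‖ ≤ M) :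
    eLpNorm f (ENNReal.ofReal p) ν ≤ ENNReal.ofReal (A ^ (2 / p) * M ^ (1 - 2 / p)) := by
  have h := eLpNorm_le_of_bounded (by norm_num) hp hM hf
  refine h.trans ?_
  rw [ENNReal.ofReal_mul (by positivity), ← ENNReal.ofReal_rpow_of_nonneg hA (by positivity)]
  gcongr
  simpa using hf2

theorem ae_aemeasurable_section {α X : Type*} [MeasurableSpace α] [MeasurableSpace X]
    {μ : Measure α} {ν : Measure X} [SFinite ν]
    {f : α × X → ℝ≥0∞} (hf : AEMeasurable f (μ.prod ν)) :
    ∀ᵐ s ∂μ, AEMeasurable (fun x => f (s, x)) ν := by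
  filter_upwards [Measure.ae_ae_of_ae_prod hf.ae_eq_mk] with s hs
  exact ⟨fun x => hf.mk f (s, x), hf.measurable_mk.comp measurable_prodMk_left, hs⟩

/-- A form of Minkowski's integral inequality. -/
theorem eLpNorm_le_lintegral_of_le {p : ℝ} (hp : 1 < p) {μ : Measure α} {ν : Measure X}
    [SFinite μ] [SFinite ν] {F : α → X → E} (hF : AEMeasurable (fun z : α × X => ‖F z.1 z.2‖ₑ) (μ.prod ν))
    {w : α → ℝ} (hw : Measurable w) (hw0 : ∀ᵐ s ∂μ, 0 < w s)
    (hFw : ∀ᵐ s ∂μ, eLpNorm (F s) (ENNReal.ofReal p) ν ≤ ENNReal.ofReal (w s))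
    {g : X → E} (hg : ∀ᵐ x ∂ν, ‖g x‖ₑ ≤ ∫⁻ s, ‖F s x‖ₑ ∂μ) :
    eLpNorm g (ENNReal.ofReal p) ν ≤ ∫⁻ s, ENNReal.ofReal (w s) ∂μ := by
  have hp0 : 0 < p := by linarith
  set W := ∫⁻ s, ENNReal.ofReal (w s) ∂μ with hWdef
  set q := p / (p - 1) with hq
  have hpq : p.HolderConjugate q := Real.HolderConjugate.conjExponent hp
  have hq0 : 0 < q := hpq.symm.pos
  rw [← ENNReal.rpow_le_rpow_iff hp0, eLpNorm_ofReal_rpow hp0]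
  have hF' : AEMeasurable (fun z : X × α => ‖F z.2 z.1‖ₑ) (ν.prod μ) := hF.prod_swap
  have hFx : ∀ᵐ x ∂ν, AEMeasurable (fun s => ‖F s x‖ₑ) μ := ae_aemeasurable_section hF'
  have hwE : Measurable fun s => ENNReal.ofReal (w s) := hw.ennreal_ofReal
  -- Hölder for the splitting ‖F‖ = (‖F‖ w^{-1/q}) · w^{1/q}. The weight w bounds the norms of the
  -- slices, so integrating in x first turns w^{-p/q} w^p into w; positivity of w makes the
  -- splitting exact.
  have key : ∀ᵐ x ∂ν, (∫⁻ s, ‖F s x‖ₑ ∂μ) ^ p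
      ≤ (∫⁻ s, ‖F s x‖ₑ ^ p * ENNReal.ofReal (w s) ^ (-(p / q)) ∂μ) * W ^ (p / q) := by
    filter_upwards [hFx] with x hx
    have h1 : ∫⁻ s, ‖F s x‖ₑ ∂μ = ∫⁻ s, ((fun s => ‖F s x‖ₑ * ENNReal.ofReal (w s) ^ (-(1 / q)))
        * fun s => ENNReal.ofReal (w s) ^ (1 / q)) s ∂μ := by
      refine lintegral_congr_ae ?_
      filter_upwards [hw0] with s hs
      have hs' : ENNReal.ofReal (w s) ≠ 0 := by simpa using hs
      rw [Pi.mul_apply, mul_assoc, ← ENNReal.rpow_add _ _ hs' ENNReal.ofReal_ne_top]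
      simp
    have h2 := ENNReal.lintegral_mul_le_Lp_mul_Lq μ hpq
      (f := fun s => ‖F s x‖ₑ * ENNReal.ofReal (w s) ^ (-(1 / q)))
      (g := fun s => ENNReal.ofReal (w s) ^ (1 / q))
      (hx.mul (hwE.pow_const (-(1 / q))).aemeasurable) (hwE.pow_const (1 / q)).aemeasurable
    rw [← h1] at h2
    refine (ENNReal.rpow_le_rpow h2 hp0.le).trans (le_of_eq ?_)
    rw [ENNReal.mul_rpow_of_nonneg _ _ hp0.le, ← ENNReal.rpow_mul, ← ENNReal.rpow_mul,
      one_div_mul_cancel hp0.ne', ENNReal.rpow_one]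
    congr 1
    · refine lintegral_congr fun s => ?_
      rw [ENNReal.mul_rpow_of_nonneg _ _ hp0.le, ← ENNReal.rpow_mul]
      congr 2; ring
    · rw [one_div_mul_eq_div]
      congr 1
      refine lintegral_congr fun s => ?_
      rw [← ENNReal.rpow_mul, one_div_mul_cancel hq0.ne', ENNReal.rpow_one]
  calc ∫⁻ x, ‖g x‖ₑ ^ p ∂ν ≤ ∫⁻ x, (∫⁻ s, ‖F s x‖ₑ ∂μ) ^ p ∂ν := by
        refine lintegral_mono_ae ?_
        filter_upwards [hg] with x hx using ENNReal.rpow_le_rpow hx hp0.le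
    _ ≤ ∫⁻ x, (∫⁻ s, ‖F s x‖ₑ ^ p * ENNReal.ofReal (w s) ^ (-(p / q)) ∂μ) * W ^ (p / q) ∂ν :=
        lintegral_mono_ae key
    _ = (∫⁻ x, ∫⁻ s, ‖F s x‖ₑ ^ p * ENNReal.ofReal (w s) ^ (-(p / q)) ∂μ ∂ν) * W ^ (p / q) := by
        refine lintegral_mul_const'' _ ?_
        refine AEMeasurable.lintegral_prod_right' (f := fun z : X × α =>
          ‖F z.2 z.1‖ₑ ^ p * ENNReal.ofReal (w z.2) ^ (-(p / q))) ?_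
        exact (hF'.pow_const _).mul ((hwE.pow_const _).comp measurable_snd).aemeasurable
    _ = (∫⁻ s, ∫⁻ x, ‖F s x‖ₑ ^ p * ENNReal.ofReal (w s) ^ (-(p / q)) ∂ν ∂μ) * W ^ (p / q) := by
        rw [lintegral_lintegral_swap]
        exact (hF'.pow_const _).mul ((hwE.pow_const _).comp measurable_snd).aemeasurable
    _ ≤ (∫⁻ s, ENNReal.ofReal (w s) ∂μ) * W ^ (p / q) := by
        refine mul_le_mul_left (lintegral_mono_ae ?_) _
        have hFs : ∀ᵐ s ∂μ, AEMeasurable (fun x => ‖F s x‖ₑ) ν := ae_aemeasurable_section hF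
        filter_upwards [hw0, hFw, hFs] with s hs hs2 hs3
        have hs' : ENNReal.ofReal (w s) ≠ 0 := by simpa using hs
        rw [lintegral_mul_const'' _ (hs3.pow_const _), ← eLpNorm_ofReal_rpow hp0]
        calc eLpNorm (F s) (ENNReal.ofReal p) ν ^ p * ENNReal.ofReal (w s) ^ (-(p / q))
            ≤ ENNReal.ofReal (w s) ^ p * ENNReal.ofReal (w s) ^ (-(p / q)) := by gcongr
          _ = ENNReal.ofReal (w s) := by
              rw [← ENNReal.rpow_add _ _ hs' ENNReal.ofReal_ne_top]
              have : p + -(p / q) = 1 := by rw [hq]; field_simp; ring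
              rw [this, ENNReal.rpow_one]
    _ = W ^ p := by
        have : p = 1 + p / q := by rw [hq]; field_simp; ring
        conv_rhs => rw [this, ENNReal.rpow_add_of_nonneg _ _ zero_le_one (by positivity),
          ENNReal.rpow_one]

end Inequalities

/-! ### Marcinkiewicz interpolation between L² and L^∞. -/

section Truncation

variable {X E : Type*} [MeasurableSpace X] [NormedAddCommGroup E]

theorem lintegral_Ioi_indicator_rpow {r b : ℝ} (hr : -1 < r) (hb : 0 ≤ b) :
    ∫⁻ t in Set.Ioi (0 : ℝ), (Set.Iio b).indicator (fun t => ENNReal.ofReal (t ^ r)) t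
      = ENNReal.ofReal (b ^ (r + 1) / (r + 1)) := by
  rw [lintegral_indicator measurableSet_Iio, Measure.restrict_restrict measurableSet_Iio,
    Set.inter_comm, Set.Ioi_inter_Iio, setLIntegral_congr Ioo_ae_eq_Ioc]
  have hint : IntervalIntegrable (fun t : ℝ => t ^ r) volume 0 b :=
    intervalIntegral.intervalIntegrable_rpow' hr
  rw [intervalIntegrable_iff_integrableOn_Ioc_of_le hb] at hint
  rw [← ofReal_integral_eq_lintegral_ofReal hint, ← intervalIntegral.integral_of_le hb,
    integral_rpow (Or.inl hr), Real.zero_rpow (by linarith), sub_zero]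
  filter_upwards [ae_restrict_mem measurableSet_Ioc] with t ht
  exact Real.rpow_nonneg ht.1.le _

/-- Real interpolation between `L²` and `L^∞`. -/
theorem eLpNorm_le_of_truncation {p A : ℝ} (hp : 2 < p) (hA : 0 < A) {ν : Measure X} [SFinite ν]
    {ψ G : X → E} (hψ : StronglyMeasurable ψ) (hG : AEStronglyMeasurable G ν)
    (h : ∀ l : ℝ, 0 < l → ∃ G₁ : X → E, AEStronglyMeasurable G₁ ν ∧
      eLpNorm G₁ 2 ν ≤ eLpNorm ({x | l < ‖ψ x‖}.indicator ψ) 2 ν ∧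
      ∀ᵐ x ∂ν, ‖G x‖ ≤ ‖G₁ x‖ + A * l) :
    eLpNorm G (ENNReal.ofReal p) ν
      ≤ ENNReal.ofReal ((p * (4 * 2 ^ (p - 2) / (p - 2))) ^ (1 / p) * A ^ (1 - 2 / p))
        * eLpNorm ψ (ENNReal.ofReal p) ν := by
  have hp0 : 0 < p := by linarith
  have hp2 : 0 < p - 2 := by linarith
  have hψn : Measurable fun x => ‖ψ x‖ := hψ.norm.measurable
  rw [← ENNReal.rpow_le_rpow_iff hp0, eLpNorm_ofReal_rpow hp0, ENNReal.mul_rpow_of_nonneg _ _ hp0.le,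
    eLpNorm_ofReal_rpow hp0, ENNReal.ofReal_rpow_of_nonneg (by positivity) hp0.le,
    Real.mul_rpow (by positivity) (by positivity), ← Real.rpow_mul (by positivity),
    ← Real.rpow_mul hA.le, one_div_mul_cancel hp0.ne', Real.rpow_one, sub_mul, one_mul,
    div_mul_cancel₀ _ hp0.ne']
  have e1 : ∫⁻ x, ‖G x‖ₑ ^ p ∂ν = ∫⁻ x, ENNReal.ofReal (‖G x‖ ^ p) ∂ν := by
    refine lintegral_congr fun x => ?_
    rw [← ofReal_norm, ENNReal.ofReal_rpow_of_nonneg (norm_nonneg _) hp0.le]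
  rw [e1, lintegral_rpow_eq_lintegral_meas_lt_mul ν (Filter.Eventually.of_forall fun x => norm_nonneg _)
    hG.norm.aemeasurable hp0]
  -- With ψ cut at height t/(2A), the bounded part contributes at most t/2, so where ‖G‖ > t the
  -- other part exceeds t/2. Chebyshev in L² then gives the factor 4/t².
  have hmeas : ∀ t : ℝ, 0 < t → ν {x | t < ‖G x‖}
      ≤ ENNReal.ofReal (4 / t ^ 2) * ∫⁻ x, (Set.Iio (2 * A * ‖ψ x‖)).indicator
          (fun _ => ‖ψ x‖ₑ ^ (2 : ℝ)) t ∂ν := by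
    intro t ht
    obtain ⟨G₁, hm, h1, h2⟩ := h (t / (2 * A)) (by positivity)
    have h3 : ν {x | t < ‖G x‖} ≤ ν {x | ENNReal.ofReal (t / 2) ≤ ‖G₁ x‖ₑ} := by
      refine measure_mono_ae ?_
      filter_upwards [h2] with x hx hxt
      have hxt' : t < ‖G x‖ := hxt
      change ENNReal.ofReal (t / 2) ≤ ‖G₁ x‖ₑ
      rw [← ofReal_norm]
      refine ENNReal.ofReal_le_ofReal ?_
      have : A * (t / (2 * A)) = t / 2 := by field_simp
      linarith
    have h4 := meas_ge_le_mul_pow_eLpNorm_enorm ν two_ne_zero ENNReal.ofNat_ne_top hm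
      (ε := ENNReal.ofReal (t / 2)) (by simpa using ht) (fun h => absurd h ENNReal.ofReal_ne_top)
    refine h3.trans (h4.trans ?_)
    have h5 : (ENNReal.ofReal (t / 2))⁻¹ ^ (2 : ℝ≥0∞).toReal = ENNReal.ofReal (4 / t ^ 2) := by
      rw [← ENNReal.ofReal_inv_of_pos (by positivity),
        ENNReal.ofReal_rpow_of_nonneg (by positivity) (by simp)]
      congr 1
      simp; ring
    rw [h5]
    gcongr
    have h6 : (2 : ℝ≥0∞) = ENNReal.ofReal 2 := by simp
    calc eLpNorm G₁ 2 ν ^ (2 : ℝ≥0∞).toReal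
        ≤ eLpNorm ({x | t / (2 * A) < ‖ψ x‖}.indicator ψ) 2 ν ^ (2 : ℝ≥0∞).toReal := by gcongr
      _ = ∫⁻ x, ‖{x | t / (2 * A) < ‖ψ x‖}.indicator ψ x‖ₑ ^ (2 : ℝ) ∂ν := by
          rw [← eLpNorm_ofReal_rpow two_pos, ← h6]; simp
      _ ≤ _ := by
          refine lintegral_mono fun x => ?_
          by_cases hx : t / (2 * A) < ‖ψ x‖
          · have hx' : t ∈ Set.Iio (2 * A * ‖ψ x‖) := by
              rw [div_lt_iff₀ (by positivity)] at hx
              change t < _; linarith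
            rw [Set.indicator_of_mem hx', Set.indicator_of_mem (show x ∈ {x | t / (2 * A) < ‖ψ x‖} from hx)]
          · rw [Set.indicator_of_notMem (show x ∉ {x | t / (2 * A) < ‖ψ x‖} from hx)]; simp
  calc ENNReal.ofReal p * ∫⁻ t in Set.Ioi 0, ν {x | t < ‖G x‖} * ENNReal.ofReal (t ^ (p - 1))
      ≤ ENNReal.ofReal p * ∫⁻ t in Set.Ioi 0, ∫⁻ x, (Set.Iio (2 * A * ‖ψ x‖)).indicator
          (fun t => ENNReal.ofReal (t ^ (p - 3))) t * (ENNReal.ofReal 4 * ‖ψ x‖ₑ ^ (2 : ℝ)) ∂ν := by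
        gcongr ENNReal.ofReal p * ?_
        refine setLIntegral_mono' measurableSet_Ioi fun t ht => ?_
        have ht' : 0 < t := ht
        refine (mul_le_mul_left (hmeas t ht') _).trans (le_of_eq ?_)
        rw [mul_right_comm, ← ENNReal.ofReal_mul (by positivity), ← lintegral_const_mul' _ _ ENNReal.ofReal_ne_top]
        refine lintegral_congr fun x => ?_
        by_cases hx : t ∈ Set.Iio (2 * A * ‖ψ x‖)
        · rw [Set.indicator_of_mem hx, Set.indicator_of_mem hx, ← mul_assoc,
            ← ENNReal.ofReal_mul (by positivity)]
          congr 2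
          have : t ^ (p - 3) = t ^ (p - 1) / t ^ 2 := by
            rw [show p - 3 = (p - 1) - 2 by ring, Real.rpow_sub ht']; norm_num
          rw [this]; ring
        · rw [Set.indicator_of_notMem hx, Set.indicator_of_notMem hx]; simp
    -- After the exchange, the integral of t^{p-3} over (0, 2A‖ψ x‖) converges at 0 because p > 2;
    -- it produces the factor 1/(p - 2).
    _ = ENNReal.ofReal p * ∫⁻ x, (∫⁻ t in Set.Ioi (0 : ℝ), (Set.Iio (2 * A * ‖ψ x‖)).indicator
          (fun t => ENNReal.ofReal (t ^ (p - 3))) t * (ENNReal.ofReal 4 * ‖ψ x‖ₑ ^ (2 : ℝ))) ∂ν := by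
        rw [lintegral_lintegral_swap]
        refine Measurable.aemeasurable ?_
        have hms : MeasurableSet {z : ℝ × X | z.1 < 2 * A * ‖ψ z.2‖} :=
          measurableSet_lt measurable_fst ((hψn.comp measurable_snd).const_mul _)
        have hi : Measurable ({z : ℝ × X | z.1 < 2 * A * ‖ψ z.2‖}.indicator
            fun z => ENNReal.ofReal (z.1 ^ (p - 3))) :=
          (measurable_fst.pow_const _).ennreal_ofReal.indicator hms
        have he : Measurable fun z : ℝ × X => ENNReal.ofReal 4 * ‖ψ z.2‖ₑ ^ (2 : ℝ) :=
          ((hψ.enorm.comp measurable_snd).pow_const _).const_mul _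
        exact hi.mul he
    _ = ENNReal.ofReal p * ∫⁻ x, ENNReal.ofReal (4 * 2 ^ (p - 2) / (p - 2)) * ENNReal.ofReal (A ^ (p - 2))
          * ‖ψ x‖ₑ ^ p ∂ν := by
        congr 1
        refine lintegral_congr fun x => ?_
        have htop : ENNReal.ofReal 4 * ‖ψ x‖ₑ ^ (2 : ℝ) ≠ ∞ :=
          ENNReal.mul_ne_top ENNReal.ofReal_ne_top (by simp)
        rw [lintegral_mul_const' _ _ htop, lintegral_Ioi_indicator_rpow (by linarith) (by positivity),
          ← ofReal_norm, ENNReal.ofReal_rpow_of_nonneg (norm_nonneg _) (by norm_num),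
          ENNReal.ofReal_rpow_of_nonneg (norm_nonneg _) hp0.le, ← ENNReal.ofReal_mul (by positivity),
          ← ENNReal.ofReal_mul (by rw [show p - 3 + 1 = p - 2 by ring]; positivity),
          ← ENNReal.ofReal_mul (by positivity), ← ENNReal.ofReal_mul (by positivity)]
        congr 1
        rw [show p - 3 + 1 = p - 2 by ring, Real.mul_rpow (by positivity) (norm_nonneg _),
          Real.mul_rpow (by norm_num) hA.le]
        have : ‖ψ x‖ ^ p = ‖ψ x‖ ^ (p - 2) * ‖ψ x‖ ^ (2 : ℝ) := by
          rcases (norm_nonneg (ψ x)).eq_or_lt with h0 | h0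
          · rw [← h0, Real.zero_rpow hp0.ne', Real.zero_rpow hp2.ne', zero_mul]
          · rw [← Real.rpow_add h0]; ring_nf
        rw [this]; ring
    _ = _ := by
        rw [lintegral_const_mul' _ _ (ENNReal.mul_ne_top ENNReal.ofReal_ne_top ENNReal.ofReal_ne_top),
          ← mul_assoc, ← mul_assoc, ← ENNReal.ofReal_mul hp0.le, ← ENNReal.ofReal_mul (by positivity)]

end Truncation

/-! ### Averages of translates: L^p bounds uniform in the scale, and Bernstein's inequality. -/

section Averages

/-- The average of the translates `φ (x - c y)` of `φ` with weight `κ y`. -/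
noncomputable def avg (κ φ : Plane → ℂ) (c : ℝ) (x : Plane) : ℂ := ∫ y, κ y * φ (x - c • y)

/-- Continuous kernels with `κ y = O((1 + ‖y‖) ^ (-4))`. -/
structure IsKernel (κ : Plane → ℂ) (A : ℝ) : Prop where
  pos : 0 < A
  cont : Continuous κ
  bound : ∀ y, ‖κ y‖ ≤ A * (1 + ‖y‖) ^ (-4 : ℝ)

/-- The integral of `(1 + ‖y‖) ^ (-4)` over the plane. -/
noncomputable def kernelMass : ℝ := ∫ y : Plane, (1 + ‖y‖) ^ (-4 : ℝ)

theorem integrable_one_add_norm_plane {r : ℝ} (hr : 2 < r) :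
    Integrable (fun y : Plane => (1 + ‖y‖) ^ (-r)) :=
  integrable_one_add_norm (by simpa using hr)

theorem kernelMass_pos : 0 < kernelMass := by
  have hi : Integrable (fun y : Plane => (1 + ‖y‖) ^ (-4 : ℝ)) :=
    integrable_one_add_norm_plane (by norm_num)
  refine (integral_pos_iff_support_of_nonneg (fun y => by positivity) hi).2 ?_
  have : Function.support (fun y : Plane => (1 + ‖y‖) ^ (-4 : ℝ)) = Set.univ := by
    ext y
    simp only [Function.mem_support, Set.mem_univ, iff_true]
    have := one_add_norm_pos y
    positivity
  rw [this]; simp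

theorem IsKernel.integrable {κ : Plane → ℂ} {A : ℝ} (h : IsKernel κ A) : Integrable κ :=
  ((integrable_one_add_norm_plane (r := 4) (by norm_num)).const_mul A).mono'
    h.cont.aestronglyMeasurable (Filter.Eventually.of_forall h.bound)

theorem IsKernel.integral_norm_le {κ : Plane → ℂ} {A : ℝ} (h : IsKernel κ A) :
    ∫ y, ‖κ y‖ ≤ A * kernelMass := by
  rw [kernelMass, ← integral_const_mul]
  exact integral_mono h.integrable.norm
    ((integrable_one_add_norm_plane (r := 4) (by norm_num)).const_mul A) h.bound

/-- Dilating a multiplier by c only rescales its kernel, whose mass is unchanged. Bounds proved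
through `avg` are therefore uniform over all frequency scales. -/
theorem fourierInv_mul_eq_avg {κ Ψ m : Plane → ℂ} {A c : ℝ} (h : IsKernel κ A)
    (hΨ : Integrable Ψ) (hm : 𝓕 κ = m) :
    𝓕⁻ (fun ξ => m (c • ξ) * Ψ ξ) = avg κ (𝓕⁻ Ψ) c := by
  ext x
  rw [← hm]
  exact fourierInv_fourier_mul h.integrable hΨ c x

theorem norm_avg_le {κ φ : Plane → ℂ} {A c M : ℝ} (h : IsKernel κ A)
    (hφ : ∀ x, ‖φ x‖ ≤ M) (x : Plane) : ‖avg κ φ c x‖ ≤ A * kernelMass * M := by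
  have hM : 0 ≤ M := (norm_nonneg _).trans (hφ x)
  calc ‖avg κ φ c x‖ ≤ ∫ y, ‖κ y‖ * M := by
        refine norm_integral_le_of_norm_le (h.integrable.norm.mul_const M)
          (Filter.Eventually.of_forall fun y => ?_)
        rw [norm_mul]
        exact mul_le_mul_of_nonneg_left (hφ _) (norm_nonneg _)
    _ ≤ _ := by
        rw [integral_mul_const]
        exact mul_le_mul_of_nonneg_right h.integral_norm_le hM

theorem stronglyMeasurable_avg {κ φ : Plane → ℂ} (c : ℝ) (hκ : Continuous κ)
    (hφ : StronglyMeasurable φ) : StronglyMeasurable (avg κ φ c) := by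
  refine StronglyMeasurable.integral_prod_right' (f := fun z : Plane × Plane => κ z.2 * φ (z.1 - c • z.2)) ?_
  refine (hκ.stronglyMeasurable.comp_measurable measurable_snd).mul (hφ.comp_measurable ?_)
  fun_prop

theorem eLpNorm_comp_sub {p : ℝ≥0∞} {φ : Plane → ℂ} (hφ : StronglyMeasurable φ) (a : Plane) :
    eLpNorm (fun x => φ (x - a)) p volume = eLpNorm φ p volume :=
  eLpNorm_comp_measurePreserving hφ.aestronglyMeasurable (measurePreserving_sub_right volume a)

theorem eLpNorm_avg_le {κ φ : Plane → ℂ} {A p : ℝ} (c : ℝ) {N : ℝ} (h : IsKernel κ A) (hp : 1 < p)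
    (hφ : StronglyMeasurable φ) (hN : 0 < N)
    (hφN : eLpNorm φ (ENNReal.ofReal p) volume ≤ ENNReal.ofReal N) :
    eLpNorm (avg κ φ c) (ENNReal.ofReal p) volume ≤ ENNReal.ofReal (A * kernelMass * N) := by
  have hi : Integrable (fun y : Plane => (1 + ‖y‖) ^ (-4 : ℝ)) :=
    integrable_one_add_norm_plane (by norm_num)
  have hA := h.pos
  refine (eLpNorm_le_lintegral_of_le hp (μ := (volume : Measure Plane))
    (F := fun y x => κ y * φ (x - c • y)) (w := fun y => A * (1 + ‖y‖) ^ (-4 : ℝ) * N) ?_ ?_ ?_ ?_ ?_).trans ?_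
  · refine Measurable.aemeasurable ?_
    refine StronglyMeasurable.enorm (f := fun z : Plane × Plane => κ z.1 * φ (z.2 - c • z.1)) ?_
    refine (h.cont.stronglyMeasurable.comp_measurable measurable_fst).mul (hφ.comp_measurable ?_)
    fun_prop
  · fun_prop
  · filter_upwards with y
    have := one_add_norm_pos y
    positivity
  · filter_upwards with y
    have e : (fun x => κ y * φ (x - c • y)) = κ y • fun x => φ (x - c • y) := rfl
    rw [e, eLpNorm_const_smul, eLpNorm_comp_sub hφ]
    have := one_add_norm_pos y
    rw [ENNReal.ofReal_mul (by positivity)]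
    gcongr
    rw [← ofReal_norm]
    exact ENNReal.ofReal_le_ofReal (h.bound y)
  · filter_upwards with x
    exact enorm_integral_le_lintegral_enorm _
  · rw [← ofReal_integral_eq_lintegral_ofReal ((hi.const_mul A).mul_const N)
      (Filter.Eventually.of_forall fun y => by positivity), integral_mul_const, integral_const_mul]
    rfl

theorem lintegral_comp_sub_smul {f : Plane → ℝ≥0∞} (hf : Measurable f) {c : ℝ} (hc : 0 < c)
    (x : Plane) : ∫⁻ y, f (x - c • y) = ENNReal.ofReal (c ^ (-2 : ℝ)) * ∫⁻ y, f y := by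
  have h1 : ∫⁻ y, f (x - c • y) = ∫⁻ y, f (x - y) ∂(Measure.map (fun y : Plane => c • y) volume) := by
    rw [lintegral_map (by fun_prop) (by fun_prop)]
  rw [h1, Measure.map_addHaar_smul _ hc.ne', lintegral_smul_measure, lintegral_sub_left_eq_self]
  simp only [finrank_euclideanSpace, Fintype.card_fin, smul_eq_mul]
  congr 2
  rw [abs_of_pos (by positivity), Real.rpow_neg hc.le]
  norm_num

/-- Bernstein's inequality at frequency 1/c: Hölder in y, where the change of variables y ↦ x - c y
in dimension two gives c^{-2/p}. -/
theorem norm_avg_le_of_eLpNorm {κ φ : Plane → ℂ} {A p c N : ℝ} (h : IsKernel κ A) (hp : 1 < p)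
    (hc : 0 < c) (hφ : StronglyMeasurable φ) (hN : 0 ≤ N)
    (hφN : eLpNorm φ (ENNReal.ofReal p) volume ≤ ENNReal.ofReal N) (x : Plane) :
    ‖avg κ φ c x‖ ≤ A * kernelMass ^ (1 - 1 / p) * (c ^ (-(2 / p)) * N) := by
  have hi : Integrable (fun y : Plane => (1 + ‖y‖) ^ (-4 : ℝ)) :=
    integrable_one_add_norm_plane (by norm_num)
  have hA := h.pos
  have hp0 : 0 < p := by linarith
  set q := p / (p - 1) with hq
  have hpq : p.HolderConjugate q := Real.HolderConjugate.conjExponent hp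
  have hq0 : 0 < q := hpq.symm.pos
  have hq1 : 1 ≤ q := hpq.symm.lt.le
  have hJ := kernelMass_pos
  have h1 : ‖avg κ φ c x‖ₑ ≤ ∫⁻ y, ((fun y => ‖κ y‖ₑ) * fun y => ‖φ (x - c • y)‖ₑ) y := by
    refine (enorm_integral_le_lintegral_enorm _).trans (le_of_eq ?_)
    simp [enorm_mul]
  have hφm : Measurable fun y => ‖φ (x - c • y)‖ₑ := hφ.enorm.comp (by fun_prop)
  have h2 := ENNReal.lintegral_mul_le_Lp_mul_Lq volume hpq.symm
    (h.cont.stronglyMeasurable.enorm.aemeasurable) hφm.aemeasurable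
  have h3 : (∫⁻ y, ‖κ y‖ₑ ^ q) ^ (1 / q) ≤ ENNReal.ofReal (A * kernelMass ^ (1 - 1 / p)) := by
    have e : 1 - 1 / p = 1 / q := by rw [hq]; field_simp
    rw [e]
    have : ∫⁻ y, ‖κ y‖ₑ ^ q ≤ ENNReal.ofReal (A ^ q * kernelMass) := by
      rw [kernelMass, ← integral_const_mul, ofReal_integral_eq_lintegral_ofReal (hi.const_mul _)
        (Filter.Eventually.of_forall fun y => by positivity)]
      refine lintegral_mono fun y => ?_
      rw [← ofReal_norm, ENNReal.ofReal_rpow_of_nonneg (norm_nonneg _) hq0.le]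
      refine ENNReal.ofReal_le_ofReal ?_
      have hy := one_add_norm_pos y
      calc ‖κ y‖ ^ q ≤ (A * (1 + ‖y‖) ^ (-4 : ℝ)) ^ q :=
            Real.rpow_le_rpow (norm_nonneg _) (h.bound y) hq0.le
        _ = A ^ q * (1 + ‖y‖) ^ (-4 * q) := by
            rw [Real.mul_rpow hA.le (by positivity), ← Real.rpow_mul hy.le]
        _ ≤ _ := by
            gcongr
            · exact one_le_one_add_norm y
            · linarith
    refine (ENNReal.rpow_le_rpow this (by positivity)).trans (le_of_eq ?_)
    rw [ENNReal.ofReal_rpow_of_nonneg (by positivity) (by positivity),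
      Real.mul_rpow (by positivity) hJ.le, ← Real.rpow_mul hA.le, mul_one_div_cancel hq0.ne',
      Real.rpow_one]
  have h4 : (∫⁻ y, ‖φ (x - c • y)‖ₑ ^ p) ^ (1 / p) ≤ ENNReal.ofReal (c ^ (-(2 / p)) * N) := by
    rw [lintegral_comp_sub_smul (f := fun y => ‖φ y‖ₑ ^ p) (hφ.enorm.pow_const _) hc,
      ← eLpNorm_ofReal_rpow hp0, ENNReal.mul_rpow_of_nonneg _ _ (by positivity), ← ENNReal.rpow_mul,
      mul_one_div_cancel hp0.ne', ENNReal.rpow_one,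
      ENNReal.ofReal_rpow_of_nonneg (by positivity) (by positivity), ← Real.rpow_mul hc.le,
      ENNReal.ofReal_mul (by positivity)]
    have : (-2 : ℝ) * (1 / p) = -(2 / p) := by ring
    rw [this]
    gcongr
  have h5 : ‖avg κ φ c x‖ₑ ≤ ENNReal.ofReal (A * kernelMass ^ (1 - 1 / p) * (c ^ (-(2 / p)) * N)) := by
    rw [ENNReal.ofReal_mul (by positivity)]
    exact h1.trans (h2.trans (mul_le_mul' h3 h4))
  rw [← ofReal_norm] at h5
  exact (ENNReal.ofReal_le_ofReal_iff (by positivity)).1 h5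

theorem eLpNorm_fourier {F : Plane → ℂ} (h1 : Integrable F) (h2 : MemLp F 2) :
    eLpNorm (𝓕 F) 2 volume = eLpNorm F 2 volume := by
  have e : 𝓕 F = (𝓕⁻ F) ∘ Neg.neg := by
    ext x; simp [Real.fourierInv_eq_fourier_neg]
  rw [e, eLpNorm_comp_measurePreserving (continuous_fourierInv h1).aestronglyMeasurable
    (Measure.measurePreserving_neg volume), eLpNorm_fourierInv h1 h2]

open scoped Convolution in
-- Plancherel, after checking that the average lies in L¹ ∩ L². Unlike the bound by the mass of κ,
-- this one does not see the size of the kernel.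
theorem eLpNorm_avg_two_le {κ φ : Plane → ℂ} {A : ℝ} (h : IsKernel κ A)
    (hκ : ∀ ξ, ‖𝓕 κ ξ‖ ≤ 1) (hφ : StronglyMeasurable φ) (h1 : Integrable φ) (h2 : MemLp φ 2) :
    eLpNorm (avg κ φ 1) 2 volume ≤ eLpNorm φ 2 volume := by
  have hconv : avg κ φ 1 = κ ⋆[ContinuousLinearMap.mul ℂ ℂ] φ := by
    ext x
    simp [avg, MeasureTheory.convolution]
  have hL1 : Integrable (avg κ φ 1) := by
    rw [hconv]; exact h.integrable.integrable_convolution _ h1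
  have hL2 : MemLp (avg κ φ 1) 2 := by
    refine ⟨hL1.1, lt_of_le_of_lt (b := ENNReal.ofReal (A * kernelMass * ((eLpNorm φ 2 volume).toReal + 1))) ?_ ENNReal.ofReal_lt_top⟩
    have := eLpNorm_avg_le (p := 2) 1 (N := (eLpNorm φ 2 volume).toReal + 1) h (by norm_num) hφ
      (by positivity) ?_
    · simpa using this
    · rw [ENNReal.ofReal_add (by positivity) zero_le_one, ENNReal.ofReal_toReal h2.2.ne]
      simp
  rw [← eLpNorm_fourier hL1 hL2, ← eLpNorm_fourier h1 h2]
  refine eLpNorm_mono fun ξ => ?_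
  rw [hconv, Real.fourier_mul_convolution_eq h.integrable h1, norm_mul]
  exact mul_le_of_le_one_left (norm_nonneg _) (hκ ξ)

/-- An `L²` contraction given by a kernel of mass `B` has norm `O(B^{1-2/p})` on `L^p`, `p > 2`. -/
theorem eLpNorm_avg_le_of_fourier_le_one {κ ψ : Plane → ℂ} {A p : ℝ} (hp : 2 < p)
    (h : IsKernel κ A) (hκ : ∀ ξ, ‖𝓕 κ ξ‖ ≤ 1) (hψ : StronglyMeasurable ψ) (h2 : MemLp ψ 2) :
    eLpNorm (avg κ ψ 1) (ENNReal.ofReal p) volume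
      ≤ ENNReal.ofReal ((p * (4 * 2 ^ (p - 2) / (p - 2))) ^ (1 / p)
          * (A * kernelMass) ^ (1 - 2 / p)) * eLpNorm ψ (ENNReal.ofReal p) volume := by
  have hA := h.pos
  have hJ := kernelMass_pos
  -- The part of ψ above height l is integrable, being at most ‖ψ‖²/l, so the L² contraction applies
  -- to it; the part below is averaged to at most (mass) · l.
  refine eLpNorm_le_of_truncation hp (by positivity) hψ
    (stronglyMeasurable_avg 1 h.cont hψ).aestronglyMeasurable fun l hl => ?_
  have hms : MeasurableSet {x | l < ‖ψ x‖} := measurableSet_lt measurable_const hψ.norm.measurable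
  set ψ₁ := {x | l < ‖ψ x‖}.indicator ψ with hψ₁
  set ψ₂ := {x | l < ‖ψ x‖}ᶜ.indicator ψ with hψ₂
  have hm₁ : StronglyMeasurable ψ₁ := hψ.indicator hms
  have hm₂ : StronglyMeasurable ψ₂ := hψ.indicator hms.compl
  have hb₂ : ∀ x, ‖ψ₂ x‖ ≤ l := by
    intro x
    by_cases hx : l < ‖ψ x‖
    · rw [hψ₂, Set.indicator_of_notMem (by simpa using hx)]; simpa using hl.le
    · rw [hψ₂, Set.indicator_of_mem (by simpa using hx)]; exact not_lt.1 hx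
  have hsq : Integrable (fun x => ‖ψ x‖ ^ 2) := h2.integrable_norm_pow (by norm_num)
  have hi₁ : Integrable ψ₁ := by
    refine (hsq.const_mul l⁻¹).mono' hm₁.aestronglyMeasurable (Filter.Eventually.of_forall fun x => ?_)
    by_cases hx : l < ‖ψ x‖
    · rw [hψ₁, Set.indicator_of_mem (show x ∈ {x | l < ‖ψ x‖} from hx), inv_mul_eq_div, le_div_iff₀ hl]
      nlinarith [norm_nonneg (ψ x)]
    · rw [hψ₁, Set.indicator_of_notMem (show x ∉ {x | l < ‖ψ x‖} from hx), norm_zero]; positivity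
  have hL₁ : MemLp ψ₁ 2 := h2.indicator hms
  have hκb : ∀ y, ‖κ y‖ ≤ A := fun y => (h.bound y).trans (by
    have hy := one_add_norm_pos y
    have : (1 + ‖y‖) ^ (-4 : ℝ) ≤ 1 := Real.rpow_le_one_of_one_le_of_nonpos (one_le_one_add_norm y) (by norm_num)
    nlinarith)
  refine ⟨avg κ ψ₁ 1, (stronglyMeasurable_avg 1 h.cont hm₁).aestronglyMeasurable,
    eLpNorm_avg_two_le h hκ hm₁ hi₁ hL₁, Filter.Eventually.of_forall fun x => ?_⟩
  have hsum : avg κ ψ 1 x = avg κ ψ₁ 1 x + avg κ ψ₂ 1 x := by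
    rw [avg, avg, avg, ← integral_add]
    · refine integral_congr_ae (Filter.Eventually.of_forall fun y => ?_)
      simp only
      rw [← mul_add, hψ₁, hψ₂, Set.indicator_self_add_compl_apply]
    · refine Integrable.bdd_mul (c := A) ?_ h.cont.aestronglyMeasurable (Filter.Eventually.of_forall hκb)
      simp only [one_smul]
      exact hi₁.comp_sub_left x
    · refine Integrable.mul_bdd (c := l) h.integrable ?_ (Filter.Eventually.of_forall fun y => hb₂ _)
      exact (hm₂.comp_measurable (by fun_prop)).aestronglyMeasurable
  rw [hsum]
  exact (norm_add_le _ _).trans (by gcongr; exact norm_avg_le h hb₂ x)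

end Averages

/-! ### Decomposition of a function into frequency-localized pieces by a Beta integral. -/

section Subordination

/-- The multiplier `‖ξ‖^{2α} (1 + s ‖ξ‖²)^{-L}`, localized near the frequency `s^{-1/2}`. -/
noncomputable def bump (α : ℝ) (L : ℕ) (s : ℝ) (ξ : Plane) : ℝ :=
  ‖ξ‖ ^ (2 * α) * ((1 + s * ‖ξ‖ ^ 2) ^ L)⁻¹

/-- A weight on `(0, ∞)` that is integrable with respect to `ds`. -/
noncomputable def tails (γ s : ℝ) : ℝ := min (s ^ (-1 + γ)) (s ^ (-1 - γ))

theorem lintegral_tails_le {γ : ℝ} (hγ : 0 < γ) :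
    ∫⁻ s in Set.Ioi (0 : ℝ), ENNReal.ofReal (tails γ s) ≤ ENNReal.ofReal (2 / γ) := by
  rw [← Set.Ioc_union_Ioi_eq_Ioi (zero_le_one' ℝ)]
  refine (lintegral_union_le _ _ _).trans ?_
  have h1 : ∫⁻ s in Set.Ioc (0 : ℝ) 1, ENNReal.ofReal (tails γ s) ≤ ENNReal.ofReal (1 / γ) := by
    have hint : IntervalIntegrable (fun t : ℝ => t ^ (-1 + γ)) volume 0 1 :=
      intervalIntegral.intervalIntegrable_rpow' (by linarith)
    rw [intervalIntegrable_iff_integrableOn_Ioc_of_le zero_le_one] at hint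
    calc _ ≤ ∫⁻ s in Set.Ioc (0 : ℝ) 1, ENNReal.ofReal (s ^ (-1 + γ)) :=
          lintegral_mono fun s => ENNReal.ofReal_le_ofReal (min_le_left _ _)
      _ = _ := by
          rw [← ofReal_integral_eq_lintegral_ofReal hint, ← intervalIntegral.integral_of_le zero_le_one,
            integral_rpow (Or.inl (by linarith)), Real.zero_rpow (by linarith)]
          · simp
          · filter_upwards [ae_restrict_mem measurableSet_Ioc] with t ht
            exact Real.rpow_nonneg ht.1.le _
  have h2 : ∫⁻ s in Set.Ioi (1 : ℝ), ENNReal.ofReal (tails γ s) ≤ ENNReal.ofReal (1 / γ) := by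
    have hint := integrableOn_Ioi_rpow_of_lt (a := -1 - γ) (c := 1) (by linarith) one_pos
    calc _ ≤ ∫⁻ s in Set.Ioi (1 : ℝ), ENNReal.ofReal (s ^ (-1 - γ)) :=
          lintegral_mono fun s => ENNReal.ofReal_le_ofReal (min_le_right _ _)
      _ = _ := by
          rw [← ofReal_integral_eq_lintegral_ofReal hint, integral_Ioi_rpow_of_lt (by linarith) one_pos]
          · rw [Real.one_rpow, show -1 - γ + 1 = -γ by ring, neg_div_neg_eq]
          · filter_upwards [ae_restrict_mem measurableSet_Ioi] with t ht
            exact Real.rpow_nonneg (zero_le_one.trans (le_of_lt ht)) _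
  refine (add_le_add h1 h2).trans (le_of_eq ?_)
  rw [← ENNReal.ofReal_add (by positivity) (by positivity)]
  congr 1; ring

/-- The Beta integral `∫₀^∞ r^{α-1} (1 + r)^{-L} dr`. -/
noncomputable def betaConst (α : ℝ) (L : ℕ) : ℝ :=
  ∫ r in Set.Ioi (0 : ℝ), r ^ (α - 1) * ((1 + r) ^ L)⁻¹

theorem integrableOn_beta {α : ℝ} {L : ℕ} (hα : 0 < α) (hL : α < L) :
    IntegrableOn (fun r : ℝ => r ^ (α - 1) * ((1 + r) ^ L)⁻¹) (Set.Ioi 0) := by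
  have hm : Measurable (fun r : ℝ => r ^ (α - 1) * ((1 + r) ^ L)⁻¹) := by fun_prop
  rw [← Set.Ioc_union_Ioi_eq_Ioi (zero_le_one' ℝ)]
  refine IntegrableOn.union ?_ ?_
  · have hint : IntervalIntegrable (fun t : ℝ => t ^ (α - 1)) volume 0 1 :=
      intervalIntegral.intervalIntegrable_rpow' (by linarith)
    rw [intervalIntegrable_iff_integrableOn_Ioc_of_le zero_le_one] at hint
    refine hint.mono' hm.aestronglyMeasurable ?_
    filter_upwards [ae_restrict_mem measurableSet_Ioc] with r hr
    have h0 := hr.1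
    rw [Real.norm_of_nonneg (by positivity)]
    refine mul_le_of_le_one_right (by positivity) ?_
    refine inv_le_one_of_one_le₀ (one_le_pow₀ (by linarith))
  · have hint := integrableOn_Ioi_rpow_of_lt (a := α - 1 - L) (c := 1) (by linarith) one_pos
    refine hint.mono' hm.aestronglyMeasurable ?_
    filter_upwards [ae_restrict_mem measurableSet_Ioi] with r hr
    have h0 : (1 : ℝ) < r := hr
    have h00 : 0 < r := by linarith
    rw [Real.norm_of_nonneg (by positivity), Real.rpow_sub h00 (α - 1) L, Real.rpow_natCast, div_eq_mul_inv]
    gcongr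
    linarith

theorem betaConst_pos {α : ℝ} {L : ℕ} (hα : 0 < α) (hL : α < L) : 0 < betaConst α L := by
  refine (setIntegral_pos_iff_support_of_nonneg_ae ?_ (integrableOn_beta hα hL)).2 ?_
  · filter_upwards [ae_restrict_mem measurableSet_Ioi] with r hr
    have h0 : (0 : ℝ) < r := hr
    simp only [Pi.zero_apply]; positivity
  · have : Set.Ioi (0 : ℝ) ⊆ Function.support (fun r : ℝ => r ^ (α - 1) * ((1 + r) ^ L)⁻¹) := by
      intro r hr
      have h0 : (0 : ℝ) < r := hr
      simp only [Function.mem_support]; positivity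
    rw [Set.inter_eq_right.2 this]
    simp

theorem bump_nonneg {α : ℝ} {L : ℕ} {s : ℝ} (hs : 0 ≤ s) (ξ : Plane) : 0 ≤ bump α L s ξ := by
  unfold bump; positivity

theorem measurable_bump (α : ℝ) (L : ℕ) : Measurable fun z : ℝ × Plane => bump α L z.1 z.2 := by
  unfold bump; fun_prop

theorem measurable_bump_swap (α : ℝ) (L : ℕ) :
    Measurable fun z : Plane × ℝ => bump α L z.2 z.1 := by
  unfold bump; fun_prop

/-- The substitution r = s ‖ξ‖² removes ξ from the integral. The multipliers `bump α L s` thus form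
a continuous partition of a constant away from ξ = 0, with scale-invariant pieces that stay smooth
after multiplication by suitable singular factors. -/
theorem integrableOn_rpow_mul_bump {α : ℝ} {L : ℕ} (hα : 0 < α) (hL : α < L) {ξ : Plane} (hξ : ξ ≠ 0) :
    IntegrableOn (fun s : ℝ => s ^ (α - 1) * bump α L s ξ) (Set.Ioi 0) ∧
    ∫ s in Set.Ioi (0 : ℝ), s ^ (α - 1) * bump α L s ξ = betaConst α L := by
  have hn : 0 < ‖ξ‖ := norm_pos_iff.2 hξ
  have hb : 0 < ‖ξ‖ ^ 2 := by positivity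
  have he : ∀ s ∈ Set.Ioi (0 : ℝ), s ^ (α - 1) * bump α L s ξ
      = ‖ξ‖ ^ 2 * ((‖ξ‖ ^ 2 * s) ^ (α - 1) * ((1 + ‖ξ‖ ^ 2 * s) ^ L)⁻¹) := by
    intro s hs
    have hs' : (0 : ℝ) < s := hs
    rw [Real.mul_rpow hb.le hs'.le, bump, Real.rpow_mul hn.le, Real.rpow_sub hb]
    norm_num
    rw [mul_comm s (‖ξ‖ ^ 2)]
    field_simp
  constructor
  · refine IntegrableOn.congr_fun ?_ (fun s hs => (he s hs).symm) measurableSet_Ioi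
    refine Integrable.const_mul ?_ _
    have := (integrableOn_Ioi_comp_mul_left_iff (fun r : ℝ => r ^ (α - 1) * ((1 + r) ^ L)⁻¹) 0 hb).2
      (by rw [mul_zero]; exact integrableOn_beta hα hL)
    exact this
  · rw [setIntegral_congr_fun measurableSet_Ioi he, integral_const_mul,
      integral_comp_mul_left_Ioi (fun r : ℝ => r ^ (α - 1) * ((1 + r) ^ L)⁻¹) 0 hb, mul_zero, smul_eq_mul,
      ← mul_assoc, mul_inv_cancel₀ hb.ne', one_mul]
    rfl

/-- Tonelli: the s-integral of the weight is the same for almost every ξ, so the double integral of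
the norm is that constant times the integral of ‖F‖. -/
theorem integrable_prod_of_norm_eq {E : Type*} [MeasurableSpace E] {μ : Measure E} [SFinite μ]
    {k : E × ℝ → ℂ} {w : E → ℝ → ℝ} {F : E → ℂ} {c : ℝ}
    (hk : StronglyMeasurable k) (hF : Integrable F μ)
    (hnorm : ∀ ξ, ∀ s ∈ Set.Ioi (0 : ℝ), ‖k (ξ, s)‖ = w ξ s * ‖F ξ‖)
    (hw : ∀ᵐ ξ ∂μ, IntegrableOn (w ξ) (Set.Ioi 0) ∧ ∫ s in Set.Ioi (0 : ℝ), w ξ s = c) :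
    Integrable k (μ.prod (volume.restrict (Set.Ioi (0 : ℝ)))) := by
  refine (integrable_prod_iff hk.aestronglyMeasurable).2 ⟨?_, ?_⟩
  · filter_upwards [hw] with ξ hξ
    refine Integrable.mono' (hξ.1.mul_const ‖F ξ‖)
      (hk.comp_measurable measurable_prodMk_left).aestronglyMeasurable ?_
    filter_upwards [ae_restrict_mem measurableSet_Ioi] with s hs
    exact (hnorm ξ s hs).le
  · refine (hF.norm.const_mul c).congr ?_
    filter_upwards [hw] with ξ hξ
    rw [setIntegral_congr_fun measurableSet_Ioi (hnorm ξ), integral_mul_const, hξ.2]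

theorem stronglyMeasurable_fourierChar_inner {E : Type*} [MeasurableSpace E] {f g : E → Plane}
    (hf : Measurable f) (hg : Measurable g) :
    StronglyMeasurable fun z => (Real.fourierChar (inner ℝ (f z) (g z)) : ℂ) := by
  have h : Continuous fun r : ℝ => (Real.fourierChar r : ℂ) :=
    continuous_subtype_val.comp Real.continuous_fourierChar
  exact (h.measurable.comp (hf.inner hg)).stronglyMeasurable

theorem stronglyMeasurable_beta_kernel (α : ℝ) (L : ℕ) {F : Plane → ℂ}
    (hFm : StronglyMeasurable F) (x : Plane) :
    StronglyMeasurable (fun z : Plane × ℝ => (Real.fourierChar (inner ℝ z.1 x) : ℂ)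
      * (((z.2 ^ (α - 1) * bump α L z.2 z.1 : ℝ) : ℂ) * F z.1)) := by
  have h1 : Measurable fun z : Plane × ℝ => z.2 ^ (α - 1) := measurable_snd.pow_const _
  have h2 : Measurable fun z : Plane × ℝ => bump α L z.2 z.1 :=
    measurable_bump_swap α L
  have h3 : Measurable fun z : Plane × ℝ => ((z.2 ^ (α - 1) * bump α L z.2 z.1 : ℝ) : ℂ) :=
    Complex.measurable_ofReal.comp (h1.mul h2)
  have h4 : StronglyMeasurable fun z : Plane × ℝ => F z.1 := hFm.comp_measurable measurable_fst
  have h5 : StronglyMeasurable fun z : Plane × ℝ => (Real.fourierChar (inner ℝ z.1 x) : ℂ) :=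
    stronglyMeasurable_fourierChar_inner measurable_fst measurable_const
  exact h5.mul (h3.stronglyMeasurable.mul h4)

/-- The partition of the constant is multiplied by F, and the two integrals are exchanged; the
origin, where it fails, is a null set. -/
theorem betaConst_mul_fourierInv {α : ℝ} {L : ℕ} (hα : 0 < α) (hL : α < L) {F : Plane → ℂ}
    (hFm : StronglyMeasurable F) (hF : Integrable F) (x : Plane) :
    (betaConst α L : ℂ) * 𝓕⁻ F x
      = ∫ s in Set.Ioi (0 : ℝ), ((s ^ (α - 1) : ℝ) : ℂ) * 𝓕⁻ (fun ξ => (bump α L s ξ : ℂ) * F ξ) x := by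
  have hne : ∀ᵐ ξ : Plane, ξ ≠ 0 := by
    simp [ae_iff]
  have hsw := integrable_prod_of_norm_eq (w := fun ξ s => s ^ (α - 1) * bump α L s ξ)
    (c := betaConst α L) (stronglyMeasurable_beta_kernel α L hFm x) hF
    (fun ξ s hs => by
      have hs' : (0 : ℝ) < s := hs
      rw [norm_mul, norm_mul, Circle.norm_coe, one_mul, Complex.norm_real,
        Real.norm_of_nonneg (mul_nonneg (by positivity) (bump_nonneg hs'.le ξ))])
    (hne.mono fun ξ hξ => integrableOn_rpow_mul_bump hα hL hξ)
  have h1 : (betaConst α L : ℂ) * 𝓕⁻ F x = ∫ ξ, ∫ s in Set.Ioi (0 : ℝ),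
      (Real.fourierChar (inner ℝ ξ x) : ℂ) * (((s ^ (α - 1) * bump α L s ξ : ℝ) : ℂ) * F ξ) := by
    rw [Real.fourierInv_eq, ← integral_const_mul]
    refine integral_congr_ae ?_
    filter_upwards [hne] with ξ hξ
    rw [integral_const_mul, integral_mul_const, integral_complex_ofReal,
      (integrableOn_rpow_mul_bump hα hL hξ).2, Circle.smul_def, smul_eq_mul]
    ring
  rw [h1, integral_integral_swap hsw]
  congr 1; ext s
  rw [Real.fourierInv_eq, ← integral_const_mul]
  congr 1; ext ξ
  rw [Circle.smul_def, smul_eq_mul, Complex.ofReal_mul]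
  ring

/-- To bound the inverse Fourier transform of `F` in `L^p` it suffices to bound those of
`bump α L s * F`. -/
theorem eLpNorm_fourierInv_le_of_bump {α γ p : ℝ} {L : ℕ} (hα : 0 < α) (hL : α < L) (hγ : 0 < γ)
    (hp : 1 < p) : ∃ C : ℝ, 0 < C ∧ ∀ (F : Plane → ℂ) (N : ℝ), StronglyMeasurable F → Integrable F →
      0 < N → (∀ s : ℝ, 0 < s → eLpNorm (𝓕⁻ (fun ξ => (bump α L s ξ : ℂ) * F ξ)) (ENNReal.ofReal p) volume
        ≤ ENNReal.ofReal (N * (s ^ (1 - α) * tails γ s))) →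
      eLpNorm (𝓕⁻ F) (ENNReal.ofReal p) volume ≤ ENNReal.ofReal (C * N) := by
  have hc := betaConst_pos hα hL
  refine ⟨(betaConst α L)⁻¹ * (2 / γ), by positivity, fun F N hFm hF hN hs => ?_⟩
  have htm : Measurable (tails γ) := by unfold tails; fun_prop
  have htp : ∀ s : ℝ, 0 < s → 0 < tails γ s := fun s hs => lt_min (by positivity) (by positivity)
  refine (eLpNorm_le_lintegral_of_le hp (μ := volume.restrict (Set.Ioi (0 : ℝ)))
    (F := fun s x => (((betaConst α L)⁻¹ * s ^ (α - 1) : ℝ) : ℂ) * 𝓕⁻ (fun ξ => (bump α L s ξ : ℂ) * F ξ) x)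
    (w := fun s => (betaConst α L)⁻¹ * N * tails γ s) ?_ (htm.const_mul _) ?_ ?_ ?_).trans ?_
  · refine (StronglyMeasurable.enorm ?_).aemeasurable
    refine StronglyMeasurable.mul ?_ ?_
    · exact (by fun_prop : Measurable fun z : ℝ × Plane => (((betaConst α L)⁻¹ * z.1 ^ (α - 1) : ℝ) : ℂ)).stronglyMeasurable
    · simp only [Real.fourierInv_eq, Circle.smul_def, smul_eq_mul]
      refine StronglyMeasurable.integral_prod_right' (f := fun w : (ℝ × Plane) × Plane =>
        (Real.fourierChar (inner ℝ w.2 w.1.2) : ℂ) * ((bump α L w.1.1 w.2 : ℂ) * F w.2)) ?_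
      refine StronglyMeasurable.mul (stronglyMeasurable_fourierChar_inner measurable_snd
        (measurable_snd.comp measurable_fst)) ?_
      refine StronglyMeasurable.mul ?_ (hFm.comp_measurable measurable_snd)
      exact (Complex.measurable_ofReal.comp ((measurable_bump α L).comp
        (by fun_prop : Measurable fun w : (ℝ × Plane) × Plane => (w.1.1, w.2)))).stronglyMeasurable
  · filter_upwards [ae_restrict_mem measurableSet_Ioi] with s hs'
    have := htp s hs'
    positivity
  · filter_upwards [ae_restrict_mem measurableSet_Ioi] with s hs'
    have hs0 : (0 : ℝ) < s := hs'
    have ht := htp s hs0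
    have e : (fun x => (((betaConst α L)⁻¹ * s ^ (α - 1) : ℝ) : ℂ) * 𝓕⁻ (fun ξ => (bump α L s ξ : ℂ) * F ξ) x)
      = (((betaConst α L)⁻¹ * s ^ (α - 1) : ℝ) : ℂ) • 𝓕⁻ (fun ξ => (bump α L s ξ : ℂ) * F ξ) := rfl
    rw [e, eLpNorm_const_smul, ← ofReal_norm, Complex.norm_real, Real.norm_of_nonneg (by positivity)]
    refine (mul_le_mul_right (hs s hs0) _).trans (le_of_eq ?_)
    rw [← ENNReal.ofReal_mul (by positivity)]
    congr 1
    have : s ^ (α - 1) * s ^ (1 - α) = 1 := by rw [← Real.rpow_add hs0]; simp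
    linear_combination ((betaConst α L)⁻¹ * N * tails γ s) * this
  · filter_upwards with x
    have h1 : 𝓕⁻ F x = ∫ s in Set.Ioi (0 : ℝ), (((betaConst α L)⁻¹ * s ^ (α - 1) : ℝ) : ℂ)
        * 𝓕⁻ (fun ξ => (bump α L s ξ : ℂ) * F ξ) x := by
      have h2 := betaConst_mul_fourierInv hα hL hFm hF x
      have h3 : (betaConst α L : ℂ) ≠ 0 := by exact_mod_cast hc.ne'
      rw [← mul_right_inj' h3, h2, ← integral_const_mul]
      congr 1; ext s
      push_cast
      field_simp
    rw [h1]
    exact enorm_integral_le_lintegral_enorm _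
  · have : ∀ s, ENNReal.ofReal ((betaConst α L)⁻¹ * N * tails γ s)
        = ENNReal.ofReal ((betaConst α L)⁻¹ * N) * ENNReal.ofReal (tails γ s) := fun s =>
      ENNReal.ofReal_mul (by positivity)
    simp only [this]
    rw [lintegral_const_mul' _ _ ENNReal.ofReal_ne_top]
    refine (mul_le_mul_right (lintegral_tails_le hγ) _).trans (le_of_eq ?_)
    rw [← ENNReal.ofReal_mul (by positivity)]
    congr 1; ring

end Subordination

/-! ### Hölder's inequality for two and three functions. -/

section Holder

variable {X E F G : Type*} [MeasurableSpace X] [NormedAddCommGroup E] [NormedAddCommGroup F]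
  [NormedAddCommGroup G]

theorem eLpNorm_ofReal_eq {p : ℝ} (hp : 0 < p) (f : X → E) (ν : Measure X) :
    eLpNorm f (ENNReal.ofReal p) ν = (∫⁻ x, ‖f x‖ₑ ^ p ∂ν) ^ (1 / p) := by
  rw [← eLpNorm_ofReal_rpow hp, ← ENNReal.rpow_mul, mul_one_div_cancel hp.ne', ENNReal.rpow_one]

theorem eLpNorm_two_eq (f : X → E) (ν : Measure X) :
    eLpNorm f 2 ν = (∫⁻ x, ‖f x‖ₑ ^ (2 : ℝ) ∂ν) ^ (1 / 2 : ℝ) := by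
  rw [← eLpNorm_ofReal_eq two_pos, show ENNReal.ofReal 2 = 2 by norm_num]

/-- Hölder's inequality for three functions. -/
theorem lintegral_mul_mul_le {p q r : ℝ} (hp : 0 < p) (hq : 0 < q) (hr : 0 < r)
    (h : 1 / p + 1 / q + 1 / r = 1) {ν : Measure X} {f : X → E} {g : X → F} {k : X → G}
    (hf : AEStronglyMeasurable f ν) (hg : AEStronglyMeasurable g ν)
    (hk : AEStronglyMeasurable k ν) :
    ∫⁻ x, ‖f x‖ₑ * ‖g x‖ₑ * ‖k x‖ₑ ∂ν ≤ eLpNorm f (ENNReal.ofReal p) ν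
      * eLpNorm g (ENNReal.ofReal q) ν * eLpNorm k (ENNReal.ofReal r) ν := by
  have key := ENNReal.lintegral_prod_norm_pow_le (μ := ν) (Finset.univ : Finset (Fin 3))
    (f := ![fun x => ‖f x‖ₑ ^ p, fun x => ‖g x‖ₑ ^ q, fun x => ‖k x‖ₑ ^ r])
    (p := ![1 / p, 1 / q, 1 / r])
    (by
      intro i _
      fin_cases i
      · exact hf.enorm.pow_const _
      · exact hg.enorm.pow_const _
      · exact hk.enorm.pow_const _)
    (by simpa [Fin.sum_univ_three] using h)
    (by
      intro i _
      fin_cases i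
      · exact (one_div_pos.2 hp).le
      · exact (one_div_pos.2 hq).le
      · exact (one_div_pos.2 hr).le)
  simp only [Fin.prod_univ_three, Matrix.cons_val_zero, Matrix.cons_val_one, Matrix.cons_val_two,
    Matrix.head_cons, Matrix.tail_cons] at key
  rw [eLpNorm_ofReal_eq hp, eLpNorm_ofReal_eq hq, eLpNorm_ofReal_eq hr]
  refine le_trans (le_of_eq ?_) key
  congr 1; ext x
  rw [← ENNReal.rpow_mul, ← ENNReal.rpow_mul, ← ENNReal.rpow_mul, mul_one_div_cancel hp.ne',
    mul_one_div_cancel hq.ne', mul_one_div_cancel hr.ne']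
  simp

theorem lintegral_mul_le_eLpNorm_two {ν : Measure X} {f : X → E} {g : X → F}
    (hf : AEStronglyMeasurable f ν) (hg : AEStronglyMeasurable g ν) :
    ∫⁻ x, ‖f x‖ₑ * ‖g x‖ₑ ∂ν ≤ eLpNorm f 2 ν * eLpNorm g 2 ν := by
  have h := ENNReal.lintegral_mul_le_Lp_mul_Lq ν (Real.HolderConjugate.two_two) hf.enorm hg.enorm
  rw [eLpNorm_two_eq, eLpNorm_two_eq]
  exact h

end Holder

/-! ### The propagator and Riesz symbols, and weighted L² bounds in frequency. -/

section Weights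

/-- The propagator symbol `e^{ia⟨2πξ⟩}`. -/
noncomputable def osc (a : ℝ) (ξ : Plane) : ℂ :=
  Complex.exp (Complex.I * ((a * jb (freq ξ) : ℝ) : ℂ))

theorem norm_osc (a : ℝ) (ξ : Plane) : ‖osc a ξ‖ = 1 := by
  rw [osc, mul_comm]; exact Complex.norm_exp_ofReal_mul_I _

theorem continuous_jb {V : Type*} [NormedAddCommGroup V] : Continuous (jb : V → ℝ) := by
  unfold jb; fun_prop

theorem continuous_freq : Continuous freq := by unfold freq; fun_prop

theorem continuous_osc (a : ℝ) : Continuous (osc a) := by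
  have := continuous_jb.comp continuous_freq
  unfold osc
  exact Complex.continuous_exp.comp (continuous_const.mul
    (Complex.continuous_ofReal.comp (continuous_const.mul this)))

/-- The symbol `ξ_j / ‖ξ‖`. -/
noncomputable def riesz (j : Fin 2) (ξ : Plane) : ℝ := ξ j / ‖ξ‖

theorem abs_coord_le (j : Fin 2) (ξ : Plane) : |ξ j| ≤ ‖ξ‖ := by
  simpa using PiLp.norm_apply_le ξ j

theorem abs_riesz_le (j : Fin 2) (ξ : Plane) : |riesz j ξ| ≤ 1 := by
  rw [riesz, abs_div, abs_norm]
  exact div_le_one_of_le₀ (abs_coord_le j ξ) (norm_nonneg _)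

theorem measurable_riesz (j : Fin 2) : Measurable (riesz j) := by
  unfold riesz; fun_prop

/-- `‖(1 + ‖ξ‖)^M Φ‖_{L²} ≤ N`. -/
def SobolevBound (M : ℕ) (N : ℝ) (Φ : Plane → ℂ) : Prop :=
  eLpNorm (fun ξ => (((1 + ‖ξ‖) ^ M : ℝ) : ℂ) * Φ ξ) 2 volume ≤ ENNReal.ofReal N

theorem SobolevBound.eLpNorm_le {F Φ : Plane → ℂ} {A N : ℝ} {M : ℕ} (hA : 0 ≤ A)
    (hΦ : SobolevBound M N Φ) (h : ∀ ξ, ‖F ξ‖ ≤ A * ((1 + ‖ξ‖) ^ M * ‖Φ ξ‖)) :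
    eLpNorm F 2 volume ≤ ENNReal.ofReal (A * N) := by
  rw [ENNReal.ofReal_mul hA]
  refine (eLpNorm_le_mul_eLpNorm_of_ae_le_mul (c := A)
    (g := fun ξ => (((1 + ‖ξ‖) ^ M : ℝ) : ℂ) * Φ ξ) (Filter.Eventually.of_forall fun ξ => ?_)
    2).trans (mul_le_mul_right hΦ _)
  rw [norm_mul, Complex.norm_real, Real.norm_of_nonneg (by positivity)]
  exact h ξ

theorem eLpNorm_one_add_norm_two :
    eLpNorm (fun ξ : Plane => (1 + ‖ξ‖) ^ (-2 : ℝ)) 2 volume = ENNReal.ofReal (√kernelMass) := by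
  rw [eLpNorm_two_eq]
  have : ∀ ξ : Plane, ‖(1 + ‖ξ‖) ^ (-2 : ℝ)‖ₑ ^ (2 : ℝ) = ENNReal.ofReal ((1 + ‖ξ‖) ^ (-4 : ℝ)) := by
    intro ξ
    have h := one_add_norm_pos ξ
    rw [← ofReal_norm, Real.norm_of_nonneg (by positivity), ENNReal.ofReal_rpow_of_pos (by positivity),
      ← Real.rpow_mul h.le]
    norm_num
  simp only [this]
  rw [← ofReal_integral_eq_lintegral_ofReal (integrable_one_add_norm_plane (by norm_num))
    (Filter.Eventually.of_forall fun ξ => by have := one_add_norm_pos ξ; positivity)]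
  change ENNReal.ofReal kernelMass ^ (1 / 2 : ℝ) = _
  rw [ENNReal.ofReal_rpow_of_pos kernelMass_pos, Real.sqrt_eq_rpow]

theorem integrable_of_lintegral_le {V : Type*} [MeasurableSpace V] {μ : Measure V} {F : V → ℂ}
    {N : ℝ} (hF : AEStronglyMeasurable F μ) (hN : 0 ≤ N)
    (h : ∫⁻ ξ, ‖F ξ‖ₑ ∂μ ≤ ENNReal.ofReal N) : Integrable F μ ∧ ∫ ξ, ‖F ξ‖ ∂μ ≤ N := by
  refine ⟨⟨hF, h.trans_lt ENNReal.ofReal_lt_top⟩, ?_⟩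
  rw [integral_norm_eq_lintegral_enorm hF]
  exact ENNReal.toReal_le_of_le_ofReal hN h

/-- Cauchy–Schwarz against (1 + ‖ξ‖)^{-2}, which is square integrable in dimension two; this is the
origin of the two extra powers. -/
theorem SobolevBound.integrable {F Φ : Plane → ℂ} {A N : ℝ} {M : ℕ} (hA : 0 ≤ A) (hN : 0 ≤ N)
    (hΦ : SobolevBound M N Φ)
    (hF : AEStronglyMeasurable F) (h : ∀ ξ, ‖F ξ‖ * (1 + ‖ξ‖) ^ 2 ≤ A * ((1 + ‖ξ‖) ^ M * ‖Φ ξ‖)) :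
    Integrable F ∧ ∫ ξ, ‖F ξ‖ ≤ A * √kernelMass * N := by
  refine integrable_of_lintegral_le hF (by positivity) ?_
  have hw : AEStronglyMeasurable (fun ξ : Plane => (1 + ‖ξ‖) ^ (-2 : ℝ)) :=
    (by fun_prop : Measurable fun ξ : Plane => (1 + ‖ξ‖) ^ (-2 : ℝ)).aestronglyMeasurable
  have hF' : AEStronglyMeasurable (fun ξ : Plane => (((1 + ‖ξ‖) ^ 2 : ℝ) : ℂ) * F ξ) :=
    (by fun_prop : Continuous fun ξ : Plane => (((1 + ‖ξ‖) ^ 2 : ℝ) : ℂ)).aestronglyMeasurable.mul hF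
  calc ∫⁻ ξ, ‖F ξ‖ₑ = ∫⁻ ξ, ‖(1 + ‖ξ‖) ^ (-2 : ℝ)‖ₑ * ‖(((1 + ‖ξ‖) ^ 2 : ℝ) : ℂ) * F ξ‖ₑ := by
        congr 1; ext ξ
        have h1 := one_add_norm_pos ξ
        rw [← ofReal_norm, ← ofReal_norm, ← ofReal_norm, ← ENNReal.ofReal_mul (norm_nonneg _), norm_mul,
          Complex.norm_real, Real.norm_of_nonneg (by positivity), Real.norm_of_nonneg (by positivity),
          ← mul_assoc, ← Real.rpow_natCast, ← Real.rpow_add h1]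
        norm_num
    _ ≤ _ := lintegral_mul_le_eLpNorm_two hw hF'
    _ ≤ ENNReal.ofReal (√kernelMass) * ENNReal.ofReal (A * N) := by
        rw [eLpNorm_one_add_norm_two]
        refine mul_le_mul_right (hΦ.eLpNorm_le hA fun ξ => ?_) _
        rw [norm_mul, Complex.norm_real, Real.norm_of_nonneg (by positivity), mul_comm]
        exact h ξ
    _ = _ := by
        rw [← ENNReal.ofReal_mul (by positivity)]
        congr 1; ring

theorem SobolevBound.nonneg_mono {Φ : Plane → ℂ} {N N' : ℝ} {M M' : ℕ}
    (hΦ : SobolevBound M N Φ) (hM : M' ≤ M) (hN : N ≤ N') : SobolevBound M' N' Φ := by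
  refine (hΦ.eLpNorm_le (A := 1) zero_le_one fun ξ => ?_).trans
    (ENNReal.ofReal_le_ofReal (by linarith))
  rw [norm_mul, Complex.norm_real, Real.norm_of_nonneg (by positivity), one_mul]
  gcongr
  exact one_le_one_add_norm ξ

theorem SobolevBound.integrable_memLp {Φ : Plane → ℂ} {N : ℝ} {M : ℕ}
    (hΦ : SobolevBound M N Φ) (hN : 0 ≤ N) (hM : 2 ≤ M) (hm : StronglyMeasurable Φ) :
    Integrable Φ ∧ MemLp Φ 2 := by
  have h1 : ∀ ξ : Plane, (1 : ℝ) ≤ 1 + ‖ξ‖ := one_le_one_add_norm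
  refine ⟨(hΦ.integrable (A := 1) zero_le_one hN hm.aestronglyMeasurable
    fun ξ => ?_).1, hm.aestronglyMeasurable, ?_⟩
  · rw [one_mul, mul_comm]
    gcongr
    exact h1 ξ
  · refine (hΦ.eLpNorm_le (A := 1) zero_le_one fun ξ => ?_).trans_lt ENNReal.ofReal_lt_top
    rw [one_mul]
    exact le_mul_of_one_le_left (norm_nonneg _) (one_le_pow₀ (h1 ξ))

end Weights

/-! ### Low-frequency gain from spatial decay. -/

section Resolvent

theorem one_add_norm_sq_pos {s : ℝ} (hs : 0 ≤ s) (ξ : Plane) : 0 < 1 + s * ‖ξ‖ ^ 2 := by positivity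

/-- Scaling by √s in dimension two, after the comparison of 1/(1 + u²) with 2(1 + u)^{-2}. -/
theorem eLpNorm_resolvent_two {s : ℝ} (hs : 0 < s) :
    eLpNorm (fun ξ : Plane => (1 + s * ‖ξ‖ ^ 2)⁻¹) 2 volume
      ≤ ENNReal.ofReal (2 * √kernelMass * s ^ (-(1 / 2) : ℝ)) := by
  have hm : Measurable fun x : Plane => ‖2 * (1 + ‖x‖) ^ (-2 : ℝ)‖ₑ ^ (2 : ℝ) := by fun_prop
  have key : ∫⁻ ξ : Plane, ‖(1 + s * ‖ξ‖ ^ 2)⁻¹‖ₑ ^ (2 : ℝ)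
      ≤ ENNReal.ofReal (s ^ (-1 : ℝ)) * ∫⁻ x : Plane, ‖2 * (1 + ‖x‖) ^ (-2 : ℝ)‖ₑ ^ (2 : ℝ) := by
    have h2 := lintegral_comp_sub_smul hm (Real.sqrt_pos.2 hs) 0
    rw [Real.sqrt_eq_rpow, ← Real.rpow_mul hs.le, show (1 / 2 * -2 : ℝ) = -1 by norm_num] at h2
    rw [← h2]
    refine lintegral_mono fun ξ => ?_
    gcongr
    rw [← ofReal_norm, ← ofReal_norm, Real.norm_of_nonneg (by positivity),
      Real.norm_of_nonneg (by positivity)]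
    refine ENNReal.ofReal_le_ofReal ?_
    rw [zero_sub, norm_neg, norm_smul, Real.norm_of_nonneg (by positivity), ← Real.sqrt_eq_rpow,
      Real.rpow_neg (by positivity), ← div_eq_mul_inv, inv_eq_one_div,
      div_le_div_iff₀ (by positivity) (by positivity)]
    norm_num
    have := Real.sq_sqrt hs.le
    nlinarith [sq_nonneg (1 - √s * ‖ξ‖)]
  calc eLpNorm (fun ξ : Plane => (1 + s * ‖ξ‖ ^ 2)⁻¹) 2 volume
      = (∫⁻ ξ : Plane, ‖(1 + s * ‖ξ‖ ^ 2)⁻¹‖ₑ ^ (2 : ℝ)) ^ (1 / 2 : ℝ) := by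
        rw [eLpNorm_two_eq]
    _ ≤ (ENNReal.ofReal (s ^ (-1 : ℝ)) * ∫⁻ x : Plane, ‖2 * (1 + ‖x‖) ^ (-2 : ℝ)‖ₑ ^ (2 : ℝ))
        ^ (1 / 2 : ℝ) := by gcongr
    _ = ENNReal.ofReal (s ^ (-(1 / 2) : ℝ)) * eLpNorm (fun x : Plane => 2 * (1 + ‖x‖) ^ (-2 : ℝ)) 2 volume := by
        rw [ENNReal.mul_rpow_of_nonneg _ _ (by norm_num), ENNReal.ofReal_rpow_of_pos (by positivity),
          ← Real.rpow_mul hs.le, eLpNorm_two_eq]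
        norm_num
    _ = _ := by
        have : (fun x : Plane => 2 * (1 + ‖x‖) ^ (-2 : ℝ)) = (2 : ℝ) • fun x : Plane => (1 + ‖x‖) ^ (-2 : ℝ) := rfl
        rw [this, eLpNorm_const_smul, eLpNorm_one_add_norm_two, ← ofReal_norm, Real.norm_of_nonneg (by norm_num),
          ← ENNReal.ofReal_mul (by norm_num), ← ENNReal.ofReal_mul (by positivity)]
        congr 1; ring

theorem exists_eLpNorm_one_add_norm {r : ℝ} (hr : 2 < r) : ∃ C : ℝ, 0 < C ∧
    eLpNorm (fun x : Plane => (1 + ‖x‖) ^ (-1 : ℝ)) (ENNReal.ofReal r) volume ≤ ENNReal.ofReal C := by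
  have h : eLpNorm (fun x : Plane => (1 + ‖x‖) ^ (-1 : ℝ)) (ENNReal.ofReal r) volume < ∞ := by
    rw [eLpNorm_ofReal_eq (by linarith)]
    refine ENNReal.rpow_lt_top_of_nonneg (by positivity) (ne_of_lt ?_)
    have e : ∀ x : Plane, ‖(1 + ‖x‖) ^ (-1 : ℝ)‖ₑ ^ r = ‖(1 + ‖x‖) ^ (-r)‖ₑ := by
      intro x
      have h := one_add_norm_pos x
      rw [← ofReal_norm, ← ofReal_norm, Real.norm_of_nonneg (by positivity), Real.norm_of_nonneg (by positivity),
        ENNReal.ofReal_rpow_of_pos (by positivity), ← Real.rpow_mul h.le]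
      norm_num
    simp only [e]
    exact (integrable_one_add_norm_plane hr).2
  refine ⟨(eLpNorm (fun x : Plane => (1 + ‖x‖) ^ (-1 : ℝ)) (ENNReal.ofReal r) volume).toReal + 1,
    add_pos_of_nonneg_of_pos ENNReal.toReal_nonneg one_pos, ?_⟩
  rw [ENNReal.ofReal_add ENNReal.toReal_nonneg zero_le_one, ENNReal.ofReal_toReal h.ne]
  exact le_self_add

/-- Low frequency gain from spatial decay: `‖(1 + s‖ξ‖²)⁻¹ Φ‖_{L²} = O(s^{-1/3})`. -/
theorem exists_eLpNorm_resolvent_mul_le {p : ℝ} (hp : 2 < p) (hp3 : p < 3) : ∃ C : ℝ, 0 < C ∧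
    ∀ (Φ : Plane → ℂ) (X : ℝ), StronglyMeasurable Φ → Integrable Φ → MemLp Φ 2 → 0 < X →
      eLpNorm (fun x => ((1 + ‖x‖ : ℝ) : ℂ) * 𝓕⁻ Φ x) (ENNReal.ofReal p) volume ≤ ENNReal.ofReal X →
      ∀ s : ℝ, 0 < s → eLpNorm (fun ξ => (((1 + s * ‖ξ‖ ^ 2)⁻¹ : ℝ) : ℂ) * Φ ξ) 2 volume
        ≤ ENNReal.ofReal (C * (s ^ (-(1 / 3) : ℝ) * X)) := by
  -- The Hölder exponents will be 6, 1/(5/6 - 1/p) and p. The middle one is for (1 + ‖x‖)^{-1},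
  -- which lies in L^r exactly for r > 2 in the plane, and this is where p < 3 enters.
  have hr0 : 0 < 5 / 6 - 1 / p := by
    have : 1 / p < 1 / 2 := one_div_lt_one_div_of_lt two_pos hp
    linarith
  have hr : 2 < 1 / (5 / 6 - 1 / p) := by
    rw [lt_div_iff₀ hr0]
    have : 1 / 3 < 1 / p := one_div_lt_one_div_of_lt (by linarith) hp3
    linarith
  obtain ⟨C, hC, hCw⟩ := exists_eLpNorm_one_add_norm hr
  have hk := kernelMass_pos
  refine ⟨(2 * √kernelMass) ^ (2 / 3 : ℝ) * C, by positivity, fun Φ X hm h1 h2 hX hw s hs => ?_⟩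
  have hq : ∀ ξ : Plane, 0 < (1 + s * ‖ξ‖ ^ 2)⁻¹ ∧ (1 + s * ‖ξ‖ ^ 2)⁻¹ ≤ 1 := fun ξ =>
    ⟨inv_pos.2 (one_add_norm_sq_pos hs.le ξ), inv_le_one_of_one_le₀ (by
      have : 0 ≤ s * ‖ξ‖ ^ 2 := by positivity
      linarith)⟩
  have hqc : Continuous fun ξ : Plane => (((1 + s * ‖ξ‖ ^ 2)⁻¹ : ℝ) : ℂ) :=
    Complex.continuous_ofReal.comp (Continuous.inv₀ (by fun_prop)
      fun ξ => (one_add_norm_sq_pos hs.le ξ).ne')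
  -- Duality: with E = ‖F₁‖_{L²}, the square E² is the pairing of F₂ with Φ. In space, 𝓕⁻ F₂ is at
  -- most E in L² and O(s^{-1/2} E) in L^∞, hence O(s^{-1/3} E) in L⁶. Pairing with (1 + ‖x‖)^{-1}
  -- times the weighted profile gives E² = O(s^{-1/3} E X), and one factor E cancels.
  set F₁ : Plane → ℂ := fun ξ => (((1 + s * ‖ξ‖ ^ 2)⁻¹ : ℝ) : ℂ) * Φ ξ with hF₁
  set F₂ : Plane → ℂ := fun ξ => (((1 + s * ‖ξ‖ ^ 2)⁻¹ : ℝ) : ℂ) * F₁ ξ with hF₂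
  have hn1 : ∀ ξ, ‖F₁ ξ‖ ≤ ‖Φ ξ‖ := fun ξ => by
    rw [hF₁]
    simp only [norm_mul, Complex.norm_real, Real.norm_of_nonneg (hq ξ).1.le]
    exact mul_le_of_le_one_left (norm_nonneg _) (hq ξ).2
  have hn2 : ∀ ξ, ‖F₂ ξ‖ ≤ ‖F₁ ξ‖ := fun ξ => by
    rw [hF₂]
    simp only [norm_mul, Complex.norm_real, Real.norm_of_nonneg (hq ξ).1.le]
    exact mul_le_of_le_one_left (by positivity) (hq ξ).2
  have m1 : StronglyMeasurable F₁ := hqc.stronglyMeasurable.mul hm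
  have m2 : StronglyMeasurable F₂ := hqc.stronglyMeasurable.mul m1
  have i1 : Integrable F₁ := h1.mono m1.aestronglyMeasurable (Filter.Eventually.of_forall hn1)
  have i2 : Integrable F₂ := i1.mono m2.aestronglyMeasurable (Filter.Eventually.of_forall hn2)
  have l1 : MemLp F₁ 2 := h2.mono m1.aestronglyMeasurable (Filter.Eventually.of_forall hn1)
  have l2 : MemLp F₂ 2 := l1.mono m2.aestronglyMeasurable (Filter.Eventually.of_forall hn2)
  set J : ℝ := ∫ ξ, ‖F₁ ξ‖ ^ 2 with hJ
  have hJ0 : 0 ≤ J := integral_nonneg fun ξ => by positivity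
  have hE : eLpNorm F₁ 2 volume = ENNReal.ofReal (√J) := by
    rw [l1.eLpNorm_eq_integral_rpow_norm (by norm_num) (by norm_num), Real.sqrt_eq_rpow]
    norm_num [hJ]
  set E : ℝ := √J with hEdef
  have hE0 : 0 ≤ E := Real.sqrt_nonneg _
  have hEJ : E ^ 2 = J := Real.sq_sqrt hJ0
  have sup2 : ∀ x, ‖𝓕⁻ F₂ x‖ ≤ 2 * √kernelMass * s ^ (-(1 / 2) : ℝ) * E := by
    intro x
    refine (norm_fourierInv_le F₂ x).trans (integrable_of_lintegral_le m2.aestronglyMeasurable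
      (by positivity) ?_).2
    calc ∫⁻ ξ, ‖F₂ ξ‖ₑ = ∫⁻ ξ, ‖(1 + s * ‖ξ‖ ^ 2)⁻¹‖ₑ * ‖F₁ ξ‖ₑ := by
          congr 1; ext ξ
          rw [hF₂]
          simp only [enorm_mul]
          congr 1
          rw [← ofReal_norm, ← ofReal_norm, Complex.norm_real]
      _ ≤ _ := lintegral_mul_le_eLpNorm_two
          (by fun_prop : Measurable fun ξ : Plane => (1 + s * ‖ξ‖ ^ 2)⁻¹).aestronglyMeasurable
          m1.aestronglyMeasurable
      _ ≤ ENNReal.ofReal (2 * √kernelMass * s ^ (-(1 / 2) : ℝ)) * ENNReal.ofReal E := by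
          rw [hE]; gcongr; exact eLpNorm_resolvent_two hs
      _ = _ := by rw [← ENNReal.ofReal_mul (by positivity)]
  have n2 : eLpNorm (𝓕⁻ F₂) 2 volume ≤ ENNReal.ofReal E := by
    rw [eLpNorm_fourierInv i2 l2, ← hE]
    exact eLpNorm_mono hn2
  have n6 := eLpNorm_le_of_sq_of_bounded (p := 6) (by norm_num) (by positivity) hE0 n2
    (Filter.Eventually.of_forall sup2)
  have hpair : ENNReal.ofReal (E ^ 2) ≤ ∫⁻ x, ‖𝓕⁻ F₂ x‖ₑ * ‖(1 + ‖x‖) ^ (-1 : ℝ)‖ₑ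
      * ‖((1 + ‖x‖ : ℝ) : ℂ) * 𝓕⁻ Φ x‖ₑ := by
    have e1 := integral_conj_fourierInv_mul i2 l2 h1 h2
    have e2 : ∫ ξ, (starRingEnd ℂ) (F₂ ξ) * Φ ξ = ((E ^ 2 : ℝ) : ℂ) := by
      rw [hEJ, hJ, ← integral_complex_ofReal]
      congr 1; ext ξ
      rw [← Complex.normSq_eq_norm_sq, Complex.normSq_eq_conj_mul_self, hF₂, hF₁]
      simp only [map_mul, Complex.conj_ofReal]
      ring
    rw [e2] at e1
    have e3 : ENNReal.ofReal (E ^ 2) = ‖((E ^ 2 : ℝ) : ℂ)‖ₑ := by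
      rw [← ofReal_norm, Complex.norm_real, Real.norm_of_nonneg (by positivity)]
    rw [e3, ← e1]
    refine (enorm_integral_le_lintegral_enorm _).trans (le_of_eq ?_)
    congr 1; ext x
    have h := one_add_norm_pos x
    rw [enorm_mul, enorm_mul, mul_assoc, ← mul_assoc (‖(1 + ‖x‖) ^ (-1 : ℝ)‖ₑ)]
    congr 1
    · rw [← ofReal_norm, ← ofReal_norm, RCLike.norm_conj]
    · rw [← ofReal_norm ((1 + ‖x‖) ^ (-1 : ℝ)), ← ofReal_norm ((1 + ‖x‖ : ℝ) : ℂ),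
        Complex.norm_real, Real.norm_of_nonneg (by positivity), Real.norm_of_nonneg (by positivity),
        ← ENNReal.ofReal_mul (by positivity), Real.rpow_neg_one, inv_mul_cancel₀ h.ne']
      simp
  have c2 := (continuous_fourierInv i2).aestronglyMeasurable (μ := (volume : Measure Plane))
  have c3 := (continuous_fourierInv h1).aestronglyMeasurable (μ := (volume : Measure Plane))
  have hol := lintegral_mul_mul_le (p := 6) (q := 1 / (5 / 6 - 1 / p)) (r := p) (by norm_num)
    (by positivity) (by linarith) (by rw [one_div_one_div]; ring) c2
    (by fun_prop : Measurable fun x : Plane => (1 + ‖x‖) ^ (-1 : ℝ)).aestronglyMeasurable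
    ((by fun_prop : Continuous fun x : Plane => ((1 + ‖x‖ : ℝ) : ℂ)).aestronglyMeasurable.mul c3)
  have fin := hpair.trans (hol.trans (mul_le_mul' (mul_le_mul' n6 hCw) hw))
  rw [← ENNReal.ofReal_mul (by positivity), ← ENNReal.ofReal_mul (by positivity),
    ENNReal.ofReal_le_ofReal_iff (by positivity)] at fin
  rw [hE]
  refine ENNReal.ofReal_le_ofReal ?_
  rcases hE0.eq_or_lt with h0 | h0
  · rw [← h0]; positivity
  · rw [show (1 - 2 / 6 : ℝ) = 2 / 3 by norm_num, show (2 / 6 : ℝ) = 1 / 3 by norm_num,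
      Real.mul_rpow (by positivity) h0.le, Real.mul_rpow (by positivity) (by positivity),
      ← Real.rpow_mul hs.le, show (-(1 / 2) * (2 / 3) : ℝ) = -(1 / 3) by norm_num] at fin
    have hEE : E ^ (1 / 3 : ℝ) * E ^ (2 / 3 : ℝ) = E := by
      rw [← Real.rpow_add h0]; norm_num
    refine le_of_mul_le_mul_left ?_ h0
    calc E * E = E ^ 2 := by ring
      _ ≤ _ := fin
      _ = (E ^ (1 / 3 : ℝ) * E ^ (2 / 3 : ℝ)) * ((2 * √kernelMass) ^ (2 / 3 : ℝ) * C * (s ^ (-(1 / 3) : ℝ) * X)) := by ring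
      _ = _ := by rw [hEE]

end Resolvent

/-! ### Kernels of explicit multipliers on the plane. -/

section PlaneKernels

theorem IsSymbol.exists_isKernel {n : ℕ} {ρ m : ℝ} {S : Plane → ℂ} (hS : IsSymbol n ρ m S)
    (hρ : 0 ≤ ρ) (hn : 4 ≤ n) (hm : m + 4 * ρ ≤ -3) :
    ∃ (κ : Plane → ℂ) (A : ℝ), IsKernel κ A ∧ 𝓕 κ = S := by
  have hd : Module.finrank ℝ Plane = 2 := by simp
  obtain ⟨-, h2, h3, C, hC, h4⟩ := hS.exists_kernel hρ (by rw [hd]; exact hn)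
    (by rw [hd]; push_cast; linarith)
  refine ⟨𝓕⁻ S, C, ⟨hC, h2, fun y => ?_⟩, h3⟩
  have := h4 y
  rw [hd] at this
  convert this using 2
  norm_num

variable {E : Type*} [NormedAddCommGroup E] [InnerProductSpace ℝ E]

theorem isSymbol_norm_sq (n : ℕ) : IsSymbol n 0 2 (fun x : E => ‖x‖ ^ 2) := by
  have h := IsSymbol.clm (E := E) (n := n) (ρ := 0) (ContinuousLinearMap.id ℝ E) le_rfl
  have h2 := IsSymbol.bilin (innerSL ℝ) h h
  norm_num at h2
  have e : (fun x : E => ‖x‖ ^ 2) = fun x => innerSL ℝ x x := by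
    ext x
    exact (real_inner_self_eq_norm_sq x).symm
  rw [e]
  exact h2

theorem isSymbol_inv_one_add_norm_sq (n : ℕ) :
    IsSymbol n 0 (-2) (fun x : E => (1 + ‖x‖ ^ 2)⁻¹) := by
  have h := IsSymbol.inv (E := E) (D := fun x => 1 + ‖x‖ ^ 2) (n := n) (ρ := 0) (d := 2) (e := 1)
    (c := 1 / 2) le_rfl (by norm_num)
    (fun n => ((IsSymbol.const 1 le_rfl).order_mono (by norm_num)).add (isSymbol_norm_sq n))
    (fun x => by
      norm_num
      nlinarith [sq_nonneg (1 - ‖x‖)]) (by norm_num)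
  norm_num at h
  exact h

theorem isSymbol_resolvent_pow (n L : ℕ) :
    IsSymbol n 0 (-(2 * L : ℝ)) (fun x : E => ((1 + ‖x‖ ^ 2) ^ L)⁻¹) := by
  have h := (isSymbol_inv_one_add_norm_sq (E := E) n).pow le_rfl L
  simp only [inv_pow] at h
  exact h.order_mono (le_of_eq (by ring))

theorem isSymbol_coord (n : ℕ) (j : Fin 2) : IsSymbol n 0 1 (fun ξ : Plane => ξ j) :=
  IsSymbol.clm (EuclideanSpace.proj j) le_rfl

theorem exists_kernel_resolvent {L : ℕ} (hL : 2 ≤ L) : ∃ (κ : Plane → ℂ) (A : ℝ), IsKernel κ A ∧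
    𝓕 κ = fun ξ => ((((1 + ‖ξ‖ ^ 2) ^ L)⁻¹ : ℝ) : ℂ) := by
  refine (isSymbol_resolvent_pow (E := Plane) 4 L).ofReal.exists_isKernel le_rfl le_rfl ?_
  have : (2 : ℝ) ≤ L := by exact_mod_cast hL
  linarith

theorem exists_kernel_coord {n L : ℕ} (hL : n + 2 ≤ L) (j : Fin 2) :
    ∃ (κ : Plane → ℂ) (A : ℝ), IsKernel κ A ∧
      𝓕 κ = fun ξ => ((ξ j * ‖ξ‖ ^ (2 * n) * ((1 + ‖ξ‖ ^ 2) ^ L)⁻¹ : ℝ) : ℂ) := by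
  have h := (((isSymbol_coord 4 j).mul ((isSymbol_norm_sq 4).pow le_rfl n)).mul
    (isSymbol_resolvent_pow 4 L)).ofReal.exists_isKernel le_rfl le_rfl (by
      have : (n + 2 : ℝ) ≤ L := by exact_mod_cast hL
      linarith)
  simp only [← pow_mul] at h
  exact h

end PlaneKernels

/-! ### Power bounds used in summing over scales. -/

section Tails

theorem le_tails_of_one_le {γ s e : ℝ} (hγ : 0 ≤ γ) (hs : 1 ≤ s) (he : e ≤ -1 - γ) :
    s ^ e ≤ tails γ s :=
  le_min (Real.rpow_le_rpow_of_exponent_le hs (by linarith))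
    (Real.rpow_le_rpow_of_exponent_le hs he)

theorem le_tails_of_le_one {γ s e : ℝ} (hγ : 0 ≤ γ) (hs0 : 0 < s) (hs : s ≤ 1)
    (he : -1 + γ ≤ e) : s ^ e ≤ tails γ s :=
  le_min (Real.rpow_le_rpow_of_exponent_ge hs0 hs he)
    (Real.rpow_le_rpow_of_exponent_ge hs0 hs (by linarith))

theorem rpow_le_one_add_pow {u β : ℝ} {k : ℕ} (hu : 0 ≤ u) (h0 : 0 ≤ β) (hk : β ≤ k) :
    u ^ β ≤ (1 + u) ^ k :=
  calc u ^ β ≤ (1 + u) ^ β := Real.rpow_le_rpow hu (by linarith) h0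
    _ ≤ (1 + u) ^ (k : ℝ) := Real.rpow_le_rpow_of_exponent_le (by linarith) hk
    _ = _ := Real.rpow_natCast _ _

/-- With u = s‖ξ‖² one has ‖ξ‖^{2β} = s^{-β} u^β, and u^β is absorbed by k of the L resolvent
factors. -/
theorem norm_rpow_mul_resolvent_le {s β : ℝ} {k L : ℕ} (hs : 0 < s) (h0 : 0 ≤ β) (hk : β ≤ k)
    (hL : k ≤ L) (ξ : Plane) : ‖ξ‖ ^ (2 * β) * ((1 + s * ‖ξ‖ ^ 2) ^ L)⁻¹
      ≤ s ^ (-β) * ((1 + s * ‖ξ‖ ^ 2) ^ (L - k))⁻¹ := by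
  have hu : 0 ≤ s * ‖ξ‖ ^ 2 := by positivity
  have h1 : ‖ξ‖ ^ (2 * β) = s ^ (-β) * (s * ‖ξ‖ ^ 2) ^ β := by
    rw [Real.mul_rpow hs.le (by positivity), ← mul_assoc, ← Real.rpow_add hs, neg_add_cancel,
      Real.rpow_zero, one_mul, Real.rpow_mul (norm_nonneg _)]
    norm_num
  rw [h1, mul_assoc]
  gcongr
  rw [← div_eq_mul_inv, div_le_iff₀ (by positivity), ← div_eq_inv_mul, le_div_iff₀ (by positivity)]
  calc _ ≤ (1 + s * ‖ξ‖ ^ 2) ^ k * (1 + s * ‖ξ‖ ^ 2) ^ (L - k) := by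
        gcongr; exact rpow_le_one_add_pow hu h0 hk
    _ = _ := by rw [← pow_add]; congr 1; omega

end Tails

/-! ### L^r bounds for Riesz transforms and derivatives of the solution. -/

section Linear

/-- If the `L²` and `L^∞` norms of `f` are at most `A x^a` and `A y^b`, so is the interpolated bound. -/
theorem eLpNorm_le_of_rpow {r P Q s a b : ℝ} (hr : 2 ≤ r) (hs : 0 < s) (hP : 0 ≤ P) (hQ : 0 ≤ Q)
    {f : Plane → ℂ} (h2 : eLpNorm f 2 volume ≤ ENNReal.ofReal (P * s ^ a))
    (h : ∀ x, ‖f x‖ ≤ Q * s ^ b) :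
    eLpNorm f (ENNReal.ofReal r) volume
      ≤ ENNReal.ofReal (P ^ (2 / r) * Q ^ (1 - 2 / r) * s ^ (a * (2 / r) + b * (1 - 2 / r))) := by
  refine (eLpNorm_le_of_sq_of_bounded hr (by positivity) (by positivity) h2
    (Filter.Eventually.of_forall h)).trans (le_of_eq ?_)
  rw [Real.mul_rpow hP (by positivity), Real.mul_rpow hQ (by positivity), ← Real.rpow_mul hs.le,
    ← Real.rpow_mul hs.le, Real.rpow_add hs]
  congr 1; ring

/-- `L^r` bound for a frequency localized profile, from its decay and its Sobolev norm. -/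
theorem exists_eLpNorm_riesz_mul_le {p r : ℝ} (hp : 2 < p) (hp3 : p < 3) (hr : 2 < r)
    (hr9 : r ≤ 9 / 2) (j : Fin 2) {B M : ℕ} (hM1 : 2 * B + 1 ≤ 2 / r * M) (hM2 : 2 * B + 2 ≤ M)
    (hM3 : 3 ≤ M) :
    ∃ C : ℝ, 0 < C ∧ ∀ (Φ : Plane → ℂ) (a X Y Z : ℝ), StronglyMeasurable Φ → 0 < X → X ≤ Y → 0 < Z →
      SobolevBound M Y Φ →
      eLpNorm (fun x => ((1 + ‖x‖ : ℝ) : ℂ) * 𝓕⁻ Φ x) (ENNReal.ofReal p) volume ≤ ENNReal.ofReal X →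
      (∀ x, ‖𝓕⁻ (fun ξ => ((‖ξ‖ ^ (1 / 2 : ℝ) : ℝ) : ℂ) * (osc a ξ * Φ ξ)) x‖ ≤ Z) →
      eLpNorm (𝓕⁻ fun ξ => ((riesz j ξ * ‖ξ‖ ^ (2 * B) : ℝ) : ℂ) * (osc a ξ * Φ ξ))
        (ENNReal.ofReal r) volume ≤ ENNReal.ofReal (C * (Y ^ (2 / r) * Z ^ (1 - 2 / r))) := by
  obtain ⟨C₁, hC₁, hres⟩ := exists_eLpNorm_resolvent_mul_le hp hp3
  obtain ⟨κ, A, hκ, hκF⟩ := exists_kernel_coord (n := B + M) (L := B + M + 3) (by omega) j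
  -- With α = M + 3/4 the factor ‖ξ‖^{2α} is ‖ξ‖^{2M} · ‖ξ‖ · ‖ξ‖^{1/2}: the single ‖ξ‖ cancels the
  -- denominator of the Riesz symbol, leaving a smooth multiplier, and ‖ξ‖^{1/2} is the one required
  -- by the sup bound. For large s the exponent of s, apart from s^{1-α}, is -B - 3/4 - 7/(6r). At B
  -- = 0 and r = 9/2 this equals -1 - 1/108, hence the choice of γ.
  obtain ⟨C₂, hC₂, hbump⟩ := eLpNorm_fourierInv_le_of_bump (α := M + 3 / 4) (γ := 1 / 108) (p := r)
    (L := B + M + 3) (by positivity) (by push_cast; linarith [B.cast_nonneg (α := ℝ)]) (by norm_num)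
    (by linarith)
  have hA := hκ.pos
  have hk := kernelMass_pos
  refine ⟨C₂ * (max C₁ 1 ^ (2 / r) * (A * kernelMass) ^ (1 - 2 / r)), by positivity,
    fun Φ a X Y Z hm hX hXY hZ hsob hwt hsup => ?_⟩
  have hY : 0 < Y := hX.trans_le hXY
  obtain ⟨hi, h2⟩ := hsob.integrable_memLp hY.le (by omega) hm
  have hom : StronglyMeasurable fun ξ => osc a ξ * Φ ξ :=
    (continuous_osc a).stronglyMeasurable.mul hm
  have hon : ∀ ξ, ‖osc a ξ * Φ ξ‖ = ‖Φ ξ‖ := fun ξ => by rw [norm_mul, norm_osc, one_mul]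
  have hFm : StronglyMeasurable fun ξ => ((riesz j ξ * ‖ξ‖ ^ (2 * B) : ℝ) : ℂ) * (osc a ξ * Φ ξ) :=
    (Complex.measurable_ofReal.comp ((measurable_riesz j).mul
      (by fun_prop : Measurable fun ξ : Plane => ‖ξ‖ ^ (2 * B)))).stronglyMeasurable.mul hom
  have hgm : StronglyMeasurable fun ξ => ((‖ξ‖ ^ (1 / 2 : ℝ) : ℝ) : ℂ) * (osc a ξ * Φ ξ) :=
    (by fun_prop : Measurable fun ξ : Plane => ((‖ξ‖ ^ (1 / 2 : ℝ) : ℝ) : ℂ)).stronglyMeasurable.mul hom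
  have hFn : ∀ ξ, ‖((riesz j ξ * ‖ξ‖ ^ (2 * B) : ℝ) : ℂ) * (osc a ξ * Φ ξ)‖ ≤ ‖ξ‖ ^ (2 * B) * ‖Φ ξ‖ := by
    intro ξ
    rw [norm_mul, hon, Complex.norm_real, norm_mul, Real.norm_of_nonneg (by positivity : 0 ≤ ‖ξ‖ ^ (2 * B))]
    gcongr
    exact mul_le_of_le_one_left (by positivity) (abs_riesz_le j ξ)
  have hFi : Integrable fun ξ => ((riesz j ξ * ‖ξ‖ ^ (2 * B) : ℝ) : ℂ) * (osc a ξ * Φ ξ) := by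
    refine (hsob.integrable (A := 1) zero_le_one hY.le hFm.aestronglyMeasurable fun ξ => ?_).1
    have h1 := one_le_one_add_norm ξ
    calc _ ≤ ‖ξ‖ ^ (2 * B) * ‖Φ ξ‖ * (1 + ‖ξ‖) ^ 2 := by gcongr; exact hFn ξ
      _ ≤ (1 + ‖ξ‖) ^ (2 * B) * ‖Φ ξ‖ * (1 + ‖ξ‖) ^ 2 := by gcongr; linarith
      _ = (1 + ‖ξ‖) ^ (2 * B + 2) * ‖Φ ξ‖ := by ring
      _ ≤ _ := by rw [one_mul]; gcongr
  have hgi : Integrable fun ξ => ((‖ξ‖ ^ (1 / 2 : ℝ) : ℝ) : ℂ) * (osc a ξ * Φ ξ) := by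
    refine (hsob.integrable (A := 1) zero_le_one hY.le hgm.aestronglyMeasurable fun ξ => ?_).1
    have h1 := one_le_one_add_norm ξ
    have h3 : ‖ξ‖ ^ (1 / 2 : ℝ) ≤ (1 + ‖ξ‖) ^ 1 :=
      rpow_le_one_add_pow (norm_nonneg ξ) (by norm_num) (by norm_num)
    rw [norm_mul, hon, Complex.norm_real, Real.norm_of_nonneg (by positivity)]
    calc _ ≤ (1 + ‖ξ‖) ^ 1 * ‖Φ ξ‖ * (1 + ‖ξ‖) ^ 2 := by gcongr
      _ = (1 + ‖ξ‖) ^ 3 * ‖Φ ξ‖ := by ring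
      _ ≤ _ := by rw [one_mul]; gcongr
  rw [mul_assoc]
  refine hbump _ _ hFm hFi (by positivity) fun s hs => ?_
  have hr2 : 0 < 2 / r := by positivity
  have hr3 : 2 / r < 1 := by rw [div_lt_one (by linarith)]; exact hr
  have hr4 : 4 / 9 ≤ 2 / r := by rw [le_div_iff₀ (by linarith)]; linarith
  -- the pointwise bound
  have hS : ∀ x, ‖𝓕⁻ (fun ξ => (bump (M + 3 / 4) (B + M + 3) s ξ : ℂ)
      * (((riesz j ξ * ‖ξ‖ ^ (2 * B) : ℝ) : ℂ) * (osc a ξ * Φ ξ))) x‖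
      ≤ (A * kernelMass * Z) * s ^ (-(1 / 2 + B + M) : ℝ) := by
    intro x
    have e : (fun ξ => (bump (M + 3 / 4) (B + M + 3) s ξ : ℂ)
        * (((riesz j ξ * ‖ξ‖ ^ (2 * B) : ℝ) : ℂ) * (osc a ξ * Φ ξ)))
        = ((s ^ (-(1 / 2 + B + M) : ℝ) : ℝ) : ℂ) • fun ξ => (fun ξ : Plane => ((ξ j * ‖ξ‖ ^ (2 * (B + M))
          * ((1 + ‖ξ‖ ^ 2) ^ (B + M + 3))⁻¹ : ℝ) : ℂ)) (√s • ξ)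
          * (((‖ξ‖ ^ (1 / 2 : ℝ) : ℝ) : ℂ) * (osc a ξ * Φ ξ)) := by
      ext ξ
      simp only [Pi.smul_apply, smul_eq_mul, ← mul_assoc]
      congr 2
      norm_cast
      have hsq : (√s) ^ 2 = s := Real.sq_sqrt hs.le
      have e1 : (√s • ξ) j = √s * ξ j := by simp
      have e2 : ‖√s • ξ‖ ^ 2 = s * ‖ξ‖ ^ 2 := by
        rw [norm_smul, mul_pow, Real.norm_of_nonneg (Real.sqrt_nonneg s), hsq]
      have e3 : s ^ (-(1 / 2 + (B : ℝ) + M)) = (√s * s ^ (B + M))⁻¹ := by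
        rw [Real.rpow_neg hs.le, Real.rpow_add hs, Real.rpow_add hs, ← Real.sqrt_eq_rpow,
          Real.rpow_natCast, Real.rpow_natCast, pow_add, mul_assoc]
      rw [e1, pow_mul ‖√s • ξ‖, e2, e3, bump, riesz]
      rcases eq_or_ne ξ 0 with rfl | h0
      · simp
      · have hn : 0 < ‖ξ‖ := norm_pos_iff.2 h0
        have hs2 : 0 < √s := Real.sqrt_pos.2 hs
        have e4 : ‖ξ‖ ^ (2 * ((M : ℝ) + 3 / 4)) = ‖ξ‖ ^ (2 * M) * ‖ξ‖ * ‖ξ‖ ^ (1 / 2 : ℝ) := by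
          rw [show 2 * ((M : ℝ) + 3 / 4) = ((2 * M : ℕ) : ℝ) + 1 + 1 / 2 by push_cast; ring,
            Real.rpow_add hn, Real.rpow_add hn, Real.rpow_natCast, Real.rpow_one]
        rw [e4, mul_pow]
        have hs3 : s ^ (B + M) ≠ 0 := by positivity
        field_simp
        ring
    rw [e]
    have e5 : 𝓕⁻ (((s ^ (-(1 / 2 + B + M) : ℝ) : ℝ) : ℂ) • fun ξ => (fun ξ : Plane => ((ξ j * ‖ξ‖ ^ (2 * (B + M))
          * ((1 + ‖ξ‖ ^ 2) ^ (B + M + 3))⁻¹ : ℝ) : ℂ)) (√s • ξ)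
          * (((‖ξ‖ ^ (1 / 2 : ℝ) : ℝ) : ℂ) * (osc a ξ * Φ ξ))) x
        = ((s ^ (-(1 / 2 + B + M) : ℝ) : ℝ) : ℂ) * 𝓕⁻ (fun ξ => (fun ξ : Plane => ((ξ j * ‖ξ‖ ^ (2 * (B + M))
          * ((1 + ‖ξ‖ ^ 2) ^ (B + M + 3))⁻¹ : ℝ) : ℂ)) (√s • ξ)
          * (((‖ξ‖ ^ (1 / 2 : ℝ) : ℝ) : ℂ) * (osc a ξ * Φ ξ))) x := by
      rw [Real.fourierInv_eq, Real.fourierInv_eq, ← integral_const_mul]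
      congr 1; ext ξ
      simp only [Pi.smul_apply, smul_eq_mul, Circle.smul_def]
      ring
    rw [e5, fourierInv_mul_eq_avg hκ hgi hκF, norm_mul, Complex.norm_real,
      Real.norm_of_nonneg (by positivity), mul_comm]
    gcongr
    exact norm_avg_le hκ hsup x
  have hbF : Integrable (fun ξ => (bump (M + 3 / 4) (B + M + 3) s ξ : ℂ)
      * (((riesz j ξ * ‖ξ‖ ^ (2 * B) : ℝ) : ℂ) * (osc a ξ * Φ ξ))) ∧ ∀ ξ,
      ‖(bump (M + 3 / 4) (B + M + 3) s ξ : ℂ)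
      * (((riesz j ξ * ‖ξ‖ ^ (2 * B) : ℝ) : ℂ) * (osc a ξ * Φ ξ))‖ ≤
        ‖ξ‖ ^ (2 * ((M : ℝ) + B + 3 / 4)) * ((1 + s * ‖ξ‖ ^ 2) ^ (B + M + 3))⁻¹ * ‖Φ ξ‖ := by
    constructor
    · refine Integrable.bdd_mul (c := s ^ (-((M : ℝ) + 3 / 4))) hFi
        ((Complex.measurable_ofReal.comp ((measurable_bump _ _).comp
          (measurable_const.prodMk measurable_id))).aestronglyMeasurable)
        (Filter.Eventually.of_forall fun ξ => ?_)
      rw [Complex.norm_real, Real.norm_of_nonneg (bump_nonneg hs.le _)]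
      refine (norm_rpow_mul_resolvent_le (k := M + 1) hs (by positivity) (by push_cast; linarith) (by omega) ξ).trans ?_
      refine mul_le_of_le_one_right (by positivity) (inv_le_one_of_one_le₀ (one_le_pow₀ ?_))
      have : 0 ≤ s * ‖ξ‖ ^ 2 := by positivity
      linarith
    · intro ξ
      rw [norm_mul, Complex.norm_real, Real.norm_of_nonneg (bump_nonneg hs.le _)]
      refine (mul_le_mul_of_nonneg_left (hFn ξ) (bump_nonneg hs.le _)).trans (le_of_eq ?_)
      have e4 : ‖ξ‖ ^ (2 * ((M : ℝ) + B + 3 / 4)) = ‖ξ‖ ^ (2 * ((M : ℝ) + 3 / 4)) * ‖ξ‖ ^ (2 * B) := by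
        rw [show 2 * ((M : ℝ) + B + 3 / 4) = 2 * ((M : ℝ) + 3 / 4) + ((2 * B : ℕ) : ℝ) by push_cast; ring,
          Real.rpow_add_natCast' (norm_nonneg ξ) (by positivity)]
      rw [bump, e4]; ring
  set G := fun ξ => (bump (M + 3 / 4) (B + M + 3) s ξ : ℂ)
      * (((riesz j ξ * ‖ξ‖ ^ (2 * B) : ℝ) : ℂ) * (osc a ξ * Φ ξ)) with hG
  have main : ∀ e : ℝ, eLpNorm G 2 volume ≤ ENNReal.ofReal (max C₁ 1 * Y * s ^ e) →
      s ^ (e * (2 / r) + -(1 / 2 + (B : ℝ) + M) * (1 - 2 / r)) ≤ s ^ (1 - ((M : ℝ) + 3 / 4)) * tails (1 / 108) s →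
      eLpNorm (𝓕⁻ G) (ENNReal.ofReal r) volume ≤ ENNReal.ofReal
        ((max C₁ 1 ^ (2 / r) * (A * kernelMass) ^ (1 - 2 / r)) * (Y ^ (2 / r) * Z ^ (1 - 2 / r))
        * (s ^ (1 - ((M : ℝ) + 3 / 4)) * tails (1 / 108) s)) := by
    intro e he hes
    have hl2 : MemLp G 2 := ⟨hbF.1.aestronglyMeasurable, he.trans_lt ENNReal.ofReal_lt_top⟩
    rw [← eLpNorm_fourierInv hbF.1 hl2] at he
    refine (eLpNorm_le_of_rpow hr.le hs (by positivity) (by positivity) he hS).trans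
      (ENNReal.ofReal_le_ofReal ?_)
    calc _ ≤ (max C₁ 1 * Y) ^ (2 / r) * (A * kernelMass * Z) ^ (1 - 2 / r)
          * (s ^ (1 - ((M : ℝ) + 3 / 4)) * tails (1 / 108) s) := by gcongr
      _ = _ := by
        rw [Real.mul_rpow (by positivity) hY.le, Real.mul_rpow (by positivity) hZ.le]
        ring
  -- For s ≥ 1, low frequencies, the L² norm of the piece gains s^{-1/3} from the weighted bound.
  -- For s ≤ 1 it gains s^{M/2} from M derivatives; `hM1` ensures that, after interpolation, this
  -- pays for ‖ξ‖^{2B} and the sup bound.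
  rcases le_total 1 s with h1 | h1
  · refine main (-((M : ℝ) + B + 3 / 4) + -(1 / 3)) ?_ ?_
    · refine (eLpNorm_le_mul_eLpNorm_of_ae_le_mul (c := s ^ (-((M : ℝ) + B + 3 / 4)))
        (g := fun ξ => (((1 + s * ‖ξ‖ ^ 2)⁻¹ : ℝ) : ℂ) * Φ ξ) (Filter.Eventually.of_forall fun ξ => ?_) 2).trans ?_
      · refine (hbF.2 ξ).trans ?_
        rw [norm_mul, Complex.norm_real, Real.norm_of_nonneg (by positivity), ← mul_assoc]
        refine mul_le_mul_of_nonneg_right ?_ (norm_nonneg _)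
        refine (norm_rpow_mul_resolvent_le (k := M + B + 1) hs (by positivity) (by push_cast; linarith)
          (by omega) ξ).trans ?_
        gcongr
        refine le_self_pow₀ ?_ (by omega)
        have : 0 ≤ s * ‖ξ‖ ^ 2 := by positivity
        linarith
      · refine (mul_le_mul_right (hres Φ X hm hi h2 hX hwt s hs) _).trans ?_
        rw [← ENNReal.ofReal_mul (by positivity)]
        refine ENNReal.ofReal_le_ofReal ?_
        rw [Real.rpow_add hs]
        calc _ = C₁ * X * (s ^ (-((M : ℝ) + B + 3 / 4)) * s ^ (-(1 / 3) : ℝ)) := by ring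
          _ ≤ _ := by gcongr; exact le_max_left _ _
    · refine le_trans (le_of_eq ?_) (mul_le_mul_of_nonneg_left (le_tails_of_one_le (γ := 1 / 108)
        (e := (-((M : ℝ) + B + 3 / 4) + -(1 / 3)) * (2 / r) + -(1 / 2 + (B : ℝ) + M) * (1 - 2 / r)
          - (1 - ((M : ℝ) + 3 / 4))) (by norm_num) h1 ?_) (by positivity))
      · rw [← Real.rpow_add hs]; congr 1; ring
      · have := B.cast_nonneg (α := ℝ)
        nlinarith
  · refine main ((M : ℝ) / 2 - ((M : ℝ) + B + 3 / 4)) ?_ ?_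
    · refine (hsob.eLpNorm_le (A := s ^ ((M : ℝ) / 2 - ((M : ℝ) + B + 3 / 4))) (by positivity) fun ξ => ?_).trans ?_
      · refine (hbF.2 ξ).trans ?_
        rw [← mul_assoc]
        refine mul_le_mul_of_nonneg_right ?_ (norm_nonneg _)
        have hb : 0 ≤ (M : ℝ) / 2 + B + 3 / 4 := by positivity
        have e4 : ‖ξ‖ ^ (2 * ((M : ℝ) + B + 3 / 4)) = ‖ξ‖ ^ (2 * ((M : ℝ) / 2 + B + 3 / 4)) * ‖ξ‖ ^ M := by
          rw [show 2 * ((M : ℝ) + B + 3 / 4) = 2 * ((M : ℝ) / 2 + B + 3 / 4) + (M : ℝ) by ring,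
            Real.rpow_add_natCast' (norm_nonneg ξ) (by positivity)]
        rw [e4, mul_right_comm]
        refine mul_le_mul ((norm_rpow_mul_resolvent_le (k := M + B + 1) hs hb (by push_cast; linarith [M.cast_nonneg (α := ℝ)])
          (by omega) ξ).trans ?_) (by gcongr; linarith) (by positivity) (by positivity)
        rw [show (M : ℝ) / 2 - ((M : ℝ) + B + 3 / 4) = -((M : ℝ) / 2 + B + 3 / 4) by ring]
        refine mul_le_of_le_one_right (by positivity) (inv_le_one_of_one_le₀ (one_le_pow₀ ?_))
        have : 0 ≤ s * ‖ξ‖ ^ 2 := by positivity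
        linarith
      · refine ENNReal.ofReal_le_ofReal ?_
        rw [mul_comm]
        gcongr
        exact le_mul_of_one_le_left hY.le (le_max_right _ _)
    · refine le_trans (le_of_eq ?_) (mul_le_mul_of_nonneg_left (le_tails_of_le_one (γ := 1 / 108)
        (e := ((M : ℝ) / 2 - ((M : ℝ) + B + 3 / 4)) * (2 / r) + -(1 / 2 + (B : ℝ) + M) * (1 - 2 / r)
          - (1 - ((M : ℝ) + 3 / 4))) (by norm_num) hs h1 ?_) (by positivity))
      · rw [← Real.rpow_add hs]; congr 1; ring
      · nlinarith

end Linear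

/-! ### Functions with a singularity 1/‖ξ‖ in frequency. -/

section Singular

theorem measurable_bump_right (α : ℝ) (L : ℕ) (s : ℝ) : Measurable fun ξ => bump α L s ξ := by
  unfold bump; fun_prop

theorem one_le_resolvent {s : ℝ} (hs : 0 ≤ s) (ξ : Plane) : 1 ≤ 1 + s * ‖ξ‖ ^ 2 := by
  have : 0 ≤ s * ‖ξ‖ ^ 2 := by positivity
  linarith

/-- `L^r` bound for functions with a singularity `‖ξ‖⁻¹ Φ` in frequency. -/
theorem exists_eLpNorm_fourierInv_le_of_norm_mul_le {e r : ℝ} (hr : 2 < r) (he : 1 / r < e) :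
    ∃ C : ℝ, 0 < C ∧ ∀ (F Φ : Plane → ℂ) (X : ℝ), StronglyMeasurable F → StronglyMeasurable Φ →
      Integrable F → 0 < X → SobolevBound 3 X Φ →
      (∀ s : ℝ, 1 ≤ s → eLpNorm (fun ξ => (((1 + s * ‖ξ‖ ^ 2)⁻¹ : ℝ) : ℂ) * Φ ξ) 2 volume
        ≤ ENNReal.ofReal (X * s ^ (-e))) → (∀ ξ, ‖ξ‖ * ‖F ξ‖ ≤ ‖Φ ξ‖) →
      eLpNorm (𝓕⁻ F) (ENNReal.ofReal r) volume ≤ ENNReal.ofReal (C * X) := by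
  have hγ : 0 < e - 1 / r := by linarith
  -- For s ≥ 1 the pieces are O(s^{-1/2-e}) in L² and O(s^{-1-e}) in L^∞, the latter through the L¹
  -- norm of the transform. At exponent r this interpolates to s^{-1-(e-1/r)}, integrable because e
  -- > 1/r.
  obtain ⟨C, hC, hbump⟩ := eLpNorm_fourierInv_le_of_bump (α := 1) (γ := min (e - 1 / r) 1) (p := r)
    (L := 3) one_pos (by norm_num) (lt_min hγ one_pos) (by linarith)
  have hk := kernelMass_pos
  set Q : ℝ := 2 * √kernelMass with hQ
  have hQ0 : 0 < Q := by positivity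
  have hr1 : 0 < 2 / r := by positivity
  have hr2 : 2 / r < 1 := by rw [div_lt_one (by linarith)]; exact hr
  refine ⟨C * Q ^ (1 - 2 / r), by positivity, fun F Φ X hFm hΦm hFi hX hsob hres hFΦ => ?_⟩
  rw [mul_assoc]
  refine hbump F _ hFm hFi (by positivity) fun s hs => ?_
  have hbn : ∀ ξ, ‖(bump 1 3 s ξ : ℂ) * F ξ‖ ≤ ‖ξ‖ * ((1 + s * ‖ξ‖ ^ 2) ^ 3)⁻¹ * ‖Φ ξ‖ := by
    intro ξ
    rw [norm_mul, Complex.norm_real, Real.norm_of_nonneg (bump_nonneg hs.le _), bump]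
    norm_num
    calc ‖ξ‖ ^ 2 * ((1 + s * ‖ξ‖ ^ 2) ^ 3)⁻¹ * ‖F ξ‖
        = ‖ξ‖ * ((1 + s * ‖ξ‖ ^ 2) ^ 3)⁻¹ * (‖ξ‖ * ‖F ξ‖) := by ring
      _ ≤ _ := by gcongr; exact hFΦ ξ
  have hbm : StronglyMeasurable fun ξ => (bump 1 3 s ξ : ℂ) * F ξ :=
    (Complex.measurable_ofReal.comp (measurable_bump_right 1 3 s)).stronglyMeasurable.mul hFm
  set G := fun ξ => (bump 1 3 s ξ : ℂ) * F ξ with hG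
  have main : ∀ a b : ℝ, eLpNorm G 2 volume ≤ ENNReal.ofReal (X * s ^ a) →
      (Integrable G ∧ ∫ ξ, ‖G ξ‖ ≤ Q * X * s ^ b) →
      s ^ (a * (2 / r) + b * (1 - 2 / r)) ≤ s ^ (1 - 1 : ℝ) * tails (min (e - 1 / r) 1) s →
      eLpNorm (𝓕⁻ G) (ENNReal.ofReal r) volume ≤ ENNReal.ofReal
        (Q ^ (1 - 2 / r) * X * (s ^ (1 - 1 : ℝ) * tails (min (e - 1 / r) 1) s)) := by
    intro a b h2 h1 hab
    have hl2 : MemLp G 2 := ⟨hbm.aestronglyMeasurable, h2.trans_lt ENNReal.ofReal_lt_top⟩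
    rw [← eLpNorm_fourierInv h1.1 hl2] at h2
    refine (eLpNorm_le_of_rpow hr.le hs hX.le (by positivity) h2 fun x =>
      (norm_fourierInv_le G x).trans h1.2).trans (ENNReal.ofReal_le_ofReal ?_)
    refine mul_le_mul (le_of_eq ?_) hab (by positivity) (by positivity)
    rw [Real.mul_rpow hQ0.le hX.le]
    calc _ = Q ^ (1 - 2 / r) * (X ^ (2 / r) * X ^ (1 - 2 / r)) := by ring
      _ = _ := by rw [← Real.rpow_add hX]; norm_num
  rcases le_total 1 s with h1 | h1
  · have hbn' : ∀ ξ, ‖G ξ‖ ≤ s ^ (-(1 / 2) : ℝ) * ((1 + s * ‖ξ‖ ^ 2) ^ 2)⁻¹ * ‖Φ ξ‖ := by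
      intro ξ
      refine (hbn ξ).trans (mul_le_mul_of_nonneg_right ?_ (norm_nonneg _))
      have := norm_rpow_mul_resolvent_le (β := 1 / 2) (k := 1) (L := 3) hs (by norm_num) (by norm_num)
        (by norm_num) ξ
      norm_num at this
      exact this
    have hq := fun ξ => one_le_resolvent hs.le ξ
    refine main (-(1 / 2) + -e) (-(1 / 2) + (-(1 / 2) + -e)) ?_ ?_ ?_
    · refine (eLpNorm_le_mul_eLpNorm_of_ae_le_mul (c := s ^ (-(1 / 2) : ℝ))
        (g := fun ξ => (((1 + s * ‖ξ‖ ^ 2)⁻¹ : ℝ) : ℂ) * Φ ξ) (Filter.Eventually.of_forall fun ξ => ?_) 2).trans ?_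
      · refine (hbn' ξ).trans ?_
        rw [norm_mul, Complex.norm_real, Real.norm_of_nonneg (by positivity), ← mul_assoc]
        gcongr
        exact le_self_pow₀ (hq ξ) two_ne_zero
      · refine (mul_le_mul_right (hres s h1) _).trans (le_of_eq ?_)
        rw [← ENNReal.ofReal_mul (by positivity), Real.rpow_add hs]
        congr 1; ring
    · refine integrable_of_lintegral_le hbm.aestronglyMeasurable (by positivity) ?_
      have hΦ' : StronglyMeasurable fun ξ => (((1 + s * ‖ξ‖ ^ 2)⁻¹ : ℝ) : ℂ) * Φ ξ :=
        (by fun_prop : Measurable fun ξ : Plane => (((1 + s * ‖ξ‖ ^ 2)⁻¹ : ℝ) : ℂ)).stronglyMeasurable.mul hΦm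
      calc ∫⁻ ξ, ‖G ξ‖ₑ ≤ ∫⁻ ξ, ENNReal.ofReal (s ^ (-(1 / 2) : ℝ)) * (‖(1 + s * ‖ξ‖ ^ 2)⁻¹‖ₑ
            * ‖(((1 + s * ‖ξ‖ ^ 2)⁻¹ : ℝ) : ℂ) * Φ ξ‖ₑ) := by
            refine lintegral_mono fun ξ => ?_
            have h0 := one_add_norm_sq_pos hs.le ξ
            rw [← ofReal_norm (G ξ), ← ofReal_norm ((1 + s * ‖ξ‖ ^ 2)⁻¹),
              ← ofReal_norm (_ * Φ ξ), ← ENNReal.ofReal_mul (norm_nonneg _),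
              ← ENNReal.ofReal_mul (by positivity), norm_mul _ (Φ ξ), Complex.norm_real,
              Real.norm_of_nonneg (by positivity)]
            refine ENNReal.ofReal_le_ofReal ((hbn' ξ).trans (le_of_eq ?_))
            rw [inv_eq_one_div, inv_eq_one_div]
            field_simp
        _ = ENNReal.ofReal (s ^ (-(1 / 2) : ℝ)) * ∫⁻ ξ, (‖(1 + s * ‖ξ‖ ^ 2)⁻¹‖ₑ
            * ‖(((1 + s * ‖ξ‖ ^ 2)⁻¹ : ℝ) : ℂ) * Φ ξ‖ₑ) := lintegral_const_mul' _ _ ENNReal.ofReal_ne_top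
        _ ≤ ENNReal.ofReal (s ^ (-(1 / 2) : ℝ)) * (ENNReal.ofReal (Q * s ^ (-(1 / 2) : ℝ))
            * ENNReal.ofReal (X * s ^ (-e))) := by
            gcongr
            refine (lintegral_mul_le_eLpNorm_two
              (by fun_prop : Measurable fun ξ : Plane => (1 + s * ‖ξ‖ ^ 2)⁻¹).aestronglyMeasurable
              hΦ'.aestronglyMeasurable).trans (mul_le_mul' (eLpNorm_resolvent_two hs) (hres s h1))
        _ = _ := by
            rw [← ENNReal.ofReal_mul (by positivity), ← ENNReal.ofReal_mul (by positivity),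
              Real.rpow_add hs, Real.rpow_add hs]
            congr 1; ring
    · rw [sub_self, Real.rpow_zero, one_mul]
      refine le_tails_of_one_le (lt_min hγ one_pos).le h1 ?_
      have := min_le_left (e - 1 / r) 1
      have e2 : 2 / r = 2 * (1 / r) := by ring
      rw [e2]
      linarith
  · have hbn' : ∀ ξ, ‖G ξ‖ ≤ ‖ξ‖ * ‖Φ ξ‖ := by
      intro ξ
      refine (hbn ξ).trans ?_
      gcongr
      exact mul_le_of_le_one_right (norm_nonneg _)
        (inv_le_one_of_one_le₀ (one_le_pow₀ (one_le_resolvent hs.le ξ)))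
    have hq := fun ξ : Plane => one_le_one_add_norm ξ
    refine main 0 0 ?_ ?_ ?_
    · rw [Real.rpow_zero, mul_one, ← one_mul X]
      refine hsob.eLpNorm_le zero_le_one fun ξ => (hbn' ξ).trans ?_
      rw [one_mul]
      gcongr
      exact (by linarith : ‖ξ‖ ≤ 1 + ‖ξ‖).trans (le_self_pow₀ (hq ξ) (by norm_num))
    · have := hsob.integrable (F := G) (A := 1) zero_le_one hX.le hbm.aestronglyMeasurable fun ξ => by
        calc _ ≤ ‖ξ‖ * ‖Φ ξ‖ * (1 + ‖ξ‖) ^ 2 := by gcongr; exact hbn' ξ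
          _ ≤ (1 + ‖ξ‖) * ‖Φ ξ‖ * (1 + ‖ξ‖) ^ 2 := by gcongr; linarith
          _ = _ := by ring
      refine ⟨this.1, this.2.trans ?_⟩
      rw [Real.rpow_zero, mul_one]
      gcongr
      rw [hQ]
      have := Real.sqrt_nonneg kernelMass
      linarith
    · rw [sub_self, Real.rpow_zero, one_mul]
      refine le_tails_of_le_one (lt_min hγ one_pos).le hs h1 ?_
      have := min_le_right (e - 1 / r) 1
      linarith

/-- The low-frequency gain of a localized profile has e = 1/3, which exceeds 1/r = 2/9. -/
theorem exists_eLpNorm_fourierInv_le_of_profile {p : ℝ} (hp : 2 < p) (hp3 : p < 3) :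
    ∃ C : ℝ, 0 < C ∧ ∀ (F Φ : Plane → ℂ) (X : ℝ), StronglyMeasurable F → StronglyMeasurable Φ →
      Integrable F → 0 < X → SobolevBound 3 X Φ →
      eLpNorm (fun x => ((1 + ‖x‖ : ℝ) : ℂ) * 𝓕⁻ Φ x) (ENNReal.ofReal p) volume ≤ ENNReal.ofReal X →
      (∀ ξ, ‖ξ‖ * ‖F ξ‖ ≤ ‖Φ ξ‖) →
      eLpNorm (𝓕⁻ F) (ENNReal.ofReal (9 / 2)) volume ≤ ENNReal.ofReal (C * X) := by
  obtain ⟨C₁, hC₁, h1⟩ := exists_eLpNorm_resolvent_mul_le hp hp3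
  obtain ⟨C₂, hC₂, h2⟩ := exists_eLpNorm_fourierInv_le_of_norm_mul_le (e := 1 / 3) (r := 9 / 2)
    (by norm_num) (by norm_num)
  refine ⟨C₂ * max C₁ 1, by positivity, fun F Φ X hF hΦ hFi hX hsob hwt hle => ?_⟩
  obtain ⟨hi, hl⟩ := hsob.integrable_memLp hX.le (by norm_num) hΦ
  rw [mul_assoc]
  refine h2 F Φ _ hF hΦ hFi (by positivity) (hsob.nonneg_mono le_rfl
    (le_mul_of_one_le_left hX.le (le_max_right _ _))) (fun s hs => ?_) hle
  refine (h1 Φ X hΦ hi hl hX hwt s (by linarith)).trans (ENNReal.ofReal_le_ofReal ?_)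
  have : 0 < s := by linarith
  calc C₁ * (s ^ (-(1 / 3) : ℝ) * X) = C₁ * X * s ^ (-(1 / 3) : ℝ) := by ring
    _ ≤ _ := by gcongr; exact le_max_left _ _

/-- Here the numerator is only bounded near the origin. The L² norm of the resolvent symbol still
gives e = 1/2, which is larger than 1/p precisely because p > 2. -/
theorem exists_eLpNorm_fourierInv_le_of_singular {p : ℝ} (hp : 2 < p) :
    ∃ C : ℝ, 0 < C ∧ ∀ (F : Plane → ℂ) (A : ℝ), StronglyMeasurable F → Integrable F → 0 < A →
      (∀ ξ, ‖ξ‖ * ‖F ξ‖ ≤ A * ((1 + ‖ξ‖) ^ 5)⁻¹) →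
      eLpNorm (𝓕⁻ F) (ENNReal.ofReal p) volume ≤ ENNReal.ofReal (C * A) := by
  obtain ⟨C₂, hC₂, h2⟩ := exists_eLpNorm_fourierInv_le_of_norm_mul_le (e := 1 / 2) (r := p)
    hp (one_div_lt_one_div_of_lt two_pos hp)
  have hk := kernelMass_pos
  refine ⟨C₂ * (2 * √kernelMass), by positivity, fun F A hF hFi hA hle => ?_⟩
  have hq := fun ξ : Plane => one_le_one_add_norm ξ
  set Φ : Plane → ℂ := fun ξ => ((A * ((1 + ‖ξ‖) ^ 5)⁻¹ : ℝ) : ℂ) with hΦdef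
  have hΦ : Measurable Φ := by rw [hΦdef]; fun_prop
  have hΦn : ∀ ξ, ‖Φ ξ‖ = A * ((1 + ‖ξ‖) ^ 5)⁻¹ := fun ξ => by
    rw [hΦdef, Complex.norm_real, Real.norm_of_nonneg (by positivity)]
  rw [mul_assoc]
  refine h2 F Φ _ hF hΦ.stronglyMeasurable hFi (by positivity) ?_ (fun s hs => ?_)
    fun ξ => (hle ξ).trans (hΦn ξ).ge
  · refine (eLpNorm_le_mul_eLpNorm_of_ae_le_mul (c := A) (g := fun ξ : Plane => (1 + ‖ξ‖) ^ (-2 : ℝ))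
      (Filter.Eventually.of_forall fun ξ => ?_) 2).trans ?_
    · have h0 := one_add_norm_pos ξ
      rw [norm_mul, hΦn, Complex.norm_real, Real.norm_of_nonneg (by positivity),
        Real.norm_of_nonneg (by positivity), Real.rpow_neg h0.le, ← mul_assoc, mul_comm _ A, mul_assoc]
      norm_num
      gcongr
      rw [← div_eq_mul_inv, inv_eq_one_div, div_le_div_iff₀ (by positivity) (by positivity)]
      exact le_of_eq (by ring)
    · rw [eLpNorm_one_add_norm_two, ← ENNReal.ofReal_mul hA.le]
      refine ENNReal.ofReal_le_ofReal ?_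
      have := mul_nonneg hA.le (Real.sqrt_nonneg kernelMass)
      linarith
  · have hs0 : 0 < s := by linarith
    refine (eLpNorm_le_mul_eLpNorm_of_ae_le_mul (c := A) (g := fun ξ : Plane => (1 + s * ‖ξ‖ ^ 2)⁻¹)
      (Filter.Eventually.of_forall fun ξ => ?_) 2).trans ?_
    · rw [norm_mul, hΦn, Complex.norm_real, mul_comm]
      gcongr
      exact mul_le_of_le_one_right hA.le (inv_le_one_of_one_le₀ (one_le_pow₀ (hq ξ)))
    · refine (mul_le_mul_right (eLpNorm_resolvent_two hs0) _).trans (le_of_eq ?_)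
      rw [← ENNReal.ofReal_mul hA.le]
      congr 1; ring

end Singular

/-! ### The kernel of the smoothed propagator. -/

section Propagator

theorem isSymbol_jb_freq (n : ℕ) : IsSymbol n 0 1 (fun ξ : Plane => jb (freq ξ)) := by
  have hπ := Real.pi_gt_three
  have h := IsSymbol.sqrt (E := Plane) (D := fun x => 1 + (2 * Real.pi) ^ 2 * ‖x‖ ^ 2) (n := n) (ρ := 0)
    (d := 2) (e := 1) (c := 1 / 2) le_rfl (by norm_num)
    (fun n => ((IsSymbol.const 1 le_rfl).order_mono (by norm_num)).add
      ((isSymbol_norm_sq n).const_mul _))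
    (fun x => by
      norm_num
      have h1 : 1 ≤ (2 * Real.pi) ^ 2 := by nlinarith
      nlinarith [sq_nonneg (1 - ‖x‖), mul_le_mul_of_nonneg_right h1 (sq_nonneg ‖x‖)]) (by norm_num)
  norm_num at h
  have e : (fun ξ : Plane => jb (freq ξ)) = fun x => √(1 + (2 * Real.pi) ^ 2 * ‖x‖ ^ 2) := by
    ext ξ
    rw [jb, freq, norm_smul, Real.norm_of_nonneg (by positivity), mul_pow]
  rw [e]
  exact h.order_mono (by norm_num)

/-- A derivative of order k of e^{ia⟨2πξ⟩} is O((T(1 + ‖ξ‖))^k). A kernel bound on the plane uses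
derivatives up to order four, hence T⁴, and four resolvents more than absorb the powers of ‖ξ‖. The
crude power of T is harmless, since only a small power of the mass survives interpolation with L².
-/
theorem exists_kernel_osc : ∃ C : ℝ, 0 < C ∧ ∀ a T : ℝ, 1 ≤ T → |a| ≤ T → ∃ κ : Plane → ℂ,
    IsKernel κ (C * T ^ 4) ∧ 𝓕 κ = fun ξ => osc a ξ * ((((1 + ‖ξ‖ ^ 2) ^ 4)⁻¹ : ℝ) : ℂ) := by
  have hd : Module.finrank ℝ Plane = 2 := by simp
  obtain ⟨C₀, hC₀, hker⟩ := exists_fourierInv_bound (V := Plane)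
  -- derivatives of the phase
  have hj := isSymbol_jb_freq 4
  have hr := (isSymbol_resolvent_pow (E := Plane) 4 4).ofReal
  choose! D hD0 hD using fun k (hk : k ≤ 4) => hj.exists_nonneg hk
  choose! R hR0 hR using fun k (hk : k ≤ 4) => hr.exists_nonneg hk
  set D' : ℝ := 1 + ∑ k ∈ Finset.range 5, D k with hD'
  have hDk : ∀ k ≤ 4, D k ≤ D' := fun k hk => by
    have := Finset.single_le_sum (f := D) (fun i hi => hD0 i (by simpa [Nat.lt_succ_iff] using hi))
      (Finset.mem_range.2 (Nat.lt_succ_of_le hk))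
    linarith
  have hD1 : 1 ≤ D' := by
    have := Finset.sum_nonneg (f := D) (s := Finset.range 5)
      (fun i hi => hD0 i (by simpa [Nat.lt_succ_iff] using hi))
    linarith
  have hosc : ∀ a T : ℝ, 1 ≤ T → |a| ≤ T → ContDiff ℝ ((⊤ : ℕ∞) : WithTop ℕ∞) (osc a) ∧
      ∀ k ≤ 4, ∀ ξ, ‖iteratedFDeriv ℝ k (osc a) ξ‖ ≤ k.factorial * 1 * (D' * T * (1 + ‖ξ‖)) ^ k := by
    intro a T hT ha
    have hf : ContDiff ℝ ((⊤ : ℕ∞) : WithTop ℕ∞) (fun ξ : Plane => a • jb (freq ξ)) := hj.1.const_smul a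
    have hg : ContDiff ℝ ((⊤ : ℕ∞) : WithTop ℕ∞) (fun y : ℝ => Complex.exp ((y : ℂ) * Complex.I)) := by
      exact Complex.contDiff_exp.comp ((Complex.ofRealCLM.contDiff).mul contDiff_const)
    have ec : osc a = (fun y : ℝ => Complex.exp ((y : ℂ) * Complex.I)) ∘ fun ξ : Plane => a • jb (freq ξ) := by
      ext ξ
      simp [osc, mul_comm]
    rw [ec]
    refine ⟨hg.comp hf, fun k hk ξ => ?_⟩
    have h1 := one_le_one_add_norm ξ
    have hbig : 1 ≤ D' * T * (1 + ‖ξ‖) :=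
      one_le_mul_of_one_le_of_one_le (one_le_mul_of_one_le_of_one_le hD1 hT) h1
    refine norm_iteratedFDeriv_comp_le hg hf (natCast_le_top k) ξ (fun i hi => ?_) (fun i hi1 hi => ?_)
    · have hi' : ∀ (i : ℕ), iteratedDeriv i (fun y : ℝ => Complex.exp ((y : ℂ) * Complex.I))
          = fun y : ℝ => Complex.I ^ i * Complex.exp ((y : ℂ) * Complex.I) := by
        intro i
        induction i with
        | zero => ext y; simp
        | succ n ih =>
          rw [iteratedDeriv_succ, ih]
          ext y
          have h2 : HasDerivAt (fun y : ℝ => Complex.I ^ n * Complex.exp ((y : ℂ) * Complex.I))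
              (Complex.I ^ n * (Complex.exp ((y : ℂ) * Complex.I) * (1 * Complex.I))) y :=
            (((Complex.ofRealCLM.hasDerivAt (x := y)).mul_const Complex.I).cexp).const_mul _
          rw [h2.deriv]; ring
      rw [norm_iteratedFDeriv_eq_norm_iteratedDeriv, hi']
      refine le_of_eq ?_
      rw [norm_mul, norm_pow, Complex.norm_I, one_pow, one_mul, Complex.norm_exp_ofReal_mul_I]
    · rw [iteratedFDeriv_const_smul_apply' (hj.1.of_le (natCast_le_top i)).contDiffAt, norm_smul, Real.norm_eq_abs]
      have hh := hD i (by omega) ξ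
      rw [zero_mul, add_zero, Real.rpow_one] at hh
      have hDi := hDk i (by omega)
      calc |a| * ‖iteratedFDeriv ℝ i (fun ξ : Plane => jb (freq ξ)) ξ‖
          ≤ T * (D' * (1 + ‖ξ‖)) := by
            gcongr
            exact hh.trans (by gcongr)
        _ = D' * T * (1 + ‖ξ‖) := by ring
        _ ≤ _ := le_self_pow₀ hbig (by omega)
  set R' : ℝ := 1 + ∑ k ∈ Finset.range 5, R k with hR'
  have hRk : ∀ k ≤ 4, R k ≤ R' := fun k hk => by
    have := Finset.single_le_sum (f := R) (fun i hi => hR0 i (by simpa [Nat.lt_succ_iff] using hi))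
      (Finset.mem_range.2 (Nat.lt_succ_of_le hk))
    linarith
  have hR1 : 1 ≤ R' := by
    have := Finset.sum_nonneg (f := R) (s := Finset.range 5)
      (fun i hi => hR0 i (by simpa [Nat.lt_succ_iff] using hi))
    linarith
  set A : ℝ := 16 * (24 * D' ^ 4 * R') with hA
  refine ⟨(C₀ + 1) * A, by positivity, fun a T hT ha => ?_⟩
  obtain ⟨ho1, ho2⟩ := hosc a T hT ha
  have hS : ∀ k ≤ 4, ∀ ξ, ‖iteratedFDeriv ℝ k
      (fun ξ => osc a ξ * ((((1 + ‖ξ‖ ^ 2) ^ 4)⁻¹ : ℝ) : ℂ)) ξ‖ ≤ A * T ^ 4 * (1 + ‖ξ‖) ^ (-3 : ℝ) := by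
    intro k hk ξ
    have h1 := one_le_one_add_norm ξ
    have h0 := one_add_norm_pos ξ
    refine (norm_iteratedFDeriv_mul_le ho1 hr.1 ξ (natCast_le_top k)).trans ?_
    calc _ ≤ ∑ i ∈ Finset.range (k + 1), (k.choose i : ℝ) * (24 * D' ^ 4 * R' * T ^ 4 * (1 + ‖ξ‖) ^ (-4 : ℝ)) := by
          refine Finset.sum_le_sum fun i hi => ?_
          have hik : i ≤ k := Nat.lt_succ_iff.1 (Finset.mem_range.1 hi)
          rw [mul_assoc]
          refine mul_le_mul_of_nonneg_left ?_ (by positivity)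
          have e1 := ho2 i (by omega) ξ
          have e2 := hR (k - i) (by omega) ξ
          have e3 : ((i.factorial : ℕ) : ℝ) ≤ 24 := by
            have : i.factorial ≤ (4).factorial := Nat.factorial_le (by omega)
            exact_mod_cast this
          calc _ ≤ (24 * 1 * (D' * T * (1 + ‖ξ‖)) ^ 4) * (R' * (1 + ‖ξ‖) ^ (-8 : ℝ)) := by
                refine mul_le_mul (e1.trans ?_) (e2.trans ?_) (norm_nonneg _) (by positivity)
                · gcongr
                  · exact one_le_mul_of_one_le_of_one_le (one_le_mul_of_one_le_of_one_le hD1 hT) h1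
                  · omega
                · norm_num
                  gcongr
                  exact hRk _ (by omega)
            _ = 24 * D' ^ 4 * R' * T ^ 4 * ((1 + ‖ξ‖) ^ 4 * (1 + ‖ξ‖) ^ (-8 : ℝ)) := by ring
            _ = _ := by
                congr 1
                rw [← Real.rpow_natCast, ← Real.rpow_add h0]
                norm_num
      _ = 2 ^ k * (24 * D' ^ 4 * R' * T ^ 4 * (1 + ‖ξ‖) ^ (-4 : ℝ)) := by
          rw [← Finset.sum_mul]
          congr 1
          exact_mod_cast Nat.sum_range_choose k
      _ ≤ 2 ^ 4 * (24 * D' ^ 4 * R' * T ^ 4 * (1 + ‖ξ‖) ^ (-3 : ℝ)) := by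
          gcongr
          · norm_num
          · norm_num
      _ = _ := by rw [hA]; ring
  obtain ⟨-, k2, k3, k4⟩ := hker _ (A * T ^ 4) (ho1.mul hr.1) (by
    intro k hk ξ
    rw [hd] at hk ⊢
    refine (hS k hk ξ).trans (le_of_eq ?_)
    norm_num)
  refine ⟨_, ⟨by positivity, k2, fun y => (k4 y).trans ?_⟩, k3⟩
  rw [hd]
  have : (1 + ‖y‖) ^ (-(((2 : ℕ) : ℝ) + 2)) = (1 + ‖y‖) ^ (-4 : ℝ) := by norm_num
  rw [this, ← mul_assoc]
  have h0 := one_add_norm_pos y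
  gcongr
  linarith

end Propagator

/-! ### From L^p to L^{9/2}: smoothed Riesz transforms and propagators. -/

section LowFactor

theorem fourierInv_const_mul (c : ℂ) (F : Plane → ℂ) :
    𝓕⁻ (fun ξ => c * F ξ) = fun x => c * 𝓕⁻ F x := by
  ext x
  rw [Real.fourierInv_eq, Real.fourierInv_eq, ← integral_const_mul]
  congr 1; ext ξ
  simp only [smul_eq_mul, Circle.smul_def]
  ring

theorem eLpNorm_const_mul' (c : ℂ) (f : Plane → ℂ) (p : ℝ≥0∞) :
    eLpNorm (fun x => c * f x) p volume = ENNReal.ofReal ‖c‖ * eLpNorm f p volume := by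
  have : (fun x => c * f x) = c • f := rfl
  rw [this, eLpNorm_const_smul, ofReal_norm]

theorem eLpNorm_le_of_bounded_ofReal {p q A M : ℝ} (hp : 0 < p) (hpq : p ≤ q) (hA : 0 ≤ A)
    (hM : 0 ≤ M) {f : Plane → ℂ} (h1 : eLpNorm f (ENNReal.ofReal p) volume ≤ ENNReal.ofReal A)
    (h2 : ∀ x, ‖f x‖ ≤ M) :
    eLpNorm f (ENNReal.ofReal q) volume ≤ ENNReal.ofReal (A ^ (p / q) * M ^ (1 - p / q)) := by
  refine (eLpNorm_le_of_bounded hp hpq hM (Filter.Eventually.of_forall h2)).trans ?_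
  have hq : 0 < q := hp.trans_le hpq
  rw [ENNReal.ofReal_mul (by positivity), ← ENNReal.ofReal_rpow_of_nonneg hA (by positivity)]
  gcongr

theorem stronglyMeasurable_ofReal_mul {f : Plane → ℝ} {F : Plane → ℂ} (hf : Measurable f)
    (hF : StronglyMeasurable F) : StronglyMeasurable fun ξ => (f ξ : ℂ) * F ξ :=
  (Complex.measurable_ofReal.comp hf).stronglyMeasurable.mul hF

theorem Integrable.ofReal_mul {f : Plane → ℝ} {F : Plane → ℂ} {c : ℝ} (hF : Integrable F)
    (hf : Measurable f) (hc : ∀ ξ, |f ξ| ≤ c) : Integrable fun ξ => (f ξ : ℂ) * F ξ :=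
  hF.bdd_mul (c := c) (Complex.measurable_ofReal.comp hf).aestronglyMeasurable
    (Filter.Eventually.of_forall fun ξ => by
      simpa [Complex.norm_real, Real.norm_eq_abs] using hc ξ)

theorem abs_resolvent_pow_le (L : ℕ) (ξ : Plane) : |((1 + ‖ξ‖ ^ 2) ^ L)⁻¹| ≤ 1 := by
  rw [abs_of_nonneg (by positivity)]
  exact inv_le_one_of_one_le₀ (one_le_pow₀ (by nlinarith [sq_nonneg ‖ξ‖]))

theorem measurable_resolvent_pow (L : ℕ) : Measurable fun ξ : Plane => ((1 + ‖ξ‖ ^ 2) ^ L)⁻¹ := by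
  fun_prop

/-- With α = 1/2 the bump cancels the denominator of the Riesz symbol. Raising the exponent from p
to 9/2 gains s^{-(1/p - 2/9)} at low frequency by Bernstein, and 1/p - 2/9 > 1/9 as p < 3, hence γ =
1/9. At high frequency the two resolvents supply a smooth multiplier, and the bound is uniform in s.
-/
theorem exists_eLpNorm_riesz_resolvent_le {p : ℝ} (hp : 2 < p) (hp3 : p < 3) (k : Fin 2) :
    ∃ C : ℝ, 0 < C ∧ ∀ (F : Plane → ℂ) (N : ℝ), StronglyMeasurable F → Integrable F → 0 < N →
      eLpNorm (𝓕⁻ F) (ENNReal.ofReal p) volume ≤ ENNReal.ofReal N →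
      eLpNorm (𝓕⁻ fun ξ => ((riesz k ξ * ((1 + ‖ξ‖ ^ 2) ^ 2)⁻¹ : ℝ) : ℂ) * F ξ)
        (ENNReal.ofReal (9 / 2)) volume ≤ ENNReal.ofReal (C * N) := by
  obtain ⟨κ₁, A₁, h1, e1⟩ := exists_kernel_coord (n := 0) (L := 3) (by norm_num) k
  obtain ⟨κ₂, A₂, h2, e2⟩ := exists_kernel_resolvent (L := 2) le_rfl
  obtain ⟨κ₃, A₃, h3, e3⟩ := exists_kernel_resolvent (L := 3) (by norm_num)
  obtain ⟨κ₄, A₄, h4, e4⟩ := exists_kernel_coord (n := 0) (L := 2) (by norm_num) k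
  obtain ⟨C, hC, hbump⟩ := eLpNorm_fourierInv_le_of_bump (α := 1 / 2) (γ := 1 / 9) (p := 9 / 2)
    (L := 3) (by norm_num) (by norm_num) (by norm_num) (by norm_num)
  have hk := kernelMass_pos
  have p1 := h1.pos
  have p2 := h2.pos
  have p3 := h3.pos
  have p4 := h4.pos
  have hp0 : 0 < p := by linarith
  have hpq : p ≤ 9 / 2 := by linarith
  set K₁ : ℝ := (A₁ * kernelMass * (A₂ * kernelMass)) ^ (p / (9 / 2))
    * (A₁ * kernelMass ^ (1 - 1 / p) * (A₂ * kernelMass)) ^ (1 - p / (9 / 2)) with hK₁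
  set K₂ : ℝ := A₃ * kernelMass * ((A₄ * kernelMass) ^ (p / (9 / 2))
    * (A₄ * kernelMass ^ (1 - 1 / p)) ^ (1 - p / (9 / 2))) with hK₂
  have hK1 : 0 < K₁ := by positivity
  have hK2 : 0 < K₂ := by positivity
  refine ⟨C * max K₁ K₂, by positivity, fun F N hFm hFi hN hFN => ?_⟩
  have hm : Measurable fun ξ : Plane => riesz k ξ * ((1 + ‖ξ‖ ^ 2) ^ 2)⁻¹ :=
    (measurable_riesz k).mul (measurable_resolvent_pow 2)
  have hb : ∀ ξ : Plane, |riesz k ξ * ((1 + ‖ξ‖ ^ 2) ^ 2)⁻¹| ≤ 1 := fun ξ => by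
    rw [abs_mul]
    exact mul_le_one₀ (abs_riesz_le k ξ) (abs_nonneg _) (abs_resolvent_pow_le 2 ξ)
  have hφ : StronglyMeasurable (𝓕⁻ F) := (continuous_fourierInv hFi).stronglyMeasurable
  have sq : N ^ (p / (9 / 2)) * N ^ (1 - p / (9 / 2)) = N := by
    rw [← Real.rpow_add hN]; norm_num
  rw [mul_assoc]
  refine hbump _ _ (stronglyMeasurable_ofReal_mul hm hFm) (Integrable.ofReal_mul hFi hm hb)
    (by positivity) fun s hs => ?_
  have hs2 : 0 < √s := Real.sqrt_pos.2 hs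
  have hsq : (√s) ^ 2 = s := Real.sq_sqrt hs.le
  have en : ∀ ξ : Plane, ‖√s • ξ‖ ^ 2 = s * ‖ξ‖ ^ 2 := fun ξ => by
    rw [norm_smul, mul_pow, Real.norm_of_nonneg hs2.le, hsq]
  have hpt : ∀ ξ : Plane, bump (1 / 2) 3 s ξ * riesz k ξ = ξ k * ((1 + s * ‖ξ‖ ^ 2) ^ 3)⁻¹ := by
    intro ξ
    rw [bump, riesz]
    rcases eq_or_ne ξ 0 with rfl | h0
    · simp
    · have hn : ‖ξ‖ ≠ 0 := norm_ne_zero_iff.2 h0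
      norm_num
      field_simp
  rcases le_total 1 s with hs1 | hs1
  · have hF' : Integrable fun ξ => ((((1 + ‖ξ‖ ^ 2) ^ 2)⁻¹ : ℝ) : ℂ) * F ξ :=
      Integrable.ofReal_mul hFi (measurable_resolvent_pow 2) (abs_resolvent_pow_le 2)
    have hF'n : eLpNorm (𝓕⁻ fun ξ => ((((1 + ‖ξ‖ ^ 2) ^ 2)⁻¹ : ℝ) : ℂ) * F ξ) (ENNReal.ofReal p) volume
        ≤ ENNReal.ofReal (A₂ * kernelMass * N) := by
      have := fourierInv_mul_eq_avg (c := 1) h2 hFi e2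
      simp only [one_smul] at this
      rw [this]
      exact eLpNorm_avg_le 1 h2 (by linarith) hφ hN hFN
    have e : (fun ξ => (bump (1 / 2) 3 s ξ : ℂ) * (((riesz k ξ * ((1 + ‖ξ‖ ^ 2) ^ 2)⁻¹ : ℝ) : ℂ) * F ξ))
        = fun ξ => (((√s)⁻¹ : ℝ) : ℂ) * ((fun ξ : Plane => ((ξ k * ‖ξ‖ ^ (2 * 0)
          * ((1 + ‖ξ‖ ^ 2) ^ 3)⁻¹ : ℝ) : ℂ)) (√s • ξ)
          * (((((1 + ‖ξ‖ ^ 2) ^ 2)⁻¹ : ℝ) : ℂ) * F ξ)) := by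
      ext ξ
      beta_reduce
      rw [← mul_assoc, ← mul_assoc, ← mul_assoc, en]
      congr 1
      norm_cast
      rw [← mul_assoc, hpt]
      simp only [mul_zero, pow_zero, mul_one, PiLp.smul_apply, smul_eq_mul]
      field_simp
    rw [e, fourierInv_const_mul, fourierInv_mul_eq_avg h1 hF' e1, eLpNorm_const_mul']
    have hφ' := (continuous_fourierInv hF').stronglyMeasurable
    have b1 := eLpNorm_avg_le √s h1 (by linarith) hφ' (by positivity) hF'n
    have b2 := norm_avg_le_of_eLpNorm h1 (by linarith) hs2 hφ' (by positivity) hF'n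
    refine (mul_le_mul_right (eLpNorm_le_of_bounded_ofReal hp0 hpq (by positivity) (by positivity)
      b1 b2) _).trans ?_
    rw [← ENNReal.ofReal_mul (norm_nonneg _), Complex.norm_real, Real.norm_of_nonneg (by positivity)]
    refine ENNReal.ofReal_le_ofReal ?_
    have key : (√s)⁻¹ * ((√s) ^ (-(2 / p))) ^ (1 - p / (9 / 2)) ≤ s ^ (1 - 1 / 2 : ℝ) * tails (1 / 9) s := by
      refine le_trans (le_of_eq ?_) (mul_le_mul_of_nonneg_left (le_tails_of_one_le (γ := 1 / 9)
        (e := -(1 / 2) - (1 / p) * (1 - p / (9 / 2)) - 1 / 2) (by norm_num) hs1 ?_) (by positivity))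
      · rw [← Real.rpow_add hs, Real.sqrt_eq_rpow, ← Real.rpow_neg hs.le, ← Real.rpow_mul hs.le,
          ← Real.rpow_mul hs.le, ← Real.rpow_add hs]
        congr 1; ring
      · have : 1 / 3 < 1 / p := one_div_lt_one_div_of_lt hp0 hp3
        have e5 : (1 / p) * (1 - p / (9 / 2)) = 1 / p - 2 / 9 := by field_simp
        rw [e5]; linarith
    calc _ = K₁ * (N ^ (p / (9 / 2)) * N ^ (1 - p / (9 / 2)))
          * ((√s)⁻¹ * ((√s) ^ (-(2 / p))) ^ (1 - p / (9 / 2))) := by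
          rw [hK₁, show A₁ * kernelMass * (A₂ * kernelMass * N)
              = A₁ * kernelMass * (A₂ * kernelMass) * N by ring,
            show A₁ * kernelMass ^ (1 - 1 / p) * (√s ^ (-(2 / p)) * (A₂ * kernelMass * N))
              = A₁ * kernelMass ^ (1 - 1 / p) * (A₂ * kernelMass) * √s ^ (-(2 / p)) * N by ring,
            Real.mul_rpow (by positivity) hN.le, Real.mul_rpow (by positivity) hN.le,
            Real.mul_rpow (y := √s ^ (-(2 / p))) (by positivity) (by positivity)]
          ring
      _ ≤ max K₁ K₂ * N * (s ^ (1 - 1 / 2 : ℝ) * tails (1 / 9) s) := by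
          rw [sq]
          gcongr
          exact le_max_left _ _
  · have hm4 : Measurable fun ξ : Plane => ξ k * ‖ξ‖ ^ (2 * 0) * ((1 + ‖ξ‖ ^ 2) ^ 2)⁻¹ := by fun_prop
    have hF' : Integrable fun ξ => ((ξ k * ‖ξ‖ ^ (2 * 0) * ((1 + ‖ξ‖ ^ 2) ^ 2)⁻¹ : ℝ) : ℂ) * F ξ := by
      refine Integrable.ofReal_mul (c := 1) hFi hm4 fun ξ => ?_
      rw [mul_zero, pow_zero, mul_one, abs_mul, abs_of_nonneg (by positivity : 0 ≤ ((1 + ‖ξ‖ ^ 2) ^ 2)⁻¹),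
        ← div_eq_mul_inv]
      refine div_le_one_of_le₀ ((abs_coord_le k ξ).trans ?_) (by positivity)
      nlinarith [sq_nonneg (1 - ‖ξ‖), sq_nonneg (‖ξ‖), sq_nonneg (‖ξ‖ ^ 2)]
    have eF := fourierInv_mul_eq_avg (c := 1) h4 hFi e4
    simp only [one_smul] at eF
    have b1 := eLpNorm_avg_le 1 h4 (by linarith) hφ hN hFN
    have b2 := norm_avg_le_of_eLpNorm h4 (by linarith) one_pos hφ hN.le hFN
    have b3 := eLpNorm_le_of_bounded_ofReal hp0 hpq (by positivity) (by positivity) b1 b2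
    rw [← eF] at b3
    have e : (fun ξ => (bump (1 / 2) 3 s ξ : ℂ) * (((riesz k ξ * ((1 + ‖ξ‖ ^ 2) ^ 2)⁻¹ : ℝ) : ℂ) * F ξ))
        = fun ξ => (fun ξ : Plane => ((((1 + ‖ξ‖ ^ 2) ^ 3)⁻¹ : ℝ) : ℂ)) (√s • ξ)
          * (((ξ k * ‖ξ‖ ^ (2 * 0) * ((1 + ‖ξ‖ ^ 2) ^ 2)⁻¹ : ℝ) : ℂ) * F ξ) := by
      ext ξ
      beta_reduce
      rw [← mul_assoc, ← mul_assoc, en]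
      congr 1
      norm_cast
      rw [← mul_assoc, hpt]
      ring
    rw [e, fourierInv_mul_eq_avg h3 hF' e3]
    refine (eLpNorm_avg_le √s h3 (by norm_num) (continuous_fourierInv hF').stronglyMeasurable
      (by positivity) b3).trans (ENNReal.ofReal_le_ofReal ?_)
    have key : 1 ≤ s ^ (1 - 1 / 2 : ℝ) * tails (1 / 9) s := by
      refine le_trans (le_of_eq ?_) (mul_le_mul_of_nonneg_left (le_tails_of_le_one (γ := 1 / 9)
        (e := - (1 / 2)) (by norm_num) hs hs1 (by norm_num)) (by positivity))
      rw [← Real.rpow_add hs]; norm_num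
    calc _ = K₂ * (N ^ (p / (9 / 2)) * N ^ (1 - p / (9 / 2))) * 1 := by
          rw [hK₂, Real.one_rpow, one_mul, Real.mul_rpow (by positivity) hN.le,
            Real.mul_rpow (by positivity) hN.le]
          ring
      _ ≤ max K₁ K₂ * N * (s ^ (1 - 1 / 2 : ℝ) * tails (1 / 9) s) := by
          rw [sq]
          gcongr
          exact le_max_right _ _

/-- `L^p → L^{9/2}` bound for `e^{ia⟨∇⟩}` composed with a smoothing operator. -/
theorem exists_eLpNorm_osc_le {p : ℝ} (hp : 2 < p) (hp3 : p < 3) (k : Fin 2) :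
    ∃ C : ℝ, 0 < C ∧ ∀ (Φ : Plane → ℂ) (a T N : ℝ), StronglyMeasurable Φ → Integrable Φ → MemLp Φ 2 →
      1 ≤ T → |a| ≤ T → 0 < N → eLpNorm (𝓕⁻ Φ) (ENNReal.ofReal p) volume ≤ ENNReal.ofReal N →
      eLpNorm (𝓕⁻ fun ξ => ((riesz k ξ * ((1 + ‖ξ‖ ^ 2) ^ 6)⁻¹ : ℝ) : ℂ) * (osc a ξ * Φ ξ))
        (ENNReal.ofReal (9 / 2)) volume ≤ ENNReal.ofReal (C * ((T ^ 4) ^ (1 - 2 / p) * N)) := by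
  obtain ⟨C₁, hC₁, hR⟩ := exists_eLpNorm_riesz_resolvent_le hp hp3 k
  obtain ⟨C₂, hC₂, hosc⟩ := exists_kernel_osc
  have hk := kernelMass_pos
  have hp2 : 0 < p - 2 := by linarith
  have hp0 : 0 < p := by linarith
  refine ⟨C₁ * ((p * (4 * 2 ^ (p - 2) / (p - 2))) ^ (1 / p) * (C₂ * kernelMass) ^ (1 - 2 / p)),
    by positivity, fun Φ a T N hm hi h2 hT ha hN hΦ => ?_⟩
  obtain ⟨κ, hκ, e⟩ := hosc a T hT ha
  have hF : StronglyMeasurable fun ξ => osc a ξ * ((((1 + ‖ξ‖ ^ 2) ^ 4)⁻¹ : ℝ) : ℂ) * Φ ξ := by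
    have h1 : Measurable fun ξ : Plane => ((((1 + ‖ξ‖ ^ 2) ^ 4)⁻¹ : ℝ) : ℂ) := by fun_prop
    exact ((continuous_osc a).stronglyMeasurable.mul h1.stronglyMeasurable).mul hm
  have hb : ∀ ξ, ‖osc a ξ * ((((1 + ‖ξ‖ ^ 2) ^ 4)⁻¹ : ℝ) : ℂ)‖ ≤ 1 := fun ξ => by
    rw [norm_mul, norm_osc, one_mul, Complex.norm_real]
    exact abs_resolvent_pow_le 4 ξ
  have hFi : Integrable fun ξ => osc a ξ * ((((1 + ‖ξ‖ ^ 2) ^ 4)⁻¹ : ℝ) : ℂ) * Φ ξ := by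
    refine hi.mono hF.aestronglyMeasurable (Filter.Eventually.of_forall fun ξ => ?_)
    rw [norm_mul]
    exact mul_le_of_le_one_left (norm_nonneg _) (hb ξ)
  have eF := fourierInv_mul_eq_avg (c := 1) hκ hi e
  simp only [one_smul] at eF
  have hT0 : 0 < T := by linarith
  have b := eLpNorm_avg_le_of_fourier_le_one hp hκ (by intro ξ; rw [e]; exact hb ξ)
    (continuous_fourierInv hi).stronglyMeasurable (memLp_fourierInv hi h2)
  have b2 := b.trans (mul_le_mul_right hΦ _)
  rw [← eF, ← ENNReal.ofReal_mul (by positivity)] at b2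
  have fin := hR _ _ hF hFi (by positivity) b2
  -- Of the six resolvents, four regularize the propagator and two the Riesz transform.
  have e6 : (fun ξ => ((riesz k ξ * ((1 + ‖ξ‖ ^ 2) ^ 6)⁻¹ : ℝ) : ℂ) * (osc a ξ * Φ ξ))
      = fun ξ => ((riesz k ξ * ((1 + ‖ξ‖ ^ 2) ^ 2)⁻¹ : ℝ) : ℂ)
        * (osc a ξ * ((((1 + ‖ξ‖ ^ 2) ^ 4)⁻¹ : ℝ) : ℂ) * Φ ξ) := by
    ext ξ
    have : ((1 + ‖ξ‖ ^ 2) ^ 6)⁻¹ = ((1 + ‖ξ‖ ^ 2) ^ 2)⁻¹ * ((1 + ‖ξ‖ ^ 2) ^ 4)⁻¹ := by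
      rw [← mul_inv, ← pow_add]
    rw [this]
    push_cast
    ring
  rw [e6]
  refine fin.trans (le_of_eq ?_)
  congr 1
  rw [show C₂ * T ^ 4 * kernelMass = C₂ * kernelMass * T ^ 4 by ring,
    Real.mul_rpow (x := C₂ * kernelMass) (y := T ^ 4) (by positivity) (by positivity)]

  ring

end LowFactor

/-! ### Time decay of the solution in L^{9/2} and L^{18/5}. -/

section Profiles

/-- The bounds on the Fourier transform `Φ` of a profile at a time of size `T`, which evolves by
`e^{ia⟨∇⟩}`. -/
structure ProfileBound (M₁ M₂ : ℕ) (p T a X : ℝ) (Φ : Plane → ℂ) : Prop where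
  meas : StronglyMeasurable Φ
  one_le_T : 1 ≤ T
  abs_le : |a| ≤ T
  X_pos : 0 < X
  sob₁ : SobolevBound M₁ X Φ
  sob₂ : SobolevBound M₂ (X * T) Φ
  sup : ∀ x, ‖𝓕⁻ (fun ξ => ((‖ξ‖ ^ (1 / 2 : ℝ) : ℝ) : ℂ) * (osc a ξ * Φ ξ)) x‖ ≤ X / T
  wt : eLpNorm (fun x => ((1 + ‖x‖ : ℝ) : ℂ) * 𝓕⁻ Φ x) (ENNReal.ofReal p) volume ≤ ENNReal.ofReal X

/-- The component `j` of the Riesz transform of `|∇|^{2B} e^{ia⟨∇⟩} f`. -/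
noncomputable def mode (a : ℝ) (Φ : Plane → ℂ) (B : ℕ) (j : Fin 2) (ξ : Plane) : ℂ :=
  ((riesz j ξ * ‖ξ‖ ^ (2 * B) : ℝ) : ℂ) * (osc a ξ * Φ ξ)

theorem stronglyMeasurable_mode {a : ℝ} {Φ : Plane → ℂ} (h : StronglyMeasurable Φ) (B : ℕ)
    (j : Fin 2) : StronglyMeasurable (mode a Φ B j) :=
  stronglyMeasurable_ofReal_mul ((measurable_riesz j).mul
    (by fun_prop : Measurable fun ξ : Plane => ‖ξ‖ ^ (2 * B)))
    ((continuous_osc a).stronglyMeasurable.mul h)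

theorem norm_mode_le (a : ℝ) (Φ : Plane → ℂ) (B : ℕ) (j : Fin 2) (ξ : Plane) :
    ‖mode a Φ B j ξ‖ ≤ ‖ξ‖ ^ (2 * B) * ‖Φ ξ‖ := by
  rw [mode, norm_mul, norm_mul, norm_osc, one_mul, Complex.norm_real, norm_mul,
    Real.norm_of_nonneg (by positivity : 0 ≤ ‖ξ‖ ^ (2 * B))]
  gcongr
  exact mul_le_of_le_one_left (by positivity) (abs_riesz_le j ξ)

theorem rpow_mul_div_rpow {X T : ℝ} (hX : 0 < X) (hT : 0 < T) (α : ℝ) :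
    X ^ α * (X / T) ^ (1 - α) = X * T ^ (-(1 - α)) := by
  rw [Real.div_rpow hX.le hT.le, Real.rpow_neg hT.le, ← mul_div_assoc, ← Real.rpow_add hX,
    add_sub_cancel, Real.rpow_one, div_eq_mul_inv]

/-- Interpolating L² with the rate 1/T gives the power 1 - 2/r, equal to 5/9 at r = 9/2 and 4/9 at r
= 18/5. These two exponents are Hölder conjugate relative to L², and the powers of decay add up to
one. -/
theorem exists_eLpNorm_mode_low_le {p : ℝ} (hp : 2 < p) (hp3 : p < 3) (j : Fin 2) {B M₁ : ℕ}
    (hM : 9 * (2 * B + 1) ≤ 4 * M₁) (hM3 : 3 ≤ M₁) :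
    ∃ C : ℝ, 0 < C ∧ ∀ (M₂ : ℕ) (T a X : ℝ) (Φ : Plane → ℂ), ProfileBound M₁ M₂ p T a X Φ →
      eLpNorm (𝓕⁻ (mode a Φ B j)) (ENNReal.ofReal (9 / 2)) volume
        ≤ ENNReal.ofReal (C * (X * T ^ (-(5 / 9) : ℝ))) := by
  obtain ⟨C, hC, h⟩ := exists_eLpNorm_riesz_mul_le hp hp3 (r := 9 / 2) (by norm_num) (by norm_num) j
    (B := B) (M := M₁) (by have : (9 * (2 * B + 1) : ℝ) ≤ 4 * M₁ := by exact_mod_cast hM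
                           norm_num; linarith) (by omega) hM3
  refine ⟨C, hC, fun M₂ T a X Φ hP => ?_⟩
  have hT : 0 < T := by linarith [hP.one_le_T]
  have hX := hP.X_pos
  refine (h Φ a X X (X / T) hP.meas hX le_rfl (by positivity) hP.sob₁ hP.wt hP.sup).trans (le_of_eq ?_)
  rw [rpow_mul_div_rpow hX hT]
  norm_num

theorem exists_eLpNorm_mode_high_le {p : ℝ} (hp : 2 < p) (hp3 : p < 3) (j : Fin 2) {B M₁ : ℕ}
    (hM : 9 * (2 * B + 1) ≤ 5 * M₁) (hM2 : 2 * B + 2 ≤ M₁) (hM3 : 3 ≤ M₁) :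
    ∃ C : ℝ, 0 < C ∧ ∀ (M₂ : ℕ) (T a X : ℝ) (Φ : Plane → ℂ), ProfileBound M₁ M₂ p T a X Φ →
      eLpNorm (𝓕⁻ (mode a Φ B j)) (ENNReal.ofReal (18 / 5)) volume
        ≤ ENNReal.ofReal (C * (X * T ^ (-(4 / 9) : ℝ))) := by
  obtain ⟨C, hC, h⟩ := exists_eLpNorm_riesz_mul_le hp hp3 (r := 18 / 5) (by norm_num) (by norm_num) j
    (B := B) (M := M₁) (by have : (9 * (2 * B + 1) : ℝ) ≤ 5 * M₁ := by exact_mod_cast hM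
                           norm_num; linarith) hM2 hM3
  refine ⟨C, hC, fun M₂ T a X Φ hP => ?_⟩
  have hT : 0 < T := by linarith [hP.one_le_T]
  have hX := hP.X_pos
  refine (h Φ a X X (X / T) hP.meas hX le_rfl (by positivity) hP.sob₁ hP.wt hP.sup).trans (le_of_eq ?_)
  rw [rpow_mul_div_rpow hX hT]
  norm_num

/-- With the higher Sobolev norm growing like T, interpolation gives T^{5/9} · T^{-4/9}. -/
theorem exists_eLpNorm_mode_top_le {p : ℝ} (hp : 2 < p) (hp3 : p < 3) (j : Fin 2) {B M₂ : ℕ}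
    (hM : 9 * (2 * B + 1) ≤ 5 * M₂) (hM2 : 2 * B + 2 ≤ M₂) (hM3 : 3 ≤ M₂) :
    ∃ C : ℝ, 0 < C ∧ ∀ (M₁ : ℕ) (T a X : ℝ) (Φ : Plane → ℂ), ProfileBound M₁ M₂ p T a X Φ →
      eLpNorm (𝓕⁻ (mode a Φ B j)) (ENNReal.ofReal (18 / 5)) volume
        ≤ ENNReal.ofReal (C * (X * T ^ (1 / 9 : ℝ))) := by
  obtain ⟨C, hC, h⟩ := exists_eLpNorm_riesz_mul_le hp hp3 (r := 18 / 5) (by norm_num) (by norm_num) j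
    (B := B) (M := M₂) (by have : (9 * (2 * B + 1) : ℝ) ≤ 5 * M₂ := by exact_mod_cast hM
                           norm_num; linarith) hM2 hM3
  refine ⟨C, hC, fun M₁ T a X Φ hP => ?_⟩
  have hT : 0 < T := by linarith [hP.one_le_T]
  have hX := hP.X_pos
  refine (h Φ a X (X * T) (X / T) hP.meas hX (le_mul_of_one_le_right hX.le hP.one_le_T) (by positivity)
    hP.sob₂ hP.wt hP.sup).trans (le_of_eq ?_)
  rw [Real.mul_rpow hX.le hT.le, mul_right_comm, rpow_mul_div_rpow hX hT, mul_assoc X,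
    ← Real.rpow_add hT]
  norm_num

end Profiles

/-! ### Difference quotients in frequency and the corresponding bounded weights in space. -/

section DifferenceQuotients

open Filter Topology

/-- The coordinate directions of the plane. -/
noncomputable def dir (l : Fin 2) : Plane := EuclideanSpace.single l 1

theorem norm_dir (l : Fin 2) : ‖dir l‖ = 1 := by simp [dir]

theorem inner_dir (l : Fin 2) (x : Plane) : inner ℝ (dir l) x = x l := by
  simp [dir, EuclideanSpace.inner_single_left]

/-- The difference quotient of `F` in the direction `-dir l`. -/
noncomputable def dq (ε : ℝ) (l : Fin 2) (F : Plane → ℂ) (ξ : Plane) : ℂ :=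
  ((ε⁻¹ : ℝ) : ℂ) * (F (ξ - ε • dir l) - F ξ)

/-- The weight `(e^{2πiεx_l} - 1) / ε`, which approximates `2πi x_l`. -/
noncomputable def wfac (ε : ℝ) (l : Fin 2) (x : Plane) : ℂ :=
  ((ε⁻¹ : ℝ) : ℂ) * ((Real.fourierChar (ε * x l) : ℂ) - 1)

theorem norm_exp_ofReal_mul_I_sub_le (α β : ℝ) :
    ‖Complex.exp (Complex.I * (α : ℂ)) - Complex.exp (Complex.I * (β : ℂ))‖ ≤ |α - β| := by
  have h : Complex.exp (Complex.I * (α : ℂ)) - Complex.exp (Complex.I * (β : ℂ))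
      = Complex.exp (Complex.I * (β : ℂ)) * (Complex.exp (Complex.I * ((α - β : ℝ) : ℂ)) - 1) := by
    rw [mul_sub, ← Complex.exp_add, mul_one]
    congr 2
    push_cast; ring
  rw [h, norm_mul, mul_comm Complex.I (β : ℂ), Complex.norm_exp_ofReal_mul_I, one_mul]
  exact Real.norm_exp_I_mul_ofReal_sub_one_le

theorem norm_wfac_le (ε : ℝ) (l : Fin 2) (x : Plane) : ‖wfac ε l x‖ ≤ 2 * Real.pi * |x l| := by
  have h := norm_exp_ofReal_mul_I_sub_le (2 * Real.pi * (ε * x l)) 0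
  simp only [Complex.ofReal_zero, mul_zero, Complex.exp_zero, sub_zero] at h
  rw [wfac, norm_mul, Complex.norm_real, Real.fourierChar_apply, mul_comm _ Complex.I]
  rcases eq_or_ne ε 0 with rfl | h0
  · simp only [inv_zero, norm_zero, zero_mul]; positivity
  · have hε : 0 < |ε| := abs_pos.2 h0
    calc _ ≤ ‖ε⁻¹‖ * |2 * Real.pi * (ε * x l)| := by gcongr
      _ = _ := by
        rw [norm_inv, Real.norm_eq_abs, abs_mul, abs_mul ε, abs_of_pos Real.two_pi_pos]
        field_simp

theorem fourierInv_comp_sub (F : Plane → ℂ) (v x : Plane) :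
    𝓕⁻ (fun ξ => F (ξ - v)) x = (Real.fourierChar (inner ℝ v x) : ℂ) * 𝓕⁻ F x := by
  rw [Real.fourierInv_eq, Real.fourierInv_eq, ← integral_const_mul,
    ← integral_add_right_eq_self (fun ξ => Real.fourierChar (inner ℝ ξ x) • F (ξ - v)) v]
  congr 1; ext ξ
  simp only [add_sub_cancel_right, Circle.smul_def, smul_eq_mul, inner_add_left, AddChar.map_add_eq_mul,
    Circle.coe_mul]
  ring

theorem integrable_fourierChar_smul {F : Plane → ℂ} (hF : Integrable F) (x : Plane) :
    Integrable fun ξ : Plane => Real.fourierChar (inner ℝ ξ x) • F ξ := by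
  refine hF.mono ?_ (Eventually.of_forall fun ξ => by simp)
  simp only [Circle.smul_def, smul_eq_mul]
  exact (stronglyMeasurable_fourierChar_inner measurable_id
    measurable_const).aestronglyMeasurable.mul hF.1

theorem fourierInv_sub' {F G : Plane → ℂ} (hF : Integrable F) (hG : Integrable G) (x : Plane) :
    𝓕⁻ (fun ξ => F ξ - G ξ) x = 𝓕⁻ F x - 𝓕⁻ G x := by
  simp only [Real.fourierInv_eq, smul_sub]
  exact integral_sub (integrable_fourierChar_smul hF x)
    (integrable_fourierChar_smul hG x)

theorem fourierInv_add' {F G : Plane → ℂ} (hF : Integrable F) (hG : Integrable G) (x : Plane) :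
    𝓕⁻ (fun ξ => F ξ + G ξ) x = 𝓕⁻ F x + 𝓕⁻ G x := by
  simp only [Real.fourierInv_eq, smul_add]
  exact integral_add (integrable_fourierChar_smul hF x)
    (integrable_fourierChar_smul hG x)

/-- Translation in frequency is modulation in space. This replaces multiplication by x with a
bounded multiplication that requires no differentiability of F, at the price of bounds uniform as ε
→ 0. -/
theorem fourierInv_dq {F : Plane → ℂ} (hF : Integrable F) (ε : ℝ) (l : Fin 2) :
    𝓕⁻ (dq ε l F) = fun x => wfac ε l x * 𝓕⁻ F x := by
  ext x
  have h := congrFun (fourierInv_const_mul ((ε⁻¹ : ℝ) : ℂ) (fun ξ => F (ξ - ε • dir l) - F ξ)) x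
  change 𝓕⁻ (fun ξ => ((ε⁻¹ : ℝ) : ℂ) * (F (ξ - ε • dir l) - F ξ)) x = _
  rw [h, fourierInv_sub' (hF.comp_sub_right _) hF, fourierInv_comp_sub, inner_smul_left, inner_dir, wfac]
  simp only [conj_trivial]
  ring

/-- Dominated convergence for `𝓕⁻`, from `L¹ ∩ L²` to `L^q`. -/
theorem eventually_eLpNorm_fourierInv_le {q c δ : ℝ} (hq : 2 ≤ q) (hδ : 0 < δ) {G : ℝ → Plane → ℂ}
    {Φ : Plane → ℂ} (hΦ1 : Integrable Φ) (hΦ2 : MemLp Φ 2)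
    (hm : ∀ ε, StronglyMeasurable (G ε)) (hb : ∀ ε ξ, 0 < ε → ‖G ε ξ‖ ≤ c * ‖Φ ξ‖)
    (hlim : ∀ ξ, Tendsto (fun ε => G ε ξ) (𝓝[>] 0) (𝓝 0)) :
    ∀ᶠ ε in 𝓝[>] (0 : ℝ), eLpNorm (𝓕⁻ (G ε)) (ENNReal.ofReal q) volume ≤ ENNReal.ofReal δ := by
  have hpos : ∀ᶠ ε in 𝓝[>] (0 : ℝ), 0 < ε := eventually_mem_nhdsWithin
  have hle : ∀ ε ξ, 0 < ε → ‖G ε ξ‖ₑ ≤ ENNReal.ofReal c * ‖Φ ξ‖ₑ := fun ε ξ hε => by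
    rw [← ofReal_norm, ← ofReal_norm, ← ENNReal.ofReal_mul' (norm_nonneg _)]
    exact ENNReal.ofReal_le_ofReal (hb ε ξ hε)
  have hδ' : (0 : ℝ≥0∞) < ENNReal.ofReal δ := ENNReal.ofReal_pos.2 hδ
  have t1 : Tendsto (fun ε => ∫⁻ ξ, ‖G ε ξ‖ₑ) (𝓝[>] 0) (𝓝 (∫⁻ _ : Plane, 0)) := by
    refine tendsto_lintegral_filter_of_dominated_convergence (fun ξ => ENNReal.ofReal c * ‖Φ ξ‖ₑ)
      (Eventually.of_forall fun ε => (hm ε).enorm) ?_ ?_ ?_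
    · filter_upwards [hpos] with ε hε
      exact Eventually.of_forall fun ξ => hle ε ξ hε
    · rw [lintegral_const_mul' _ _ ENNReal.ofReal_ne_top]
      exact ENNReal.mul_ne_top ENNReal.ofReal_ne_top hΦ1.2.ne
    · refine Eventually.of_forall fun ξ => ?_
      simpa using (hlim ξ).enorm
  have t2 : Tendsto (fun ε => ∫⁻ ξ, ‖G ε ξ‖ₑ ^ (2 : ℝ)) (𝓝[>] 0) (𝓝 (∫⁻ _ : Plane, 0)) := by
    refine tendsto_lintegral_filter_of_dominated_convergence
      (fun ξ => (ENNReal.ofReal c * ‖Φ ξ‖ₑ) ^ (2 : ℝ))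
      (Eventually.of_forall fun ε => (hm ε).enorm.pow_const _) ?_ ?_ ?_
    · filter_upwards [hpos] with ε hε
      exact Eventually.of_forall fun ξ => by gcongr; exact hle ε ξ hε
    · simp only [ENNReal.mul_rpow_of_nonneg _ _ zero_le_two]
      rw [lintegral_const_mul' _ _ (ENNReal.rpow_ne_top_of_nonneg zero_le_two ENNReal.ofReal_ne_top)]
      refine ENNReal.mul_ne_top (ENNReal.rpow_ne_top_of_nonneg zero_le_two ENNReal.ofReal_ne_top) ?_
      rw [← eLpNorm_ofReal_rpow two_pos, show ENNReal.ofReal 2 = 2 by norm_num]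
      exact ENNReal.rpow_ne_top_of_nonneg zero_le_two hΦ2.2.ne
    · refine Eventually.of_forall fun ξ => ?_
      have := ((hlim ξ).enorm).ennrpow_const 2
      simpa using this
  rw [lintegral_zero] at t1 t2
  filter_upwards [hpos, t1.eventually (ge_mem_nhds hδ'),
    t2.eventually (ge_mem_nhds (ENNReal.rpow_pos hδ' ENNReal.ofReal_ne_top : 0 < ENNReal.ofReal δ ^ (2 : ℝ)))]
    with ε hε h1 h2
  have hi := integrable_of_lintegral_le (hm ε).aestronglyMeasurable hδ.le h1
  have n2 : eLpNorm (G ε) 2 volume ≤ ENNReal.ofReal δ := by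
    rw [eLpNorm_two_eq]
    refine (ENNReal.rpow_le_rpow h2 (by norm_num)).trans (le_of_eq ?_)
    rw [← ENNReal.rpow_mul]
    norm_num
  have hl : MemLp (G ε) 2 := ⟨(hm ε).aestronglyMeasurable, n2.trans_lt ENNReal.ofReal_lt_top⟩
  rw [← eLpNorm_fourierInv hi.1 hl] at n2
  refine (eLpNorm_le_of_sq_of_bounded hq hδ.le hδ.le n2 (Eventually.of_forall fun x =>
    (norm_fourierInv_le _ x).trans hi.2)).trans (le_of_eq ?_)
  rw [← Real.rpow_add hδ]
  norm_num

end DifferenceQuotients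

/-! ### Difference quotients of the Riesz, resolvent and propagator symbols. -/

section SymbolDifferences

open Filter Topology

/-- The Riesz symbol is homogeneous of degree zero, so its gradient is O(1/‖ξ‖). Multiplying by ‖ξ‖,
instead of dividing, makes the estimate valid for all ξ and v, including increments that cross the
origin. -/
theorem abs_riesz_sub_le (j : Fin 2) (ξ v : Plane) :
    |riesz j (ξ - v) - riesz j ξ| * ‖ξ‖ ≤ 2 * ‖v‖ := by
  have hc : |(ξ - v) j - ξ j| ≤ ‖v‖ := by
    have := abs_coord_le j v
    simpa using this
  have hn : |‖ξ‖ - ‖ξ - v‖| ≤ ‖v‖ := by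
    have := abs_norm_sub_norm_le ξ (ξ - v)
    simpa using this
  rcases eq_or_ne ξ 0 with rfl | h0
  · simp
  have hξ : 0 < ‖ξ‖ := norm_pos_iff.2 h0
  have key : (riesz j (ξ - v) - riesz j ξ) * ‖ξ‖
      = riesz j (ξ - v) * (‖ξ‖ - ‖ξ - v‖) + ((ξ - v) j - ξ j) := by
    rcases eq_or_ne (ξ - v) 0 with h1 | h1
    · rw [h1]; simp [riesz, hξ.ne']
    · have h2 : ‖ξ - v‖ ≠ 0 := norm_ne_zero_iff.2 h1
      simp only [riesz]
      field_simp
      ring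
  calc _ = |(riesz j (ξ - v) - riesz j ξ) * ‖ξ‖| := by rw [abs_mul, abs_of_pos hξ]
    _ ≤ |riesz j (ξ - v)| * |‖ξ‖ - ‖ξ - v‖| + |(ξ - v) j - ξ j| := by
        rw [key, ← abs_mul]; exact abs_add_le _ _
    _ ≤ 1 * ‖v‖ + ‖v‖ := by
        gcongr
        exact abs_riesz_le j _
    _ = _ := by ring

theorem exists_abs_resolvent_sub_le (L : ℕ) : ∃ C : ℝ, 0 < C ∧ ∀ ξ v : Plane, ‖v‖ ≤ 1 →
    |((1 + ‖ξ - v‖ ^ 2) ^ L)⁻¹ - ((1 + ‖ξ‖ ^ 2) ^ L)⁻¹| ≤ C * ‖v‖ * ((1 + ‖ξ‖ ^ 2) ^ L)⁻¹ := by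
  refine ⟨4 * L * 3 ^ L + 1, by positivity, fun ξ v hv => ?_⟩
  have hn : |‖ξ‖ - ‖ξ - v‖| ≤ ‖v‖ := by
    have := abs_norm_sub_norm_le ξ (ξ - v)
    simpa using this
  have hn0 := norm_nonneg ξ
  have hn1 := norm_nonneg (ξ - v)
  set a : ℝ := 1 + ‖ξ‖ ^ 2 with ha
  set b : ℝ := 1 + ‖ξ - v‖ ^ 2 with hb
  obtain ⟨h1, h2⟩ := abs_le.1 hn
  have ha0 : 0 < a := by positivity
  have hb0 : 0 < b := by positivity
  have hab : a ≤ 3 * b := by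
    have : ‖ξ‖ ≤ ‖ξ - v‖ + 1 := by linarith
    nlinarith [sq_nonneg (‖ξ - v‖ - 1)]
  have hd : |a - b| ≤ 4 * ‖v‖ * b := by
    have e : a - b = (‖ξ‖ - ‖ξ - v‖) * (‖ξ‖ + ‖ξ - v‖) := by rw [ha, hb]; ring
    rw [e, abs_mul, abs_of_nonneg (by positivity : 0 ≤ ‖ξ‖ + ‖ξ - v‖)]
    calc _ ≤ ‖v‖ * (4 * b) := by
          gcongr
          nlinarith [sq_nonneg (‖ξ - v‖ - 1), sq_nonneg (‖ξ‖ - 1)]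
      _ = _ := by ring
  have hp := abs_pow_sub_pow_le a b L
  rw [abs_of_pos ha0, abs_of_pos hb0] at hp
  have hmax : max a b ≤ 3 * b := max_le hab (by linarith)
  have hnum : |a ^ L - b ^ L| ≤ (4 * L * 3 ^ L + 1) * ‖v‖ * b ^ L := by
    rcases L.eq_zero_or_pos with rfl | hL
    · simp
    · calc _ ≤ |a - b| * L * max a b ^ (L - 1) := hp
        _ ≤ (4 * ‖v‖ * b) * L * (3 * b) ^ (L - 1) := by gcongr
        _ = 4 * L * 3 ^ (L - 1) * ‖v‖ * (b * b ^ (L - 1)) := by rw [mul_pow]; ring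
        _ = 4 * L * 3 ^ (L - 1) * ‖v‖ * b ^ L := by rw [mul_pow_sub_one hL.ne']
        _ ≤ _ := by
          gcongr
          have h3 : (3 : ℝ) ^ (L - 1) ≤ 3 ^ L := pow_le_pow_right₀ (by norm_num) (by omega)
          have : (4 : ℝ) * L * 3 ^ (L - 1) ≤ 4 * L * 3 ^ L := by gcongr
          linarith
  have e : (b ^ L)⁻¹ - (a ^ L)⁻¹ = (a ^ L - b ^ L) / (a ^ L * b ^ L) := by field_simp
  rw [e, abs_div, abs_of_pos (by positivity : 0 < a ^ L * b ^ L), div_le_iff₀ (by positivity)]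
  calc _ ≤ _ := hnum
    _ = _ := by field_simp

theorem abs_jb_freq_sub_le (ξ v : Plane) : |jb (freq (ξ - v)) - jb (freq ξ)| ≤ 2 * Real.pi * ‖v‖ := by
  have hsq : ∀ x : Plane, jb x ^ 2 = 1 + ‖x‖ ^ 2 := fun x => Real.sq_sqrt (by positivity)
  have hlip : ∀ x y : Plane, jb x - jb y ≤ ‖x - y‖ := by
    intro x y
    have hx : 0 < jb x := Real.sqrt_pos.2 (by positivity)
    have hy : 0 < jb y := Real.sqrt_pos.2 (by positivity)
    have hyn : ‖y‖ ≤ jb y := Real.le_sqrt_of_sq_le (by linarith)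
    have h1 : ‖x‖ ≤ ‖y‖ + ‖x - y‖ := by
      have := norm_add_le y (x - y); simpa using this
    have h2 : jb x ≤ jb y + ‖x - y‖ := by
      refine Real.sqrt_le_iff.2 ⟨by positivity, ?_⟩
      nlinarith [hsq y, norm_nonneg x, norm_nonneg y, norm_nonneg (x - y)]
    linarith
  have e : ‖freq (ξ - v) - freq ξ‖ = 2 * Real.pi * ‖v‖ := by
    rw [freq, freq, ← smul_sub, norm_smul, Real.norm_of_nonneg Real.two_pi_pos.le]
    simp
  rw [abs_sub_le_iff, ← e]
  exact ⟨hlip _ _, by rw [norm_sub_rev]; exact hlip _ _⟩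

theorem norm_osc_sub_le (a : ℝ) (ξ v : Plane) :
    ‖osc a (ξ - v) - osc a ξ‖ ≤ |a| * (2 * Real.pi * ‖v‖) := by
  refine (norm_exp_ofReal_mul_I_sub_le _ _).trans ?_
  rw [← mul_sub, abs_mul]
  gcongr
  exact abs_jb_freq_sub_le ξ v

/-- The derivative of `s ↦ osc a (ξ - s • dir l)` at `0` is `-i a (2π)² ξ_l / ⟨2πξ⟩ * osc a ξ`. -/
theorem tendsto_dq_osc (a : ℝ) (l : Fin 2) (ξ : Plane) :
    Tendsto (fun ε : ℝ => dq ε l (osc a) ξ) (𝓝[>] 0)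
      (𝓝 (-(Complex.I * (a * (2 * Real.pi) ^ 2 : ℝ)) * ((ξ l / jb (freq ξ) : ℝ) : ℂ) * osc a ξ)) := by
  have hj : 0 < jb (freq ξ) := Real.sqrt_pos.2 (by positivity)
  have e : ∀ s : ℝ, jb (freq (ξ - s • dir l))
      = √(1 + (2 * Real.pi) ^ 2 * (‖ξ‖ ^ 2 - 2 * (s * ξ l) + s ^ 2)) := by
    intro s
    rw [jb, freq, norm_smul, mul_pow, Real.norm_of_nonneg Real.two_pi_pos.le, norm_sub_sq_real,
      inner_smul_right, real_inner_comm, inner_dir, norm_smul, norm_dir, mul_one, Real.norm_eq_abs, sq_abs]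
  have h1 : HasDerivAt (fun s : ℝ => 1 + (2 * Real.pi) ^ 2 * (‖ξ‖ ^ 2 - 2 * (s * ξ l) + s ^ 2))
      (-(2 * (2 * Real.pi) ^ 2 * ξ l)) 0 := by
    have := ((((((hasDerivAt_id (0 : ℝ)).mul_const (ξ l)).const_mul 2).const_sub (‖ξ‖ ^ 2)).add
      ((hasDerivAt_id (0 : ℝ)).pow 2)).const_mul ((2 * Real.pi) ^ 2)).const_add 1
    refine (this.congr_deriv ?_).congr_of_eventuallyEq ?_
    · norm_num
      ring
    · exact Eventually.of_forall fun s => by simp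
  have h2 : HasDerivAt (fun s : ℝ => jb (freq (ξ - s • dir l)))
      (-((2 * Real.pi) ^ 2 * (ξ l / jb (freq ξ)))) 0 := by
    simp only [e]
    have e0 : √(1 + (2 * Real.pi) ^ 2 * (‖ξ‖ ^ 2 - 2 * (0 * ξ l) + 0 ^ 2)) = jb (freq ξ) := by
      rw [← e 0]; simp
    have hne : (1 + (2 * Real.pi) ^ 2 * (‖ξ‖ ^ 2 - 2 * (0 * ξ l) + 0 ^ 2)) ≠ 0 := by
      have : 0 ≤ (2 * Real.pi) ^ 2 * ‖ξ‖ ^ 2 := by positivity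
      simp only [zero_mul, mul_zero, sub_zero, ne_eq, OfNat.ofNat_ne_zero, not_false_eq_true, zero_pow, add_zero]
      positivity
    have := h1.sqrt hne
    rw [e0] at this
    convert this using 1
    field_simp
  have h3 : HasDerivAt (fun s : ℝ => osc a (ξ - s • dir l))
      (osc a ξ * (Complex.I * ((a * -((2 * Real.pi) ^ 2 * (ξ l / jb (freq ξ))) : ℝ) : ℂ))) 0 := by
    have h4 := (((h2.const_mul a).ofReal_comp).const_mul Complex.I).cexp
    have e7 : osc a ξ = osc a (ξ - (0 : ℝ) • dir l) := by simp
    rw [e7]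
    exact h4
  have h5 := h3.tendsto_slope_zero_right
  simp only [zero_add, zero_smul, sub_zero] at h5
  have e6 : osc a ξ * (Complex.I * ((a * -((2 * Real.pi) ^ 2 * (ξ l / jb (freq ξ))) : ℝ) : ℂ))
      = -(Complex.I * (a * (2 * Real.pi) ^ 2 : ℝ)) * ((ξ l / jb (freq ξ) : ℝ) : ℂ) * osc a ξ := by
    push_cast; ring
  rw [e6] at h5
  refine h5.congr fun ε => ?_
  rw [dq, Complex.real_smul]

end SymbolDifferences

/-! ### The weighted L^{9/2} bound for the smoothed factor. -/

section WeightedLow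

open Filter Topology

/-- The symbol `(ξ_k / ‖ξ‖) (1 + ‖ξ‖²)⁻⁶`. -/
noncomputable def smoothRiesz (k : Fin 2) (ξ : Plane) : ℝ := riesz k ξ * ((1 + ‖ξ‖ ^ 2) ^ 6)⁻¹

/-- The Fourier transform of the smoothed Riesz transform of `e^{ia⟨∇⟩} f`. -/
noncomputable def low (a : ℝ) (Φ : Plane → ℂ) (k : Fin 2) (ξ : Plane) : ℂ :=
  (smoothRiesz k ξ : ℂ) * (osc a ξ * Φ ξ)

theorem measurable_smoothRiesz (k : Fin 2) : Measurable (smoothRiesz k) :=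
  (measurable_riesz k).mul (measurable_resolvent_pow 6)

theorem abs_smoothRiesz_le (k : Fin 2) (ξ : Plane) : |smoothRiesz k ξ| ≤ 1 := by
  rw [smoothRiesz, abs_mul]
  exact mul_le_one₀ (abs_riesz_le k ξ) (abs_nonneg _) (abs_resolvent_pow_le 6 ξ)

theorem stronglyMeasurable_osc_mul {Φ : Plane → ℂ} (a : ℝ) (h : StronglyMeasurable Φ) :
    StronglyMeasurable fun ξ => osc a ξ * Φ ξ := (continuous_osc a).stronglyMeasurable.mul h

theorem stronglyMeasurable_low {Φ : Plane → ℂ} (a : ℝ) (h : StronglyMeasurable Φ) (k : Fin 2) :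
    StronglyMeasurable (low a Φ k) :=
  stronglyMeasurable_ofReal_mul (measurable_smoothRiesz k) (stronglyMeasurable_osc_mul a h)

theorem norm_low_le (a : ℝ) (Φ : Plane → ℂ) (k : Fin 2) (ξ : Plane) : ‖low a Φ k ξ‖ ≤ ‖Φ ξ‖ := by
  rw [low, norm_mul, norm_mul, norm_osc, one_mul, Complex.norm_real]
  exact mul_le_of_le_one_left (norm_nonneg _) (abs_smoothRiesz_le k ξ)

theorem resolvent_mul_le (ξ : Plane) : ((1 + ‖ξ‖ ^ 2) ^ 6)⁻¹ * (1 + ‖ξ‖) ≤ 64 * ((1 + ‖ξ‖) ^ 5)⁻¹ := by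
  have hq := one_le_one_add_norm ξ
  have h0 : (1 + ‖ξ‖) ^ 6 ≤ 64 * (1 + ‖ξ‖ ^ 2) ^ 6 := by
    have h1 : 1 + ‖ξ‖ ≤ 2 * (1 + ‖ξ‖ ^ 2) := by nlinarith [sq_nonneg (‖ξ‖ - 1)]
    calc (1 + ‖ξ‖) ^ 6 ≤ (2 * (1 + ‖ξ‖ ^ 2)) ^ 6 := by gcongr
      _ = _ := by rw [mul_pow]; norm_num
  rw [inv_mul_le_iff₀ (by positivity), ← div_eq_mul_inv, mul_div_assoc', le_div_iff₀ (by positivity)]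
  nlinarith

theorem exists_abs_smoothRiesz_sub_le (k : Fin 2) : ∃ C : ℝ, 0 < C ∧ ∀ ξ v : Plane, ‖v‖ ≤ 1 →
    |smoothRiesz k (ξ - v) - smoothRiesz k ξ| * ‖ξ‖ ≤ C * ‖v‖ * ((1 + ‖ξ‖) ^ 5)⁻¹ := by
  obtain ⟨C, hC, h⟩ := exists_abs_resolvent_sub_le 6
  refine ⟨(C + 2) * 64, by positivity, fun ξ v hv => ?_⟩
  have e : smoothRiesz k (ξ - v) - smoothRiesz k ξ
      = riesz k (ξ - v) * (((1 + ‖ξ - v‖ ^ 2) ^ 6)⁻¹ - ((1 + ‖ξ‖ ^ 2) ^ 6)⁻¹)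
        + (riesz k (ξ - v) - riesz k ξ) * ((1 + ‖ξ‖ ^ 2) ^ 6)⁻¹ := by
    rw [smoothRiesz, smoothRiesz]; ring
  have hr : 0 ≤ ((1 + ‖ξ‖ ^ 2) ^ 6)⁻¹ := by positivity
  calc |smoothRiesz k (ξ - v) - smoothRiesz k ξ| * ‖ξ‖
      ≤ (|riesz k (ξ - v)| * |((1 + ‖ξ - v‖ ^ 2) ^ 6)⁻¹ - ((1 + ‖ξ‖ ^ 2) ^ 6)⁻¹|
        + |riesz k (ξ - v) - riesz k ξ| * ((1 + ‖ξ‖ ^ 2) ^ 6)⁻¹) * ‖ξ‖ := by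
        rw [e, ← abs_mul, ← abs_of_nonneg hr, ← abs_mul, abs_of_nonneg hr]
        gcongr
        exact abs_add_le _ _
    _ ≤ (1 * (C * ‖v‖ * ((1 + ‖ξ‖ ^ 2) ^ 6)⁻¹) + |riesz k (ξ - v) - riesz k ξ|
        * ((1 + ‖ξ‖ ^ 2) ^ 6)⁻¹) * ‖ξ‖ := by
        gcongr
        · exact abs_riesz_le k _
        · exact h ξ v hv
    _ = (C * ‖v‖ * ‖ξ‖ + |riesz k (ξ - v) - riesz k ξ| * ‖ξ‖) * ((1 + ‖ξ‖ ^ 2) ^ 6)⁻¹ := by ring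
    _ ≤ (C * ‖v‖ * (1 + ‖ξ‖) + 2 * ‖v‖ * (1 + ‖ξ‖)) * ((1 + ‖ξ‖ ^ 2) ^ 6)⁻¹ := by
        refine mul_le_mul_of_nonneg_right (add_le_add ?_ ?_) hr
        · gcongr
          linarith
        · exact (abs_riesz_sub_le k ξ v).trans
            (le_mul_of_one_le_right (by positivity) (one_le_one_add_norm ξ))
    _ = (C + 2) * ‖v‖ * (((1 + ‖ξ‖ ^ 2) ^ 6)⁻¹ * (1 + ‖ξ‖)) := by ring
    _ ≤ (C + 2) * ‖v‖ * (64 * ((1 + ‖ξ‖) ^ 5)⁻¹) := by exact mul_le_mul_of_nonneg_left (resolvent_mul_le ξ) (by positivity)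
    _ = _ := by ring

theorem norm_smul_dir {ε : ℝ} (hε : 0 < ε) (l : Fin 2) : ‖ε • dir l‖ = ε := by
  rw [norm_smul, norm_dir, mul_one, Real.norm_of_nonneg hε.le]

/-- Contribution of the difference quotient of the profile. -/
theorem exists_eLpNorm_low_dq_profile_le {p : ℝ} (hp : 2 < p) (hp4 : p ≤ 9 / 4) (k l : Fin 2)
    {M₁ : ℕ} (hM₁ : 3 ≤ M₁) :
    ∃ C : ℝ, 0 < C ∧ ∀ (M₂ : ℕ) (T a X : ℝ) (Φ : Plane → ℂ), ProfileBound M₁ M₂ p T a X Φ →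
      ∀ ε : ℝ, 0 < ε → eLpNorm (𝓕⁻ fun ξ => (fun ξ => (smoothRiesz k ξ : ℂ) * (osc a ξ * dq (-ε) l Φ ξ))
        (ξ - ε • dir l)) (ENNReal.ofReal (9 / 2)) volume ≤ ENNReal.ofReal (C * (X * T ^ (4 / 9 : ℝ))) := by
  obtain ⟨C, hC, h⟩ := exists_eLpNorm_osc_le hp (by linarith) k
  have hπ := Real.pi_pos
  refine ⟨C * (2 * Real.pi), by positivity, fun M₂ T a X Φ hP ε hε => ?_⟩
  have hT := hP.one_le_T
  have hT0 : 0 < T := by linarith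
  have hX := hP.X_pos
  obtain ⟨hi, h2⟩ := hP.sob₁.integrable_memLp hX.le (by omega) hP.meas
  have hsm : StronglyMeasurable (dq (-ε) l Φ) :=
    ((hP.meas.comp_measurable (measurable_id.sub_const _)).sub hP.meas).const_mul _
  have hdi : Integrable (dq (-ε) l Φ) := ((hi.comp_sub_right _).sub hi).const_mul _
  have hd2 : MemLp (dq (-ε) l Φ) 2 := by
    have h3 : MemLp (fun ξ => Φ (ξ - (-ε) • dir l)) 2 :=
      h2.comp_measurePreserving (measurePreserving_sub_right volume _)
    exact (h3.sub h2).const_mul _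
  have hw : eLpNorm (𝓕⁻ (dq (-ε) l Φ)) (ENNReal.ofReal p) volume ≤ ENNReal.ofReal (2 * Real.pi * X) := by
    rw [fourierInv_dq hi]
    refine (eLpNorm_le_mul_eLpNorm_of_ae_le_mul (c := 2 * Real.pi)
      (g := fun x => ((1 + ‖x‖ : ℝ) : ℂ) * 𝓕⁻ Φ x) (Eventually.of_forall fun x => ?_) _).trans ?_
    · rw [norm_mul, norm_mul, Complex.norm_real, Real.norm_of_nonneg (by positivity), ← mul_assoc]
      gcongr
      refine (norm_wfac_le _ l x).trans ?_
      gcongr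
      exact (abs_coord_le l x).trans (by linarith [norm_nonneg x])
    · rw [ENNReal.ofReal_mul (p := 2 * Real.pi) (by positivity)]
      exact mul_le_mul_right hP.wt _
  have hb := h _ a T _ hsm hdi hd2 hT hP.abs_le (by positivity) hw
  -- The shift in frequency is a modulation in space, so it does not affect the norm.
  have e : eLpNorm (𝓕⁻ fun ξ => (fun ξ => (smoothRiesz k ξ : ℂ) * (osc a ξ * dq (-ε) l Φ ξ))
      (ξ - ε • dir l)) (ENNReal.ofReal (9 / 2)) volume
      = eLpNorm (𝓕⁻ fun ξ => (smoothRiesz k ξ : ℂ) * (osc a ξ * dq (-ε) l Φ ξ))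
        (ENNReal.ofReal (9 / 2)) volume := by
    refine eLpNorm_congr_norm_ae (Eventually.of_forall fun x => ?_)
    rw [fourierInv_comp_sub (fun ξ => (smoothRiesz k ξ : ℂ) * (osc a ξ * dq (-ε) l Φ ξ)), norm_mul,
      Circle.norm_coe, one_mul]
  rw [e]
  refine hb.trans (ENNReal.ofReal_le_ofReal ?_)
  -- The condition p ≤ 9/4 is exactly 4(1 - 2/p) ≤ 4/9.
  have hT4 : (T ^ 4) ^ (1 - 2 / p) ≤ T ^ (4 / 9 : ℝ) := by
    rw [← Real.rpow_natCast, ← Real.rpow_mul hT0.le]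
    refine Real.rpow_le_rpow_of_exponent_le hT ?_
    have : 8 / 9 ≤ 2 / p := by rw [le_div_iff₀ (by linarith)]; linarith
    push_cast
    linarith
  calc _ ≤ C * (T ^ (4 / 9 : ℝ) * (2 * Real.pi * X)) := by gcongr
    _ = _ := by ring

/-- Contribution of the difference quotient of the symbol `smoothRiesz k`. -/
theorem exists_eLpNorm_low_dq_symbol_le {p : ℝ} (hp : 2 < p) (hp3 : p < 3) (k l : Fin 2)
    {M₁ : ℕ} (hM₁ : 3 ≤ M₁) :
    ∃ C : ℝ, 0 < C ∧ ∀ (M₂ : ℕ) (T a X : ℝ) (Φ : Plane → ℂ), ProfileBound M₁ M₂ p T a X Φ →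
      ∀ ε : ℝ, 0 < ε → ε ≤ 1 → eLpNorm (𝓕⁻ fun ξ => ((ε⁻¹ * (smoothRiesz k (ξ - ε • dir l)
        - smoothRiesz k ξ) : ℝ) : ℂ) * (osc a (ξ - ε • dir l) * Φ ξ))
        (ENNReal.ofReal (9 / 2)) volume ≤ ENNReal.ofReal (C * X) := by
  obtain ⟨C, hC, h⟩ := exists_eLpNorm_fourierInv_le_of_profile hp hp3
  obtain ⟨D, hD, hd⟩ := exists_abs_smoothRiesz_sub_le k
  refine ⟨D * C, by positivity, fun M₂ T a X Φ hP ε hε hε1 => ?_⟩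
  have hX := hP.X_pos
  obtain ⟨hi, h2⟩ := hP.sob₁.integrable_memLp hX.le (by omega) hP.meas
  -- The difference quotient of the symbol is O(1/‖ξ‖); dividing by D normalizes it to the form ‖ξ‖
  -- ‖F‖ ≤ ‖Φ‖ handled by the estimate for singular functions.
  set F : Plane → ℂ := fun ξ => ((D⁻¹ * (ε⁻¹ * (smoothRiesz k (ξ - ε • dir l) - smoothRiesz k ξ)) : ℝ) : ℂ)
    * (osc a (ξ - ε • dir l) * Φ ξ) with hF
  have hom : StronglyMeasurable fun ξ => osc a (ξ - ε • dir l) * Φ ξ :=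
    ((continuous_osc a).comp (continuous_id.sub continuous_const)).stronglyMeasurable.mul hP.meas
  have hrm : Measurable fun ξ => D⁻¹ * (ε⁻¹ * (smoothRiesz k (ξ - ε • dir l) - smoothRiesz k ξ)) :=
    ((((measurable_smoothRiesz k).comp (measurable_id.sub_const _)).sub
      (measurable_smoothRiesz k)).const_mul _).const_mul _
  have hFm : StronglyMeasurable F := stronglyMeasurable_ofReal_mul hrm hom
  have hoi : Integrable fun ξ => osc a (ξ - ε • dir l) * Φ ξ :=
    hi.mono hom.aestronglyMeasurable (Eventually.of_forall fun ξ => by rw [norm_mul, norm_osc, one_mul])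
  have hFi : Integrable F := by
    refine Integrable.ofReal_mul (c := D⁻¹ * (ε⁻¹ * 2)) hoi hrm fun ξ => ?_
    rw [abs_mul, abs_mul, abs_of_pos (inv_pos.2 hD), abs_of_pos (inv_pos.2 hε)]
    gcongr
    refine (abs_sub _ _).trans ?_
    have h1 := abs_smoothRiesz_le k (ξ - ε • dir l)
    have h2 := abs_smoothRiesz_le k ξ
    linarith
  have e : (fun ξ => ((ε⁻¹ * (smoothRiesz k (ξ - ε • dir l) - smoothRiesz k ξ) : ℝ) : ℂ)
      * (osc a (ξ - ε • dir l) * Φ ξ)) = fun ξ => (D : ℂ) * F ξ := by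
    ext ξ
    rw [hF]
    push_cast
    have : (D : ℂ) ≠ 0 := by exact_mod_cast hD.ne'
    field_simp
  rw [e, fourierInv_const_mul, eLpNorm_const_mul', Complex.norm_real, Real.norm_of_nonneg hD.le,
    mul_assoc, ENNReal.ofReal_mul hD.le]
  gcongr
  refine h F Φ X hFm hP.meas hFi hX (hP.sob₁.nonneg_mono hM₁ le_rfl) hP.wt fun ξ => ?_
  rw [hF]
  simp only
  rw [norm_mul, norm_mul, norm_osc, one_mul, Complex.norm_real, Real.norm_eq_abs, abs_mul, abs_mul,
    abs_of_pos (inv_pos.2 hD), abs_of_pos (inv_pos.2 hε), ← mul_assoc]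
  refine mul_le_of_le_one_left (norm_nonneg _) ?_
  have := (hd ξ (ε • dir l) (by rw [norm_smul_dir hε]; exact hε1)).trans
    (mul_le_of_le_one_right (by positivity) (inv_le_one_of_one_le₀
      (one_le_pow₀ (one_le_one_add_norm ξ))))
  rw [norm_smul_dir hε] at this
  calc _ = D⁻¹ * ε⁻¹ * (|smoothRiesz k (ξ - ε • dir l) - smoothRiesz k ξ| * ‖ξ‖) := by ring
    _ ≤ D⁻¹ * ε⁻¹ * (D * ε) := by gcongr
    _ = 1 := by field_simp

theorem isSymbol_inv_jb_freq (n : ℕ) : IsSymbol n 0 (-1) (fun ξ : Plane => (jb (freq ξ))⁻¹) := by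
  have hπ := Real.pi_gt_three
  have h := IsSymbol.one_div_sqrt (E := Plane) (D := fun x => 1 + (2 * Real.pi) ^ 2 * ‖x‖ ^ 2) (n := n)
    (ρ := 0) (d := 2) (e := 1) (c := 1 / 2) le_rfl (by norm_num)
    (fun n => ((IsSymbol.const 1 le_rfl).order_mono (by norm_num)).add
      ((isSymbol_norm_sq n).const_mul _))
    (fun x => by
      norm_num
      have h1 : 1 ≤ (2 * Real.pi) ^ 2 := by nlinarith
      nlinarith [sq_nonneg (1 - ‖x‖), mul_le_mul_of_nonneg_right h1 (sq_nonneg ‖x‖)]) (by norm_num)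
  have e : (fun ξ : Plane => (jb (freq ξ))⁻¹) = fun x => 1 / √(1 + (2 * Real.pi) ^ 2 * ‖x‖ ^ 2) := by
    ext ξ
    rw [jb, freq, norm_smul, Real.norm_of_nonneg (by positivity), mul_pow, one_div]
  rw [e]
  exact h

/-- Contribution of the difference quotient of `e^{ia⟨∇⟩}`. -/
theorem exists_eventually_eLpNorm_low_dq_osc_le {p : ℝ} (hp : 2 < p) (hp3 : p < 3) (k l : Fin 2)
    {M₁ : ℕ} (hM₁ : 3 ≤ M₁) :
    ∃ C : ℝ, 0 < C ∧ ∀ (M₂ : ℕ) (T a X : ℝ) (Φ : Plane → ℂ), ProfileBound M₁ M₂ p T a X Φ →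
      ∀ᶠ ε in 𝓝[>] (0 : ℝ), eLpNorm (𝓕⁻ fun ξ => (smoothRiesz k ξ : ℂ) * (dq ε l (osc a) ξ * Φ ξ))
        (ENNReal.ofReal (9 / 2)) volume ≤ ENNReal.ofReal (C * (X * T ^ (4 / 9 : ℝ))) := by
  have hπ := Real.pi_pos
  obtain ⟨C, hC, h⟩ := exists_eLpNorm_mode_low_le hp hp3 k (B := 0) (M₁ := M₁) (by omega) hM₁
  obtain ⟨κ, A, hκ, eκ⟩ := (((isSymbol_coord 4 l).mul (isSymbol_inv_jb_freq 4)).mul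
    (isSymbol_resolvent_pow 4 6)).ofReal.exists_isKernel le_rfl le_rfl (by norm_num)
  have hA := hκ.pos
  have hk := kernelMass_pos
  -- The limit of the quotient is a smooth multiplier times a (of size at most T) applied to a
  -- function decaying like T^{-5/9}, which gives T^{4/9}. The summand 1 pays for the difference
  -- from that limit, which tends to zero and so is eventually at most X T^{4/9}; this is why the
  -- bound holds only for small ε.
  refine ⟨(2 * Real.pi) ^ 2 * (A * kernelMass * C) + 1, by positivity, fun M₂ T a X Φ hP => ?_⟩
  have hT := hP.one_le_T
  have hT0 : 0 < T := by linarith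
  have hX := hP.X_pos
  obtain ⟨hi, h2⟩ := hP.sob₁.integrable_memLp hX.le (by omega) hP.meas
  have hmm := stronglyMeasurable_mode (a := a) hP.meas 0 k
  have hmi : Integrable (mode a Φ 0 k) := hi.mono hmm.aestronglyMeasurable
    (Eventually.of_forall fun ξ => (norm_mode_le a Φ 0 k ξ).trans (by simp))
  -- the limit
  set L : Plane → ℂ := fun ξ => (-(Complex.I * (a * (2 * Real.pi) ^ 2 : ℝ)))
    * (((ξ l * (jb (freq ξ))⁻¹ * ((1 + ‖ξ‖ ^ 2) ^ 6)⁻¹ : ℝ) : ℂ) * mode a Φ 0 k ξ) with hL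
  have hj : ∀ ξ : Plane, |ξ l| * (jb (freq ξ))⁻¹ ≤ 1 := fun ξ => by
    have h1 : ‖ξ‖ ≤ jb (freq ξ) := by
      refine Real.le_sqrt_of_sq_le ?_
      rw [freq, norm_smul, Real.norm_of_nonneg Real.two_pi_pos.le, mul_pow]
      have := Real.pi_gt_three
      nlinarith [sq_nonneg ‖ξ‖, mul_le_mul_of_nonneg_right (by nlinarith : 1 ≤ (2 * Real.pi) ^ 2) (sq_nonneg ‖ξ‖)]
    have h2 : 0 < jb (freq ξ) := Real.sqrt_pos.2 (by positivity)
    rw [← div_eq_mul_inv]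
    exact div_le_one_of_le₀ ((abs_coord_le l ξ).trans h1) h2.le
  have hjb : Measurable fun ξ : Plane => (jb (freq ξ))⁻¹ :=
    (continuous_jb.comp continuous_freq).measurable.inv
  have hsm : Measurable fun ξ : Plane => ξ l * (jb (freq ξ))⁻¹ * ((1 + ‖ξ‖ ^ 2) ^ 6)⁻¹ :=
    ((by fun_prop : Measurable fun ξ : Plane => ξ l).mul hjb).mul (measurable_resolvent_pow 6)
  have hLm : StronglyMeasurable L := (stronglyMeasurable_ofReal_mul hsm hmm).const_mul _
  have hj0 : ∀ ξ : Plane, 0 ≤ (jb (freq ξ))⁻¹ := fun ξ => inv_nonneg.2 (Real.sqrt_nonneg _)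
  have hsb : ∀ ξ : Plane, |ξ l * (jb (freq ξ))⁻¹ * ((1 + ‖ξ‖ ^ 2) ^ 6)⁻¹| ≤ 1 := fun ξ => by
    rw [abs_mul, abs_mul, abs_of_nonneg (hj0 ξ)]
    exact mul_le_one₀ (hj ξ) (abs_nonneg _) (abs_resolvent_pow_le 6 ξ)
  have hLi : Integrable L := (Integrable.ofReal_mul hmi hsm hsb).const_mul _
  have hLn : ∀ ξ, ‖L ξ‖ ≤ |a| * (2 * Real.pi) ^ 2 * ‖Φ ξ‖ := fun ξ => by
    rw [hL]
    simp only
    rw [norm_mul, norm_neg, norm_mul, Complex.norm_I, one_mul, Complex.norm_real,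
      norm_mul _ (mode a Φ 0 k ξ), Complex.norm_real, Real.norm_eq_abs, Real.norm_eq_abs, abs_mul, abs_of_nonneg (by positivity : (0 : ℝ) ≤ (2 * Real.pi) ^ 2)]
    gcongr
    calc _ ≤ 1 * ‖Φ ξ‖ := mul_le_mul (hsb ξ) ((norm_mode_le a Φ 0 k ξ).trans (by simp)) (norm_nonneg _) zero_le_one
      _ = _ := one_mul _
  have hLq : eLpNorm (𝓕⁻ L) (ENNReal.ofReal (9 / 2)) volume
      ≤ ENNReal.ofReal ((2 * Real.pi) ^ 2 * (A * kernelMass * C) * (X * T ^ (4 / 9 : ℝ))) := by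
    rw [hL, fourierInv_const_mul, eLpNorm_const_mul']
    have e1 := fourierInv_mul_eq_avg (c := 1) hκ hmi eκ
    simp only [one_smul] at e1
    rw [e1]
    refine (mul_le_mul_right (eLpNorm_avg_le 1 hκ (by norm_num) (continuous_fourierInv hmi).stronglyMeasurable
      (by positivity) (h M₂ T a X Φ hP)) _).trans ?_
    rw [← ENNReal.ofReal_mul (norm_nonneg _)]
    refine ENNReal.ofReal_le_ofReal ?_
    rw [norm_neg, norm_mul, Complex.norm_I, one_mul, Complex.norm_real, Real.norm_eq_abs, abs_mul,
      abs_of_nonneg (by positivity : (0 : ℝ) ≤ (2 * Real.pi) ^ 2)]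
    calc |a| * (2 * Real.pi) ^ 2 * (A * kernelMass * (C * (X * T ^ (-(5 / 9) : ℝ))))
        ≤ T * (2 * Real.pi) ^ 2 * (A * kernelMass * (C * (X * T ^ (-(5 / 9) : ℝ)))) := by
          gcongr; exact hP.abs_le
      _ = (2 * Real.pi) ^ 2 * (A * kernelMass * C) * (X * (T ^ (1 : ℝ) * T ^ (-(5 / 9) : ℝ))) := by
          rw [Real.rpow_one]; ring
      _ = _ := by rw [← Real.rpow_add hT0]; norm_num
  -- the convergence
  have hdm : ∀ ε, StronglyMeasurable fun ξ => (smoothRiesz k ξ : ℂ) * (dq ε l (osc a) ξ * Φ ξ) := fun ε => by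
    refine stronglyMeasurable_ofReal_mul (measurable_smoothRiesz k) (StronglyMeasurable.mul ?_ hP.meas)
    exact ((((continuous_osc a).comp (continuous_id.sub continuous_const)).sub
      (continuous_osc a)).const_mul _).stronglyMeasurable
  have hdn : ∀ ε ξ, 0 < ε → ‖(smoothRiesz k ξ : ℂ) * (dq ε l (osc a) ξ * Φ ξ)‖
      ≤ |a| * (2 * Real.pi) * ‖Φ ξ‖ := fun ε ξ hε => by
    have h1 := norm_osc_sub_le a ξ (ε • dir l)
    rw [norm_smul_dir hε] at h1
    rw [norm_mul, norm_mul, Complex.norm_real, dq, norm_mul, Complex.norm_real,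
      Real.norm_of_nonneg (inv_pos.2 hε).le]
    calc _ ≤ 1 * (ε⁻¹ * (|a| * (2 * Real.pi * ε)) * ‖Φ ξ‖) := by
          gcongr
          exact abs_smoothRiesz_le k ξ
      _ = _ := by field_simp
  have hdi : ∀ ε, 0 < ε → Integrable fun ξ => (smoothRiesz k ξ : ℂ) * (dq ε l (osc a) ξ * Φ ξ) := fun ε hε =>
    (hi.const_mul ((|a| * (2 * Real.pi) : ℝ) : ℂ)).mono (hdm ε).aestronglyMeasurable
      (Eventually.of_forall fun ξ => by
        rw [norm_mul ((|a| * (2 * Real.pi) : ℝ) : ℂ), Complex.norm_real,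
          Real.norm_of_nonneg (by positivity : 0 ≤ |a| * (2 * Real.pi))]
        exact hdn ε ξ hε)
  have hconv := eventually_eLpNorm_fourierInv_le (q := 9 / 2) (c := |a| * (2 * Real.pi) + |a| * (2 * Real.pi) ^ 2)
    (δ := X * T ^ (4 / 9 : ℝ)) (by norm_num) (by positivity)
    (G := fun ε ξ => (smoothRiesz k ξ : ℂ) * (dq ε l (osc a) ξ * Φ ξ) - L ξ) hi h2
    (fun ε => (hdm ε).sub hLm)
    (fun ε ξ hε => by
      refine (norm_sub_le _ _).trans ?_
      have h1 := hdn ε ξ hε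
      have h2 := hLn ξ
      linarith)
    (fun ξ => by
      have h1 := ((tendsto_dq_osc a l ξ).mul_const (Φ ξ)).const_mul (smoothRiesz k ξ : ℂ)
      have h2 := h1.sub_const (L ξ)
      convert h2 using 2
      rw [hL]
      simp only [mode, smoothRiesz, mul_zero, pow_zero, mul_one, div_eq_mul_inv]
      push_cast
      ring)
  filter_upwards [hconv, eventually_mem_nhdsWithin] with ε h1 hε
  have hε0 : 0 < ε := hε
  have e2 : (𝓕⁻ fun ξ => (smoothRiesz k ξ : ℂ) * (dq ε l (osc a) ξ * Φ ξ))
      = 𝓕⁻ (fun ξ => (smoothRiesz k ξ : ℂ) * (dq ε l (osc a) ξ * Φ ξ) - L ξ) + 𝓕⁻ L := by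
    ext x
    rw [Pi.add_apply, fourierInv_sub' (hdi ε hε0) hLi, sub_add_cancel]
  rw [e2]
  refine (eLpNorm_add_le (continuous_fourierInv ((hdi ε hε0).sub hLi)).aestronglyMeasurable
    (continuous_fourierInv hLi).aestronglyMeasurable (by norm_num)).trans ?_
  refine (add_le_add h1 hLq).trans (le_of_eq ?_)
  rw [← ENNReal.ofReal_add (by positivity) (by positivity)]
  congr 1; ring

/-- The weighted `L^{9/2}` norm of the low frequency factor grows slowly. -/
theorem exists_eventually_eLpNorm_wfac_low_le {p : ℝ} (hp : 2 < p) (hp4 : p ≤ 9 / 4) (k l : Fin 2)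
    {M₁ : ℕ} (hM₁ : 3 ≤ M₁) :
    ∃ C : ℝ, 0 < C ∧ ∀ (M₂ : ℕ) (T a X : ℝ) (Φ : Plane → ℂ), ProfileBound M₁ M₂ p T a X Φ →
      ∀ᶠ ε in 𝓝[>] (0 : ℝ), eLpNorm (fun x => wfac ε l x * 𝓕⁻ (low a Φ k) x)
        (ENNReal.ofReal (9 / 2)) volume ≤ ENNReal.ofReal (C * (X * T ^ (4 / 9 : ℝ))) := by
  obtain ⟨C₁, hC₁, h1⟩ := exists_eLpNorm_low_dq_profile_le hp hp4 k l hM₁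
  obtain ⟨C₂, hC₂, h2⟩ := exists_eLpNorm_low_dq_symbol_le hp (by linarith) k l hM₁
  obtain ⟨C₃, hC₃, h3⟩ := exists_eventually_eLpNorm_low_dq_osc_le hp (by linarith) k l hM₁
  refine ⟨C₁ + C₂ + C₃, by positivity, fun M₂ T a X Φ hP => ?_⟩
  have hT := hP.one_le_T
  have hX := hP.X_pos
  have hT4 : 1 ≤ T ^ (4 / 9 : ℝ) := Real.one_le_rpow hT (by norm_num)
  obtain ⟨hi, -⟩ := hP.sob₁.integrable_memLp hX.le (by omega) hP.meas
  have hlow : Integrable (low a Φ k) := hi.mono (stronglyMeasurable_low a hP.meas k).aestronglyMeasurable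
    (Eventually.of_forall (norm_low_le a Φ k))
  filter_upwards [h3 M₂ T a X Φ hP, Ioc_mem_nhdsGT (zero_lt_one' ℝ)] with ε h3' hε
  have h1' := h1 M₂ T a X Φ hP ε hε.1
  have h2' := h2 M₂ T a X Φ hP ε hε.1 hε.2
  rw [← fourierInv_dq hlow]
  set v := ε • dir l with hv
  set F₁ : Plane → ℂ := fun ξ => (fun ξ => (smoothRiesz k ξ : ℂ) * (osc a ξ * dq (-ε) l Φ ξ)) (ξ - v) with hF₁
  set F₂ : Plane → ℂ := fun ξ => ((ε⁻¹ * (smoothRiesz k (ξ - v) - smoothRiesz k ξ) : ℝ) : ℂ)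
    * (osc a (ξ - v) * Φ ξ) with hF₂
  set F₃ : Plane → ℂ := fun ξ => (smoothRiesz k ξ : ℂ) * (dq ε l (osc a) ξ * Φ ξ) with hF₃
  -- Discrete Leibniz rule. In the first term the whole product is shifted, so that before the shift
  -- it is still the original multiplier applied to a difference quotient of Φ, taken in the
  -- opposite direction.
  have e : dq ε l (low a Φ k) = fun ξ => (F₁ ξ + F₂ ξ) + F₃ ξ := by
    ext ξ
    have e0 : ξ - v - -ε • dir l = ξ := by rw [hv]; simp
    simp only [hF₁, hF₂, hF₃, dq, low, e0, ← hv]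
    push_cast
    rw [inv_neg]
    ring
  have hdqi : Integrable (dq (-ε) l Φ) := ((hi.comp_sub_right _).sub hi).const_mul _
  have hdqm : StronglyMeasurable (dq (-ε) l Φ) :=
    ((hP.meas.comp_measurable (measurable_id.sub_const _)).sub hP.meas).const_mul _
  have i1 : Integrable F₁ := by
    have hh : Integrable fun ξ => (smoothRiesz k ξ : ℂ) * (osc a ξ * dq (-ε) l Φ ξ) :=
      hdqi.mono (stronglyMeasurable_low a hdqm k).aestronglyMeasurable
        (Eventually.of_forall (norm_low_le a (dq (-ε) l Φ) k))
    exact hh.comp_sub_right v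
  have i3 : Integrable F₃ := by
    have hdm : StronglyMeasurable F₃ := by
      refine stronglyMeasurable_ofReal_mul (measurable_smoothRiesz k) (StronglyMeasurable.mul ?_ hP.meas)
      exact ((((continuous_osc a).comp (continuous_id.sub continuous_const)).sub
        (continuous_osc a)).const_mul _).stronglyMeasurable
    refine (hi.const_mul ((ε⁻¹ * 2 : ℝ) : ℂ)).mono hdm.aestronglyMeasurable (Eventually.of_forall fun ξ => ?_)
    rw [norm_mul, norm_mul, norm_mul, Complex.norm_real, Complex.norm_real, dq, norm_mul, Complex.norm_real,
      Real.norm_of_nonneg (by have := hε.1; positivity : 0 ≤ ε⁻¹ * 2),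
      Real.norm_of_nonneg (by have := hε.1; positivity : 0 ≤ ε⁻¹)]
    have hε0 := hε.1
    calc _ ≤ 1 * (ε⁻¹ * 2 * ‖Φ ξ‖) := by
          gcongr
          · exact abs_smoothRiesz_le k ξ
          · refine (norm_sub_le _ _).trans ?_
            rw [norm_osc, norm_osc]; norm_num
      _ = _ := one_mul _
  have i2 : Integrable F₂ := by
    have hdl : Integrable (dq ε l (low a Φ k)) := ((hlow.comp_sub_right _).sub hlow).const_mul _
    rw [e] at hdl
    have := (hdl.sub i3).sub i1
    refine this.congr (Eventually.of_forall fun ξ => ?_)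
    simp only [Pi.sub_apply]
    ring
  have e2 : 𝓕⁻ (dq ε l (low a Φ k)) = (𝓕⁻ F₁ + 𝓕⁻ F₂) + 𝓕⁻ F₃ := by
    ext x
    have i12 : Integrable fun ξ => F₁ ξ + F₂ ξ := i1.add i2
    rw [e, fourierInv_add' i12 i3, fourierInv_add' i1 i2]
    rfl
  have c1 := (continuous_fourierInv i1).aestronglyMeasurable (μ := (volume : Measure Plane))
  have c2 := (continuous_fourierInv i2).aestronglyMeasurable (μ := (volume : Measure Plane))
  have c3 := (continuous_fourierInv i3).aestronglyMeasurable (μ := (volume : Measure Plane))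
  rw [e2]
  refine (eLpNorm_add_le (c1.add c2) c3 (by norm_num)).trans ?_
  refine (add_le_add ((eLpNorm_add_le c1 c2 (by norm_num)).trans (add_le_add h1' h2')) h3').trans ?_
  have hXT : 0 ≤ X * T ^ (4 / 9 : ℝ) := by positivity
  rw [← ENNReal.ofReal_add (by positivity) (by positivity), ← ENNReal.ofReal_add (by positivity) (by positivity)]
  refine ENNReal.ofReal_le_ofReal ?_
  have : C₂ * X ≤ C₂ * (X * T ^ (4 / 9 : ℝ)) := by
    gcongr
    exact le_mul_of_one_le_right hX.le hT4
  linarith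

end WeightedLow

/-! ### Bilinear operators with integrable kernels on pairs of points. -/

section Pairs

/-- Pairs of points of the plane, with the Euclidean norm. -/
abbrev PlanePair : Type := WithLp 2 (Plane × Plane)

/-- The pair `(ζ, η)`. -/
noncomputable def pr (ζ η : Plane) : PlanePair := WithLp.toLp 2 (ζ, η)

@[simp] theorem pr_fst (ζ η : Plane) : (pr ζ η).fst = ζ := rfl

@[simp] theorem pr_snd (ζ η : Plane) : (pr ζ η).snd = η := rfl

theorem measurable_pr {α : Type*} [MeasurableSpace α] {f g : α → Plane} (hf : Measurable f)
    (hg : Measurable g) : Measurable fun x => pr (f x) (g x) :=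
  (WithLp.measurable_toLp 2 _).comp (hf.prodMk hg)

theorem finrank_planePair : Module.finrank ℝ PlanePair = 4 := by
  rw [LinearEquiv.finrank_eq (WithLp.linearEquiv 2 ℝ (Plane × Plane))]; simp

theorem norm_snd_le_pair (Y : PlanePair) : ‖Y.snd‖ ≤ ‖Y‖ := WithLp.norm_snd_le Plane Y

/-- Measurable functions in `L¹ ∩ L²`. -/
structure Tame (A : Plane → ℂ) : Prop where
  meas : StronglyMeasurable A
  int : Integrable A
  mem : MemLp A 2

/-- The bilinear operator, on the Fourier side, with symbol `S`. -/
noncomputable def bil (S : PlanePair → ℂ) (A B : Plane → ℂ) (ξ : Plane) : ℂ :=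
  ∫ η, S (pr (ξ - η) η) * (A (ξ - η) * B η)

theorem measurePreserving_sub_left' (ξ : Plane) :
    MeasurePreserving (fun η : Plane => ξ - η) volume volume :=
  Measure.measurePreserving_sub_left volume ξ

theorem Tame.integrable_mul_comp {A B : Plane → ℂ} (hA : Tame A) (hB : Tame B) (ξ : Plane) :
    Integrable fun η => A (ξ - η) * B η :=
  MemLp.integrable_mul (p := 2) (q := 2) (hA.mem.comp_measurePreserving (measurePreserving_sub_left' ξ)) hB.mem

theorem Tame.integrable_bil {S : PlanePair → ℂ} {A B : Plane → ℂ} {c : ℝ} (hA : Tame A)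
    (hB : Tame B) (hS : Continuous S) (hc : ∀ Y, ‖S Y‖ ≤ c) (ξ : Plane) :
    Integrable fun η => S (pr (ξ - η) η) * (A (ξ - η) * B η) := by
  refine (hA.integrable_mul_comp hB ξ).bdd_mul (c := c) ?_ (Filter.Eventually.of_forall fun η => hc _)
  exact (hS.measurable.comp (measurable_pr (by fun_prop) (by fun_prop))).aestronglyMeasurable

theorem Tame.norm_bil_le {S : PlanePair → ℂ} {A B : Plane → ℂ} {c u v : ℝ} (hA : Tame A)
    (hB : Tame B) (hu : 0 ≤ u) (hv : 0 ≤ v) (hc : ∀ Y, ‖S Y‖ ≤ c)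
    (hAu : eLpNorm A 2 volume ≤ ENNReal.ofReal u) (hBv : eLpNorm B 2 volume ≤ ENNReal.ofReal v)
    (ξ : Plane) : ‖bil S A B ξ‖ ≤ c * (u * v) := by
  have hc0 : 0 ≤ c := (norm_nonneg _).trans (hc 0)
  have hAm := hA.mem.comp_measurePreserving (measurePreserving_sub_left' ξ)
  have h1 : ∫ η, ‖A (ξ - η) * B η‖ ≤ u * v := by
    refine (integrable_of_lintegral_le (hA.integrable_mul_comp hB ξ).1 (by positivity) ?_).2
    simp only [enorm_mul]
    refine (lintegral_mul_le_eLpNorm_two hAm.1 hB.mem.1).trans ?_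
    rw [ENNReal.ofReal_mul hu]
    refine mul_le_mul' (le_trans (le_of_eq ?_) hAu) hBv
    exact eLpNorm_comp_measurePreserving hA.mem.1 (measurePreserving_sub_left' ξ)
  calc ‖bil S A B ξ‖ ≤ ∫ η, c * ‖A (ξ - η) * B η‖ := by
        refine norm_integral_le_of_norm_le ((hA.integrable_mul_comp hB ξ).norm.const_mul c)
          (Filter.Eventually.of_forall fun η => ?_)
        rw [norm_mul]
        exact mul_le_mul_of_nonneg_right (hc _) (norm_nonneg _)
    _ ≤ _ := by rw [integral_const_mul]; gcongr

theorem Tame.integrable_pair {S : PlanePair → ℂ} {A B : Plane → ℂ} {c : ℝ} (hA : Tame A)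
    (hB : Tame B) (hS : Continuous S) (hc : ∀ Y, ‖S Y‖ ≤ c) :
    Integrable (fun z : Plane × Plane => S (pr z.1 z.2) * (A z.1 * B z.2)) := by
  refine (hA.int.mul_prod hB.int).bdd_mul (c := c) ?_ (Filter.Eventually.of_forall fun η => hc _)
  exact (hS.measurable.comp (measurable_pr measurable_fst measurable_snd)).aestronglyMeasurable

theorem Tame.integrable_pair_sub {S : PlanePair → ℂ} {A B : Plane → ℂ} {c : ℝ} (hA : Tame A)
    (hB : Tame B) (hS : Continuous S) (hc : ∀ Y, ‖S Y‖ ≤ c) :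
    Integrable (fun z : Plane × Plane => S (pr (z.1 - z.2) z.2) * (A (z.1 - z.2) * B z.2)) :=
  (measurePreserving_sub_prod (volume : Measure Plane) volume).integrable_comp_of_integrable
    (hA.integrable_pair hB hS hc)

theorem stronglyMeasurable_bil {S : PlanePair → ℂ} {A B : Plane → ℂ} (hS : Continuous S)
    (hA : StronglyMeasurable A) (hB : StronglyMeasurable B) : StronglyMeasurable (bil S A B) := by
  refine StronglyMeasurable.integral_prod_right'
    (f := fun z : Plane × Plane => S (pr (z.1 - z.2) z.2) * (A (z.1 - z.2) * B z.2)) ?_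
  refine StronglyMeasurable.mul ?_ (StronglyMeasurable.mul ?_ ?_)
  · exact (hS.measurable.comp (measurable_pr (by fun_prop) (by fun_prop))).stronglyMeasurable
  · exact hA.comp_measurable (by fun_prop)
  · exact hB.comp_measurable measurable_snd

theorem memLp_two_of_bounded {F : Plane → ℂ} {c : ℝ} (hF : Integrable F) (hc : ∀ ξ, ‖F ξ‖ ≤ c) :
    MemLp F 2 := by
  have h1 : MemLp F 1 := memLp_one_iff_integrable.2 hF
  refine ⟨hF.1, ?_⟩
  have hc0 : 0 ≤ c := (norm_nonneg _).trans (hc 0)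
  have h := eLpNorm_le_of_bounded (p := 2) (r := 1) (M := c) (by norm_num) (by norm_num) hc0
    (f := F) (ν := volume) (Filter.Eventually.of_forall hc)
  simp only [ENNReal.ofReal_ofNat, ENNReal.ofReal_one] at h
  refine h.trans_lt (ENNReal.mul_lt_top (ENNReal.rpow_lt_top_of_nonneg (by norm_num) h1.2.ne)
    ENNReal.ofReal_lt_top)

/-- Integrability is Fubini with two integrable factors, boundedness is Cauchy–Schwarz, and together
they give L². Functions of this class can thus be transformed both by the integral and in L². -/
theorem Tame.bil {S : PlanePair → ℂ} {A B : Plane → ℂ} {c : ℝ} (hA : Tame A)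
    (hB : Tame B) (hS : Continuous S) (hc : ∀ Y, ‖S Y‖ ≤ c) : Tame (bil S A B) := by
  have hi : Integrable (EulerPoisson.bil S A B) := (hA.integrable_pair_sub hB hS hc).integral_prod_left
  refine ⟨stronglyMeasurable_bil hS hA.meas hB.meas, hi,
    memLp_two_of_bounded (c := c * ((eLpNorm A 2 volume).toReal * (eLpNorm B 2 volume).toReal)) hi
      fun ξ => ?_⟩
  refine hA.norm_bil_le hB ENNReal.toReal_nonneg ENNReal.toReal_nonneg hc ?_ ?_ ξ
  · rw [ENNReal.ofReal_toReal hA.mem.2.ne]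
  · rw [ENNReal.ofReal_toReal hB.mem.2.ne]

/-- The bilinear operator with kernel `K`. -/
noncomputable def conv (K : PlanePair → ℂ) (U V : Plane → ℂ) (x : Plane) : ℂ :=
  ∫ Y, K Y * (U (x - Y.fst) * V (x - Y.snd))

theorem integral_planePair {F : PlanePair → ℂ} (hF : Measurable F) :
    ∫ Y, F Y = ∫ z : Plane × Plane, F (pr z.1 z.2) := by
  have h := (WithLp.volume_preserving_toLp Plane Plane)
  rw [← h.map_eq, integral_map h.measurable.aemeasurable hF.aestronglyMeasurable]
  rfl

theorem integrable_planePair {F : PlanePair → ℂ} (hF : Measurable F)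
    (hi : Integrable fun z : Plane × Plane => F (pr z.1 z.2)) : Integrable F :=
  ((WithLp.volume_preserving_toLp Plane Plane).integrable_comp hF.aestronglyMeasurable).1 hi

theorem inner_planePair (Y Z : PlanePair) :
    inner ℝ Y Z = inner ℝ Y.fst Z.fst + inner ℝ Y.snd Z.snd :=
  WithLp.prod_inner_apply Y Z

theorem measurable_tensor {A B : Plane → ℂ} (hA : Measurable A) (hB : Measurable B) :
    Measurable fun Y : PlanePair => A Y.fst * B Y.snd :=
  (hA.comp (by fun_prop)).mul (hB.comp (by fun_prop))

theorem fourierInv_tensor {A B : Plane → ℂ} (hA : Tame A) (hB : Tame B) (Z : PlanePair) :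
    𝓕⁻ (fun Y : PlanePair => A Y.fst * B Y.snd) Z = 𝓕⁻ A Z.fst * 𝓕⁻ B Z.snd := by
  simp only [Real.fourierInv_eq, Circle.smul_def, smul_eq_mul]
  rw [integral_planePair]
  · rw [← integral_prod_mul]
    congr 1; ext z
    rw [inner_planePair, AddChar.map_add_eq_mul, Circle.coe_mul, pr_fst, pr_snd]
    ring
  · refine Measurable.mul ?_ (measurable_tensor hA.meas.measurable hB.meas.measurable)
    exact (continuous_subtype_val.comp (Real.continuous_fourierChar.comp (by fun_prop))).measurable

theorem integral_pair_eq {G : Plane × Plane → ℂ} (hG : Integrable G) :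
    ∫ z, G z = ∫ ξ, ∫ η, G (ξ - η, η) := by
  have hmp := measurePreserving_sub_prod (volume : Measure Plane) volume
  have hi := hmp.integrable_comp_of_integrable hG
  have h := integral_map hmp.measurable.aemeasurable (f := G) (by rw [hmp.map_eq]; exact hG.1)
  rw [hmp.map_eq] at h
  exact h.trans (integral_prod _ hi)

/-- The shear (ξ, η) ↦ (ξ - η, η) identifies the left side with the inverse transform of 𝓕 K · (A ⊗
B) on pairs, evaluated at the diagonal point (x, x); there a multiplier is an average of translates
of 𝓕⁻ A ⊗ 𝓕⁻ B. -/
theorem fourierInv_bil {K : PlanePair → ℂ} {A B : Plane → ℂ} (hA : Tame A) (hB : Tame B)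
    (hK : Integrable K) (x : Plane) :
    𝓕⁻ (bil (𝓕 K) A B) x = conv K (𝓕⁻ A) (𝓕⁻ B) x := by
  have hS : Continuous (𝓕 K) := VectorFourier.fourierIntegral_continuous Real.continuous_fourierChar
    (by simp only [innerₗ_apply_apply]; exact continuous_inner) hK
  have hc : ∀ Y, ‖𝓕 K Y‖ ≤ ∫ Y, ‖K Y‖ := fun Y =>
    VectorFourier.norm_fourierIntegral_le_integral_norm _ _ _ _ _
  have hm := measurable_tensor hA.meas.measurable hB.meas.measurable
  have hΨ : Integrable fun Y : PlanePair => A Y.fst * B Y.snd :=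
    integrable_planePair hm (hA.int.mul_prod hB.int)
  have h := fourierInv_fourier_mul hK hΨ 1 (pr x x)
  simp only [one_smul, fourierInv_tensor hA hB] at h
  refine Eq.trans ?_ h
  simp only [Real.fourierInv_eq, Circle.smul_def, smul_eq_mul]
  have hmeas : Measurable fun Y : PlanePair => (Real.fourierChar (inner ℝ Y (pr x x)) : ℂ)
      * (𝓕 K Y * (A Y.fst * B Y.snd)) := by
    refine Measurable.mul ?_ (hS.measurable.mul hm)
    exact (continuous_subtype_val.comp (Real.continuous_fourierChar.comp (by fun_prop))).measurable
  rw [integral_planePair hmeas]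
  have hi : Integrable (fun z : Plane × Plane => (Real.fourierChar (inner ℝ (pr z.1 z.2) (pr x x)) : ℂ)
      * (𝓕 K (pr z.1 z.2) * (A z.1 * B z.2))) := by
    refine (hA.integrable_pair hB hS hc).bdd_mul (c := 1) ?_
      (Filter.Eventually.of_forall fun z => (Circle.norm_coe _).le)
    exact ((continuous_subtype_val.comp (Real.continuous_fourierChar.comp
      (by fun_prop : Continuous fun Y : PlanePair => inner ℝ Y (pr x x)))).measurable.comp
      (measurable_pr measurable_fst measurable_snd)).aestronglyMeasurable
  refine Eq.trans ?_ (integral_pair_eq hi).symm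
  congr 1; ext ξ
  rw [bil, ← integral_const_mul]
  congr 1; ext η
  rw [inner_planePair, pr_fst, pr_snd, pr_fst, pr_snd, ← inner_add_left, sub_add_cancel]

/-- Continuous kernels with `K Y = O((1 + ‖Y‖) ^ (-5))`. -/
structure IsPairKernel (K : PlanePair → ℂ) (A : ℝ) : Prop where
  pos : 0 < A
  cont : Continuous K
  bound : ∀ Y, ‖K Y‖ ≤ A * (1 + ‖Y‖) ^ (-5 : ℝ)

/-- The integral of `(1 + ‖Y‖) ^ (-5)` over pairs. -/
noncomputable def pairMass : ℝ := ∫ Y : PlanePair, (1 + ‖Y‖) ^ (-5 : ℝ)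

theorem integrable_one_add_norm_pair :
    Integrable (fun Y : PlanePair => (1 + ‖Y‖) ^ (-5 : ℝ)) :=
  integrable_one_add_norm (by rw [finrank_planePair]; norm_num)

theorem pairMass_pos : 0 < pairMass := by
  refine (integral_pos_iff_support_of_nonneg (fun y => by positivity)
    integrable_one_add_norm_pair).2 ?_
  have : Function.support (fun y : PlanePair => (1 + ‖y‖) ^ (-5 : ℝ)) = Set.univ := by
    ext y
    simp only [Function.mem_support, Set.mem_univ, iff_true]
    have := one_add_norm_pos y
    positivity
  rw [this]; simp

theorem IsPairKernel.integrable {K : PlanePair → ℂ} {A : ℝ} (h : IsPairKernel K A) : Integrable K :=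
  (integrable_one_add_norm_pair.const_mul A).mono' h.cont.aestronglyMeasurable
    (Filter.Eventually.of_forall h.bound)

theorem IsPairKernel.integrable_conv {K : PlanePair → ℂ} {A u v : ℝ} {U V : Plane → ℂ}
    (h : IsPairKernel K A) (hU : Continuous U) (hV : Continuous V) (hu : ∀ x, ‖U x‖ ≤ u)
    (hv : ∀ x, ‖V x‖ ≤ v) (x : Plane) :
    Integrable fun Y : PlanePair => K Y * (U (x - Y.fst) * V (x - Y.snd)) := by
  refine h.integrable.mul_bdd (c := u * v) ?_ (Filter.Eventually.of_forall fun Y => ?_)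
  · exact ((hU.comp (by fun_prop)).mul (hV.comp (by fun_prop))).aestronglyMeasurable
  · rw [norm_mul]
    exact mul_le_mul (hu _) (hv _) (norm_nonneg _) ((norm_nonneg _).trans (hu 0))

/-- Minkowski in the kernel variable, then Hölder for each pair of translates. -/
theorem eLpNorm_conv_le {K : PlanePair → ℂ} {A p q u v : ℝ} {U V : Plane → ℂ}
    (hK : IsPairKernel K A) (hp : 0 < p) (hq : 0 < q) (hpq : 1 / p + 1 / q = 1 / 2)
    (hU : StronglyMeasurable U) (hV : StronglyMeasurable V) (hu : 0 < u) (hv : 0 < v)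
    (hUu : eLpNorm U (ENNReal.ofReal p) volume ≤ ENNReal.ofReal u)
    (hVv : eLpNorm V (ENNReal.ofReal q) volume ≤ ENNReal.ofReal v) :
    eLpNorm (conv K U V) 2 volume ≤ ENNReal.ofReal (A * pairMass * (u * v)) := by
  have hA := hK.pos
  have : ENNReal.HolderTriple (ENNReal.ofReal p) (ENNReal.ofReal q) 2 := ⟨by
    rw [← ENNReal.ofReal_inv_of_pos hp, ← ENNReal.ofReal_inv_of_pos hq,
      ← ENNReal.ofReal_add (by positivity) (by positivity), ← one_div, ← one_div, hpq,
      one_div, ENNReal.ofReal_inv_of_pos two_pos, ENNReal.ofReal_ofNat]⟩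
  have h := eLpNorm_le_lintegral_of_le (p := 2) (by norm_num) (μ := (volume : Measure PlanePair))
    (ν := (volume : Measure Plane)) (g := conv K U V)
    (F := fun Y x => K Y * (U (x - Y.fst) * V (x - Y.snd)))
    (w := fun Y => A * (1 + ‖Y‖) ^ (-5 : ℝ) * (u * v)) ?_ (by fun_prop) ?_ ?_ ?_
  · rw [ENNReal.ofReal_ofNat] at h
    refine h.trans (le_of_eq ?_)
    rw [← ofReal_integral_eq_lintegral_ofReal
      ((integrable_one_add_norm_pair.const_mul A).mul_const _)
      (Filter.Eventually.of_forall fun Y => by have := one_add_norm_pos Y; positivity),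
      integral_mul_const, integral_const_mul, pairMass]
  · refine Measurable.aemeasurable (Measurable.enorm ?_)
    refine (hK.cont.measurable.comp measurable_fst).mul
      ((hU.measurable.comp ?_).mul (hV.measurable.comp ?_)) <;> fun_prop
  · exact Filter.Eventually.of_forall fun Y => by have := one_add_norm_pos Y; positivity
  · refine Filter.Eventually.of_forall fun Y => ?_
    have hB := one_add_norm_pos Y
    rw [ENNReal.ofReal_mul (by positivity), ENNReal.ofReal_mul hu.le, ENNReal.ofReal_ofNat]
    have e : (fun x => K Y * (U (x - Y.fst) * V (x - Y.snd)))
        = K Y • fun x => U (x - Y.fst) * V (x - Y.snd) := by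
      ext x; simp [smul_eq_mul]
    rw [e, eLpNorm_const_smul]
    refine mul_le_mul' ?_ ?_
    · rw [← ofReal_norm]
      exact ENNReal.ofReal_le_ofReal (hK.bound Y)
    · have hm : Measurable fun x : Plane => x - Y.fst := by fun_prop
      have hm' : Measurable fun x : Plane => x - Y.snd := by fun_prop
      have := eLpNorm_smul_le_mul_eLpNorm (p := ENNReal.ofReal p) (q := ENNReal.ofReal q) (r := 2)
        (μ := (volume : Measure Plane)) (hV.comp_measurable hm').aestronglyMeasurable
        (hU.comp_measurable hm).aestronglyMeasurable
      refine this.trans (mul_le_mul' ?_ ?_)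
      · exact (eLpNorm_comp_sub hU Y.fst).trans_le hUu
      · exact (eLpNorm_comp_sub hV Y.snd).trans_le hVv
  · exact Filter.Eventually.of_forall fun x => enorm_integral_le_lintegral_enorm _

theorem wfac_add (ε : ℝ) (l : Fin 2) (x y : Plane) :
    wfac ε l (x + y) = wfac ε l y + (Real.fourierChar (ε * y l) : ℂ) * wfac ε l x := by
  simp only [wfac, PiLp.add_apply, mul_add, AddChar.map_add_eq_mul, Circle.coe_mul]
  ring

theorem continuous_wfac (ε : ℝ) (l : Fin 2) : Continuous (wfac ε l) := by
  have : Continuous fun r : ℝ => (Real.fourierChar r : ℂ) :=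
    continuous_subtype_val.comp Real.continuous_fourierChar
  unfold wfac
  exact continuous_const.mul ((this.comp (by fun_prop)).sub continuous_const)

theorem norm_wfac_le_inv (ε : ℝ) (l : Fin 2) (x : Plane) : ‖wfac ε l x‖ ≤ |ε⁻¹| * 2 := by
  rw [wfac, norm_mul, Complex.norm_real, Real.norm_eq_abs]
  gcongr
  refine (norm_sub_le _ _).trans ?_
  rw [Circle.norm_coe, norm_one]; norm_num

/-- The discrete form of x = Y₂ + (x - Y₂): the weight falls either on the kernel or on the second
input, never on the first. The unimodular factor in the second kernel comes from the cocycle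
identity `wfac_add`. -/
theorem wfac_mul_conv {K : PlanePair → ℂ} {A u v ε : ℝ} {l : Fin 2} {U V : Plane → ℂ}
    (hK₁ : IsPairKernel (fun Y => wfac ε l Y.snd * K Y) A)
    (hK₂ : IsPairKernel (fun Y => (Real.fourierChar (ε * Y.snd l) : ℂ) * K Y) A)
    (hU : Continuous U) (hV : Continuous V) (hu : ∀ x, ‖U x‖ ≤ u)
    (hv : ∀ x, ‖V x‖ ≤ v) (x : Plane) :
    wfac ε l x * conv K U V x = conv (fun Y => wfac ε l Y.snd * K Y) U V x
      + conv (fun Y => (Real.fourierChar (ε * Y.snd l) : ℂ) * K Y) U (fun y => wfac ε l y * V y) x := by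
  simp only [conv]
  rw [← integral_add (hK₁.integrable_conv hU hV hu hv x), ← integral_const_mul]
  · congr 1; ext Y
    have := wfac_add ε l (x - Y.snd) Y.snd
    rw [sub_add_cancel] at this
    rw [this]; ring
  · refine hK₂.integrable_conv hU ((continuous_wfac ε l).mul hV) hu (v := |ε⁻¹| * 2 * v) (fun y => ?_) x
    rw [Pi.mul_apply, norm_mul]
    exact mul_le_mul (norm_wfac_le_inv ε l y) (hv y) (norm_nonneg _) (by positivity)

/-- In dimension four the kernel decays like the power -6, one more than is asked of a
`IsPairKernel`; the spare power absorbs the weight `wfac`. -/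
theorem IsSymbol.exists_pairKernel {n : ℕ} {ρ m : ℝ} {S : PlanePair → ℂ} (hS : IsSymbol n ρ m S)
    (hρ : 0 ≤ ρ) (hn : 6 ≤ n) (hm : m + 6 * ρ ≤ -5) :
    ∃ (K : PlanePair → ℂ) (A : ℝ), 𝓕 K = S ∧ Continuous K ∧ 0 < A ∧
      ∀ Y, ‖K Y‖ ≤ A * (1 + ‖Y‖) ^ (-6 : ℝ) := by
  obtain ⟨-, h2, h3, C, hC, h4⟩ := hS.exists_kernel hρ (by rw [finrank_planePair]; exact hn)
    (by rw [finrank_planePair]; push_cast; linarith)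
  refine ⟨𝓕⁻ S, C, h3, h2, hC, fun y => ?_⟩
  have := h4 y
  rw [finrank_planePair] at this
  convert this using 2
  norm_num

theorem isPairKernel_mul {K k : PlanePair → ℂ} {A c : ℝ} (hA : 0 < A) (hc : 0 < c)
    (hK : Continuous K) (hk : Continuous k) (hKA : ∀ Y, ‖K Y‖ ≤ A * (1 + ‖Y‖) ^ (-6 : ℝ))
    (hkc : ∀ Y, ‖k Y‖ ≤ c * (1 + ‖Y‖)) : IsPairKernel (fun Y => k Y * K Y) (c * A) := by
  refine ⟨by positivity, hk.mul hK, fun Y => ?_⟩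
  have hB := one_add_norm_pos Y
  rw [norm_mul]
  calc ‖k Y‖ * ‖K Y‖ ≤ c * (1 + ‖Y‖) * (A * (1 + ‖Y‖) ^ (-6 : ℝ)) :=
        mul_le_mul (hkc Y) (hKA Y) (norm_nonneg _) (by positivity)
    _ = c * A * ((1 + ‖Y‖) ^ (1 : ℝ) * (1 + ‖Y‖) ^ (-6 : ℝ)) := by rw [Real.rpow_one]; ring
    _ = _ := by rw [← Real.rpow_add hB]; norm_num

theorem Tame.continuous_fourierInv {A : Plane → ℂ} (h : Tame A) : Continuous (𝓕⁻ A) :=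
  EulerPoisson.continuous_fourierInv h.int

/-- Bilinear operators with smooth decaying symbol map `L^p × L^q` to `L²`, also with the weight on
the second factor. -/
theorem IsSymbol.exists_eLpNorm_bil_le {n : ℕ} {ρ m p q : ℝ} {S : PlanePair → ℂ}
    (hS : IsSymbol n ρ m S) (hρ : 0 ≤ ρ) (hn : 6 ≤ n) (hm : m + 6 * ρ ≤ -5)
    (hp : 0 < p) (hq : 0 < q) (hpq : 1 / p + 1 / q = 1 / 2) :
    ∃ C : ℝ, 0 < C ∧ (∀ Y, ‖S Y‖ ≤ C) ∧ ∀ (A B : Plane → ℂ) (u v : ℝ), Tame A → Tame B → 0 < u →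
      0 < v →
      eLpNorm (𝓕⁻ A) (ENNReal.ofReal p) volume ≤ ENNReal.ofReal u →
      eLpNorm (𝓕⁻ B) (ENNReal.ofReal q) volume ≤ ENNReal.ofReal v →
      eLpNorm (bil S A B) 2 volume ≤ ENNReal.ofReal (C * (u * v)) ∧
      ∀ (w ε : ℝ) (l : Fin 2), 0 < w →
        eLpNorm (fun x => wfac ε l x * 𝓕⁻ B x) (ENNReal.ofReal q) volume ≤ ENNReal.ofReal w →
        eLpNorm (fun x => wfac ε l x * 𝓕⁻ (bil S A B) x) 2 volume
          ≤ ENNReal.ofReal (C * (u * (v + w))) := by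
  obtain ⟨K, a, hKS, hKc, ha, hKa⟩ := hS.exists_pairKernel hρ hn hm
  have hπ := Real.pi_pos
  have hM := pairMass_pos
  have hK : IsPairKernel K a := by
    have := isPairKernel_mul (k := fun _ => 1) (c := 1) ha one_pos hKc continuous_const hKa
      (fun Y => by simp)
    simpa using this
  have hSc : Continuous S := hS.1.continuous
  have hSb : ∀ Y, ‖S Y‖ ≤ ∫ Y, ‖K Y‖ := fun Y => by
    rw [← hKS]; exact VectorFourier.norm_fourierIntegral_le_integral_norm _ _ _ _ _
  -- The factor 2π + 1 covers the kernels with and without the weight, and the integral of ‖K‖ makes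
  -- the constant also a bound for the symbol.
  refine ⟨(2 * Real.pi + 1) * a * pairMass + ∫ Y, ‖K Y‖, by positivity, fun Y =>
    (hSb Y).trans (le_add_of_nonneg_left (by positivity)), fun A B u v hA hB hu hv hAu hBv => ?_⟩
  have hle : ∀ {r s c : ℝ}, 0 ≤ s → c ≤ (2 * Real.pi + 1) * a * pairMass → r = c * s →
      ENNReal.ofReal r ≤ ENNReal.ofReal (((2 * Real.pi + 1) * a * pairMass + ∫ Y, ‖K Y‖) * s) := by
    intro r s c hs hc hr
    rw [hr]
    refine ENNReal.ofReal_le_ofReal (mul_le_mul_of_nonneg_right (hc.trans ?_) hs)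
    exact le_add_of_nonneg_right (integral_nonneg fun _ => norm_nonneg _)
  have hT := hA.bil hB hSc hSb
  have hUm := hA.continuous_fourierInv
  have hVm := hB.continuous_fourierInv
  have e : 𝓕⁻ (bil S A B) = conv K (𝓕⁻ A) (𝓕⁻ B) := by
    ext x; rw [← hKS]; exact fourierInv_bil hA hB hK.integrable x
  refine ⟨?_, fun w ε l hw hBw => ?_⟩
  · rw [← eLpNorm_fourierInv hT.int hT.mem, e]
    refine (eLpNorm_conv_le hK hp hq hpq hUm.stronglyMeasurable hVm.stronglyMeasurable hu hv hAu
      hBv).trans (hle (by positivity) ?_ rfl)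
    gcongr
    exact le_mul_of_one_le_left ha.le (by linarith)
  · have hk₁ : IsPairKernel (fun Y => wfac ε l Y.snd * K Y) ((2 * Real.pi + 1) * a) :=
      isPairKernel_mul ha (by positivity) hKc ((continuous_wfac ε l).comp (by fun_prop)) hKa
        fun Y => by
          have h1 := norm_wfac_le ε l Y.snd
          have h2 := abs_coord_le l Y.snd
          have h3 := norm_snd_le_pair Y
          have h4 := norm_nonneg Y
          calc _ ≤ _ := h1
            _ ≤ 2 * Real.pi * ‖Y‖ := by gcongr; exact h2.trans h3
            _ ≤ _ := by nlinarith
    have hk₂ : IsPairKernel (fun Y => (Real.fourierChar (ε * Y.snd l) : ℂ) * K Y)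
        ((2 * Real.pi + 1) * a) :=
      isPairKernel_mul ha (by positivity) hKc (continuous_subtype_val.comp
        (Real.continuous_fourierChar.comp (by fun_prop))) hKa fun Y => by
          rw [Circle.norm_coe]
          have h4 := norm_nonneg Y
          nlinarith
    rw [e]
    have e2 := wfac_mul_conv hk₁ hk₂ hUm hVm (norm_fourierInv_le A) (norm_fourierInv_le B)
    simp only [e2]
    have hWm : Continuous fun y => wfac ε l y * 𝓕⁻ B y := (continuous_wfac ε l).mul hVm
    have hsm : ∀ {k : PlanePair → ℂ} {U V : Plane → ℂ}, Continuous k → Continuous U → Continuous V →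
        StronglyMeasurable (conv k U V) := by
      intro k U V hk hU hV
      refine StronglyMeasurable.integral_prod_right'
        (f := fun z : Plane × PlanePair => k z.2 * (U (z.1 - z.2.fst) * V (z.1 - z.2.snd))) ?_
      refine Continuous.stronglyMeasurable ?_
      exact (hk.comp continuous_snd).mul ((hU.comp (by fun_prop)).mul (hV.comp (by fun_prop)))
    refine (eLpNorm_add_le (hsm hk₁.cont hUm hVm).aestronglyMeasurable
      (hsm hk₂.cont hUm hWm).aestronglyMeasurable (by norm_num)).trans ?_
    refine (add_le_add (eLpNorm_conv_le hk₁ hp hq hpq hUm.stronglyMeasurable hVm.stronglyMeasurable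
      hu hv hAu hBv) (eLpNorm_conv_le hk₂ hp hq hpq hUm.stronglyMeasurable hWm.stronglyMeasurable
      hu hw hAu hBw)).trans ?_
    rw [← ENNReal.ofReal_add (by positivity) (by positivity)]
    exact hle (by positivity) le_rfl (by ring)

end Pairs

/-! ### Quadratic estimates: distributing derivatives and balancing powers of time. -/

section Bilinear
open Filter Topology

theorem SobolevBound.eLpNorm_two_le {M : ℕ} {N : ℝ} {F Φ : Plane → ℂ} (hΦ : SobolevBound M N Φ)
    (h : ∀ ξ, ‖F ξ‖ ≤ (1 + ‖ξ‖) ^ M * ‖Φ ξ‖) : eLpNorm F 2 volume ≤ ENNReal.ofReal N := by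
  have := hΦ.eLpNorm_le (A := 1) zero_le_one (F := F) (fun ξ => by rw [one_mul]; exact h ξ)
  rwa [one_mul] at this

theorem SobolevBound.tame {M : ℕ} {N : ℝ} {F Φ : Plane → ℂ} (hΦ : SobolevBound M N Φ) (hN : 0 ≤ N)
    (hF : StronglyMeasurable F) (h : ∀ ξ, ‖F ξ‖ * (1 + ‖ξ‖) ^ 2 ≤ (1 + ‖ξ‖) ^ M * ‖Φ ξ‖) :
    Tame F ∧ eLpNorm F 2 volume ≤ ENNReal.ofReal N := by
  have h2 : eLpNorm F 2 volume ≤ ENNReal.ofReal N := hΦ.eLpNorm_two_le fun ξ =>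
    (le_mul_of_one_le_right (norm_nonneg _) (one_le_pow₀ (one_le_one_add_norm ξ))).trans (h ξ)
  exact ⟨⟨hF, (hΦ.integrable (A := 1) zero_le_one hN hF.aestronglyMeasurable
    (fun ξ => by rw [one_mul]; exact h ξ)).1, hF.aestronglyMeasurable,
    h2.trans_lt ENNReal.ofReal_lt_top⟩, h2⟩

theorem SobolevBound.tame_mode {M B : ℕ} {N : ℝ} {Φ : Plane → ℂ} (hΦ : SobolevBound M N Φ)
    (hN : 0 ≤ N) (hm : StronglyMeasurable Φ) (hB : 2 * B + 2 ≤ M) (a : ℝ) (j : Fin 2) :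
    Tame (mode a Φ B j) ∧ eLpNorm (mode a Φ B j) 2 volume ≤ ENNReal.ofReal N := by
  refine hΦ.tame hN (stronglyMeasurable_mode hm B j) fun ξ => ?_
  have h1 := one_le_one_add_norm ξ
  calc ‖mode a Φ B j ξ‖ * (1 + ‖ξ‖) ^ 2 ≤ (‖ξ‖ ^ (2 * B) * ‖Φ ξ‖) * (1 + ‖ξ‖) ^ 2 := by
        gcongr; exact norm_mode_le a Φ B j ξ
    _ ≤ ((1 + ‖ξ‖) ^ (2 * B) * ‖Φ ξ‖) * (1 + ‖ξ‖) ^ 2 := by gcongr; linarith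
    _ = (1 + ‖ξ‖) ^ (2 * B + 2) * ‖Φ ξ‖ := by ring
    _ ≤ _ := by gcongr

theorem low_eq_mode (a : ℝ) (Φ : Plane → ℂ) (k : Fin 2) (ξ : Plane) :
    low a Φ k ξ = ((((1 + ‖ξ‖ ^ 2) ^ 6)⁻¹ : ℝ) : ℂ) * mode a Φ 0 k ξ := by
  rw [low, mode, smoothRiesz]
  push_cast
  ring

theorem SobolevBound.tame_low {M : ℕ} {N : ℝ} {Φ : Plane → ℂ} (hΦ : SobolevBound M N Φ)
    (hN : 0 ≤ N) (hm : StronglyMeasurable Φ) (hM : 2 ≤ M) (a : ℝ) (k : Fin 2) :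
    Tame (low a Φ k) ∧ eLpNorm (low a Φ k) 2 volume ≤ ENNReal.ofReal N := by
  refine hΦ.tame hN (stronglyMeasurable_low a hm k) fun ξ => ?_
  have h1 := one_le_one_add_norm ξ
  have h0 : ‖low a Φ k ξ‖ ≤ ‖Φ ξ‖ := by
    rw [low, norm_mul, norm_mul, norm_osc, one_mul, Complex.norm_real, Real.norm_eq_abs]
    exact mul_le_of_le_one_left (norm_nonneg _) (abs_smoothRiesz_le k ξ)
  calc ‖low a Φ k ξ‖ * (1 + ‖ξ‖) ^ 2 ≤ ‖Φ ξ‖ * (1 + ‖ξ‖) ^ M :=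
        mul_le_mul h0 (pow_le_pow_right₀ h1 hM) (by positivity) (norm_nonneg _)
    _ = _ := mul_comm _ _

theorem exists_eLpNorm_low_le {p : ℝ} (hp : 2 < p) (hp3 : p < 3) (k : Fin 2) {M₁ : ℕ}
    (hM₁ : 3 ≤ M₁) :
    ∃ C : ℝ, 0 < C ∧ ∀ (M₂ : ℕ) (T a X : ℝ) (Φ : Plane → ℂ), ProfileBound M₁ M₂ p T a X Φ →
      eLpNorm (𝓕⁻ (low a Φ k)) (ENNReal.ofReal (9 / 2)) volume
        ≤ ENNReal.ofReal (C * (X * T ^ (-(5 / 9) : ℝ))) := by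
  obtain ⟨C, hC, h⟩ := exists_eLpNorm_mode_low_le hp hp3 k (B := 0) (M₁ := M₁) (by omega) hM₁
  obtain ⟨κ, A, hκ, eκ⟩ := exists_kernel_resolvent (L := 6) (by norm_num)
  have hA := hκ.pos
  have hk := kernelMass_pos
  refine ⟨A * kernelMass * C, by positivity, fun M₂ T a X Φ hP => ?_⟩
  have hT : 0 < T := by linarith [hP.one_le_T]
  have hX := hP.X_pos
  have hm := (hP.sob₁.tame_mode hX.le hP.meas (B := 0) (by omega) a k).1
  have e : 𝓕⁻ (low a Φ k) = avg κ (𝓕⁻ (mode a Φ 0 k)) 1 := by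
    rw [← fourierInv_mul_eq_avg hκ hm.int eκ]
    congr 1; ext ξ
    rw [low_eq_mode, one_smul]
  rw [e]
  refine (eLpNorm_avg_le 1 hκ (by norm_num) hm.continuous_fourierInv.stronglyMeasurable
    (by positivity) (h M₂ T a X Φ hP)).trans (le_of_eq ?_)
  congr 1; ring

/-- The bounds on a quadratic term. -/
structure QuadBound (C T X : ℝ) (G : Plane → ℂ) : Prop where
  tame : Tame G
  sup : ∀ ξ, ‖G ξ‖ ≤ C * X ^ 2
  two : eLpNorm G 2 volume ≤ ENNReal.ofReal (C * (X ^ 2 / T))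
  wt : ∀ l, ∀ᶠ ε in 𝓝[>] (0 : ℝ), eLpNorm (fun x => wfac ε l x * 𝓕⁻ G x) 2 volume
    ≤ ENNReal.ofReal (C * X ^ 2)

theorem Tame.add {F G : Plane → ℂ} (hF : Tame F) (hG : Tame G) : Tame fun ξ => F ξ + G ξ :=
  ⟨hF.meas.add hG.meas, hF.int.add hG.int, hF.mem.add hG.mem⟩

theorem QuadBound.add {C C' T X : ℝ} {F G : Plane → ℂ} (hC : 0 ≤ C) (hC' : 0 ≤ C') (hT : 0 < T)
    (hF : QuadBound C T X F) (hG : QuadBound C' T X G) :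
    QuadBound (C + C') T X fun ξ => F ξ + G ξ := by
  refine ⟨hF.tame.add hG.tame, fun ξ => ?_, ?_, fun l => ?_⟩
  · rw [add_mul]
    exact (norm_add_le _ _).trans (add_le_add (hF.sup ξ) (hG.sup ξ))
  · rw [add_mul, ENNReal.ofReal_add (by positivity) (by positivity)]
    exact (eLpNorm_add_le hF.tame.mem.1 hG.tame.mem.1 (by norm_num)).trans
      (add_le_add hF.two hG.two)
  · filter_upwards [hF.wt l, hG.wt l] with ε h1 h2
    rw [add_mul, ENNReal.ofReal_add (by positivity) (by positivity)]
    have e : (fun x => wfac ε l x * 𝓕⁻ (fun ξ => F ξ + G ξ) x)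
        = (fun x => wfac ε l x * 𝓕⁻ F x) + fun x => wfac ε l x * 𝓕⁻ G x := by
      ext x
      rw [fourierInv_add' hF.tame.int hG.tame.int, mul_add]; rfl
    rw [e]
    refine (eLpNorm_add_le ?_ ?_ (by norm_num)).trans (add_le_add h1 h2)
    · exact ((continuous_wfac ε l).mul hF.tame.continuous_fourierInv).aestronglyMeasurable
    · exact ((continuous_wfac ε l).mul hG.tame.continuous_fourierInv).aestronglyMeasurable

variable {p : ℝ} {ρ m : ℝ} {M₁ M₂ B : ℕ}

/-- The powers balance: T^{-4/9} · T^{-5/9} = 1/T without weight. With the weight, always placed on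
the smoothed factor, T^{-4/9} · T^{4/9} = 1. The bound of the Fourier transform is Cauchy–Schwarz
and involves no decay. -/
theorem exists_quadBound_bil_mode_low (hp : 2 < p) (hp4 : p ≤ 9 / 4) {S : PlanePair → ℂ}
    (hS : IsSymbol 6 ρ m S) (hρ : 0 ≤ ρ) (hm : m + 6 * ρ ≤ -5) (j k : Fin 2)
    (hM : 9 * (2 * B + 1) ≤ 5 * M₁) (hM2 : 2 * B + 2 ≤ M₁) (hM3 : 3 ≤ M₁) :
    ∃ C : ℝ, 0 < C ∧ (∀ Y, ‖S Y‖ ≤ C) ∧ ∀ (M₂ : ℕ) (T X a a' : ℝ) (Φ Φ' : Plane → ℂ),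
      ProfileBound M₁ M₂ p T a X Φ → ProfileBound M₁ M₂ p T a' X Φ' →
      QuadBound C T X (bil S (mode a Φ B j) (low a' Φ' k)) := by
  obtain ⟨C₁, hC₁, h1⟩ := exists_eLpNorm_mode_high_le hp (by linarith) j hM hM2 hM3
  obtain ⟨C₂, hC₂, h2⟩ := exists_eLpNorm_low_le hp (by linarith) k hM3
  choose C₃ hC₃ h3 using fun l => exists_eventually_eLpNorm_wfac_low_le hp hp4 k l hM3
  obtain ⟨C, hC, hSC, h⟩ := hS.exists_eLpNorm_bil_le hρ le_rfl hm (p := 18 / 5) (q := 9 / 2)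
    (by norm_num) (by norm_num) (by norm_num)
  have hC₃s : 0 ≤ ∑ l, C₃ l := Finset.sum_nonneg fun l _ => (hC₃ l).le
  have hC₃l : ∀ l, C₃ l ≤ ∑ l, C₃ l := fun l =>
    Finset.single_le_sum (fun l _ => (hC₃ l).le) (Finset.mem_univ l)
  set D := C * (C₁ * (C₂ + ∑ l, C₃ l)) with hD
  have hD0 : 0 ≤ D := by positivity
  refine ⟨C + D, by positivity, fun Y => (hSC Y).trans (by linarith),
    fun M₂ T X a a' Φ Φ' hP hP' => ?_⟩
  have hT1 := hP.one_le_T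
  have hT : 0 < T := by linarith
  have hX := hP.X_pos
  obtain ⟨tA, nA⟩ := hP.sob₁.tame_mode hX.le hP.meas hM2 a j
  obtain ⟨tB, nB⟩ := hP'.sob₁.tame_low hX.le hP'.meas (by omega) a' k
  have key := h _ _ _ _ tA tB (by positivity) (by positivity) (h1 M₂ T a X Φ hP)
    (h2 M₂ T a' X Φ' hP')
  have e1 : T ^ (-(4 / 9) : ℝ) * T ^ (-(5 / 9) : ℝ) = T⁻¹ := by
    rw [← Real.rpow_add hT, ← Real.rpow_neg_one]; norm_num
  have e2 : T ^ (-(4 / 9) : ℝ) * T ^ (4 / 9 : ℝ) = 1 := by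
    rw [← Real.rpow_add hT]; norm_num
  have hTi : T⁻¹ ≤ 1 := inv_le_one_of_one_le₀ hT1
  refine ⟨tA.bil tB hS.1.continuous hSC, fun ξ => ?_, ?_, fun l => ?_⟩
  · refine (tA.norm_bil_le tB hX.le hX.le hSC nA nB ξ).trans ?_
    rw [← sq]
    gcongr
    linarith
  · refine key.1.trans (ENNReal.ofReal_le_ofReal ?_)
    calc C * (C₁ * (X * T ^ (-(4 / 9) : ℝ)) * (C₂ * (X * T ^ (-(5 / 9) : ℝ))))
        = C * (C₁ * C₂) * (X ^ 2 * (T ^ (-(4 / 9) : ℝ) * T ^ (-(5 / 9) : ℝ))) := by ring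
      _ = C * (C₁ * C₂) * (X ^ 2 / T) := by rw [e1, ← div_eq_mul_inv]
      _ ≤ (C + D) * (X ^ 2 / T) := by
        gcongr
        rw [hD]
        have : C * (C₁ * C₂) ≤ C * (C₁ * (C₂ + ∑ l, C₃ l)) := by gcongr; linarith
        linarith
  · filter_upwards [h3 l M₂ T a' X Φ' hP'] with ε hε
    have := hC₃ l
    refine (key.2 _ ε l (by positivity) hε).trans (ENNReal.ofReal_le_ofReal ?_)
    calc C * (C₁ * (X * T ^ (-(4 / 9) : ℝ)) * (C₂ * (X * T ^ (-(5 / 9) : ℝ))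
          + C₃ l * (X * T ^ (4 / 9 : ℝ))))
        = C * (C₁ * (C₂ * (T ^ (-(4 / 9) : ℝ) * T ^ (-(5 / 9) : ℝ))
          + C₃ l * (T ^ (-(4 / 9) : ℝ) * T ^ (4 / 9 : ℝ)))) * X ^ 2 := by ring
      _ = C * (C₁ * (C₂ * T⁻¹ + C₃ l)) * X ^ 2 := by rw [e1, e2, mul_one]
      _ ≤ D * X ^ 2 := by
        rw [hD]
        gcongr
        · exact mul_le_of_le_one_right hC₂.le hTi
        · exact hC₃l l
      _ ≤ _ := by gcongr; linarith

/-- Here the differentiated factor is measured in the growing Sobolev norm. It costs T^{1/9}, still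
less than the T^{-5/9} gained from the other factor. -/
theorem exists_eLpNorm_bil_mode_low_le (hp : 2 < p) (hp3 : p < 3) {S : PlanePair → ℂ}
    (hS : IsSymbol 6 ρ m S) (hρ : 0 ≤ ρ) (hm : m + 6 * ρ ≤ -5) (j k : Fin 2)
    (hM : 9 * (2 * B + 1) ≤ 5 * M₂) (hM2 : 2 * B + 2 ≤ M₂) (hM3 : 3 ≤ M₁) (hM4 : 3 ≤ M₂) :
    ∃ C : ℝ, 0 < C ∧ (∀ Y, ‖S Y‖ ≤ C) ∧ ∀ (T X a a' : ℝ) (Φ Φ' : Plane → ℂ),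
      ProfileBound M₁ M₂ p T a X Φ → ProfileBound M₁ M₂ p T a' X Φ' →
      Tame (bil S (mode a Φ B j) (low a' Φ' k)) ∧
      eLpNorm (bil S (mode a Φ B j) (low a' Φ' k)) 2 volume ≤ ENNReal.ofReal (C * X ^ 2) := by
  obtain ⟨C₁, hC₁, h1⟩ := exists_eLpNorm_mode_top_le hp hp3 j hM hM2 hM4
  obtain ⟨C₂, hC₂, h2⟩ := exists_eLpNorm_low_le hp hp3 k hM3
  obtain ⟨C, hC, hSC, h⟩ := hS.exists_eLpNorm_bil_le hρ le_rfl hm (p := 18 / 5) (q := 9 / 2)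
    (by norm_num) (by norm_num) (by norm_num)
  refine ⟨C + C * (C₁ * C₂), by positivity, fun Y => (hSC Y).trans (by
    have : 0 ≤ C * (C₁ * C₂) := by positivity
    linarith), fun T X a a' Φ Φ' hP hP' => ?_⟩
  have hT1 := hP.one_le_T
  have hT : 0 < T := by linarith
  have hX := hP.X_pos
  obtain ⟨tA, nA⟩ := hP.sob₂.tame_mode (by positivity) hP.meas hM2 a j
  obtain ⟨tB, nB⟩ := hP'.sob₁.tame_low hX.le hP'.meas (by omega) a' k
  have key := h _ _ _ _ tA tB (by positivity) (by positivity) (h1 M₁ T a X Φ hP)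
    (h2 M₂ T a' X Φ' hP')
  refine ⟨tA.bil tB hS.1.continuous hSC, key.1.trans (ENNReal.ofReal_le_ofReal ?_)⟩
  have e1 : T ^ (1 / 9 : ℝ) * T ^ (-(5 / 9) : ℝ) ≤ 1 := by
    rw [← Real.rpow_add hT]
    exact Real.rpow_le_one_of_one_le_of_nonpos hT1 (by norm_num)
  calc C * (C₁ * (X * T ^ (1 / 9 : ℝ)) * (C₂ * (X * T ^ (-(5 / 9) : ℝ))))
      = C * (C₁ * C₂) * X ^ 2 * (T ^ (1 / 9 : ℝ) * T ^ (-(5 / 9) : ℝ)) := by ring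
    _ ≤ C * (C₁ * C₂) * X ^ 2 * 1 := by gcongr
    _ ≤ _ := by rw [mul_one]; gcongr; linarith

theorem IsSymbol.swap {n : ℕ} {S : PlanePair → ℂ} (hS : IsSymbol n ρ m S) :
    IsSymbol n ρ m fun Y : PlanePair => S (pr Y.snd Y.fst) := by
  let e : PlanePair ≃ₗᵢ[ℝ] PlanePair := (LinearIsometryEquiv.withLpProdComm 2 ℝ Plane Plane)
  have he : (fun Y : PlanePair => S (pr Y.snd Y.fst)) = S ∘ e := rfl
  rw [he]
  refine ⟨hS.1.comp e.contDiff, fun k hk => ?_⟩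
  obtain ⟨C, hC⟩ := hS.2 k hk
  refine ⟨C, fun Y => ?_⟩
  rw [e.norm_iteratedFDeriv_comp_right]
  simpa using hC (e Y)

theorem isSymbol_norm_sq_clm {E F : Type*} [NormedAddCommGroup E] [NormedSpace ℝ E]
    [NormedAddCommGroup F] [InnerProductSpace ℝ F] (n : ℕ) (L : E →L[ℝ] F) :
    IsSymbol n 0 2 fun x => ‖L x‖ ^ 2 := by
  have h := IsSymbol.clm (n := n) (ρ := 0) L le_rfl
  have h2 := IsSymbol.bilin (innerSL ℝ) h h
  norm_num at h2
  have e : (fun x => ‖L x‖ ^ 2) = fun x => innerSL ℝ (L x) (L x) := by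
    ext x
    exact (real_inner_self_eq_norm_sq (L x)).symm
  rw [e]
  exact h2

theorem isSymbol_fst_sq (n : ℕ) : IsSymbol n 0 2 fun Y : PlanePair => ‖Y.fst‖ ^ 2 :=
  isSymbol_norm_sq_clm n (WithLp.fstL 2 ℝ Plane Plane)

theorem isSymbol_snd_sq (n : ℕ) : IsSymbol n 0 2 fun Y : PlanePair => ‖Y.snd‖ ^ 2 :=
  isSymbol_norm_sq_clm n (WithLp.sndL 2 ℝ Plane Plane)

/-- The weight `1 + ‖ζ‖^{2B} + ‖η‖^{2B}`. -/
noncomputable def pairWeight (B : ℕ) (Y : PlanePair) : ℝ :=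
  1 + (‖Y.fst‖ ^ 2) ^ B + (‖Y.snd‖ ^ 2) ^ B

theorem pairWeight_pos (B : ℕ) (Y : PlanePair) : 0 < pairWeight B Y := by
  unfold pairWeight; positivity

theorem isSymbol_pairWeight (n B : ℕ) : IsSymbol n 0 (2 * B) (pairWeight B) := by
  have h0 : (0 : ℝ) ≤ 2 * B := by positivity
  have h1 := (isSymbol_fst_sq n).pow le_rfl B
  have h2 := (isSymbol_snd_sq n).pow le_rfl B
  rw [mul_comm] at h1 h2
  exact (((IsSymbol.const (1 : ℝ) le_rfl).order_mono h0).add h1).add h2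

theorem norm_sq_planePair (Y : PlanePair) : ‖Y‖ ^ 2 = ‖Y.fst‖ ^ 2 + ‖Y.snd‖ ^ 2 :=
  WithLp.prod_norm_sq_eq_of_L2 Y

theorem one_add_add_pow_le {u v : ℝ} (hu : 0 ≤ u) (hv : 0 ≤ v) (B : ℕ) :
    (1 + u + v) ^ B ≤ 3 ^ B * (1 + u ^ B + v ^ B) := by
  have h1 : 1 + u + v ≤ 3 * max 1 (max u v) := by
    have := le_max_left (1 : ℝ) (max u v)
    have := (le_max_left u v).trans (le_max_right 1 _)
    have := (le_max_right u v).trans (le_max_right 1 _)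
    linarith
  have h2 : (max 1 (max u v)) ^ B ≤ 1 + u ^ B + v ^ B := by
    have := pow_nonneg hu B
    have := pow_nonneg hv B
    rcases max_choice 1 (max u v) with h | h
    · rw [h, one_pow]; linarith
    · rw [h]
      rcases max_choice u v with h' | h' <;> rw [h'] <;> linarith
  calc (1 + u + v) ^ B ≤ (3 * max 1 (max u v)) ^ B := by gcongr
    _ = 3 ^ B * (max 1 (max u v)) ^ B := mul_pow _ _ _
    _ ≤ _ := by gcongr

theorem pairWeight_lower (B : ℕ) (Y : PlanePair) :
    (6 ^ B : ℝ)⁻¹ * (1 + ‖Y‖) ^ (2 * (B : ℝ)) ≤ pairWeight B Y := by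
  have h0 : (1 + ‖Y‖) ^ 2 ≤ 2 * (1 + ‖Y.fst‖ ^ 2 + ‖Y.snd‖ ^ 2) := by
    nlinarith [norm_sq_planePair Y, sq_nonneg (1 - ‖Y‖)]
  have h1 := one_add_add_pow_le (sq_nonneg ‖Y.fst‖) (sq_nonneg ‖Y.snd‖) B
  rw [inv_mul_le_iff₀ (by positivity), Real.rpow_mul (one_add_norm_pos Y).le, Real.rpow_ofNat,
    Real.rpow_natCast]
  calc ((1 + ‖Y‖) ^ 2) ^ B ≤ (2 * (1 + ‖Y.fst‖ ^ 2 + ‖Y.snd‖ ^ 2)) ^ B := by gcongr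
    _ = 2 ^ B * (1 + ‖Y.fst‖ ^ 2 + ‖Y.snd‖ ^ 2) ^ B := mul_pow _ _ _
    _ ≤ 2 ^ B * (3 ^ B * pairWeight B Y) := by gcongr; exact h1
    _ = _ := by rw [← mul_assoc, ← mul_pow]; norm_num

theorem isSymbol_inv_pairWeight (n B : ℕ) (hρ : 0 ≤ ρ) :
    IsSymbol n ρ (-(2 * B)) fun Y => 1 / pairWeight B Y :=
  IsSymbol.inv hρ (by positivity) (fun n => isSymbol_pairWeight n B) (pairWeight_lower B)
    (by linarith)

/-- `𝓜` divided by the weight, with the inverse of the smoothing factor of `low` on the second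
factor. -/
noncomputable def reduced (𝓜 : PlanePair → ℂ) (B : ℕ) (Y : PlanePair) : ℂ :=
  𝓜 Y * ((1 / pairWeight B Y * (1 + ‖Y.snd‖ ^ 2) ^ 6 : ℝ) : ℂ)

theorem IsSymbol.reduced {𝓜 : PlanePair → ℂ} (h : IsSymbol 6 ρ m 𝓜) (hρ : 0 ≤ ρ) (B : ℕ) :
    IsSymbol 6 ρ (m - 2 * B + 12) (reduced 𝓜 B) := by
  have h1 := (((IsSymbol.const (1 : ℝ) le_rfl).order_mono zero_le_two).add
    (isSymbol_snd_sq 6)).pow le_rfl 6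
  have h2 := ((isSymbol_inv_pairWeight 6 B hρ).mul (h1.mono le_rfl hρ le_rfl)).ofReal
  refine (h.mul h2).order_mono (le_of_eq ?_)
  push_cast; ring

theorem reduced_mul_low (𝓜 : PlanePair → ℂ) (B : ℕ) (a' : ℝ) (Φ' : Plane → ℂ) (k : Fin 2)
    (A : ℂ) (Y : PlanePair) :
    reduced 𝓜 B Y * (A * low a' Φ' k Y.snd)
      = 𝓜 Y * ((1 / pairWeight B Y : ℝ) : ℂ) * (A * mode a' Φ' 0 k Y.snd) := by
  have h : ((1 + ‖Y.snd‖ ^ 2 : ℝ) : ℂ) ≠ 0 := by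
    exact_mod_cast (by positivity : (0 : ℝ) < 1 + ‖Y.snd‖ ^ 2).ne'
  rw [low_eq_mode, reduced]
  push_cast at h ⊢
  field_simp

theorem mode_eq (a : ℝ) (Φ : Plane → ℂ) (B : ℕ) (j : Fin 2) (ξ : Plane) :
    mode a Φ B j ξ = (((‖ξ‖ ^ 2) ^ B : ℝ) : ℂ) * mode a Φ 0 j ξ := by
  rw [mode, mode, ← pow_mul]
  push_cast
  ring

/-- Insert (1 + ‖ζ‖^{2B} + ‖η‖^{2B}) / `pairWeight` = 1. In each of the three terms at most one
factor carries derivatives; the other one is replaced by its smoothed version `low`, with the six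
inverse resolvents hidden in the reduced symbol. In the third term the two variables are exchanged,
so that the differentiated factor always comes first. -/
theorem symbol_mul_modes (𝓜 : PlanePair → ℂ) (B : ℕ) (a a' : ℝ) (Φ Φ' : Plane → ℂ) (j k : Fin 2)
    (ζ η : Plane) :
    𝓜 (pr ζ η) * (mode a Φ 0 j ζ * mode a' Φ' 0 k η)
      = reduced 𝓜 B (pr ζ η) * (mode a Φ 0 j ζ * low a' Φ' k η)
        + reduced 𝓜 B (pr ζ η) * (mode a Φ B j ζ * low a' Φ' k η)
        + reduced (fun Y => 𝓜 (pr Y.snd Y.fst)) B (pr η ζ) * (mode a' Φ' B k η * low a Φ j ζ) := by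
  have h1 := reduced_mul_low 𝓜 B a' Φ' k (mode a Φ 0 j ζ) (pr ζ η)
  have h2 := reduced_mul_low 𝓜 B a' Φ' k (mode a Φ B j ζ) (pr ζ η)
  have h3 := reduced_mul_low (fun Y => 𝓜 (pr Y.snd Y.fst)) B a Φ j (mode a' Φ' B k η) (pr η ζ)
  simp only [pr_fst, pr_snd] at h1 h2 h3
  rw [h1, h2, h3, mode_eq a Φ B j ζ, mode_eq a' Φ' B k η]
  have e : pairWeight B (pr η ζ) = pairWeight B (pr ζ η) := by
    simp only [pairWeight, pr_fst, pr_snd]; ring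
  rw [e]
  have h : ((pairWeight B (pr ζ η) : ℝ) : ℂ) ≠ 0 := by
    exact_mod_cast (pairWeight_pos B (pr ζ η)).ne'
  have hw : ((pairWeight B (pr ζ η) : ℝ) : ℂ)
      = 1 + (((‖ζ‖ ^ 2) ^ B : ℝ) : ℂ) + (((‖η‖ ^ 2) ^ B : ℝ) : ℂ) := by
    simp only [pairWeight, pr_fst, pr_snd]; push_cast; ring
  rw [Complex.ofReal_div, Complex.ofReal_one]
  field_simp
  rw [hw]

theorem bil_modes {𝓜 : PlanePair → ℂ} {B : ℕ} {a a' c : ℝ} {Φ Φ' : Plane → ℂ} {j k : Fin 2}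
    (hS : Continuous (reduced 𝓜 B)) (hSc : ∀ Y, ‖reduced 𝓜 B Y‖ ≤ c)
    (hS' : Continuous (reduced (fun Y => 𝓜 (pr Y.snd Y.fst)) B))
    (hSc' : ∀ Y, ‖reduced (fun Y => 𝓜 (pr Y.snd Y.fst)) B Y‖ ≤ c)
    (hA₀ : Tame (mode a Φ 0 j)) (hA : Tame (mode a Φ B j)) (hB : Tame (mode a' Φ' B k))
    (hA' : Tame (low a Φ j)) (hB' : Tame (low a' Φ' k)) (ξ : Plane) :
    Integrable (fun η => 𝓜 (pr (ξ - η) η) * (mode a Φ 0 j (ξ - η) * mode a' Φ' 0 k η)) ∧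
    bil 𝓜 (mode a Φ 0 j) (mode a' Φ' 0 k) ξ
      = bil (reduced 𝓜 B) (mode a Φ 0 j) (low a' Φ' k) ξ
        + bil (reduced 𝓜 B) (mode a Φ B j) (low a' Φ' k) ξ
        + bil (reduced (fun Y => 𝓜 (pr Y.snd Y.fst)) B) (mode a' Φ' B k) (low a Φ j) ξ := by
  have i1 := hA₀.integrable_bil hB' hS hSc ξ
  have i2 := hA.integrable_bil hB' hS hSc ξ
  have i3 := (hB.integrable_bil hA' hS' hSc' ξ).comp_sub_left ξ
  simp only [sub_sub_cancel] at i3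
  have e := fun η => symbol_mul_modes 𝓜 B a a' Φ Φ' j k (ξ - η) η
  simp only [e]
  have i12 := i1.fun_add i2
  refine ⟨i12.add i3, ?_⟩
  rw [bil, integral_congr_ae (Filter.Eventually.of_forall e), integral_add i12 i3,
    integral_add i1 i2]
  congr 1
  rw [bil, ← integral_sub_left_eq_self _ volume ξ]
  simp only [sub_sub_cancel]

/-- The number 17 is 12 + 5: twelve powers from undoing the smoothing of `low`, and five of decay
for a kernel on pairs. The condition 9(2B + 1) ≤ 5 M₁ is the regularity needed to place 2B
derivatives in L^{18/5}. -/
theorem exists_quadBound_bil (hp : 2 < p) (hp4 : p ≤ 9 / 4) {𝓜 : PlanePair → ℂ}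
    (h𝓜 : IsSymbol 6 ρ m 𝓜) (hρ : 0 ≤ ρ) (hm : m + 6 * ρ + 17 ≤ 2 * B) (j k : Fin 2)
    (hM : 9 * (2 * B + 1) ≤ 5 * M₁) (hM2 : 2 * B + 2 ≤ M₁) (hM3 : 3 ≤ M₁) :
    ∃ C : ℝ, 0 < C ∧ ∀ (M₂ : ℕ) (T X a a' : ℝ) (Φ Φ' : Plane → ℂ),
      ProfileBound M₁ M₂ p T a X Φ → ProfileBound M₁ M₂ p T a' X Φ' →
      (∀ ξ, Integrable fun η => 𝓜 (pr (ξ - η) η) * (mode a Φ 0 j (ξ - η) * mode a' Φ' 0 k η)) ∧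
      QuadBound C T X (bil 𝓜 (mode a Φ 0 j) (mode a' Φ' 0 k)) := by
  have hS := h𝓜.reduced hρ B
  have hS' := h𝓜.swap.reduced hρ B
  obtain ⟨C₁, hC₁, b1, h1⟩ := exists_quadBound_bil_mode_low (B := 0) hp hp4 hS hρ (by linarith) j k
    (by omega) (by omega) hM3
  obtain ⟨C₂, hC₂, -, h2⟩ := exists_quadBound_bil_mode_low hp hp4 hS hρ (by linarith) j k hM hM2 hM3
  obtain ⟨C₃, hC₃, b3, h3⟩ := exists_quadBound_bil_mode_low hp hp4 hS' hρ (by linarith) k j hM hM2 hM3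
  refine ⟨C₁ + C₂ + C₃, by positivity, fun M₂ T X a a' Φ Φ' hP hP' => ?_⟩
  have hT : 0 < T := by linarith [hP.one_le_T]
  have hX := hP.X_pos
  have key := bil_modes (a := a) (a' := a') (Φ := Φ) (Φ' := Φ') (j := j) (k := k) hS.1.continuous
    (c := C₁ + C₃) (fun Y => (b1 Y).trans (by linarith)) hS'.1.continuous
    (fun Y => (b3 Y).trans (by linarith))
    (hP.sob₁.tame_mode hX.le hP.meas (by omega) a j).1
    (hP.sob₁.tame_mode hX.le hP.meas (by omega) a j).1
    (hP'.sob₁.tame_mode hX.le hP'.meas (by omega) a' k).1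
    (hP.sob₁.tame_low hX.le hP.meas (by omega) a j).1
    (hP'.sob₁.tame_low hX.le hP'.meas (by omega) a' k).1
  refine ⟨fun ξ => (key ξ).1, ?_⟩
  rw [funext fun ξ => (key ξ).2]
  exact ((h1 M₂ T X a a' Φ Φ' hP hP').add hC₁.le hC₂.le hT (h2 M₂ T X a a' Φ Φ' hP hP')).add
    (by positivity) hC₃.le hT (h3 M₂ T X a' a Φ' Φ hP' hP)

theorem exists_eLpNorm_bil_modes_le (hp : 2 < p) (hp3 : p < 3) {𝓜 : PlanePair → ℂ}
    (h𝓜 : IsSymbol 6 ρ m 𝓜) (hρ : 0 ≤ ρ) (hm : m + 6 * ρ + 17 ≤ 2 * B) (j k : Fin 2)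
    (hM : 9 * (2 * B + 1) ≤ 5 * M₂) (hM2 : 2 * B + 2 ≤ M₂) (hM3 : 3 ≤ M₁) (hM4 : 3 ≤ M₂) :
    ∃ C : ℝ, 0 < C ∧ ∀ (T X a a' : ℝ) (Φ Φ' : Plane → ℂ),
      ProfileBound M₁ M₂ p T a X Φ → ProfileBound M₁ M₂ p T a' X Φ' →
      eLpNorm (bil 𝓜 (mode a Φ 0 j) (mode a' Φ' 0 k)) 2 volume ≤ ENNReal.ofReal (C * X ^ 2) := by
  have hS := h𝓜.reduced hρ B
  have hS' := h𝓜.swap.reduced hρ B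
  obtain ⟨C₁, hC₁, b1, h1⟩ := exists_eLpNorm_bil_mode_low_le (B := 0) hp hp3 hS hρ (by linarith) j k
    (by omega) (by omega) hM3 hM4
  obtain ⟨C₂, hC₂, -, h2⟩ :=
    exists_eLpNorm_bil_mode_low_le hp hp3 hS hρ (by linarith) j k hM hM2 hM3 hM4
  obtain ⟨C₃, hC₃, b3, h3⟩ :=
    exists_eLpNorm_bil_mode_low_le hp hp3 hS' hρ (by linarith) k j hM hM2 hM3 hM4
  refine ⟨C₁ + C₂ + C₃, by positivity, fun T X a a' Φ Φ' hP hP' => ?_⟩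
  have hT : 0 < T := by linarith [hP.one_le_T]
  have hX := hP.X_pos
  have hXT : 0 ≤ X * T := by positivity
  have key := bil_modes (a := a) (a' := a') (Φ := Φ) (Φ' := Φ') (j := j) (k := k) hS.1.continuous
    (c := C₁ + C₃) (fun Y => (b1 Y).trans (by linarith)) hS'.1.continuous
    (fun Y => (b3 Y).trans (by linarith))
    (hP.sob₂.tame_mode hXT hP.meas (by omega) a j).1
    (hP.sob₂.tame_mode hXT hP.meas (by omega) a j).1
    (hP'.sob₂.tame_mode hXT hP'.meas (by omega) a' k).1
    (hP.sob₂.tame_low hXT hP.meas (by omega) a j).1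
    (hP'.sob₂.tame_low hXT hP'.meas (by omega) a' k).1
  rw [funext fun ξ => (key ξ).2, add_mul, add_mul, ENNReal.ofReal_add (by positivity) (by positivity),
    ENNReal.ofReal_add (by positivity) (by positivity)]
  obtain ⟨t1, n1⟩ := h1 T X a a' Φ Φ' hP hP'
  obtain ⟨t2, n2⟩ := h2 T X a a' Φ Φ' hP hP'
  obtain ⟨t3, n3⟩ := h3 T X a' a Φ' Φ hP' hP
  refine (eLpNorm_add_le (t1.mem.1.add t2.mem.1) t3.mem.1 (by norm_num)).trans ?_
  exact add_le_add ((eLpNorm_add_le t1.mem.1 t2.mem.1 (by norm_num)).trans (add_le_add n1 n2)) n3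

end Bilinear

/-! ### The weighted norm of the outer operator applied to a quadratic term. -/

section Output
open Filter Topology

/-- `𝓕⁻` maps a decaying weight times `L²` to `L^p`, `p ≥ 2`. -/
theorem eLpNorm_fourierInv_le_of_weight {p c N : ℝ} {H W : Plane → ℂ} (hp : 2 ≤ p) (hc : 0 ≤ c)
    (hN : 0 ≤ N) (hH : AEStronglyMeasurable H) (hW : AEStronglyMeasurable W)
    (hWN : eLpNorm W 2 volume ≤ ENNReal.ofReal N)
    (h : ∀ ξ, ‖H ξ‖ ≤ c * ((1 + ‖ξ‖) ^ (-2 : ℝ) * ‖W ξ‖)) :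
    Integrable H ∧
    eLpNorm (𝓕⁻ H) (ENNReal.ofReal p) volume ≤ ENNReal.ofReal (c * N * (1 + √kernelMass)) := by
  have hq : ∀ ξ : Plane, 0 ≤ (1 + ‖ξ‖) ^ (-2 : ℝ) := fun ξ =>
    Real.rpow_nonneg (one_add_norm_pos ξ).le _
  have hw : AEStronglyMeasurable (fun ξ : Plane => (1 + ‖ξ‖) ^ (-2 : ℝ)) :=
    (by fun_prop : Measurable fun ξ : Plane => (1 + ‖ξ‖) ^ (-2 : ℝ)).aestronglyMeasurable
  have h2 : eLpNorm H 2 volume ≤ ENNReal.ofReal (c * N) := by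
    rw [ENNReal.ofReal_mul hc]
    refine (eLpNorm_le_mul_eLpNorm_of_ae_le_mul (c := c) (g := W)
      (Eventually.of_forall fun ξ => (h ξ).trans ?_) 2).trans (mul_le_mul_right hWN _)
    gcongr
    refine mul_le_of_le_one_left (norm_nonneg _) ?_
    exact Real.rpow_le_one_of_one_le_of_nonpos (one_le_one_add_norm ξ) (by norm_num)
  have h1 := integrable_of_lintegral_le (N := c * (√kernelMass * N)) hH (by positivity) (by
    calc ∫⁻ ξ, ‖H ξ‖ₑ ≤ ∫⁻ ξ, ENNReal.ofReal c * (‖(1 + ‖ξ‖) ^ (-2 : ℝ)‖ₑ * ‖W ξ‖ₑ) := by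
          refine lintegral_mono fun ξ => ?_
          rw [← ofReal_norm, ← ofReal_norm, ← ofReal_norm, Real.norm_of_nonneg (hq ξ),
            ← ENNReal.ofReal_mul (hq ξ), ← ENNReal.ofReal_mul hc]
          exact ENNReal.ofReal_le_ofReal (h ξ)
      _ = ENNReal.ofReal c * ∫⁻ ξ, ‖(1 + ‖ξ‖) ^ (-2 : ℝ)‖ₑ * ‖W ξ‖ₑ :=
          lintegral_const_mul' _ _ ENNReal.ofReal_ne_top
      _ ≤ ENNReal.ofReal c * (ENNReal.ofReal (√kernelMass) * ENNReal.ofReal N) := by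
          gcongr
          refine (lintegral_mul_le_eLpNorm_two hw hW).trans ?_
          rw [eLpNorm_one_add_norm_two]
          gcongr
      _ = _ := by rw [← ENNReal.ofReal_mul (Real.sqrt_nonneg _), ← ENNReal.ofReal_mul hc])
  have hm : MemLp H 2 := ⟨hH, h2.trans_lt ENNReal.ofReal_lt_top⟩
  refine ⟨h1.1, ?_⟩
  have hk := Real.sqrt_nonneg kernelMass
  have h3 : eLpNorm (𝓕⁻ H) 2 volume ≤ ENNReal.ofReal (c * N * (1 + √kernelMass)) := by
    rw [eLpNorm_fourierInv h1.1 hm]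
    exact h2.trans (ENNReal.ofReal_le_ofReal (le_mul_of_one_le_right (by positivity) (by linarith)))
  refine (eLpNorm_le_of_sq_of_bounded hp (M := c * N * (1 + √kernelMass)) (by positivity)
    (by positivity) h3 (Eventually.of_forall fun x => ?_)).trans (le_of_eq ?_)
  · refine (norm_fourierInv_le H x).trans (h1.2.trans ?_)
    have : 0 ≤ c * N := by positivity
    linarith
  · rw [← Real.rpow_add_of_nonneg (by positivity) (by positivity)]
    · rw [add_sub_cancel, Real.rpow_one]
    · rw [sub_nonneg, div_le_one (by linarith)]; exact hp

theorem abs_smoothRiesz_le_decay (k : Fin 2) (ξ : Plane) :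
    |smoothRiesz k ξ| ≤ ((1 + ‖ξ‖ ^ 2) ^ 6)⁻¹ := by
  rw [smoothRiesz, abs_mul, abs_of_nonneg (by positivity : 0 ≤ ((1 + ‖ξ‖ ^ 2) ^ 6)⁻¹)]
  exact mul_le_of_le_one_left (by positivity) (abs_riesz_le k ξ)

theorem abs_smoothRiesz_sub_le_decay (k : Fin 2) (ξ v : Plane) (hv : ‖v‖ ≤ 1) :
    |smoothRiesz k (ξ - v)| ≤ 8 * (1 + ‖ξ‖) ^ (-2 : ℝ) := by
  refine (abs_smoothRiesz_le_decay k _).trans ?_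
  have hn : ‖ξ‖ ≤ ‖ξ - v‖ + 1 := by
    have := norm_le_norm_sub_add ξ v
    linarith
  rw [Real.rpow_neg (one_add_norm_pos ξ).le, Real.rpow_ofNat, ← div_eq_mul_inv,
    le_div_iff₀ (pow_pos (one_add_norm_pos ξ) 2), inv_mul_le_iff₀ (by positivity)]
  have h1 : (1 + ‖ξ‖) ^ 2 ≤ (1 + ‖ξ - v‖ ^ 2) * 8 := by
    have h0 := norm_nonneg ξ
    nlinarith [sq_nonneg (‖ξ - v‖ - 2)]
  have h2 : 1 + ‖ξ - v‖ ^ 2 ≤ (1 + ‖ξ - v‖ ^ 2) ^ 6 :=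
    le_self_pow₀ (by nlinarith [sq_nonneg ‖ξ - v‖]) (by norm_num)
  nlinarith

theorem abs_smoothRiesz_le_decay_two (k : Fin 2) (ξ : Plane) :
    |smoothRiesz k ξ| ≤ 8 * (1 + ‖ξ‖) ^ (-2 : ℝ) := by
  simpa using abs_smoothRiesz_sub_le_decay k ξ 0 (by simp)

/-- Discrete Leibniz rule once more. The quotient of G is bounded in L² by assumption; the quotient
of the propagator costs T, which the bound X²/T of G in L² repays; the quotient of the Riesz symbol
is O(1/‖ξ‖) and meets the sup bound of G. The decay of `smoothRiesz` passes from L² to L^p in the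
first two terms. -/
theorem exists_eventually_eLpNorm_wfac_output_le {p : ℝ} (hp : 2 < p) (i l : Fin 2) :
    ∃ C₀ : ℝ, 0 < C₀ ∧ ∀ (C T X a : ℝ) (G : Plane → ℂ), 0 < C → 0 < X → 1 ≤ T → |a| ≤ T →
      QuadBound C T X G → ∀ᶠ ε in 𝓝[>] (0 : ℝ),
        eLpNorm (fun x => wfac ε l x * 𝓕⁻ (low a G i) x) (ENNReal.ofReal p) volume
          ≤ ENNReal.ofReal (C₀ * (C * X ^ 2)) := by
  obtain ⟨D, hD, hd⟩ := exists_abs_smoothRiesz_sub_le i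
  obtain ⟨E, hE, hs⟩ := exists_eLpNorm_fourierInv_le_of_singular hp
  have hπ := Real.pi_pos
  have hk := Real.sqrt_nonneg kernelMass
  refine ⟨8 * (1 + √kernelMass) + 8 * (2 * Real.pi) * (1 + √kernelMass) + E * D, by positivity,
    fun C T X a G hC hX hT ha hG => ?_⟩
  have hT0 : 0 < T := by linarith
  have hi := hG.tame.int
  have hm := hG.tame.meas
  have hlow : Integrable (low a G i) := hi.mono (stronglyMeasurable_low a hm i).aestronglyMeasurable
    (Eventually.of_forall (norm_low_le a G i))
  filter_upwards [hG.wt l, Ioc_mem_nhdsGT (zero_lt_one' ℝ)] with ε hw hε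
  have hε0 := hε.1
  rw [← fourierInv_dq hlow]
  set v := ε • dir l with hv
  have hvn : ‖v‖ = ε := norm_smul_dir hε0 l
  have hv1 : ‖v‖ ≤ 1 := by rw [hvn]; exact hε.2
  have hoc : Continuous fun ξ => osc a (ξ - v) := (continuous_osc a).comp (continuous_id.sub continuous_const)
  have hdqm : StronglyMeasurable (dq ε l G) :=
    ((hm.comp_measurable (measurable_id.sub_const _)).sub hm).const_mul _
  set F₁ : Plane → ℂ := fun ξ => (smoothRiesz i (ξ - v) : ℂ) * (osc a (ξ - v) * dq ε l G ξ) with hF₁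
  set F₂ : Plane → ℂ := fun ξ => (smoothRiesz i ξ : ℂ) * (dq ε l (osc a) ξ * G ξ) with hF₂
  set F₃ : Plane → ℂ := fun ξ => ((ε⁻¹ * (smoothRiesz i (ξ - v) - smoothRiesz i ξ) : ℝ) : ℂ)
    * (osc a (ξ - v) * G ξ) with hF₃
  have e : dq ε l (low a G i) = fun ξ => (F₁ ξ + F₂ ξ) + F₃ ξ := by
    ext ξ
    simp only [hF₁, hF₂, hF₃, dq, low, ← hv]
    push_cast
    ring
  have m₁ : StronglyMeasurable F₁ := stronglyMeasurable_ofReal_mul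
    ((measurable_smoothRiesz i).comp (measurable_id.sub_const _)) (hoc.stronglyMeasurable.mul hdqm)
  have m₂ : StronglyMeasurable F₂ := stronglyMeasurable_ofReal_mul (measurable_smoothRiesz i)
    (((hoc.sub (continuous_osc a)).const_mul _).stronglyMeasurable.mul hm)
  have m₃ : StronglyMeasurable F₃ := stronglyMeasurable_ofReal_mul
    ((((measurable_smoothRiesz i).comp (measurable_id.sub_const _)).sub
      (measurable_smoothRiesz i)).const_mul _) (hoc.stronglyMeasurable.mul hm)
  have hdq1 : Integrable (dq ε l G) := ((hi.comp_sub_right _).sub hi).const_mul _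
  have hdq2 : MemLp (dq ε l G) 2 := by
    have h3 : MemLp (fun ξ => G (ξ - ε • dir l)) 2 :=
      hG.tame.mem.comp_measurePreserving (measurePreserving_sub_right volume _)
    exact (h3.sub hG.tame.mem).const_mul _
  have hdqN : eLpNorm (dq ε l G) 2 volume ≤ ENNReal.ofReal (C * X ^ 2) := by
    rw [← eLpNorm_fourierInv hdq1 hdq2, fourierInv_dq hi]
    exact hw
  obtain ⟨i₁, n₁⟩ := eLpNorm_fourierInv_le_of_weight (c := 8) hp.le (by norm_num) (by positivity)
    m₁.aestronglyMeasurable hdqm.aestronglyMeasurable hdqN (fun ξ => by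
      rw [hF₁, norm_mul, norm_mul, norm_osc, one_mul, Complex.norm_real, ← mul_assoc]
      gcongr
      exact abs_smoothRiesz_sub_le_decay i ξ v hv1)
  obtain ⟨i₂, n₂⟩ := eLpNorm_fourierInv_le_of_weight (c := 8 * (2 * Real.pi * T)) hp.le (by positivity)
    (by positivity) m₂.aestronglyMeasurable hm.aestronglyMeasurable hG.two (fun ξ => by
      have h1 := norm_osc_sub_le a ξ v
      rw [hvn] at h1
      rw [hF₂, norm_mul, norm_mul, Complex.norm_real, dq, norm_mul, Complex.norm_real,
        Real.norm_of_nonneg (inv_pos.2 hε0).le]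
      have h2 : ε⁻¹ * ‖osc a (ξ - v) - osc a ξ‖ ≤ 2 * Real.pi * T := by
        rw [inv_mul_le_iff₀ hε0]
        refine h1.trans ?_
        calc |a| * (2 * Real.pi * ε) ≤ T * (2 * Real.pi * ε) := by gcongr
          _ = _ := by ring
      calc _ ≤ (8 * (1 + ‖ξ‖) ^ (-2 : ℝ)) * (2 * Real.pi * T * ‖G ξ‖) := by
            refine mul_le_mul (abs_smoothRiesz_le_decay_two i ξ) ?_ (by positivity)
              (by have := one_add_norm_pos ξ; positivity)
            gcongr
        _ = _ := by ring)
  have i₃ : Integrable F₃ := by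
    have : Integrable (dq ε l (low a G i)) := ((hlow.comp_sub_right _).sub hlow).const_mul _
    rw [e] at this
    have h4 := this.sub (i₁.add i₂)
    refine h4.congr (Eventually.of_forall fun ξ => ?_)
    simp only [Pi.sub_apply, Pi.add_apply]
    ring
  have n₃ : eLpNorm (𝓕⁻ F₃) (ENNReal.ofReal p) volume ≤ ENNReal.ofReal (E * (D * (C * X ^ 2))) := by
    refine hs F₃ _ m₃ i₃ (by positivity) fun ξ => ?_
    have h1 := hd ξ v hv1
    rw [hvn] at h1
    rw [hF₃]
    simp only
    rw [norm_mul, norm_mul, norm_osc, one_mul, Complex.norm_real, Real.norm_eq_abs, abs_mul,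
      abs_of_pos (inv_pos.2 hε0)]
    calc _ = ε⁻¹ * (|smoothRiesz i (ξ - v) - smoothRiesz i ξ| * ‖ξ‖) * ‖G ξ‖ := by ring
      _ ≤ ε⁻¹ * (D * ε * ((1 + ‖ξ‖) ^ 5)⁻¹) * (C * X ^ 2) := by
        gcongr
        exact hG.sup ξ
      _ = _ := by field_simp
  have e2 : 𝓕⁻ (dq ε l (low a G i)) = (𝓕⁻ F₁ + 𝓕⁻ F₂) + 𝓕⁻ F₃ := by
    ext x
    rw [e, fourierInv_add' (i₁.fun_add i₂) i₃, fourierInv_add' i₁ i₂]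
    rfl
  have hp1 : 1 ≤ ENNReal.ofReal p := ENNReal.one_le_ofReal.2 (by linarith)
  have c₁ := (continuous_fourierInv i₁).aestronglyMeasurable (μ := (volume : Measure Plane))
  have c₂ := (continuous_fourierInv i₂).aestronglyMeasurable (μ := (volume : Measure Plane))
  have c₃ := (continuous_fourierInv i₃).aestronglyMeasurable (μ := (volume : Measure Plane))
  rw [e2]
  refine (eLpNorm_add_le (c₁.add c₂) c₃ hp1).trans ?_
  refine (add_le_add ((eLpNorm_add_le c₁ c₂ hp1).trans (add_le_add n₁ n₂)) n₃).trans (le_of_eq ?_)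
  rw [← ENNReal.ofReal_add (by positivity) (by positivity),
    ← ENNReal.ofReal_add (by positivity) (by positivity)]
  congr 1
  field_simp

theorem tendsto_wfac (l : Fin 2) (x : Plane) :
    Tendsto (fun ε => wfac ε l x) (𝓝[>] 0) (𝓝 (2 * Real.pi * Complex.I * (x l : ℂ))) := by
  have h1 : HasDerivAt (fun ε : ℝ => (Real.fourierChar (ε * x l) : ℂ))
      (2 * Real.pi * Complex.I * (x l : ℂ)) 0 := by
    have h := (Real.hasDerivAt_fourierChar (0 * x l)).scomp (0 : ℝ)
      ((hasDerivAt_id (0 : ℝ)).mul_const (x l))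
    simp only [zero_mul, one_mul, AddChar.map_zero_eq_one, Circle.coe_one, mul_one] at h
    refine h.congr_deriv ?_
    rw [Complex.real_smul, mul_comm]
  have h2 := (hasDerivAt_iff_tendsto_slope_zero.1 h1).mono_left
    (nhdsWithin_mono (0 : ℝ) fun ε (hε : 0 < ε) => hε.ne')
  refine h2.congr fun ε => ?_
  simp [wfac, Complex.real_smul]

theorem jb_le_one_add_abs (x : Plane) : jb x ≤ 1 + |x 0| + |x 1| := by
  have h : ‖x‖ ^ 2 = x 0 ^ 2 + x 1 ^ 2 := by
    rw [EuclideanSpace.norm_sq_eq]; simp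
  rw [jb, Real.sqrt_le_left (by positivity), h]
  nlinarith [abs_nonneg (x 0), abs_nonneg (x 1), sq_abs (x 0), sq_abs (x 1),
    mul_nonneg (abs_nonneg (x 0)) (abs_nonneg (x 1))]

/-- The weighted estimate for the outputs of quadratic terms. -/
theorem exists_eLpNorm_jb_output_le {p : ℝ} (hp : 2 < p) (i : Fin 2) :
    ∃ C₀ : ℝ, 0 < C₀ ∧ ∀ (C T X a : ℝ) (G : Plane → ℂ), 0 < C → 0 < X → 1 ≤ T → |a| ≤ T →
      QuadBound C T X G →
        eLpNorm (fun x => ((jb x : ℝ) : ℂ) * 𝓕⁻ (low a G i) x) (ENNReal.ofReal p) volume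
          ≤ ENNReal.ofReal (C₀ * (C * X ^ 2)) := by
  choose D hD hd using fun l => exists_eventually_eLpNorm_wfac_output_le hp i l
  have hk := Real.sqrt_nonneg kernelMass
  have hπ := Real.pi_gt_three
  refine ⟨8 * (1 + √kernelMass) + D 0 + D 1, by have := hD 0; have := hD 1; positivity,
    fun C T X a G hC hX hT ha hG => ?_⟩
  have hT0 : 0 < T := by linarith
  have hm := hG.tame.meas
  have hlm := stronglyMeasurable_low a hm i
  obtain ⟨hli, n₀⟩ := eLpNorm_fourierInv_le_of_weight (c := 8) hp.le (by norm_num) (by positivity)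
    hlm.aestronglyMeasurable hm.aestronglyMeasurable
    (hG.two.trans (ENNReal.ofReal_le_ofReal
      (by gcongr; exact div_le_self (by positivity) hT : _ ≤ C * X ^ 2))) (fun ξ => by
      rw [low, norm_mul, norm_mul, norm_osc, one_mul, Complex.norm_real, ← mul_assoc]
      gcongr
      exact abs_smoothRiesz_le_decay_two i ξ)
  have hc := continuous_fourierInv hli
  have n : ∀ l, eLpNorm (fun x => (x l : ℂ) * 𝓕⁻ (low a G i) x) (ENNReal.ofReal p) volume
      ≤ ENNReal.ofReal (D l * (C * X ^ 2)) := by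
    intro l
    -- Fatou along ε = 1/(n + 1) recovers the true weight x_l, because `wfac ε l x` tends to 2πi
    -- x_l; the factor 2π ≥ 1 is discarded.
    have ht : Tendsto (fun n : ℕ => (1 : ℝ) / (n + 1)) atTop (𝓝[>] 0) :=
      tendsto_nhdsWithin_iff.2 ⟨tendsto_one_div_add_atTop_nhds_zero_nat,
        Eventually.of_forall fun n => by simp only [Set.mem_Ioi]; positivity⟩
    have h1 := Lp.eLpNorm_lim_le_liminf_eLpNorm (p := ENNReal.ofReal p) (μ := (volume : Measure Plane))
      (f := fun (n : ℕ) x => wfac (1 / (n + 1)) l x * 𝓕⁻ (low a G i) x)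
      (fun n => ((continuous_wfac _ l).mul hc).aestronglyMeasurable)
      (fun x => 2 * Real.pi * Complex.I * (x l : ℂ) * 𝓕⁻ (low a G i) x)
      (Eventually.of_forall fun x => ((tendsto_wfac l x).comp ht).mul_const _)
    have h2 := h1.trans (liminf_le_of_frequently_le'
      (ht.eventually (hd l C T X a G hC hX hT ha hG)).frequently)
    refine (eLpNorm_mono fun x => ?_).trans h2
    rw [norm_mul, norm_mul _ (𝓕⁻ (low a G i) x), norm_mul]
    gcongr
    refine le_mul_of_one_le_left (norm_nonneg _) ?_
    rw [norm_mul, norm_mul, Complex.norm_I, Complex.norm_real, Real.norm_of_nonneg (by positivity),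
      Complex.norm_ofNat]
    linarith
  have hp1 : 1 ≤ ENNReal.ofReal p := ENNReal.one_le_ofReal.2 (by linarith)
  have hx : ∀ l : Fin 2, AEStronglyMeasurable (fun x : Plane => ‖(x l : ℂ) * 𝓕⁻ (low a G i) x‖) volume :=
    fun l => (((by fun_prop : Continuous fun x : Plane => (x l : ℂ)).mul hc).norm).aestronglyMeasurable
  have h0 : eLpNorm (fun x => ((jb x : ℝ) : ℂ) * 𝓕⁻ (low a G i) x) (ENNReal.ofReal p) volume
      ≤ eLpNorm (((fun x => ‖𝓕⁻ (low a G i) x‖) + fun x : Plane => ‖(x 0 : ℂ) * 𝓕⁻ (low a G i) x‖)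
        + fun x : Plane => ‖(x 1 : ℂ) * 𝓕⁻ (low a G i) x‖) (ENNReal.ofReal p) volume := by
    refine eLpNorm_mono_real fun x => ?_
    simp only [Pi.add_apply, norm_mul, Complex.norm_real, Real.norm_eq_abs]
    rw [abs_of_nonneg (by rw [jb]; positivity)]
    have := mul_le_mul_of_nonneg_right (jb_le_one_add_abs x) (norm_nonneg (𝓕⁻ (low a G i) x))
    linarith
  refine h0.trans ((eLpNorm_add_le (hc.norm.aestronglyMeasurable.add (hx 0)) (hx 1) hp1).trans ?_)
  refine (add_le_add (eLpNorm_add_le hc.norm.aestronglyMeasurable (hx 0) hp1) le_rfl).trans ?_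
  rw [eLpNorm_norm, eLpNorm_norm, eLpNorm_norm]
  refine (add_le_add (add_le_add n₀ (n 0)) (n 1)).trans (le_of_eq ?_)
  have := hD 0
  have := hD 1
  rw [← ENNReal.ofReal_add (by positivity) (by positivity),
    ← ENNReal.ofReal_add (by positivity) (by positivity)]
  congr 1; ring

end Output

/-! ### Nonresonance of the phases and the structure of the interaction symbol. -/

section Symbols

variable {E : Type*} [NormedAddCommGroup E] [NormedSpace ℝ E]

theorem isSymbol_one_add_norm_sq_clm (n : ℕ) (L : E →L[ℝ] Plane) :
    IsSymbol n 0 2 fun x => 1 + ‖L x‖ ^ 2 :=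
  ((IsSymbol.const (1 : ℝ) le_rfl).order_mono zero_le_two).add (isSymbol_norm_sq_clm n L)

/-- On pairs, L sees only some directions, so only the lower bound 1 is available (e = 0) and
derivatives are allowed a loss. The value ρ = 4 is dictated by the quartic `resDen` and is used
throughout for uniformity. -/
theorem isSymbol_jb_clm (n : ℕ) (L : E →L[ℝ] Plane) : IsSymbol n 4 2 fun x => jb (L x) := by
  have h := IsSymbol.sqrt (n := n) (ρ := 4) (d := 2) (e := 0) (c := 1) (by norm_num) one_pos
    (fun n => isSymbol_one_add_norm_sq_clm n L) (fun x => by simp) (by norm_num)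
  exact h.order_mono (by norm_num)

theorem isSymbol_inv_jb_clm (n : ℕ) (L : E →L[ℝ] Plane) : IsSymbol n 4 0 fun x => 1 / jb (L x) := by
  have h := IsSymbol.one_div_sqrt (n := n) (ρ := 4) (d := 2) (e := 0) (c := 1) (by norm_num) one_pos
    (fun n => isSymbol_one_add_norm_sq_clm n L) (fun x => by simp) (by norm_num)
  exact h.order_mono (by norm_num)

theorem isSymbol_coord_clm (n : ℕ) (L : E →L[ℝ] Plane) (j : Fin 2) : IsSymbol n 4 1 fun x => L x j :=
  IsSymbol.clm ((EuclideanSpace.proj j).comp L) (by norm_num)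

/-- The product of the four phases `±⟨p + q⟩ ± ⟨p⟩ ± ⟨q⟩`, up to sign. -/
noncomputable def resDen (p q : Plane) : ℝ :=
  3 + 4 * ‖p‖ ^ 2 + 4 * ‖q‖ ^ 2 + 4 * inner ℝ p q + 4 * (‖p‖ ^ 2 * ‖q‖ ^ 2 - (inner ℝ p q) ^ 2)

/-- The quartic part is a Gram determinant, nonnegative by Cauchy–Schwarz, and the quadratic part
4‖p‖² + 4‖q‖² + 4⟨p, q⟩ is nonnegative. This is the absence of resonances, in any direction and at
any frequency. -/
theorem one_le_resDen (p q : Plane) : 1 ≤ resDen p q := by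
  have h1 := abs_real_inner_le_norm p q
  obtain ⟨h2, h3⟩ := abs_le.1 h1
  have h4 : (inner ℝ p q) ^ 2 ≤ ‖p‖ ^ 2 * ‖q‖ ^ 2 := by
    rw [← mul_pow]
    exact sq_le_sq' h2 h3
  unfold resDen
  nlinarith [sq_nonneg (‖p‖ - ‖q‖), sq_nonneg ‖p‖, sq_nonneg ‖q‖]

theorem isSymbol_inv_resDen (n : ℕ) (L L' : E →L[ℝ] Plane) :
    IsSymbol n 4 0 fun x => 1 / resDen (L x) (L' x) := by
  have hD : ∀ n, IsSymbol n 0 4 fun x => resDen (L x) (L' x) := fun n => by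
    have h1 := isSymbol_norm_sq_clm n L
    have h2 := isSymbol_norm_sq_clm n L'
    have h3 := IsSymbol.bilin (innerSL ℝ) (IsSymbol.clm (n := n) (ρ := 0) L le_rfl)
      (IsSymbol.clm (n := n) (ρ := 0) L' le_rfl)
    have h4 : IsSymbol n 0 2 fun x => inner ℝ (L x) (L' x) := h3.order_mono (by norm_num)
    have h5 : IsSymbol n 0 4 fun x => ‖L x‖ ^ 2 * ‖L' x‖ ^ 2 := (h1.mul h2).order_mono (by norm_num)
    have h6 : IsSymbol n 0 4 fun x => (inner ℝ (L x) (L' x)) ^ 2 :=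
      (h4.pow le_rfl 2).order_mono (by norm_num)
    have h7 := (((((IsSymbol.const (E := E) (n := n) (ρ := 0) (3 : ℝ) le_rfl).order_mono
      (by norm_num : (0 : ℝ) ≤ 4)).add
      ((h1.const_mul 4).order_mono (by norm_num))).add ((h2.const_mul 4).order_mono (by norm_num))).add
      ((h4.const_mul 4).order_mono (by norm_num))).add ((h5.add (h6.const_mul (-1))).const_mul 4)
    convert h7 using 2
    unfold resDen; ring
  have h := IsSymbol.inv (n := n) (ρ := 4) (d := 4) (e := 0) (c := 1) (by norm_num) one_pos hD
    (fun x => by simpa using one_le_resDen (L x) (L' x)) (by norm_num)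
  exact h.order_mono (by norm_num)

/-- The product of the three phases conjugate to the phase of type `(σ, τ)`. -/
noncomputable def conjPhases (σ τ : ℤˣ) (p q : Plane) : ℝ :=
  (jb (p + q) + ((σ : ℤ) : ℝ) * jb p + ((τ : ℤ) : ℝ) * jb q)
    * (jb (p + q) - ((σ : ℤ) : ℝ) * jb p + ((τ : ℤ) : ℝ) * jb q)
    * (jb (p + q) + ((σ : ℤ) : ℝ) * jb p - ((τ : ℤ) : ℝ) * jb q)

theorem jb_sq {V : Type*} [NormedAddCommGroup V] (x : V) : jb x ^ 2 = 1 + ‖x‖ ^ 2 :=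
  Real.sq_sqrt (by positivity)

/-- As in Heron's formula, the product over the signs is (w² - s² - r²)² - 4 s² r², a polynomial in
the squares of the brackets, where w² - s² - r² = 2⟨p, q⟩ - 1. -/
theorem phase_mul_conjPhases (σ τ : ℤˣ) (p q : Plane) :
    phase σ τ (p + q) q * conjPhases σ τ p q = -resDen p q := by
  have h1 := jb_sq (p + q)
  have h2 := jb_sq p
  have h3 := jb_sq q
  rw [norm_add_sq_real] at h1
  have hσ : ((σ : ℤ) : ℝ) ^ 2 = 1 := by rcases Int.units_eq_one_or σ with rfl | rfl <;> simp
  have hτ : ((τ : ℤ) : ℝ) ^ 2 = 1 := by rcases Int.units_eq_one_or τ with rfl | rfl <;> simp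
  rw [phase, add_sub_cancel_right, conjPhases, resDen]
  set w := jb (p + q)
  set s := jb p
  set r := jb q
  set a := ((σ : ℤ) : ℝ)
  set b := ((τ : ℤ) : ℝ)
  have e : (w - a * s - b * r) * ((w + a * s + b * r) * (w - a * s + b * r) * (w + a * s - b * r))
      = (w ^ 2 - a ^ 2 * s ^ 2 - b ^ 2 * r ^ 2) ^ 2 - 4 * (a ^ 2 * s ^ 2) * (b ^ 2 * r ^ 2) := by ring
  rw [e, hσ, hτ, h1, h2, h3]
  ring

theorem inv_phase (σ τ : ℤˣ) (p q : Plane) :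
    (phase σ τ (p + q) q)⁻¹ = -(conjPhases σ τ p q * (1 / resDen p q)) := by
  have h := phase_mul_conjPhases σ τ p q
  have hQ : resDen p q ≠ 0 := by linarith [one_le_resDen p q]
  refine inv_eq_of_mul_eq_one_right ?_
  rw [mul_neg, ← mul_assoc, h]
  field_simp

theorem isSymbol_conjPhases (n : ℕ) (σ τ : ℤˣ) (L L' : E →L[ℝ] Plane) :
    IsSymbol n 4 6 fun x => conjPhases σ τ (L x) (L' x) := by
  have h1 : IsSymbol n 4 2 fun x => jb (L x + L' x) := isSymbol_jb_clm n (L + L')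
  have key : ∀ a b : ℝ, IsSymbol n 4 2 fun x => jb (L x + L' x) + a * jb (L x) + b * jb (L' x) :=
    fun a b => (h1.add ((isSymbol_jb_clm n L).const_mul a)).add ((isSymbol_jb_clm n L').const_mul b)
  have h2 := ((key σ τ).mul (key (-σ) τ)).mul (key σ (-τ))
  have h3 := h2.order_mono (m' := 6) (by norm_num)
  simpa only [conjPhases, neg_mul, ← sub_eq_add_neg, sub_add_eq_add_sub] using h3

/-- The part of the symbol `m₀` at the directions `i, j, k` of `p + q`, `p` and `q`. -/
noncomputable def epBracket (c : Fin 4 → ℂ) (i j k : Fin 2) (p q : Plane) : ℂ :=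
  c 0 * ((if i = k then p j * (jb (p + q) * (1 / jb p)) else 0 : ℝ) : ℂ)
    + c 1 * ((if i = j then q k * (jb (p + q) * (1 / jb q)) else 0 : ℝ) : ℂ)
    + c 2 * (((p + q) i * (p j * (1 / jb p)) * (q k * (1 / jb q)) : ℝ) : ℂ)
    + c 3 * ((if j = k then (p + q) i else 0 : ℝ) : ℂ)

theorem isSymbol_epBracket (n : ℕ) (c : Fin 4 → ℂ) (i j k : Fin 2) (L L' : E →L[ℝ] Plane) :
    IsSymbol n 4 3 fun x => epBracket c i j k (L x) (L' x) := by
  have h4 : (0 : ℝ) ≤ 4 := by norm_num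
  have hw : IsSymbol n 4 2 fun x => jb (L x + L' x) := isSymbol_jb_clm n (L + L')
  have hwi : IsSymbol n 4 1 fun x => (L x + L' x) i := isSymbol_coord_clm n (L + L') i
  have hp := isSymbol_coord_clm n L j
  have hq := isSymbol_coord_clm n L' k
  have hs := isSymbol_inv_jb_clm n L
  have hr := isSymbol_inv_jb_clm n L'
  have hz : IsSymbol n 4 3 fun _ : E => (0 : ℝ) := (IsSymbol.const 0 h4).order_mono (by norm_num)
  refine ((IsSymbol.add ?_ ?_).add ?_).add ?_
  · refine (IsSymbol.ofReal ?_).const_mul _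
    split_ifs
    · exact (hp.mul (hw.mul hs)).order_mono (by norm_num)
    · exact hz
  · refine (IsSymbol.ofReal ?_).const_mul _
    split_ifs
    · exact (hq.mul (hw.mul hr)).order_mono (by norm_num)
    · exact hz
  · exact (IsSymbol.ofReal (((hwi.mul (hp.mul hs)).mul (hq.mul hr)).order_mono (by norm_num))).const_mul _
  · refine (IsSymbol.ofReal ?_).const_mul _
    split_ifs
    · exact hwi.order_mono (by norm_num)
    · exact hz

theorem norm_eq_sum_riesz (p : Plane) : ‖p‖ = riesz 0 p * p 0 + riesz 1 p * p 1 := by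
  rcases eq_or_ne p 0 with rfl | h
  · simp
  have hp : ‖p‖ ≠ 0 := norm_ne_zero_iff.2 h
  have h2 : ‖p‖ ^ 2 = p 0 ^ 2 + p 1 ^ 2 := by rw [EuclideanSpace.norm_sq_eq]; simp
  rw [riesz, riesz]
  field_simp
  linarith

theorem inner_div_eq_sum_riesz (p q : Plane) :
    inner ℝ p q / (‖p‖ * ‖q‖) = riesz 0 p * riesz 0 q + riesz 1 p * riesz 1 q := by
  have h : inner ℝ p q = p 0 * q 0 + p 1 * q 1 := by
    simp [PiLp.inner_apply, Fin.sum_univ_two, mul_comm]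
  rw [h, riesz, riesz, riesz, riesz, div_mul_div_comm, div_mul_div_comm, add_div]

/-- Each cosine is a sum of products of two Riesz symbols, and each norm is the sum of Riesz symbols
times coordinates. Every term thus contains one Riesz symbol in each of the three variables, and
what remains, `epBracket`, is smooth. -/
theorem m₀_eq_sum (c : Fin 4 → ℂ) (p q : Plane) :
    m₀ c (p + q) q = ∑ i, ∑ j, ∑ k, ((riesz i (p + q) * riesz j p * riesz k q : ℝ) : ℂ)
      * epBracket c i j k p q := by
  rw [m₀, add_sub_cancel_right, inner_div_eq_sum_riesz, inner_div_eq_sum_riesz, inner_div_eq_sum_riesz]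
  have h1 := norm_eq_sum_riesz (p + q)
  have h2 := norm_eq_sum_riesz p
  have h3 := norm_eq_sum_riesz q
  rw [h1, h2, h3]
  simp only [Fin.sum_univ_two, epBracket]
  simp
  ring

theorem riesz_freq (j : Fin 2) (ξ : Plane) : riesz j (freq ξ) = riesz j ξ := by
  have hπ : (0 : ℝ) < 2 * Real.pi := by have := Real.pi_pos; positivity
  rw [riesz, riesz, freq, norm_smul, Real.norm_of_nonneg hπ.le, PiLp.smul_apply, smul_eq_mul,
    mul_div_mul_left _ _ hπ.ne']

/-- The symbol of the quadratic boundary term at the directions `i, j, k`, with the weight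
`(1 + ‖ξ‖²) ^ κ` on the output. -/
noncomputable def epSymbol (c : Fin 4 → ℂ) (σ τ : ℤˣ) (κ : ℕ) (i j k : Fin 2) (Y : PlanePair) : ℂ :=
  (((1 + ‖Y.fst + Y.snd‖ ^ 2) ^ κ : ℝ) : ℂ) * ((-Complex.I)
    * (epBracket c i j k (freq Y.fst) (freq Y.snd)
      * ((conjPhases σ τ (freq Y.fst) (freq Y.snd) * (1 / resDen (freq Y.fst) (freq Y.snd)) : ℝ) : ℂ)))

theorem isSymbol_epSymbol (c : Fin 4 → ℂ) (σ τ : ℤˣ) (κ : ℕ) (i j k : Fin 2) :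
    IsSymbol 6 4 (9 + 2 * κ) (epSymbol c σ τ κ i j k) := by
  have h4 : (0 : ℝ) ≤ 4 := by norm_num
  let L : PlanePair →L[ℝ] Plane := (2 * Real.pi) • WithLp.fstL 2 ℝ Plane Plane
  let L' : PlanePair →L[ℝ] Plane := (2 * Real.pi) • WithLp.sndL 2 ℝ Plane Plane
  have h1 := ((isSymbol_one_add_norm_sq_clm 6 (WithLp.fstL 2 ℝ Plane Plane
    + WithLp.sndL 2 ℝ Plane Plane)).pow le_rfl κ).mono le_rfl h4 le_rfl
  have h2 := (isSymbol_epBracket 6 c i j k L L').mul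
    ((isSymbol_conjPhases 6 σ τ L L').mul (isSymbol_inv_resDen 6 L L')).ofReal
  exact (h1.ofReal.mul (h2.const_mul (-Complex.I))).order_mono (by linarith)

theorem freq_sub_add (ξ η : Plane) : freq (ξ - η) + freq η = freq ξ := by
  rw [freq, freq, freq, ← smul_add, sub_add_cancel]

theorem m₀_div_phase (c : Fin 4 → ℂ) (σ τ : ℤˣ) (ξ η : Plane) :
    m₀ c (freq ξ) (freq η) / (-Complex.I * ((phase σ τ (freq ξ) (freq η) : ℝ) : ℂ))
      = ∑ i, ∑ j, ∑ k, ((riesz i ξ * riesz j (ξ - η) * riesz k η : ℝ) : ℂ)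
        * epSymbol c σ τ 0 i j k (pr (ξ - η) η) := by
  have h1 := m₀_eq_sum c (freq (ξ - η)) (freq η)
  have h2 := inv_phase σ τ (freq (ξ - η)) (freq η)
  rw [freq_sub_add] at h1 h2
  simp only [riesz_freq] at h1
  rw [h1, div_eq_mul_inv, mul_inv, ← Complex.ofReal_inv, h2, Finset.sum_mul]
  refine Finset.sum_congr rfl fun i _ => ?_
  rw [Finset.sum_mul]
  refine Finset.sum_congr rfl fun j _ => ?_
  rw [Finset.sum_mul]
  refine Finset.sum_congr rfl fun k _ => ?_
  rw [epSymbol, pr_fst, pr_snd, pow_zero, inv_neg, Complex.inv_I]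
  push_cast
  ring

end Symbols

/-! ### The boundary term as a sum of quadratic terms, and its three estimates. -/

section Boundary

/-- The types of quadratic interactions: two signs, and the directions of output and inputs. -/
abbrev TermIndex : Type := ℤˣ × ℤˣ × Fin 2 × Fin 2 × Fin 2

/-- The quadratic term of type `x`, with the weight `(1 + ‖ξ‖²) ^ κ`, before the output factors. -/
noncomputable def quadTerm (c : ℤˣ → ℤˣ → Fin 4 → ℂ) (F : Plane → ℂ) (t : ℝ) (κ : ℕ)
    (x : TermIndex) : Plane → ℂ :=
  bil (epSymbol (c x.1 x.2.1) x.1 x.2.1 κ x.2.2.1 x.2.2.2.1 x.2.2.2.2)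
    (mode (((x.1 : ℤ) : ℝ) * t) (signed x.1 F) 0 x.2.2.2.1)
    (mode (((x.2.1 : ℤ) : ℝ) * t) (signed x.2.1 F) 0 x.2.2.2.2)

theorem epSymbol_eq_mul (c : Fin 4 → ℂ) (σ τ : ℤˣ) (κ : ℕ) (i j k : Fin 2) (ξ η : Plane) :
    epSymbol c σ τ κ i j k (pr (ξ - η) η)
      = (((1 + ‖ξ‖ ^ 2) ^ κ : ℝ) : ℂ) * epSymbol c σ τ 0 i j k (pr (ξ - η) η) := by
  simp only [epSymbol, pr_fst, pr_snd, sub_add_cancel, pow_zero, Complex.ofReal_one, one_mul]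

theorem quadTerm_eq_mul (c : ℤˣ → ℤˣ → Fin 4 → ℂ) (F : Plane → ℂ) (t : ℝ) (κ : ℕ) (x : TermIndex)
    (ξ : Plane) :
    quadTerm c F t κ x ξ = (((1 + ‖ξ‖ ^ 2) ^ κ : ℝ) : ℂ) * quadTerm c F t 0 x ξ := by
  rw [quadTerm, quadTerm, bil, bil, ← integral_const_mul]
  congr 1; ext η
  rw [epSymbol_eq_mul]
  ring

/-- The oscillation separates: the two input factors turn the profiles back into the decaying
solution, and the output factor is the propagator that makes g a profile. -/
theorem exp_phase (t : ℝ) (σ τ : ℤˣ) (ξ η : Plane) :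
    Complex.exp (-Complex.I * ((t * phase σ τ (freq ξ) (freq η) : ℝ) : ℂ))
      = osc (-t) ξ * (osc (((σ : ℤ) : ℝ) * t) (ξ - η) * osc (((τ : ℤ) : ℝ) * t) η) := by
  have h : freq ξ - freq η = freq (ξ - η) := by rw [freq, freq, freq, ← smul_sub]
  rw [osc, osc, osc, ← Complex.exp_add, ← Complex.exp_add, phase, h]
  congr 1
  push_cast
  ring

variable {c : ℤˣ → ℤˣ → Fin 4 → ℂ} {h : ℝ → L2} {t : ℝ}

theorem boundaryIntegrand_eq (c : ℤˣ → ℤˣ → Fin 4 → ℂ) (h : ℝ → L2) (t : ℝ) (σ τ : ℤˣ) (ξ η : Plane) :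
    boundaryIntegrand c h t σ τ ξ η = ∑ i, ∑ j, ∑ k, (osc (-t) ξ * (riesz i ξ : ℂ))
      * (epSymbol (c σ τ) σ τ 0 i j k (pr (ξ - η) η)
        * (mode (((σ : ℤ) : ℝ) * t) (signed σ (𝓕 (profile h t) : L2)) 0 j (ξ - η)
          * mode (((τ : ℤ) : ℝ) * t) (signed τ (𝓕 (profile h t) : L2)) 0 k η)) := by
  rw [boundaryIntegrand, m₀_div_phase, exp_phase, Finset.mul_sum, Finset.sum_mul, Finset.sum_mul]
  refine Finset.sum_congr rfl fun i _ => ?_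
  rw [Finset.mul_sum, Finset.sum_mul, Finset.sum_mul]
  refine Finset.sum_congr rfl fun j _ => ?_
  rw [Finset.mul_sum, Finset.sum_mul, Finset.sum_mul]
  refine Finset.sum_congr rfl fun k _ => ?_
  simp only [mode, mul_zero, pow_zero, mul_one]
  push_cast
  ring

/-- Absolute convergence of the integrals defining the quadratic terms. -/
def QuadIntegrable (c : ℤˣ → ℤˣ → Fin 4 → ℂ) (F : Plane → ℂ) (t : ℝ) : Prop :=
  ∀ (x : TermIndex) (ξ : Plane), Integrable fun η =>
    epSymbol (c x.1 x.2.1) x.1 x.2.1 0 x.2.2.1 x.2.2.2.1 x.2.2.2.2 (pr (ξ - η) η)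
      * (mode (((x.1 : ℤ) : ℝ) * t) (signed x.1 F) 0 x.2.2.2.1 (ξ - η)
        * mode (((x.2.1 : ℤ) : ℝ) * t) (signed x.2.1 F) 0 x.2.2.2.2 η)

theorem QuadIntegrable.boundaryIntegrand (hq : QuadIntegrable c (𝓕 (profile h t) : L2) t)
    (σ τ : ℤˣ) (ξ : Plane) : Integrable (boundaryIntegrand c h t σ τ ξ) := by
  rw [funext fun η => boundaryIntegrand_eq c h t σ τ ξ η]
  exact integrable_finsetSum _ fun i _ => integrable_finsetSum _ fun j _ =>
    integrable_finsetSum _ fun k _ => (hq (σ, τ, i, j, k) ξ).const_mul _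

theorem QuadIntegrable.boundaryHat_eq (hq : QuadIntegrable c (𝓕 (profile h t) : L2) t) (ξ : Plane) :
    boundaryHat c h t ξ = ∑ x : TermIndex, (osc (-t) ξ * (riesz x.2.2.1 ξ : ℂ))
      * quadTerm c (𝓕 (profile h t) : L2) t 0 x ξ := by
  simp only [Fintype.sum_prod_type]
  rw [boundaryHat]
  refine Finset.sum_congr rfl fun σ _ => Finset.sum_congr rfl fun τ _ => ?_
  rw [integral_congr_ae (Filter.Eventually.of_forall fun η => boundaryIntegrand_eq c h t σ τ ξ η)]
  have hi : ∀ i j k, Integrable fun η => (osc (-t) ξ * (riesz i ξ : ℂ))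
      * (epSymbol (c σ τ) σ τ 0 i j k (pr (ξ - η) η)
        * (mode (((σ : ℤ) : ℝ) * t) (signed σ (𝓕 (profile h t) : L2)) 0 j (ξ - η)
          * mode (((τ : ℤ) : ℝ) * t) (signed τ (𝓕 (profile h t) : L2)) 0 k η)) :=
    fun i j k => (hq (σ, τ, i, j, k) ξ).const_mul _
  rw [integral_finsetSum _ fun i _ => integrable_finsetSum _ fun j _ =>
    integrable_finsetSum _ fun k _ => hi i j k]
  refine Finset.sum_congr rfl fun i _ => ?_
  rw [integral_finsetSum _ fun j _ => integrable_finsetSum _ fun k _ => hi i j k]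
  refine Finset.sum_congr rfl fun j _ => ?_
  rw [integral_finsetSum _ fun k _ => hi i j k]
  refine Finset.sum_congr rfl fun k _ => ?_
  rw [integral_const_mul]
  rfl

/-- The weight κ = 6 inside the quadratic term exactly undoes the six resolvents of `low`, so the
output estimate, which needs a smoothing symbol, applies to g itself. -/
theorem QuadIntegrable.boundaryHat_eq_low (hq : QuadIntegrable c (𝓕 (profile h t) : L2) t) :
    boundaryHat c h t = fun ξ => ∑ x : TermIndex,
      low (-t) (quadTerm c (𝓕 (profile h t) : L2) t 6 x) x.2.2.1 ξ := by
  ext ξ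
  rw [hq.boundaryHat_eq]
  refine Finset.sum_congr rfl fun x _ => ?_
  have h1 : ((1 + ‖ξ‖ ^ 2 : ℝ) : ℂ) ≠ 0 := by
    exact_mod_cast (by positivity : (0 : ℝ) < 1 + ‖ξ‖ ^ 2).ne'
  rw [low, quadTerm_eq_mul c _ t 6, smoothRiesz]
  push_cast at h1 ⊢
  field_simp

theorem QuadIntegrable.norm_boundaryHat_le (hq : QuadIntegrable c (𝓕 (profile h t) : L2) t) (κ : ℕ)
    (ξ : Plane) : (1 + ‖ξ‖ ^ 2) ^ κ * ‖boundaryHat c h t ξ‖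
      ≤ ∑ x : TermIndex, ‖quadTerm c (𝓕 (profile h t) : L2) t κ x ξ‖ := by
  rw [hq.boundaryHat_eq]
  refine (mul_le_mul_of_nonneg_left (norm_sum_le _ _) (by positivity)).trans ?_
  rw [Finset.mul_sum]
  refine Finset.sum_le_sum fun x _ => ?_
  rw [quadTerm_eq_mul c _ t κ, norm_mul, norm_mul, norm_mul, norm_osc, one_mul, Complex.norm_real,
    Complex.norm_real, Real.norm_of_nonneg (by positivity : (0 : ℝ) ≤ (1 + ‖ξ‖ ^ 2) ^ κ)]
  gcongr
  exact mul_le_of_le_one_left (norm_nonneg _) (abs_riesz_le _ ξ)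

/-- Bounds on both signed versions of the profile. -/
def ProfileBounds (M₁ M₂ : ℕ) (p T t X : ℝ) (F : Plane → ℂ) : Prop :=
  ∀ σ : ℤˣ, ProfileBound M₁ M₂ p T (((σ : ℤ) : ℝ) * t) X (signed σ F)

theorem ProfileBounds.one_le_T {M₁ M₂ : ℕ} {p T X : ℝ} {F : Plane → ℂ}
    (hP : ProfileBounds M₁ M₂ p T t X F) : 1 ≤ T := (hP 1).one_le_T

theorem ProfileBounds.X_pos {M₁ M₂ : ℕ} {p T X : ℝ} {F : Plane → ℂ}
    (hP : ProfileBounds M₁ M₂ p T t X F) : 0 < X := (hP 1).X_pos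

theorem ProfileBounds.abs_le {M₁ M₂ : ℕ} {p T X : ℝ} {F : Plane → ℂ}
    (hP : ProfileBounds M₁ M₂ p T t X F) : |-t| ≤ T := by
  have := (hP (-1)).abs_le
  simpa using this

theorem eLpNorm_norm_sum_le {ι : Type*} (s : Finset ι) {f : ι → Plane → ℂ} {N : ι → ℝ}
    {r : ℝ≥0∞} (hr : 1 ≤ r) (hN : ∀ x ∈ s, 0 ≤ N x) (hm : ∀ x ∈ s, AEStronglyMeasurable (f x))
    (hf : ∀ x ∈ s, eLpNorm (f x) r volume ≤ ENNReal.ofReal (N x)) :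
    eLpNorm (fun ξ => ∑ x ∈ s, ‖f x ξ‖) r volume ≤ ENNReal.ofReal (∑ x ∈ s, N x) := by
  have e : (fun ξ => ∑ x ∈ s, ‖f x ξ‖) = ∑ x ∈ s, fun ξ => ‖f x ξ‖ := by
    ext ξ; rw [Finset.sum_apply]
  rw [e, ENNReal.ofReal_sum_of_nonneg hN]
  refine (eLpNorm_sum_le (fun x hx => (hm x hx).norm) hr).trans (Finset.sum_le_sum fun x hx => ?_)
  rw [eLpNorm_norm]
  exact hf x hx

theorem stronglyMeasurable_quadTerm {F : Plane → ℂ}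
    (hF : ∀ σ, StronglyMeasurable (signed σ F)) (κ : ℕ) (x : TermIndex) :
    StronglyMeasurable (quadTerm c F t κ x) :=
  stronglyMeasurable_bil (isSymbol_epSymbol _ _ _ _ _ _ _).1.continuous
    (stronglyMeasurable_mode (hF _) _ _) (stronglyMeasurable_mode (hF _) _ _)

/-- Sobolev estimates for the boundary term, with decay in time. -/
theorem exists_boundaryHat_decay_le {p : ℝ} (hp : 2 < p) (hp4 : p ≤ 9 / 4)
    (c : ℤˣ → ℤˣ → Fin 4 → ℂ) {κ M₁ : ℕ} (hM : 9 * (2 * (25 + κ) + 1) ≤ 5 * M₁) :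
    ∃ C : ℝ, 0 < C ∧ ∀ (M₂ : ℕ) (h : ℝ → L2) (t T X : ℝ),
      ProfileBounds M₁ M₂ p T t X (𝓕 (profile h t) : L2) →
      QuadIntegrable c (𝓕 (profile h t) : L2) t ∧
      eLpNorm (fun ξ => (((1 + ‖ξ‖ ^ 2) ^ κ : ℝ) : ℂ) * boundaryHat c h t ξ) 2 volume
        ≤ ENNReal.ofReal (C * (X ^ 2 / T)) := by
  -- The symbol has order 9 + 2κ and loses 4 per derivative over six derivatives: 9 + 2κ + 24 + 17 =
  -- 2(25 + κ).
  choose D hD hd using fun x : TermIndex => exists_quadBound_bil hp hp4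
    (isSymbol_epSymbol (c x.1 x.2.1) x.1 x.2.1 κ x.2.2.1 x.2.2.2.1 x.2.2.2.2) (B := 25 + κ) (M₁ := M₁)
    (by norm_num) (by push_cast; linarith) x.2.2.2.1 x.2.2.2.2 hM (by omega) (by omega)
  -- The case κ = 0 is used only for the absolute convergence of the defining integrals.
  choose D' hD' hd' using fun x : TermIndex => exists_quadBound_bil hp hp4
    (isSymbol_epSymbol (c x.1 x.2.1) x.1 x.2.1 0 x.2.2.1 x.2.2.2.1 x.2.2.2.2) (B := 25 + κ) (M₁ := M₁)
    (by norm_num) (by push_cast; linarith) x.2.2.2.1 x.2.2.2.2 hM (by omega) (by omega)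
  refine ⟨∑ x, D x, Finset.sum_pos (fun x _ => hD x) Finset.univ_nonempty, fun M₂ h t T X hP => ?_⟩
  have hT : 0 < T := by linarith [hP.one_le_T]
  have hX := hP.X_pos
  have hq : QuadIntegrable c (𝓕 (profile h t) : L2) t := fun x =>
    (hd' x M₂ T X _ _ _ _ (hP x.1) (hP x.2.1)).1
  refine ⟨hq, ?_⟩
  have hB := fun x => (hd x M₂ T X _ _ _ _ (hP x.1) (hP x.2.1)).2
  rw [Finset.sum_mul]
  refine (eLpNorm_mono_real (fun ξ => ?_)).trans (eLpNorm_norm_sum_le Finset.univ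
    (f := fun x => quadTerm c (𝓕 (profile h t) : L2) t κ x) (N := fun x => D x * (X ^ 2 / T))
    (by norm_num) (fun x _ => by have := hD x; positivity)
    (fun x _ => (hB x).tame.meas.aestronglyMeasurable) (fun x _ => (hB x).two))
  rw [norm_mul, Complex.norm_real, Real.norm_of_nonneg (by positivity)]
  exact hq.norm_boundaryHat_le κ ξ

/-- Sobolev estimates for the boundary term, at high regularity. -/
theorem exists_boundaryHat_top_le {p : ℝ} (hp : 2 < p) (hp3 : p < 3)
    (c : ℤˣ → ℤˣ → Fin 4 → ℂ) {κ M₁ M₂ : ℕ} (hM : 9 * (2 * (25 + κ) + 1) ≤ 5 * M₂) (hM₁ : 3 ≤ M₁) :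
    ∃ C : ℝ, 0 < C ∧ ∀ (h : ℝ → L2) (t T X : ℝ),
      ProfileBounds M₁ M₂ p T t X (𝓕 (profile h t) : L2) →
      QuadIntegrable c (𝓕 (profile h t) : L2) t →
      eLpNorm (fun ξ => (((1 + ‖ξ‖ ^ 2) ^ κ : ℝ) : ℂ) * boundaryHat c h t ξ) 2 volume
        ≤ ENNReal.ofReal (C * X ^ 2) := by
  choose D hD hd using fun x : TermIndex => exists_eLpNorm_bil_modes_le hp hp3
    (isSymbol_epSymbol (c x.1 x.2.1) x.1 x.2.1 κ x.2.2.1 x.2.2.2.1 x.2.2.2.2) (B := 25 + κ) (M₁ := M₁)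
    (M₂ := M₂) (by norm_num) (by push_cast; linarith) x.2.2.2.1 x.2.2.2.2 hM (by omega) hM₁ (by omega)
  refine ⟨∑ x, D x, Finset.sum_pos (fun x _ => hD x) Finset.univ_nonempty, fun h t T X hP hq => ?_⟩
  have hX := hP.X_pos
  rw [Finset.sum_mul]
  refine (eLpNorm_mono_real (fun ξ => ?_)).trans (eLpNorm_norm_sum_le Finset.univ
    (f := fun x => quadTerm c (𝓕 (profile h t) : L2) t κ x) (N := fun x => D x * X ^ 2)
    (by norm_num) (fun x _ => by have := hD x; positivity)
    (fun x _ => (stronglyMeasurable_quadTerm (fun σ => (hP σ).meas) κ x).aestronglyMeasurable)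
    (fun x _ => hd x T X _ _ _ _ (hP x.1) (hP x.2.1)))
  rw [norm_mul, Complex.norm_real, Real.norm_of_nonneg (by positivity)]
  exact hq.norm_boundaryHat_le κ ξ

theorem fourierInv_finsetSum {ι : Type*} (s : Finset ι) {f : ι → Plane → ℂ}
    (hf : ∀ x ∈ s, Integrable (f x)) (y : Plane) :
    𝓕⁻ (fun ξ => ∑ x ∈ s, f x ξ) y = ∑ x ∈ s, 𝓕⁻ (f x) y := by
  classical
  induction s using Finset.induction_on with
  | empty => simp [Real.fourierInv_eq]
  | insert a s ha ih =>
    simp only [Finset.sum_insert ha]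
    rw [fourierInv_add' (hf a (by simp)) (integrable_finsetSum _ fun x hx => hf x (by simp [hx])),
      ih fun x hx => hf x (by simp [hx])]

/-- The weighted estimate for the boundary term. -/
theorem exists_boundaryHat_weighted_le {p : ℝ} (hp : 2 < p) (hp4 : p ≤ 9 / 4)
    (c : ℤˣ → ℤˣ → Fin 4 → ℂ) {M₁ : ℕ} (hM : 114 ≤ M₁) :
    ∃ C : ℝ, 0 < C ∧ ∀ (M₂ : ℕ) (h : ℝ → L2) (t T X : ℝ),
      ProfileBounds M₁ M₂ p T t X (𝓕 (profile h t) : L2) →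
      QuadIntegrable c (𝓕 (profile h t) : L2) t → Tame (boundaryHat c h t) ∧
      eLpNorm (fun x => ((jb x : ℝ) : ℂ) * 𝓕⁻ (boundaryHat c h t) x) (ENNReal.ofReal p) volume
        ≤ ENNReal.ofReal (C * X ^ 2) := by
  -- Here B = 25 + 6, and 114 is the least integer M₁ with 9(2 · 31 + 1) ≤ 5 M₁.
  choose D hD hd using fun x : TermIndex => exists_quadBound_bil hp hp4
    (isSymbol_epSymbol (c x.1 x.2.1) x.1 x.2.1 6 x.2.2.1 x.2.2.2.1 x.2.2.2.2) (B := 31) (M₁ := M₁)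
    (by norm_num) (by norm_num) x.2.2.2.1 x.2.2.2.2 (by omega) (by omega) (by omega)
  choose E hE he using fun i : Fin 2 => exists_eLpNorm_jb_output_le hp i
  refine ⟨∑ x : TermIndex, E x.2.2.1 * D x, Finset.sum_pos (fun x _ => mul_pos (hE _) (hD x))
    Finset.univ_nonempty, fun M₂ h t T X hP hq => ?_⟩
  have hT := hP.one_le_T
  have hX := hP.X_pos
  set G := fun x => quadTerm c (𝓕 (profile h t) : L2) t 6 x with hG
  have hB : ∀ x, QuadBound (D x) T X (G x) := fun x =>
    (hd x M₂ T X _ _ _ _ (hP x.1) (hP x.2.1)).2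
  have hl : ∀ x, Tame (low (-t) (G x) x.2.2.1) := fun x => by
    have hm := stronglyMeasurable_low (-t) (hB x).tame.meas x.2.2.1
    exact ⟨hm, (hB x).tame.int.mono hm.aestronglyMeasurable
      (Filter.Eventually.of_forall (norm_low_le _ _ _)), (hB x).tame.mem.mono hm.aestronglyMeasurable
      (Filter.Eventually.of_forall (norm_low_le _ _ _))⟩
  have hw : ∀ x, eLpNorm (fun y => ((jb y : ℝ) : ℂ) * 𝓕⁻ (low (-t) (G x) x.2.2.1) y)
      (ENNReal.ofReal p) volume ≤ ENNReal.ofReal (E x.2.2.1 * D x * X ^ 2) := fun x => by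
    rw [mul_assoc]
    exact he _ _ _ _ _ _ (hD x) hX hT hP.abs_le (hB x)
  rw [hq.boundaryHat_eq_low]
  refine ⟨⟨?_, ?_, ?_⟩, ?_⟩
  · have := Finset.stronglyMeasurable_sum (s := (Finset.univ : Finset TermIndex))
      (f := fun x => low (-t) (G x) x.2.2.1) (fun x _ => (hl x).meas)
    convert this using 1
    ext ξ; rw [Finset.sum_apply]
  · exact integrable_finsetSum _ fun x _ => (hl x).int
  · exact memLp_finsetSum _ fun x _ => (hl x).mem
  · rw [Finset.sum_mul]
    refine (eLpNorm_mono_real (fun y => ?_)).trans (eLpNorm_norm_sum_le Finset.univ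
      (f := fun x y => ((jb y : ℝ) : ℂ) * 𝓕⁻ (low (-t) (G x) x.2.2.1) y)
      (N := fun x => E x.2.2.1 * D x * X ^ 2) (ENNReal.one_le_ofReal.2 (by linarith))
      (fun x _ => by have := hD x; have := hE x.2.2.1; positivity)
      (fun x _ => ?_) (fun x _ => hw x))
    · rw [fourierInv_finsetSum _ fun x _ => (hl x).int, Finset.mul_sum]
      exact norm_sum_le _ _
    · exact ((Complex.continuous_ofReal.comp continuous_jb).mul
        (hl x).continuous_fourierInv).aestronglyMeasurable

end Boundary

/-! ### Boundedness of ⟨∇⟩⁻¹ on L^∞ and the effect of conjugation. -/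

section Profiles

theorem one_le_jb {V : Type*} [NormedAddCommGroup V] (x : V) : 1 ≤ jb x := by
  rw [jb, Real.one_le_sqrt]
  nlinarith [sq_nonneg ‖x‖]

theorem jb_pos {V : Type*} [NormedAddCommGroup V] (x : V) : 0 < jb x := by linarith [one_le_jb x]

theorem sq_mul_inv_le {a : ℝ} (ha : 1 ≤ a) (r : ℝ) : r ^ 2 * ((a ^ 2 + r ^ 2) ^ 2)⁻¹ ≤ (1 + r ^ 2)⁻¹ := by
  have h1 : 1 + r ^ 2 ≤ a ^ 2 + r ^ 2 := by nlinarith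
  have h0 : 0 < 1 + r ^ 2 := by positivity
  rw [← div_eq_mul_inv, div_le_iff₀ (by positivity), inv_mul_eq_div, le_div_iff₀ h0, sq (a ^ 2 + r ^ 2)]
  exact mul_le_mul (by nlinarith) h1 h0.le (by positivity)

theorem integrable_sq_mul_inv {a : ℝ} (ha : 1 ≤ a) :
    Integrable fun r : ℝ => r ^ 2 * ((a ^ 2 + r ^ 2) ^ 2)⁻¹ := by
  refine integrable_inv_one_add_sq.mono' (by fun_prop) (Filter.Eventually.of_forall fun r => ?_)
  rw [Real.norm_of_nonneg (by positivity)]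
  exact sq_mul_inv_le ha r

theorem integral_sq_mul_inv {a : ℝ} (ha : 0 < a) :
    ∫ r : ℝ, r ^ 2 * ((a ^ 2 + r ^ 2) ^ 2)⁻¹ = a⁻¹ * ∫ r : ℝ, r ^ 2 * ((1 + r ^ 2) ^ 2)⁻¹ := by
  have h := Measure.integral_comp_mul_left (fun r : ℝ => r ^ 2 * ((a ^ 2 + r ^ 2) ^ 2)⁻¹) a
  have e : ∀ r : ℝ, (a * r) ^ 2 * ((a ^ 2 + (a * r) ^ 2) ^ 2)⁻¹
      = a⁻¹ ^ 2 * (r ^ 2 * ((1 + r ^ 2) ^ 2)⁻¹) := fun r => by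
    have : 0 < 1 + r ^ 2 := by positivity
    have h2 : a ^ 2 + (a * r) ^ 2 = a ^ 2 * (1 + r ^ 2) := by ring
    rw [h2]
    field_simp
  simp only [e, smul_eq_mul, abs_of_pos (inv_pos.2 ha)] at h
  rw [integral_const_mul] at h
  have ha' := ha.ne'
  field_simp at h ⊢
  linarith

theorem integral_sq_mul_inv_pos : 0 < ∫ r : ℝ, r ^ 2 * ((1 + r ^ 2) ^ 2)⁻¹ := by
  have hi := integrable_sq_mul_inv (a := 1) le_rfl
  simp only [one_pow] at hi
  refine (integral_pos_iff_support_of_nonneg (fun r => by positivity) hi).2 ?_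
  have : Function.support (fun r : ℝ => r ^ 2 * ((1 + r ^ 2) ^ 2)⁻¹) = {0}ᶜ := by
    ext r
    have : 0 < 1 + r ^ 2 := by positivity
    simp [this.ne']
  rw [this, measure_compl (measurableSet_singleton 0) (by simp)]
  simp

theorem continuous_jb_freq : Continuous fun ξ : Plane => jb (freq ξ) := continuous_jb.comp continuous_freq

/-- `⟨∇⟩⁻¹` is bounded on `L^∞`. -/
theorem exists_norm_fourierInv_inv_jb_mul_le : ∃ A : ℝ, 0 < A ∧ ∀ (H : Plane → ℂ) (M : ℝ),
    StronglyMeasurable H → Integrable H → (∀ x, ‖𝓕⁻ H x‖ ≤ M) →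
    ∀ x, ‖𝓕⁻ (fun ξ => (((jb (freq ξ))⁻¹ : ℝ) : ℂ) * H ξ) x‖ ≤ A * M := by
  obtain ⟨κ, A, hκ, eκ⟩ := exists_kernel_resolvent (L := 2) le_rfl
  have hA := hκ.pos
  have hk := kernelMass_pos
  have hπ := Real.pi_pos
  refine ⟨A * kernelMass, by positivity, fun H M hHm hH hM x => ?_⟩
  -- Subordination for a multiplier of order -1, which decays too little for the direct kernel
  -- bound: a⁻¹ = c⁻¹ ∫ r² (a² + r²)^{-2} dr with a = ⟨2πξ⟩. For each r the integrand is r² (1 +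
  -- r²)^{-2} times a dilate of (1 + ‖ξ‖²)^{-2}, whose kernel mass does not depend on r.
  set c := ∫ r : ℝ, r ^ 2 * ((1 + r ^ 2) ^ 2)⁻¹ with hc
  have hc0 : 0 < c := integral_sq_mul_inv_pos
  have hw : ∀ (ξ : Plane) (r : ℝ), 0 ≤ r ^ 2 * ((jb (freq ξ) ^ 2 + r ^ 2) ^ 2)⁻¹ := fun ξ r => by positivity
  set k : Plane × ℝ → ℂ := fun z => (Real.fourierChar (inner ℝ z.1 x) : ℂ)
    * (((z.2 ^ 2 * ((jb (freq z.1) ^ 2 + z.2 ^ 2) ^ 2)⁻¹ : ℝ) : ℂ) * H z.1) with hkdef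
  have hjm : Measurable fun z : Plane × ℝ => jb (freq z.1) := continuous_jb_freq.measurable.comp measurable_fst
  have hki : Integrable k (volume.prod volume) := by
    refine (hH.norm.mul_prod integrable_inv_one_add_sq).mono' ?_ (Filter.Eventually.of_forall fun z => ?_)
    · refine ((stronglyMeasurable_fourierChar_inner measurable_fst measurable_const).mul
        (StronglyMeasurable.mul ?_ (hHm.comp_measurable measurable_fst))).aestronglyMeasurable
      refine (Complex.measurable_ofReal.comp ?_).stronglyMeasurable
      fun_prop
    · rw [hkdef]
      simp only
      rw [norm_mul, norm_mul, Circle.norm_coe, one_mul, Complex.norm_real, Real.norm_of_nonneg (hw _ _),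
        mul_comm]
      gcongr
      exact sq_mul_inv_le (one_le_jb _) _
  have e1 : 𝓕⁻ (fun ξ => (((jb (freq ξ))⁻¹ : ℝ) : ℂ) * H ξ) x
      = (c : ℂ)⁻¹ * ∫ ξ, ∫ r : ℝ, k (ξ, r) := by
    rw [Real.fourierInv_eq, ← integral_const_mul]
    congr 1; ext ξ
    rw [hkdef]
    simp only
    rw [integral_const_mul, integral_mul_const, integral_complex_ofReal, integral_sq_mul_inv (jb_pos _),
      Circle.smul_def, smul_eq_mul, ← hc]
    have : (c : ℂ) ≠ 0 := by exact_mod_cast hc0.ne'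
    push_cast
    field_simp
  have e2 : ∀ r : ℝ, ‖∫ ξ, k (ξ, r)‖ ≤ A * kernelMass * M * (r ^ 2 * ((1 + r ^ 2) ^ 2)⁻¹) := fun r => by
    have hr : 0 < 1 + r ^ 2 := by positivity
    set s := 2 * Real.pi / √(1 + r ^ 2) with hs
    have h1 : ∀ ξ : Plane, r ^ 2 * ((jb (freq ξ) ^ 2 + r ^ 2) ^ 2)⁻¹
        = r ^ 2 * ((1 + r ^ 2) ^ 2)⁻¹ * ((1 + ‖s • ξ‖ ^ 2) ^ 2)⁻¹ := fun ξ => by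
      have h2 : jb (freq ξ) ^ 2 + r ^ 2 = (1 + r ^ 2) * (1 + ‖s • ξ‖ ^ 2) := by
        rw [jb_sq, freq, norm_smul, norm_smul, mul_pow, mul_pow, hs, Real.norm_eq_abs, Real.norm_eq_abs,
          sq_abs, sq_abs, div_pow, Real.sq_sqrt hr.le]
        field_simp
        ring
      rw [h2, mul_pow, mul_inv, mul_assoc]
    have h3 : ∫ ξ, k (ξ, r) = ((r ^ 2 * ((1 + r ^ 2) ^ 2)⁻¹ : ℝ) : ℂ) * avg κ (𝓕⁻ H) s x := by
      rw [← fourierInv_mul_eq_avg hκ hH eκ, Real.fourierInv_eq, ← integral_const_mul]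
      congr 1; ext ξ
      rw [hkdef]
      simp only
      rw [h1, Circle.smul_def, smul_eq_mul]
      push_cast
      ring
    rw [h3, norm_mul, Complex.norm_real, Real.norm_of_nonneg (by positivity), mul_comm]
    exact mul_le_mul_of_nonneg_right (norm_avg_le hκ hM x) (by positivity)
  rw [e1, integral_integral_swap hki, norm_mul, norm_inv, Complex.norm_real, Real.norm_of_nonneg hc0.le]
  have hi := integrable_sq_mul_inv (a := 1) le_rfl
  simp only [one_pow] at hi
  have e3 := norm_integral_le_of_norm_le (hi.const_mul (A * kernelMass * M)) (Filter.Eventually.of_forall e2)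
  rw [integral_const_mul, ← hc] at e3
  rw [inv_mul_le_iff₀ hc0]
  linarith

theorem fourierInv_conj_neg (G : Plane → ℂ) (x : Plane) :
    𝓕⁻ (fun ξ => (starRingEnd ℂ) (G (-ξ))) x = (starRingEnd ℂ) (𝓕⁻ G x) := by
  rw [Real.fourierInv_eq, Real.fourierInv_eq, ← integral_conj, ← integral_neg_eq_self]
  congr 1; ext ξ
  rw [neg_neg, inner_neg_left, Circle.smul_def, Circle.smul_def, smul_eq_mul, smul_eq_mul, map_mul,
    AddChar.map_neg_eq_inv, Circle.coe_inv_eq_conj]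

theorem stronglyMeasurable_signed {F : Plane → ℂ} (hF : StronglyMeasurable F) (σ : ℤˣ) :
    StronglyMeasurable (signed σ F) := by
  unfold signed
  split_ifs
  · exact hF
  · exact (Complex.continuous_conj.comp_stronglyMeasurable (hF.comp_measurable measurable_neg))

theorem SobolevBound.signed {M : ℕ} {N : ℝ} {F : Plane → ℂ} (h : SobolevBound M N F)
    (hF : StronglyMeasurable F) (σ : ℤˣ) : SobolevBound M N (signed σ F) := by
  rcases Int.units_eq_one_or σ with rfl | rfl
  · simpa [EulerPoisson.signed, SobolevBound] using h
  · refine le_trans (le_of_eq ?_) h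
    have hm : AEStronglyMeasurable (fun ξ : Plane => (((1 + ‖ξ‖) ^ M : ℝ) : ℂ) * F ξ) volume :=
      (by fun_prop : Continuous fun ξ : Plane => (((1 + ‖ξ‖) ^ M : ℝ) : ℂ)).aestronglyMeasurable.mul
        hF.aestronglyMeasurable
    rw [← eLpNorm_comp_measurePreserving hm (Measure.measurePreserving_neg (volume : Measure Plane))]
    refine eLpNorm_congr_norm_ae (Filter.Eventually.of_forall fun ξ => ?_)
    simp [EulerPoisson.signed]

theorem fourierInv_signed (G : Plane → ℂ) (σ : ℤˣ) (x : Plane) :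
    ‖𝓕⁻ (signed σ G) x‖ = ‖𝓕⁻ G x‖ := by
  rcases Int.units_eq_one_or σ with rfl | rfl
  · have : signed 1 G = G := by ext ξ; simp [signed]
    rw [this]
  · have : signed (-1) G = fun ξ => (starRingEnd ℂ) (G (-ξ)) := by ext ξ; simp [signed]
    rw [this, fourierInv_conj_neg, RCLike.norm_conj]

theorem freq_neg (ξ : Plane) : freq (-ξ) = -freq ξ := by rw [freq, freq, smul_neg]

theorem jb_neg {V : Type*} [NormedAddCommGroup V] (x : V) : jb (-x) = jb x := by rw [jb, jb, norm_neg]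

/-- Conjugation combined with reflection reverses the sign of the time in the propagator, since the
bracket is even. Both signed profiles therefore inherit the same sup bound. -/
theorem half_osc_signed (t : ℝ) (F : Plane → ℂ) (σ : ℤˣ) :
    (fun ξ => ((‖ξ‖ ^ (1 / 2 : ℝ) : ℝ) : ℂ) * (osc (((σ : ℤ) : ℝ) * t) ξ * signed σ F ξ))
      = signed σ fun ξ => ((‖ξ‖ ^ (1 / 2 : ℝ) : ℝ) : ℂ) * (osc t ξ * F ξ) := by
  ext ξ
  rcases Int.units_eq_one_or σ with rfl | rfl
  · simp [signed]
  · have h1 : ((-1 : ℤˣ) = 1) = False := by simp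
    simp only [signed, h1, if_false, map_mul, Complex.conj_ofReal, norm_neg]
    congr 2
    rw [osc, osc, ← Complex.exp_conj, map_mul, Complex.conj_I, Complex.conj_ofReal, freq_neg, jb_neg]
    congr 1
    push_cast
    ring

end Profiles

/-! ### From the norms of h at a fixed time to bounds on the profile. -/

section Data
open Filter

theorem fourier_ofFourier {F : Plane → ℂ} (hF : MemLp F 2) :
    ((𝓕 (ofFourier F) : L2) : Plane → ℂ) =ᵐ[volume] F := by
  rw [ofFourier, dif_pos hF, FourierTransform.fourier_fourierInv_eq]
  exact hF.coeFn_toLp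

theorem ofFourier_ae_eq {F : Plane → ℂ} (h1 : Integrable F) (h2 : MemLp F 2) :
    (ofFourier F : Plane → ℂ) =ᵐ[volume] 𝓕⁻ F := by
  rw [ofFourier, dif_pos h2]
  exact fourierInv_toLp_ae_eq h1 h2

theorem memLp_osc_mul (t : ℝ) (u : L2) : MemLp (fun ξ => osc t ξ * u ξ) 2 :=
  (Lp.memLp u).mono ((continuous_osc t).aestronglyMeasurable.mul (Lp.aestronglyMeasurable u))
    (Eventually.of_forall fun ξ => by rw [norm_mul, norm_osc, one_mul])

theorem fourier_propagator (t : ℝ) (u : L2) :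
    ((𝓕 (propagator t u) : L2) : Plane → ℂ) =ᵐ[volume] fun ξ => osc t ξ * (𝓕 u : L2) ξ :=
  fourier_ofFourier (memLp_osc_mul t (𝓕 u))

theorem fourierInv_fourier_ae_eq (u : L2) (h1 : Integrable (𝓕 u : L2)) :
    (u : Plane → ℂ) =ᵐ[volume] 𝓕⁻ ((𝓕 u : L2) : Plane → ℂ) := by
  have h := fourierInv_toLp_ae_eq h1 (Lp.memLp (𝓕 u : L2))
  rwa [Lp.toLp_coeFn, FourierTransform.fourierInv_fourier_eq] at h

theorem one_add_norm_le_jb_freq (ξ : Plane) : 1 + ‖ξ‖ ≤ 2 * jb (freq ξ) := by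
  have hπ := Real.pi_gt_three
  have h1 := one_le_jb (freq ξ)
  have h2 : ‖ξ‖ ≤ jb (freq ξ) := by
    rw [jb, freq, norm_smul, Real.norm_of_nonneg (by positivity)]
    refine Real.le_sqrt_of_sq_le ?_
    have : ‖ξ‖ ^ 2 * 1 ≤ ‖ξ‖ ^ 2 * (2 * Real.pi) ^ 2 := by
      gcongr
      nlinarith
    nlinarith
  linarith

theorem sobolevBound_of_sobolevNorm_le {M : ℕ} {s X : ℝ} {u : L2} {F : Plane → ℂ} (hM : (M : ℝ) ≤ s)
    (hF : ∀ᵐ ξ, ‖F ξ‖ = ‖(𝓕 u : L2) ξ‖) (hu : sobolevNorm s u ≤ ENNReal.ofReal X) :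
    SobolevBound M (2 ^ M * X) F := by
  rw [SobolevBound, ENNReal.ofReal_mul (by positivity)]
  refine (eLpNorm_le_mul_eLpNorm_of_ae_le_mul (c := 2 ^ M)
    (g := fun ξ : Plane => ((jb (freq ξ) ^ s : ℝ) : ℂ) * (𝓕 u : L2) ξ) ?_ 2).trans
    (mul_le_mul_right hu _)
  filter_upwards [hF] with ξ hξ
  have h1 := jb_pos (freq ξ)
  rw [norm_mul, norm_mul, hξ, Complex.norm_real, Complex.norm_real,
    Real.norm_of_nonneg (by positivity), Real.norm_of_nonneg (by positivity), ← mul_assoc]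
  gcongr
  calc (1 + ‖ξ‖) ^ M ≤ (2 * jb (freq ξ)) ^ M := by gcongr; exact one_add_norm_le_jb_freq ξ
    _ = 2 ^ M * jb (freq ξ) ^ (M : ℝ) := by rw [mul_pow, Real.rpow_natCast]
    _ ≤ _ := by gcongr; exact one_le_jb _

theorem norm_le_of_eLpNorm_top_le {f : Plane → ℂ} {M : ℝ} (hf : Continuous f) (hM : 0 ≤ M)
    (h : eLpNorm f ∞ volume ≤ ENNReal.ofReal M) (x : Plane) : ‖f x‖ ≤ M := by
  have ho : IsOpen {x | M < ‖f x‖} := isOpen_lt continuous_const hf.norm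
  have h0 : volume {x | M < ‖f x‖} = 0 := by
    rw [eLpNorm_exponent_top] at h
    have h1 := ae_le_eLpNormEssSup (f := f) (μ := (volume : Measure Plane))
    have h2 : ∀ᵐ x, ¬ M < ‖f x‖ := by
      filter_upwards [h1] with x hx
      have := hx.trans h
      rw [← ofReal_norm, ENNReal.ofReal_le_ofReal_iff hM] at this
      exact not_lt.2 this
    simpa [ae_iff] using h2
  rw [ho.measure_eq_zero_iff volume] at h0
  by_contra hx
  have : x ∈ {x | M < ‖f x‖} := lt_of_not_ge hx
  rw [h0] at this
  exact this

theorem le_ofReal_div {a : ℝ≥0∞} {T X : ℝ} (hT : 0 < T)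
    (h : ENNReal.ofReal T * a ≤ ENNReal.ofReal X) : a ≤ ENNReal.ofReal (X / T) := by
  rw [ENNReal.ofReal_div_of_pos hT]
  rw [ENNReal.le_div_iff_mul_le (Or.inl (by simpa using hT)) (Or.inl ENNReal.ofReal_ne_top), mul_comm]
  exact h

theorem norm_freq (ξ : Plane) : ‖freq ξ‖ = 2 * Real.pi * ‖ξ‖ := by
  have hπ := Real.pi_pos
  rw [freq, norm_smul, Real.norm_of_nonneg (by positivity)]

theorem stronglyMeasurable_halfDerivHat (u : L2) : StronglyMeasurable (halfDerivHat u) :=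
  stronglyMeasurable_ofReal_mul ((continuous_freq.measurable.norm.pow_const _).mul
    continuous_jb_freq.measurable) (Lp.stronglyMeasurable _)

theorem norm_halfDerivHat_mul_le (u : L2) (ξ : Plane) : ‖halfDerivHat u ξ‖ * (1 + ‖ξ‖) ^ 2
    ≤ (1 + 2 * Real.pi) ^ 2 * ((1 + ‖ξ‖) ^ 4 * ‖(𝓕 u : L2) ξ‖) := by
  have hπ := Real.pi_gt_three
  have hfq := norm_freq
  have hq := one_le_one_add_norm ξ
  have a1 : ‖freq ξ‖ ^ (1 / 2 : ℝ) ≤ (1 + 2 * Real.pi) * (1 + ‖ξ‖) := by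
    have : ‖freq ξ‖ ≤ (1 + 2 * Real.pi) * (1 + ‖ξ‖) := by rw [hfq]; nlinarith [norm_nonneg ξ]
    calc ‖freq ξ‖ ^ (1 / 2 : ℝ) ≤ ((1 + 2 * Real.pi) * (1 + ‖ξ‖)) ^ (1 / 2 : ℝ) := by gcongr
      _ ≤ ((1 + 2 * Real.pi) * (1 + ‖ξ‖)) ^ (1 : ℝ) :=
        Real.rpow_le_rpow_of_exponent_le (by nlinarith) (by norm_num)
      _ = _ := Real.rpow_one _
  have a2 : jb (freq ξ) ≤ (1 + 2 * Real.pi) * (1 + ‖ξ‖) := by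
    rw [jb, hfq]
    refine Real.sqrt_le_iff.2 ⟨by positivity, ?_⟩
    have h0 := norm_nonneg ξ
    nlinarith [mul_nonneg (by positivity : (0 : ℝ) ≤ Real.pi) h0]
  rw [halfDerivHat, norm_mul, Complex.norm_real, Real.norm_of_nonneg
    (by have := jb_pos (freq ξ); positivity)]
  calc ‖freq ξ‖ ^ (1 / 2 : ℝ) * jb (freq ξ) * ‖(𝓕 u : L2) ξ‖ * (1 + ‖ξ‖) ^ 2
      ≤ ((1 + 2 * Real.pi) * (1 + ‖ξ‖)) * ((1 + 2 * Real.pi) * (1 + ‖ξ‖)) * ‖(𝓕 u : L2) ξ‖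
        * (1 + ‖ξ‖) ^ 2 := by have := (jb_pos (freq ξ)).le; gcongr
    _ = (1 + 2 * Real.pi) ^ 2 * ((1 + ‖ξ‖) ^ 4 * ‖(𝓕 u : L2) ξ‖) := by ring

/-- The four norms at a time `t` control the profile. -/
theorem exists_profileBounds {p δ₁ N' N : ℝ} {M₁ M₂ : ℕ} (h4 : 4 ≤ M₁) (hM₁ : (M₁ : ℝ) ≤ N')
    (hM₂ : (M₂ : ℝ) ≤ N) (hδ1 : δ₁ ≤ 1) :
    ∃ A : ℝ, 0 < A ∧ ∀ (h : ℝ → L2) (t X : ℝ), 0 < X →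
      ENNReal.ofReal (jb t ^ (1 : ℝ)) * halfDerivSupNorm (h t) ≤ ENNReal.ofReal X →
      ENNReal.ofReal (jb t ^ (-δ₁)) * sobolevNorm N (h t) ≤ ENNReal.ofReal X →
      ENNReal.ofReal (jb t ^ (0 : ℝ)) * sobolevNorm N' (h t) ≤ ENNReal.ofReal X →
      ENNReal.ofReal (jb t ^ (0 : ℝ)) * weightedNorm p (profile h t) ≤ ENNReal.ofReal X →
      ProfileBounds M₁ M₂ p (jb t) t (A * X) (𝓕 (profile h t) : L2) := by
  obtain ⟨A, hA, hj⟩ := exists_norm_fourierInv_inv_jb_mul_le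
  refine ⟨2 ^ M₁ + 2 ^ M₂ + A + 2, by positivity, fun h t X hX n1 n2 n3 n4 σ => ?_⟩
  have hT1 := one_le_jb t
  have hT := jb_pos t
  have hπ := Real.pi_gt_three
  rw [Real.rpow_zero, ENNReal.ofReal_one, one_mul] at n3 n4
  rw [Real.rpow_one] at n1
  set u := h t with hu
  set F : L2 := 𝓕 (profile h t) with hF
  have hFu : (F : Plane → ℂ) =ᵐ[volume] fun ξ => osc (-t) ξ * (𝓕 u : L2) ξ := fourier_propagator (-t) u
  have hFn : ∀ᵐ ξ, ‖F ξ‖ = ‖(𝓕 u : L2) ξ‖ := by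
    filter_upwards [hFu] with ξ hξ
    rw [hξ, norm_mul, norm_osc, one_mul]
  have hFm : StronglyMeasurable (F : Plane → ℂ) := Lp.stronglyMeasurable F
  have s1 := sobolevBound_of_sobolevNorm_le hM₁ hFn n3
  have s1u := sobolevBound_of_sobolevNorm_le (F := (𝓕 u : L2)) hM₁ (Eventually.of_forall fun _ => rfl) n3
  -- Growth of the top Sobolev norm at rate T is all that the quadratic estimate tolerates and all
  -- that is retained.
  have hTδ : jb t ^ δ₁ ≤ jb t := by
    calc jb t ^ δ₁ ≤ jb t ^ (1 : ℝ) := Real.rpow_le_rpow_of_exponent_le hT1 hδ1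
      _ = _ := Real.rpow_one _
  have n2' : sobolevNorm N u ≤ ENNReal.ofReal (X * jb t) := by
    refine (le_ofReal_div (Real.rpow_pos_of_pos hT _) n2).trans (ENNReal.ofReal_le_ofReal ?_)
    rw [Real.rpow_neg hT.le, div_inv_eq_mul]
    gcongr
  have s2 := sobolevBound_of_sobolevNorm_le hM₂ hFn n2'
  have hFi : Integrable (F : Plane → ℂ) := (s1.integrable_memLp (by positivity) (by omega) hFm).1
  -- the sup bound
  have hH2 : MemLp (halfDerivHat u) 2 := by
    by_contra hc
    rw [halfDerivSupNorm, if_neg hc, ENNReal.mul_top (by simpa using hT)] at n1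
    exact (lt_of_le_of_lt n1 ENNReal.ofReal_lt_top).ne rfl
  rw [halfDerivSupNorm, if_pos hH2] at n1
  have hHm := stronglyMeasurable_halfDerivHat u
  have hfq := norm_freq
  have hHi : Integrable (halfDerivHat u) := by
    refine (s1u.integrable (A := (1 + 2 * Real.pi) ^ 2) (by positivity) (by positivity)
      hHm.aestronglyMeasurable fun ξ => ?_).1
    refine (norm_halfDerivHat_mul_le u ξ).trans ?_
    gcongr
    exact one_le_one_add_norm ξ
  have hHsup : ∀ x, ‖𝓕⁻ (halfDerivHat u) x‖ ≤ X / jb t := by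
    refine norm_le_of_eLpNorm_top_le (continuous_fourierInv hHi) (by positivity) ?_
    rw [← eLpNorm_congr_ae (ofFourier_ae_eq hHi hH2)]
    exact le_ofReal_div hT n1
  have hsup : ∀ x, ‖𝓕⁻ (fun ξ => ((‖ξ‖ ^ (1 / 2 : ℝ) : ℝ) : ℂ) * (osc t ξ * F ξ)) x‖
      ≤ A * (X / jb t) := fun x => by
    -- The factor by which ‖ξ‖^{1/2} differs from ‖2πξ‖^{1/2}; the remaining discrepancy is ⟨∇⟩⁻¹,
    -- bounded on L^∞.
    set b : ℝ := ((2 * Real.pi) ^ (1 / 2 : ℝ))⁻¹ with hb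
    have hb1 : b ≤ 1 := inv_le_one_of_one_le₀ (Real.one_le_rpow (by linarith) (by norm_num))
    have e : 𝓕⁻ (fun ξ => ((‖ξ‖ ^ (1 / 2 : ℝ) : ℝ) : ℂ) * (osc t ξ * F ξ)) x
        = 𝓕⁻ (fun ξ => (b : ℂ) * ((((jb (freq ξ))⁻¹ : ℝ) : ℂ) * halfDerivHat u ξ)) x := by
      rw [Real.fourierInv_eq, Real.fourierInv_eq]
      refine integral_congr_ae ?_
      filter_upwards [hFu] with ξ hξ
      congr 1
      have h1 : osc t ξ * osc (-t) ξ = 1 := by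
        rw [osc, osc, ← Complex.exp_add]
        simp
      rw [hξ, ← mul_assoc (osc t ξ), h1, one_mul, halfDerivHat, hfq,
        Real.mul_rpow (by positivity) (norm_nonneg _), hb]
      have h2 : ((jb (freq ξ) : ℝ) : ℂ) ≠ 0 := by exact_mod_cast (jb_pos (freq ξ)).ne'
      have h3 : (((2 * Real.pi) ^ (1 / 2 : ℝ) : ℝ) : ℂ) ≠ 0 := by
        exact_mod_cast (Real.rpow_pos_of_pos (by positivity) _).ne'
      push_cast at h3 ⊢
      field_simp
    rw [e, congrFun (fourierInv_const_mul _ _) x, norm_mul, Complex.norm_real,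
      Real.norm_of_nonneg (by positivity)]
    exact (mul_le_of_le_one_left (norm_nonneg _) hb1).trans (hj _ _ hHm hHi hHsup x)
  have hXT : 0 ≤ X * jb t := by positivity
  refine ⟨stronglyMeasurable_signed hFm σ, hT1, ?_, by positivity, ?_, ?_, fun x => ?_, ?_⟩
  · have h1 : |t| ≤ jb t := by
      rw [jb]
      refine Real.le_sqrt_of_sq_le ?_
      simp
    rcases Int.units_eq_one_or σ with rfl | rfl <;> simpa using h1
  · refine (s1.signed hFm σ).nonneg_mono le_rfl ?_
    gcongr
    have : (0 : ℝ) ≤ 2 ^ M₂ := by positivity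
    linarith
  · refine (s2.signed hFm σ).nonneg_mono le_rfl ?_
    rw [mul_assoc]
    gcongr
    have : (0 : ℝ) ≤ 2 ^ M₁ := by positivity
    linarith
  · rw [half_osc_signed, fourierInv_signed]
    refine (hsup x).trans ?_
    rw [mul_div_assoc]
    gcongr
    have h1 : (0 : ℝ) ≤ 2 ^ M₁ := by positivity
    have h2 : (0 : ℝ) ≤ 2 ^ M₂ := by positivity
    linarith
  · have h1 : eLpNorm (fun x => ((1 + ‖x‖ : ℝ) : ℂ) * 𝓕⁻ (signed σ F) x) (ENNReal.ofReal p) volume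
        ≤ ENNReal.ofReal 2 * weightedNorm p (profile h t) := by
      refine eLpNorm_le_mul_eLpNorm_of_ae_le_mul ?_ _
      filter_upwards [fourierInv_fourier_ae_eq (profile h t) hFi] with x hx
      rw [norm_mul, norm_mul, fourierInv_signed, hx, Complex.norm_real, Complex.norm_real, ← mul_assoc,
        Real.norm_of_nonneg (by positivity), Real.norm_of_nonneg (jb_pos x).le]
      gcongr
      have : ‖x‖ ≤ jb x := by
        rw [jb]
        exact Real.le_sqrt_of_sq_le (by linarith)
      linarith [one_le_jb x]
    refine h1.trans ((mul_le_mul_right n4 _).trans ?_)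
    rw [← ENNReal.ofReal_mul (by norm_num)]
    refine ENNReal.ofReal_le_ofReal ?_
    gcongr
    have h1 : (0 : ℝ) ≤ 2 ^ M₁ := by positivity
    have h2 : (0 : ℝ) ≤ 2 ^ M₂ := by positivity
    linarith

end Data

/-! ### Choice of regularities, passage to suprema in time, and the conclusion. -/

section Assembly
open Filter

theorem sobolevNorm_le_of_weight {s N : ℝ} {κ : ℕ} {u : L2} {G : Plane → ℂ} (hs : s ≤ 2 * κ)
    (hu : ((𝓕 u : L2) : Plane → ℂ) =ᵐ[volume] G)
    (hG : eLpNorm (fun ξ => (((1 + ‖ξ‖ ^ 2) ^ κ : ℝ) : ℂ) * G ξ) 2 volume ≤ ENNReal.ofReal N) :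
    sobolevNorm s u ≤ ENNReal.ofReal ((2 * Real.pi) ^ (2 * κ) * N) := by
  have hπ := Real.pi_gt_three
  rw [ENNReal.ofReal_mul (by positivity)]
  refine (eLpNorm_le_mul_eLpNorm_of_ae_le_mul (c := (2 * Real.pi) ^ (2 * κ))
    (g := fun ξ => (((1 + ‖ξ‖ ^ 2) ^ κ : ℝ) : ℂ) * G ξ) ?_ 2).trans (mul_le_mul_right hG _)
  filter_upwards [hu] with ξ hξ
  have h1 := jb_pos (freq ξ)
  rw [norm_mul, norm_mul, hξ, Complex.norm_real, Complex.norm_real,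
    Real.norm_of_nonneg (by positivity), Real.norm_of_nonneg (by positivity), ← mul_assoc]
  gcongr
  calc jb (freq ξ) ^ s ≤ jb (freq ξ) ^ ((2 * κ : ℕ) : ℝ) :=
        Real.rpow_le_rpow_of_exponent_le (one_le_jb _) (by push_cast; exact hs)
    _ = (jb (freq ξ) ^ 2) ^ κ := by rw [Real.rpow_natCast, pow_mul]
    _ ≤ ((2 * Real.pi) ^ 2 * (1 + ‖ξ‖ ^ 2)) ^ κ := by
        gcongr
        rw [jb_sq, norm_freq, mul_pow]
        nlinarith
    _ = _ := by rw [mul_pow, ← pow_mul]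

theorem sobolevBound_four_of_weight {N : ℝ} {u : L2} {G : Plane → ℂ}
    (hu : ∀ᵐ ξ, ‖(𝓕 u : L2) ξ‖ = ‖G ξ‖)
    (hG : eLpNorm (fun ξ => (((1 + ‖ξ‖ ^ 2) ^ 2 : ℝ) : ℂ) * G ξ) 2 volume ≤ ENNReal.ofReal N) :
    SobolevBound 4 (4 * N) (𝓕 u : L2) := by
  rw [SobolevBound, ENNReal.ofReal_mul (by norm_num)]
  refine (eLpNorm_le_mul_eLpNorm_of_ae_le_mul (c := 4)
    (g := fun ξ => (((1 + ‖ξ‖ ^ 2) ^ 2 : ℝ) : ℂ) * G ξ) ?_ 2).trans (mul_le_mul_right hG _)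
  filter_upwards [hu] with ξ hξ
  rw [norm_mul, norm_mul, hξ, Complex.norm_real, Complex.norm_real,
    Real.norm_of_nonneg (by positivity), Real.norm_of_nonneg (by positivity), ← mul_assoc]
  gcongr
  have h : (1 + ‖ξ‖) ^ 2 ≤ 2 * (1 + ‖ξ‖ ^ 2) := by nlinarith [sq_nonneg (‖ξ‖ - 1)]
  calc (1 + ‖ξ‖) ^ 4 = ((1 + ‖ξ‖) ^ 2) ^ 2 := by ring
    _ ≤ (2 * (1 + ‖ξ‖ ^ 2)) ^ 2 := by gcongr
    _ = _ := by ring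

theorem halfDerivSupNorm_le {N : ℝ} {u : L2} (hN : 0 ≤ N) (hu : SobolevBound 4 N (𝓕 u : L2)) :
    halfDerivSupNorm u ≤ ENNReal.ofReal ((1 + 2 * Real.pi) ^ 2 * √kernelMass * N) := by
  have hπ := Real.pi_pos
  have hm := stronglyMeasurable_halfDerivHat u
  obtain ⟨hi, hb⟩ := hu.integrable (A := (1 + 2 * Real.pi) ^ 2) (by positivity) hN
    hm.aestronglyMeasurable (norm_halfDerivHat_mul_le u)
  have h2 : MemLp (halfDerivHat u) 2 := by
    refine ⟨hm.aestronglyMeasurable, (hu.eLpNorm_le (A := (1 + 2 * Real.pi) ^ 2) (by positivity)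
      fun ξ => ?_).trans_lt ENNReal.ofReal_lt_top⟩
    exact (le_mul_of_one_le_right (norm_nonneg _) (one_le_pow₀ (one_le_one_add_norm ξ))).trans
      (norm_halfDerivHat_mul_le u ξ)
  rw [halfDerivSupNorm, if_pos h2, eLpNorm_congr_ae (ofFourier_ae_eq hi h2), eLpNorm_exponent_top]
  refine eLpNormEssSup_le_of_ae_enorm_bound (Eventually.of_forall fun x => ?_)
  rw [← ofReal_norm]
  exact ENNReal.ofReal_le_ofReal ((norm_fourierInv_le _ x).trans hb)

theorem eLpNorm_le_of_sobolevBound_four {q N : ℝ} {u : L2} (hq : 2 ≤ q) (hN : 0 ≤ N)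
    (hu : SobolevBound 4 N (𝓕 u : L2)) :
    eLpNorm u (ENNReal.ofReal q) volume ≤ ENNReal.ofReal (N * (1 + √kernelMass)) := by
  have hm : StronglyMeasurable ((𝓕 u : L2) : Plane → ℂ) := Lp.stronglyMeasurable _
  obtain ⟨hi, h⟩ := eLpNorm_fourierInv_le_of_weight (c := 1) (H := (𝓕 u : L2)) hq zero_le_one hN
    hm.aestronglyMeasurable ((by fun_prop : Continuous fun ξ : Plane =>
      (((1 + ‖ξ‖) ^ 4 : ℝ) : ℂ)).aestronglyMeasurable.mul hm.aestronglyMeasurable) hu (fun ξ => by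
      have h0 := one_add_norm_pos ξ
      rw [Pi.mul_apply, norm_mul, Complex.norm_real, Real.norm_of_nonneg (by positivity), one_mul,
        ← mul_assoc, Real.rpow_neg h0.le, Real.rpow_ofNat]
      refine le_mul_of_one_le_left (norm_nonneg _) ?_
      rw [← div_eq_inv_mul, one_le_div (by positivity)]
      exact pow_le_pow_right₀ (one_le_one_add_norm ξ) (by norm_num))
  rw [eLpNorm_congr_ae (fourierInv_fourier_ae_eq u hi)]
  rwa [one_mul] at h

theorem propagator_neg_propagator (t : ℝ) (u : L2) : propagator (-t) (propagator t u) = u := by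
  have h1 := fourier_propagator (-t) (propagator t u)
  have h2 := fourier_propagator t u
  have h3 : (𝓕 (propagator (-t) (propagator t u)) : L2) = 𝓕 u := by
    refine Lp.ext ?_
    filter_upwards [h1, h2] with ξ e1 e2
    rw [e1, e2, ← mul_assoc, osc, osc, ← Complex.exp_add]
    simp
  have key : ∀ v : L2, (𝓕⁻ (𝓕 v : L2) : L2) = v := fun v => FourierTransform.fourierInv_fourier_eq v
  rw [← key (propagator (-t) (propagator t u)), h3, key]

theorem sobolevNorm_propagator (s t : ℝ) (u : L2) :
    sobolevNorm s (propagator t u) = sobolevNorm s u := by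
  refine eLpNorm_congr_norm_ae ?_
  filter_upwards [fourier_propagator t u] with ξ hξ
  rw [hξ, norm_mul, norm_mul, norm_mul, norm_osc, one_mul]

/-- The norms of `h` at time `t` are at most `X`. -/
structure DataBound (N' N p δ₁ : ℝ) (h : ℝ → L2) (t X : ℝ) : Prop where
  pos : 0 < X
  half : ENNReal.ofReal (jb t ^ (1 : ℝ)) * halfDerivSupNorm (h t) ≤ ENNReal.ofReal X
  top : ENNReal.ofReal (jb t ^ (-δ₁)) * sobolevNorm N (h t) ≤ ENNReal.ofReal X
  sob : ENNReal.ofReal (jb t ^ (0 : ℝ)) * sobolevNorm N' (h t) ≤ ENNReal.ofReal X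
  wt : ENNReal.ofReal (jb t ^ (0 : ℝ)) * weightedNorm p (profile h t) ≤ ENNReal.ofReal X

/-- The boundary term `g` at time `t` is well defined, and the bounds for `g` and `e^{it⟨∇⟩} g`
hold, with `Y` the size of the quadratic term. -/
structure BoundaryBound (N' p q : ℝ) (c : ℤˣ → ℤˣ → Fin 4 → ℂ) (h : ℝ → L2) (t Y : ℝ) : Prop where
  int : ∀ (σ τ : ℤˣ) (ξ : Plane), Integrable (boundaryIntegrand c h t σ τ ξ)
  mem : MemLp (boundaryHat c h t) 2
  sob : sobolevNorm N' (boundaryTerm c h t) ≤ ENNReal.ofReal Y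
  decay : sobolevNorm (N' / 2) (boundaryTerm c h t) ≤ ENNReal.ofReal (Y / jb t)
  wt : weightedNorm p (boundaryTerm c h t) ≤ ENNReal.ofReal Y
  half : halfDerivSupNorm (propagator t (boundaryTerm c h t)) ≤ ENNReal.ofReal (Y / jb t)
  lq : eLpNorm (propagator t (boundaryTerm c h t)) (ENNReal.ofReal q) volume
    ≤ ENNReal.ofReal (Y / jb t)

/-- The inputs use ⌊N'⌋ and ⌊N⌋ derivatives. The weights on the output are κ₁ = ⌈N'/2⌉ for H^{N'},
κ₂ = ⌈N'/4⌉ for H^{N'/2}, and 2 for the four derivatives controlling the L^∞ and L^q norms. Decay at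
κ₂ requires about 9N'/2 ≤ 5N', up to constants that N' ≥ 1000 absorbs; the top estimate at κ₁
requires about 9N' ≤ 5N, where N ≥ 10 N' leaves ample room. -/
theorem exists_boundaryBound {N' N p q δ₁ : ℝ} (hp : 2 < p) (hp4 : p ≤ 9 / 4) (hq : 2 ≤ q)
    (hδ₁ : δ₁ ≤ 1) (hN' : 1000 ≤ N') (hN : 10 * N' ≤ N) (c : ℤˣ → ℤˣ → Fin 4 → ℂ) :
    ∃ C : ℝ, 0 < C ∧ ∀ (h : ℝ → L2) (t X : ℝ), DataBound N' N p δ₁ h t X →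
      BoundaryBound N' p q c h t (C * X ^ 2) := by
  have hM₁ : (⌊N'⌋₊ : ℝ) ≤ N' := Nat.floor_le (by linarith)
  have hM₁' : N' < ⌊N'⌋₊ + 1 := Nat.lt_floor_add_one N'
  have hM₂ : (⌊N⌋₊ : ℝ) ≤ N := Nat.floor_le (by linarith)
  have hM₂' : N < ⌊N⌋₊ + 1 := Nat.lt_floor_add_one N
  have h1000 : 1000 ≤ ⌊N'⌋₊ := Nat.le_floor (by exact_mod_cast hN')
  set M₁ := ⌊N'⌋₊ with hM₁def
  set M₂ := ⌊N⌋₊ with hM₂def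
  have hκ₁ := Nat.le_ceil (N' / 2)
  have hκ₁' := Nat.ceil_lt_add_one (a := N' / 2) (by linarith)
  have hκ₂ := Nat.le_ceil (N' / 4)
  have hκ₂' := Nat.ceil_lt_add_one (a := N' / 4) (by linarith)
  set κ₁ := ⌈N' / 2⌉₊ with hκ₁def
  set κ₂ := ⌈N' / 4⌉₊ with hκ₂def
  obtain ⟨A, hA, hdata⟩ := exists_profileBounds (p := p) (M₁ := M₁) (M₂ := M₂) (by omega) hM₁ hM₂ hδ₁
  obtain ⟨C₁, hC₁, h1⟩ := exists_boundaryHat_top_le hp (by linarith) c (κ := κ₁) (M₁ := M₁) (M₂ := M₂)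
    (by have : (9 * (2 * (25 + κ₁) + 1) : ℝ) ≤ 5 * M₂ := by linarith
        exact_mod_cast this) (by omega)
  obtain ⟨C₂, hC₂, h2⟩ := exists_boundaryHat_decay_le hp hp4 c (κ := κ₂) (M₁ := M₁)
    (by have : (9 * (2 * (25 + κ₂) + 1) : ℝ) ≤ 5 * M₁ := by linarith
        exact_mod_cast this)
  obtain ⟨C₃, hC₃, h3⟩ := exists_boundaryHat_decay_le hp hp4 c (κ := 2) (M₁ := M₁) (by omega)
  obtain ⟨C₄, hC₄, h4⟩ := exists_boundaryHat_weighted_le hp hp4 c (M₁ := M₁) (by omega)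
  have hπ := Real.pi_pos
  have hk := Real.sqrt_nonneg kernelMass
  set B₁ := (2 * Real.pi) ^ (2 * κ₁) * C₁ with hB₁
  set B₂ := (2 * Real.pi) ^ (2 * κ₂) * C₂ with hB₂
  set B₃ := (1 + 2 * Real.pi) ^ 2 * √kernelMass * (4 * C₃) with hB₃
  set B₅ := 4 * C₃ * (1 + √kernelMass) with hB₅
  have p₁ : 0 < B₁ := by positivity
  have p₂ : 0 < B₂ := by positivity
  have p₃ : 0 ≤ B₃ := by positivity
  have p₅ : 0 < B₅ := by positivity
  refine ⟨(B₁ + B₂ + B₃ + C₄ + B₅) * A ^ 2, by positivity, fun h t X hX => ?_⟩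
  have hX0 := hX.pos
  have hT := jb_pos t
  have hP := hdata h t X hX0 hX.half hX.top hX.sob hX.wt
  obtain ⟨hQ, b2⟩ := h2 M₂ h t _ _ hP
  have b1 := h1 h t _ _ hP hQ
  obtain ⟨-, b3⟩ := h3 M₂ h t _ _ hP
  obtain ⟨htame, b4⟩ := h4 M₂ h t _ _ hP hQ
  have e : ((𝓕 (boundaryTerm c h t) : L2) : Plane → ℂ) =ᵐ[volume] boundaryHat c h t :=
    fourier_ofFourier htame.mem
  have hs := sobolevBound_four_of_weight (u := propagator t (boundaryTerm c h t))
    (G := boundaryHat c h t) (by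
      filter_upwards [fourier_propagator t (boundaryTerm c h t), e] with ξ e1 e2
      rw [e1, norm_mul, norm_osc, one_mul, e2]) b3
  have key : ∀ {B r s : ℝ}, B ≤ B₁ + B₂ + B₃ + C₄ + B₅ → 0 < s → r = B * (A * X) ^ 2 / s →
      ENNReal.ofReal r ≤ ENNReal.ofReal ((B₁ + B₂ + B₃ + C₄ + B₅) * A ^ 2 * X ^ 2 / s) := by
    intro B r s hB hs' hr
    refine ENNReal.ofReal_le_ofReal ?_
    rw [hr, mul_pow, ← mul_assoc]
    gcongr
  have key1 : ∀ {B r : ℝ}, B ≤ B₁ + B₂ + B₃ + C₄ + B₅ → r = B * (A * X) ^ 2 →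
      ENNReal.ofReal r ≤ ENNReal.ofReal ((B₁ + B₂ + B₃ + C₄ + B₅) * A ^ 2 * X ^ 2) := by
    intro B r hB hr
    have := key hB one_pos (r := r) (by rw [hr, div_one])
    rwa [div_one] at this
  refine ⟨fun σ τ ξ => hQ.boundaryIntegrand σ τ ξ, htame.mem, ?_, ?_, ?_, ?_, ?_⟩
  · exact (sobolevNorm_le_of_weight (by linarith) e b1).trans (key1 (B := B₁) (by linarith)
      (by rw [hB₁]; ring))
  · exact (sobolevNorm_le_of_weight (by linarith) e b2).trans (key (B := B₂) (by linarith) hT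
      (by rw [hB₂]; ring))
  · have e2 := ofFourier_ae_eq htame.int htame.mem
    refine le_trans (le_of_eq ?_) (b4.trans (key1 (B := C₄) (by linarith) rfl))
    refine eLpNorm_congr_ae ?_
    filter_upwards [e2] with x hx
    rw [boundaryTerm, hx]
  · exact (halfDerivSupNorm_le (by positivity) hs).trans (key (B := B₃) (by linarith) hT
      (by rw [hB₃]; ring))
  · exact (eLpNorm_le_of_sobolevBound_four hq (by positivity) hs).trans (key (B := B₅) (by linarith) hT
      (by rw [hB₅]; ring))

theorem ae_le_supTime (a : ℝ) (ν : ℝ → ℝ≥0∞) : ∀ᵐ t ∂(volume.restrict (Set.Ici (0 : ℝ))),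
    ENNReal.ofReal (jb t ^ a) * ν t ≤ supTime a ν :=
  ENNReal.ae_le_essSup _

theorem supTime_le {a Y : ℝ} {ν : ℝ → ℝ≥0∞} (ha : a ≤ 1) (hY : 0 ≤ Y)
    (h : ∀ᵐ t ∂(volume.restrict (Set.Ici (0 : ℝ))), ν t ≤ ENNReal.ofReal (Y / jb t)) :
    supTime a ν ≤ ENNReal.ofReal Y := by
  refine essSup_le_of_ae_le _ ?_
  filter_upwards [h] with t ht
  have hT := jb_pos t
  refine (mul_le_mul_right ht _).trans ?_
  rw [← ENNReal.ofReal_mul (by positivity)]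
  refine ENNReal.ofReal_le_ofReal ?_
  calc jb t ^ a * (Y / jb t) ≤ jb t ^ (1 : ℝ) * (Y / jb t) := by
        gcongr
        exact one_le_jb t
    _ = Y := by rw [Real.rpow_one]; field_simp

theorem supTime_zero_le {Y : ℝ} {ν : ℝ → ℝ≥0∞}
    (h : ∀ᵐ t ∂(volume.restrict (Set.Ici (0 : ℝ))), ν t ≤ ENNReal.ofReal Y) :
    supTime 0 ν ≤ ENNReal.ofReal Y := by
  refine essSup_le_of_ae_le _ ?_
  filter_upwards [h] with t ht
  rwa [Real.rpow_zero, ENNReal.ofReal_one, one_mul]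

/-- The pointwise estimates require a positive size X, while the norm of h may vanish; they are
applied with the norm plus δ, and then δ → 0. -/
theorem le_mul_sq_of_forall_pos {a b : ℝ≥0∞} {C : ℝ} (hC : 0 ≤ C) (hb : b < ∞)
    (h : ∀ δ : ℝ, 0 < δ → a ≤ ENNReal.ofReal (C * (b.toReal + δ) ^ 2)) :
    a ≤ ENNReal.ofReal C * b ^ 2 := by
  have h1 : ENNReal.ofReal C * b ^ 2 = ENNReal.ofReal (C * (b.toReal + 0) ^ 2) := by
    rw [add_zero, ENNReal.ofReal_mul hC, ENNReal.ofReal_pow ENNReal.toReal_nonneg,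
      ENNReal.ofReal_toReal hb.ne]
  rw [h1]
  have hc : Continuous fun δ : ℝ => ENNReal.ofReal (C * (b.toReal + δ) ^ 2) :=
    ENNReal.continuous_ofReal.comp (by fun_prop)
  exact ge_of_tendsto ((hc.tendsto 0).mono_left (nhdsWithin_le_nhds (s := Set.Ioi 0)))
    (eventually_mem_nhdsWithin.mono h)

theorem XNorm.ae_dataBound {N₁ N' N ε₁ δ₁ δ : ℝ} {h : ℝ → L2} (hX : XNorm N₁ N' N ε₁ δ₁ h < ∞)
    (hδ : 0 < δ) : ∀ᵐ t ∂(volume.restrict (Set.Ici (0 : ℝ))),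
      DataBound N' N (2 + ε₁) δ₁ h t ((XNorm N₁ N' N ε₁ δ₁ h).toReal + δ) := by
  have hle : XNorm N₁ N' N ε₁ δ₁ h ≤ ENNReal.ofReal ((XNorm N₁ N' N ε₁ δ₁ h).toReal + δ) := by
    rw [← ENNReal.ofReal_toReal hX.ne, ENNReal.toReal_ofReal ENNReal.toReal_nonneg]
    exact ENNReal.ofReal_le_ofReal (by linarith)
  filter_upwards [ae_le_supTime 1 (fun t => halfDerivSupNorm (h t)),
    ae_le_supTime (-δ₁) (fun t => sobolevNorm N (h t)), ae_le_supTime 0 (fun t => sobolevNorm N' (h t)),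
    ae_le_supTime 0 (fun t => weightedNorm (2 + ε₁) (propagator (-t) (h t)))] with t n1 n2 n3 n4
  refine ⟨by positivity, n1.trans (le_trans ?_ hle), n2.trans (le_trans ?_ hle),
    n3.trans (le_trans ?_ hle), n4.trans (le_trans ?_ hle)⟩
  · rw [XNorm, add_assoc, add_assoc, add_assoc]
    exact le_self_add
  · rw [XNorm, add_assoc, add_assoc]
    exact le_add_left le_rfl |>.trans le_self_add
  · rw [XNorm]
    exact (le_add_left le_rfl).trans le_self_add
  · rw [XNorm]
    exact le_add_left le_rfl

end Assembly
theorem AdmissibleParameters.bounds {N₁ N' N ε₁ δ₁ δ₂ : ℝ}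
    (hP : AdmissibleParameters 1000 N₁ N' N ε₁ δ₁ δ₂) :
    2 < 2 + ε₁ ∧ 2 + ε₁ ≤ 9 / 4 ∧ 2 ≤ N₁ / ε₁ ∧ δ₁ ≤ 1 ∧ 1000 ≤ N' ∧ 10 * N' ≤ N := by
  have h1 := hP.one_ll_N₁
  have h2 := hP.N₁_ll_N'
  have h3 := hP.N'_ll_N
  have h4 := hP.ε₁_ll
  have h5 := hP.δ₁_ll
  have h6 := hP.δ₂_div_ll
  have h7 := hP.δ₂_ll_one
  have h8 := hP.ε₁_pos
  have h9 := hP.N'_pos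
  refine ⟨by linarith, by linarith, ?_, by linarith, by linarith, by linarith⟩
  rw [le_div_iff₀ h8]
  linarith

end EulerPoisson

theorem proposition4p1 :
    ∃ K : ℝ, 1 ≤ K ∧ ∀ N₁ N' N ε₁ δ₁ δ₂ : ℝ,
      EulerPoisson.AdmissibleParameters K N₁ N' N ε₁ δ₁ δ₂ →
      ∀ c : ℤˣ → ℤˣ → Fin 4 → ℂ, ∃ C : ℝ≥0, ∀ h : ℝ → EulerPoisson.L2,
        EulerPoisson.XNorm N₁ N' N ε₁ δ₁ h < ∞ →
        -- the boundary term is well defined: its defining integrals converge absolutely and give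
        -- the Fourier transform of a square integrable function
        (∀ᵐ t ∂(volume.restrict (Set.Ici (0 : ℝ))),
          (∀ (σ τ : ℤˣ) (ξ : EulerPoisson.Plane),
            Integrable (EulerPoisson.boundaryIntegrand c h t σ τ ξ) volume) ∧
          MemLp (EulerPoisson.boundaryHat c h t) 2 volume) ∧
        EulerPoisson.supTime 0
            (fun t => EulerPoisson.sobolevNorm N' (EulerPoisson.boundaryTerm c h t))
          + EulerPoisson.supTime 1
            (fun t => EulerPoisson.sobolevNorm (N' / 2) (EulerPoisson.boundaryTerm c h t))
          + EulerPoisson.supTime 0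
            (fun t => EulerPoisson.weightedNorm (2 + ε₁) (EulerPoisson.boundaryTerm c h t))
          ≤ (C : ℝ≥0∞) * EulerPoisson.XNorm N₁ N' N ε₁ δ₁ h ^ 2 ∧
        EulerPoisson.X1Norm N₁ N' ε₁
            (fun t => EulerPoisson.propagator t (EulerPoisson.boundaryTerm c h t))
          ≤ (C : ℝ≥0∞) * EulerPoisson.XNorm N₁ N' N ε₁ δ₁ h ^ 2 := by
  -- The value 1000 is generous for ε₁ and δ₁; its real use is N' ≥ 1000, the room needed for
  -- rounding and for the fixed number of derivatives lost.
  refine ⟨1000, by norm_num, fun N₁ N' N ε₁ δ₁ δ₂ hP c => ?_⟩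
  obtain ⟨hp, hp4, hq, hδ₁, hN', hN⟩ := hP.bounds
  obtain ⟨C, hC, hB⟩ := EulerPoisson.exists_boundaryBound hp hp4 hq hδ₁ hN' hN c
  -- The norm of X₁ has four terms, each bounded by the same quantity; the first estimate has three.
  refine ⟨(4 * C).toNNReal, fun h hX => ?_⟩
  have hb : ∀ δ : ℝ, 0 < δ → ∀ᵐ t ∂(volume.restrict (Set.Ici (0 : ℝ))),
      EulerPoisson.BoundaryBound N' (2 + ε₁) (N₁ / ε₁) c h t
        (C * ((EulerPoisson.XNorm N₁ N' N ε₁ δ₁ h).toReal + δ) ^ 2) := fun δ hδ =>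
    (EulerPoisson.XNorm.ae_dataBound hX hδ).mono fun t ht => hB h t _ ht
  refine ⟨(hb 1 one_pos).mono fun t ht => ⟨ht.int, ht.mem⟩,
    EulerPoisson.le_mul_sq_of_forall_pos (by positivity) hX fun δ hδ => ?_,
    EulerPoisson.le_mul_sq_of_forall_pos (by positivity) hX fun δ hδ => ?_⟩
  all_goals
    have hY : 0 ≤ C * ((EulerPoisson.XNorm N₁ N' N ε₁ δ₁ h).toReal + δ) ^ 2 := by positivity
    have hbδ := hb δ hδ
    set Y := C * ((EulerPoisson.XNorm N₁ N' N ε₁ δ₁ h).toReal + δ) ^ 2 with hYdef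
    have h4 : 4 * C * ((EulerPoisson.XNorm N₁ N' N ε₁ δ₁ h).toReal + δ) ^ 2 = Y + Y + Y + Y := by
      rw [hYdef]; ring
    rw [h4]
    have hsob := EulerPoisson.supTime_zero_le (hbδ.mono fun t ht => ht.sob)
    have hwt := EulerPoisson.supTime_zero_le (hbδ.mono fun t ht => ht.wt)
  · have hdecay := EulerPoisson.supTime_le le_rfl hY (hbδ.mono fun t ht => ht.decay)
    refine (add_le_add (add_le_add hsob hdecay) hwt).trans ?_
    rw [← ENNReal.ofReal_add hY hY, ← ENNReal.ofReal_add (by positivity) hY]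
    exact ENNReal.ofReal_le_ofReal (by linarith)
  · have hhalf := EulerPoisson.supTime_le le_rfl hY (hbδ.mono fun t ht => ht.half)
    have ha : 1 - 2 / (N₁ / ε₁) ≤ 1 := sub_le_self _ (by positivity)
    have hlq := EulerPoisson.supTime_le ha hY (hbδ.mono fun t ht => ht.lq)
    -- The last two terms of the X₁ norm of e^{it⟨∇⟩} g reduce to the Sobolev and weighted norms of
    -- g itself.
    simp only [EulerPoisson.X1Norm, EulerPoisson.sobolevNorm_propagator, EulerPoisson.propagator_neg_propagator]
    refine (add_le_add (add_le_add (add_le_add hhalf hlq) hsob) hwt).trans ?_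
    rw [← ENNReal.ofReal_add hY hY, ← ENNReal.ofReal_add (by positivity) hY,
      ← ENNReal.ofReal_add (by positivity) hY]
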